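/- Manifolds are smooth, finite-dimensional, Hausdorff and second countable. Let $(L,A)$ be a Lie groupoid pair over a manifold $M$: $L\rightrightarrows M$ is a Lie groupoid with source $s$, target $t$, units $1_x$, and product $\gamma_1\gamma_2$ defined when $s(\gamma_1)=t(\gamma_2)$; and $A\rightrightarrows M$ is a closed wide Lie subgroupoid, i.e. a Lie groupoid over $M$ with a morphism $A\to L$ over $\mathrm{id}_M$ that is a closed embedding. Write $\bullet$ for the product of the tangent groupoid $TL\rightrightarrows TM$. The Lie algebroid $\ell$ of $L$ has fibre $\ell_x=\ker T_{1_x}s$ and anchor $\rho=Tt|_{\ell}$; let $\mathfrak a\subset\ell$ be the Lie algebroid of $A$, and $\ell/\mathfrak a$ the quotient vector bundle. Let $\pi:L\to L/A$ be the quotient by right translations, and $\bar t:L/A\to M$ the map induced by $t$. **Notions.** * An $\ell$-connection on $\ell/\mathfrak a$ is an $\mathbb R$-bilinear map $\nabla:\Gamma(\ell)\times\Gamma(\ell/\mathfrak a)\to\Gamma(\ell/\mathfrak a)$ with $\nabla_{fl}e=f\nabla_le$ and $\nabla_l(fe)=f\nabla_le+\rho(l)(f)\,e$ for $f\in C^\infty(M)$.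 * $A$ acts linearly on $\ell/\mathfrak a$ by $\mathrm{Ad}_a\overline{\lambda}=\overline{u\bullet\lambda\bullet 0_{a^{-1}}}$, for $a\in A$, $\lambda\in\ell_{s(a)}$ and any $u\in T_aA$ with $Ts(u)=\rho(\lambda)$. A local bisection is a submanifold $\Sigma$ of the groupoid on which $s$ and $t$ are diffeomorphisms onto open subsets of $M$. A local bisection of $L$ acts on sections of $\ell$ by $\mathrm{Ad}_\Sigma$, the differential of conjugation by $\Sigma$; a local bisection $\Sigma$ of $A$ acts on sections of $\ell/\mathfrak a$ by $(\Sigma\star e)_{t(a)}=\mathrm{Ad}_a e_{s(a)}$, $a\in\Sigma$. * An $\ell$-connection $\nabla$ on $\ell/\mathfrak a$ is $A$-compatible if (i) it extends the infinitesimal action of $\mathfrak a$: for $l\in\Gamma(\mathfrak a)$, $(\nabla_le)_x=\frac{d}{d\tau}\big|_{\tau=0}\mathrm{Ad}_{c(\tau)^{-1}}e_{t(c(\tau))}$ for every smooth curve $c$ in $A\cap s^{-1}(x)$ with $c(0)=1_x$, $c'(0)=l_x$; and (ii) $\Sigma\star\nabla_{\mathrm{Ad}_{\Sigma^{-1}}l}(\Sigma^{-1}\star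 e)=\nabla_le$ over the target of $\Sigma$, for all local bisections $\Sigma$ of $A$, $l\in\Gamma(\ell)$, $e\in\Gamma(\ell/\mathfrak a)$. * A fibrewise affine connection on $L/A\to M$ is an $\mathbb R$-bilinear map $D:\Gamma(V)\times\Gamma(V)\to\Gamma(V)$, where $V=\ker T\bar t\subset T(L/A)$, with $D_{fX}Y=fD_XY$ and $D_X(fY)=fD_XY+X(f)Y$ for $f\in C^\infty(L/A)$. It is $L$-invariant if it is preserved by the left translations of $L/A$ by all local bisections of $L$. * $\theta_\gamma:(\ell/\mathfrak a)_{s(\gamma)}\to V_{\pi(\gamma)}$ is the isomorphism $\overline\lambda\mapsto T\pi(0_\gamma\bullet\lambda^{-1})$. Say that $D$ corresponds to $\nabla$ if the pullback of $D$ by $\pi$ along the $t$-fibres is, through $\theta$, the pullback of $\nabla$ by $s$. Explicitly: let $\gamma\in L$, $l\in\Gamma(\ell)$, $v=0_\gamma\bullet l_{s(\gamma)}^{-1}\in T_\gamma L$, and $X,Y\in\Gamma(V)$ with $X_{\pi(\gamma)}=T\pi(v)$. If $Y_{\pi(\gamma')}=\sum_i h_i(\gamma')\,\theta_{\gamma'}(e_i|_{s(\gamma')})$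 for $\gamma'$ near $\gamma$, with finitely many functions $h_i$ smooth near $\gamma$ and sections $e_i\in\Gamma(\ell/\mathfrak a)$, then $$(D_XY)_{\pi(\gamma)}=\sum_i\Big(v(h_i)\,\theta_\gamma(e_i|_{s(\gamma)})+h_i(\gamma)\,\theta_\gamma\big((\nabla_le_i)|_{s(\gamma)}\big)\Big).$$ **Theorem.** The quotient space $L/A$ is Hausdorff and second countable and has a smooth manifold structure for which $\pi$ is a submersion. For every such structure, the relation "$D$ corresponds to $\nabla$" is the graph of a bijection between 1. the $A$-compatible $\ell$-connections $\nabla$ on $\ell/\mathfrak a$, and 2. the $L$-invariant fibrewise affine connections $D$ on $L/A\to M$. -/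

import Mathlib

open scoped Manifold ContDiff Topology

noncomputable section

/-! ## Vector fields along a map -/

section Along

variable {m n : ℕ} {M N : Type*}
  [TopologicalSpace M] [ChartedSpace (EuclideanSpace ℝ (Fin m)) M]
  [TopologicalSpace N] [ChartedSpace (EuclideanSpace ℝ (Fin n)) N] [IsManifold (𝓡 n) ∞ N]

/-- The family of tangent vectors `v x ∈ T_{f x} N` depends smoothly on `x ∈ s`. -/
def SmoothAlongOn (m n : ℕ) {M N : Type*}
    [TopologicalSpace M] [ChartedSpace (EuclideanSpace ℝ (Fin m)) M]
    [TopologicalSpace N] [ChartedSpace (EuclideanSpace ℝ (Fin n)) N] [IsManifold (𝓡 n) ∞ N]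
    (f : M → N) (v : ∀ x, TangentSpace (𝓡 n) (f x)) (s : Set M) : Prop :=
  ContMDiffOn (𝓡 m) (𝓡 n).tangent ∞ (fun x => (⟨f x, v x⟩ : TangentBundle (𝓡 n) N)) s

theorem SmoothAlongOn.combine {f : M → N} {u v : ∀ x, TangentSpace (𝓡 n) (f x)} {s : Set M}
    (hu : SmoothAlongOn m n f u s) (hv : SmoothAlongOn m n f v s) (a b : ℝ) :
    SmoothAlongOn m n f (fun x => a • u x + b • v x) s := by
  intro x₀ hx₀
  have hu' := Bundle.contMDiffWithinAt_totalSpace.1 (hu x₀ hx₀)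
  have hv' := Bundle.contMDiffWithinAt_totalSpace.1 (hv x₀ hx₀)
  refine Bundle.contMDiffWithinAt_totalSpace.2 ⟨hu'.1, ?_⟩
  set e := trivializationAt (EuclideanSpace ℝ (Fin n)) (TangentSpace (𝓡 n) : N → Type _) (f x₀)
    with he
  have hbase : ∀ᶠ x in 𝓝[s] x₀, f x ∈ e.baseSet :=
    hu'.1.continuousWithinAt.eventually
      (e.open_baseSet.mem_nhds (FiberBundle.mem_baseSet_trivializationAt' (f x₀)))
  have key : ∀ x, f x ∈ e.baseSet →
      (e (⟨f x, a • u x + b • v x⟩ : TangentBundle (𝓡 n) N)).2 =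
        a • (e (⟨f x, u x⟩ : TangentBundle (𝓡 n) N)).2 +
          b • (e (⟨f x, v x⟩ : TangentBundle (𝓡 n) N)).2 := by
    intro x hx
    have h := e.linear ℝ hx
    rw [h.map_add, h.map_smul, h.map_smul]
  refine ContMDiffWithinAt.congr_of_eventuallyEq
    (f := fun x => a • (e (⟨f x, u x⟩ : TangentBundle (𝓡 n) N)).2 +
          b • (e (⟨f x, v x⟩ : TangentBundle (𝓡 n) N)).2) ?_
    (hbase.mono fun x hx => key x hx)
    (key x₀ (FiberBundle.mem_baseSet_trivializationAt' (f x₀)))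
  have hsm : ∀ c : ℝ, ContMDiff (𝓡 n) (𝓡 n) ∞ (fun w : EuclideanSpace ℝ (Fin n) => c • w) :=
    fun c => (contDiff_const_smul c).contMDiff
  exact ((hsm a).contMDiffAt.comp_contMDiffWithinAt x₀ hu'.2).add
    ((hsm b).contMDiffAt.comp_contMDiffWithinAt x₀ hv'.2)

theorem smoothAlongOn_zero {f : M → N} {s : Set M} (hf : ContMDiffOn (𝓡 m) (𝓡 n) ∞ f s) :
    SmoothAlongOn m n f (fun x => (0 : TangentSpace (𝓡 n) (f x))) s := by
  intro x₀ hx₀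
  refine Bundle.contMDiffWithinAt_totalSpace.2 ⟨hf x₀ hx₀, ?_⟩
  set e := trivializationAt (EuclideanSpace ℝ (Fin n)) (TangentSpace (𝓡 n) : N → Type _) (f x₀)
    with he
  have hbase : ∀ᶠ x in 𝓝[s] x₀, f x ∈ e.baseSet :=
    (hf x₀ hx₀).continuousWithinAt.eventually
      (e.open_baseSet.mem_nhds (FiberBundle.mem_baseSet_trivializationAt' (f x₀)))
  have key : ∀ x, f x ∈ e.baseSet → (e (⟨f x, 0⟩ : TangentBundle (𝓡 n) N)).2 = 0 := by
    intro x hx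
    exact (e.linear ℝ hx).map_zero
  exact (contMDiffWithinAt_const (c := (0 : EuclideanSpace ℝ (Fin n)))).congr_of_eventuallyEq
    (hbase.mono fun x hx => key x hx)
    (key x₀ (FiberBundle.mem_baseSet_trivializationAt' (f x₀)))

/-- Transport of a tangent vector along an equality of base points. -/
def tangentCast {x y : N} (h : x = y) (v : TangentSpace (𝓡 n) x) : TangentSpace (𝓡 n) y :=
  h ▸ v

end Along

/-! ## Connections

`V` and `W` are families of vector spaces over a manifold `B` of dimension `b`, with modules `ΓV`,
`ΓW` of smooth sections, and `anchor x v f` is the derivative of the function `f` in the direction of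
the anchor of `v ∈ V x`. -/

/-- A `V`-connection on `W`: an `ℝ`-bilinear map `(l, e) ↦ ∇_l e` that is `C^∞(B)`-linear in `l` and
satisfies the Leibniz rule in `e`. -/
@[ext]
structure AnchoredConnection (b : ℕ) {B : Type*} [TopologicalSpace B]
    [ChartedSpace (EuclideanSpace ℝ (Fin b)) B]
    {V W : B → Type*} [∀ x, AddCommGroup (V x)] [∀ x, Module ℝ (V x)]
    [∀ x, AddCommGroup (W x)] [∀ x, Module ℝ (W x)]
    (ΓV : Submodule ℝ (∀ x, V x)) (ΓW : Submodule ℝ (∀ x, W x))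
    (anchor : ∀ x, V x → (B → ℝ) → ℝ) where
  nabla : ΓV →ₗ[ℝ] ΓW →ₗ[ℝ] ΓW
  smul_left : ∀ f : B → ℝ, ContMDiff (𝓡 b) 𝓘(ℝ, ℝ) ∞ f → ∀ (l l' : ΓV) (e : ΓW),
    (∀ x, l'.1 x = f x • l.1 x) → ∀ x, (nabla l' e).1 x = f x • (nabla l e).1 x
  leibniz : ∀ f : B → ℝ, ContMDiff (𝓡 b) 𝓘(ℝ, ℝ) ∞ f → ∀ (l : ΓV) (e e' : ΓW),
    (∀ x, e'.1 x = f x • e.1 x) →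
      ∀ x, (nabla l e').1 x = f x • (nabla l e).1 x + anchor x (l.1 x) f • e.1 x

/-! ## Lie groupoids -/

/-- A Lie groupoid with manifold of arrows `G` (of dimension `n`) over a manifold `M` (of dimension
`m`). The product `mul g h` is meaningful only if `source g = target h`, and nothing is required of
it otherwise. The source and target maps are automatically surjective, because of the units. -/
structure LieGroupoid (m n : ℕ) (M G : Type*)
    [TopologicalSpace M] [ChartedSpace (EuclideanSpace ℝ (Fin m)) M]
    [TopologicalSpace G] [ChartedSpace (EuclideanSpace ℝ (Fin n)) G] where
  source : G → M
  target : G → M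
  unit : M → G
  inv : G → G
  mul : G → G → G
  source_unit : ∀ x, source (unit x) = x
  target_unit : ∀ x, target (unit x) = x
  source_inv : ∀ g, source (inv g) = target g
  target_inv : ∀ g, target (inv g) = source g
  source_mul : ∀ g h, source g = target h → source (mul g h) = source h
  target_mul : ∀ g h, source g = target h → target (mul g h) = target g
  mul_assoc : ∀ g h k, source g = target h → source h = target k →
    mul (mul g h) k = mul g (mul h k)
  mul_unit : ∀ g, mul g (unit (source g)) = g
  unit_mul : ∀ g, mul (unit (target g)) g = g
  mul_inv : ∀ g, mul g (inv g) = unit (target g)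
  inv_mul : ∀ g, mul (inv g) g = unit (source g)
  source_submersion : Manifold.IsSubmersion (𝓡 n) (𝓡 m) ∞ source
  target_submersion : Manifold.IsSubmersion (𝓡 n) (𝓡 m) ∞ target
  unit_smooth : ContMDiff (𝓡 m) (𝓡 n) ∞ unit
  inv_smooth : ContMDiff (𝓡 n) (𝓡 n) ∞ inv
  mul_smooth : ContMDiffOn ((𝓡 n).prod (𝓡 n)) (𝓡 n) ∞ (fun p : G × G => mul p.1 p.2)
    {p | source p.1 = target p.2}

namespace LieGroupoid

variable {m n : ℕ} {M G : Type*}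
  [TopologicalSpace M] [ChartedSpace (EuclideanSpace ℝ (Fin m)) M]
  [TopologicalSpace G] [ChartedSpace (EuclideanSpace ℝ (Fin n)) G]

/-- The multiplication `u • v = Tm(u, v)` of the tangent groupoid `TG ⇉ TM`, for `u`, `v` with
`Ts(u) = Tt(v)`. The derivative is taken within the submanifold of composable pairs; it is determined
on the vectors tangent to that submanifold, which are the pairs with `Ts(u) = Tt(v)`. -/
def tangentMul (𝒢 : LieGroupoid m n M G) (u v : TangentBundle (𝓡 n) G) : TangentBundle (𝓡 n) G :=
  ⟨𝒢.mul u.proj v.proj,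
    mfderivWithin ((𝓡 n).prod (𝓡 n)) (𝓡 n) (fun p : G × G => 𝒢.mul p.1 p.2)
      {p | 𝒢.source p.1 = 𝒢.target p.2} (u.proj, v.proj) (u.2, v.2)⟩

/-- The fibre at `x` of the Lie algebroid: the kernel of `T s` at the unit `1_x`. -/
def algebroidFiber (𝒢 : LieGroupoid m n M G) (x : M) :
    Submodule ℝ (TangentSpace (𝓡 n) (𝒢.unit x)) :=
  LinearMap.ker (mfderiv (𝓡 n) (𝓡 m) 𝒢.source (𝒢.unit x)).toLinearMap

/-- An element of the Lie algebroid as a tangent vector to the manifold of arrows at a unit. -/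
def algebroidVector (𝒢 : LieGroupoid m n M G) {x : M} (l : 𝒢.algebroidFiber x) :
    TangentBundle (𝓡 n) G :=
  ⟨𝒢.unit x, l.1⟩

/-- The derivative of `f` in the direction of the anchor `ρ(l) = T t (l) ∈ T_x M`. -/
def anchorDeriv (𝒢 : LieGroupoid m n M G) (x : M) (l : 𝒢.algebroidFiber x) (f : M → ℝ) : ℝ :=
  NormedSpace.fromTangentSpace (𝕜 := ℝ) _
    (mfderiv (𝓡 n) 𝓘(ℝ, ℝ) (f ∘ 𝒢.target) (𝒢.unit x) l.1)

/-- The smooth sections of the Lie algebroid, a subbundle of `TG` restricted to the units. -/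
def algebroidSections [IsManifold (𝓡 n) ∞ G] (𝒢 : LieGroupoid m n M G) :
    Submodule ℝ (∀ x, 𝒢.algebroidFiber x) where
  carrier := {l | SmoothAlongOn m n 𝒢.unit (fun x => (l x).1) Set.univ}
  add_mem' := by
    intro l l' hl hl'
    have h := SmoothAlongOn.combine hl hl' 1 1
    simpa using h
  zero_mem' := smoothAlongOn_zero 𝒢.unit_smooth.contMDiffOn
  smul_mem' := by
    intro c l hl
    have h := SmoothAlongOn.combine hl hl c 0
    simpa using h

/-- A local bisection: a smooth section `sec` of the source map over an open subset `base.source` of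
`M` such that `target ∘ sec` is a diffeomorphism onto an open subset `base.target` of `M`. -/
structure LocalBisection (𝒢 : LieGroupoid m n M G) where
  base : OpenPartialHomeomorph M M
  sec : M → G
  source_sec : ∀ x ∈ base.source, 𝒢.source (sec x) = x
  target_sec : ∀ x ∈ base.source, 𝒢.target (sec x) = base x
  sec_smooth : ContMDiffOn (𝓡 m) (𝓡 n) ∞ sec base.source
  symm_smooth : ContMDiffOn (𝓡 m) (𝓡 m) ∞ base.symm base.target

/-- Conjugation `g ↦ σ(t(g)) · g · σ(s(g))⁻¹` by a section `σ` of the source map. -/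
def conj (𝒢 : LieGroupoid m n M G) (σ : M → G) (g : G) : G :=
  𝒢.mul (𝒢.mul (σ (𝒢.target g)) g) (𝒢.inv (σ (𝒢.source g)))

end LieGroupoid

/-! ## Lie groupoid pairs -/

/-- A Lie groupoid pair: a Lie groupoid `big` over `M` with a closed wide Lie subgroupoid `sub`, that
is, a Lie groupoid over `M` with a morphism `incl` to `big` over the identity of `M` that is a closed
embedding. -/
structure LieGroupoidPair (m n p : ℕ) (M G A : Type*)
    [TopologicalSpace M] [ChartedSpace (EuclideanSpace ℝ (Fin m)) M]
    [TopologicalSpace G] [ChartedSpace (EuclideanSpace ℝ (Fin n)) G]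
    [TopologicalSpace A] [ChartedSpace (EuclideanSpace ℝ (Fin p)) A] where
  big : LieGroupoid m n M G
  sub : LieGroupoid m p M A
  incl : A → G
  source_incl : ∀ a, big.source (incl a) = sub.source a
  target_incl : ∀ a, big.target (incl a) = sub.target a
  incl_mul : ∀ a b, sub.source a = sub.target b → incl (sub.mul a b) = big.mul (incl a) (incl b)
  incl_embedding : Manifold.IsSmoothEmbedding (𝓡 p) (𝓡 n) ∞ incl
  incl_closed : IsClosed (Set.range incl)

namespace LieGroupoidPair

variable {m n p k : ℕ} {M G A : Type*}
  [TopologicalSpace M] [ChartedSpace (EuclideanSpace ℝ (Fin m)) M]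
  [TopologicalSpace G] [ChartedSpace (EuclideanSpace ℝ (Fin n)) G]
  [TopologicalSpace A] [ChartedSpace (EuclideanSpace ℝ (Fin p)) A]

theorem incl_unit (P : LieGroupoidPair m n p M G A) (x : M) :
    P.incl (P.sub.unit x) = P.big.unit x := by
  set g := P.incl (P.sub.unit x) with hg
  have hs : P.big.source g = x := by rw [hg, P.source_incl, P.sub.source_unit]
  have ht : P.big.target g = x := by rw [hg, P.target_incl, P.sub.target_unit]
  have hgg : P.big.mul g g = g := by
    have h := P.sub.mul_unit (P.sub.unit x)
    rw [P.sub.source_unit] at h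
    rw [hg, ← P.incl_mul _ _ (by rw [P.sub.source_unit, P.sub.target_unit]), h]
  have h1 := P.big.mul_assoc (P.big.inv g) g g (P.big.source_inv g) (by rw [hs, ht])
  rw [hgg, P.big.inv_mul, hs] at h1
  have h2 := P.big.unit_mul g
  rw [ht] at h2
  rw [← h2, h1]

theorem incl_inv (P : LieGroupoidPair m n p M G A) (a : A) :
    P.incl (P.sub.inv a) = P.big.inv (P.incl a) := by
  have hsa := P.source_incl a
  have hta := P.target_incl a
  have h1 : P.big.mul (P.incl a) (P.incl (P.sub.inv a)) = P.big.unit (P.sub.target a) := by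
    rw [← P.incl_mul _ _ (P.sub.target_inv a).symm, P.sub.mul_inv, P.incl_unit]
  have h2 := P.big.mul_assoc (P.big.inv (P.incl a)) (P.incl a) (P.incl (P.sub.inv a))
    (P.big.source_inv _) (by rw [P.target_incl, P.sub.target_inv, hsa])
  rw [h1, P.big.inv_mul, hsa] at h2
  have h3 := P.big.unit_mul (P.incl (P.sub.inv a))
  rw [P.target_incl, P.sub.target_inv] at h3
  have h4 := P.big.mul_unit (P.big.inv (P.incl a))
  rw [P.big.source_inv, hta] at h4
  rw [← h3, h2, h4]

/-- The fibre at `x` of the Lie algebroid of the subgroupoid, as a subspace of the fibre of the Lie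
algebroid of the big groupoid. -/
def subFiber (P : LieGroupoidPair m n p M G A) (x : M) : Submodule ℝ (P.big.algebroidFiber x) where
  carrier := {l | ∃ a : P.sub.algebroidFiber x,
    tangentCast (P.incl_unit x) (mfderiv (𝓡 p) (𝓡 n) P.incl (P.sub.unit x) a.1) = l.1}
  add_mem' := by
    rintro l l' ⟨a, ha⟩ ⟨a', ha'⟩
    refine ⟨a + a', ?_⟩
    have : ∀ {y z : G} (h : y = z) (v w : TangentSpace (𝓡 n) y),
        tangentCast h (v + w) = tangentCast h v + tangentCast h w := by
      rintro y z rfl v w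
      rfl
    rw [Submodule.coe_add, map_add, this, ha, ha', Submodule.coe_add]
  zero_mem' := by
    refine ⟨0, ?_⟩
    have : ∀ {y z : G} (h : y = z), tangentCast h (0 : TangentSpace (𝓡 n) y) = 0 := by
      rintro y z rfl
      rfl
    rw [Submodule.coe_zero, map_zero, this, Submodule.coe_zero]
  smul_mem' := by
    rintro c l ⟨a, ha⟩
    refine ⟨c • a, ?_⟩
    have : ∀ {y z : G} (h : y = z) (v : TangentSpace (𝓡 n) y),
        tangentCast h (c • v) = c • tangentCast h v := by
      rintro y z rfl v
      rfl
    rw [Submodule.coe_smul, map_smul, this, ha, Submodule.coe_smul]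

/-- The fibre at `x` of the quotient of the Lie algebroids. -/
abbrev QuotFiber (P : LieGroupoidPair m n p M G A) (x : M) : Type :=
  P.big.algebroidFiber x ⧸ P.subFiber x

/-- The smooth sections of the quotient bundle: the families that lift locally to smooth sections of
the Lie algebroid. -/
def quotSections [IsManifold (𝓡 n) ∞ G] (P : LieGroupoidPair m n p M G A) :
    Submodule ℝ (∀ x, P.QuotFiber x) where
  carrier := {e | ∀ x₀, ∃ U ∈ 𝓝 x₀, ∃ l : ∀ x, P.big.algebroidFiber x,
    SmoothAlongOn m n P.big.unit (fun x => (l x).1) U ∧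
      ∀ x ∈ U, (P.subFiber x).mkQ (l x) = e x}
  add_mem' := by
    intro e e' he he' x₀
    obtain ⟨U, hU, l, hl, hle⟩ := he x₀
    obtain ⟨U', hU', l', hl', hle'⟩ := he' x₀
    refine ⟨U ∩ U', Filter.inter_mem hU hU', l + l', ?_, ?_⟩
    · have h := SmoothAlongOn.combine (ContMDiffOn.mono hl Set.inter_subset_left)
        (ContMDiffOn.mono hl' Set.inter_subset_right) 1 1
      simpa using h
    · intro x hx
      rw [Pi.add_apply, Pi.add_apply, map_add, hle x hx.1, hle' x hx.2]
  zero_mem' := by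
    intro x₀
    refine ⟨Set.univ, Filter.univ_mem, 0, smoothAlongOn_zero P.big.unit_smooth.contMDiffOn, ?_⟩
    intro x _
    rw [Pi.zero_apply, Pi.zero_apply, map_zero]
  smul_mem' := by
    intro c e he x₀
    obtain ⟨U, hU, l, hl, hle⟩ := he x₀
    refine ⟨U, hU, c • l, ?_, ?_⟩
    · have h := SmoothAlongOn.combine hl hl c 0
      simpa using h
    · intro x hx
      rw [Pi.smul_apply, Pi.smul_apply, map_smul, hle x hx]

/-- Connections of the Lie algebroid of the big groupoid on the quotient bundle. -/
abbrev QuotConnection [IsManifold (𝓡 n) ∞ G] (P : LieGroupoidPair m n p M G A) :=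
  AnchoredConnection m P.big.algebroidSections P.quotSections P.big.anchorDeriv

/-- `β' = Ad_a β`, for the canonical action of the subgroupoid on the quotient bundle and an arrow
`a : x ⟶ y` of the subgroupoid. If `β` is the class of `l`, then `Ad_a β` is the class of
`u • l • 0_{a⁻¹}`, for any vector `u` tangent to the subgroupoid at `a` with `T s (u) = ρ(l)`. -/
def IsAd (P : LieGroupoidPair m n p M G A) (a : A) {x y : M}
    (β : P.QuotFiber x) (β' : P.QuotFiber y) : Prop :=
  P.sub.source a = x ∧ P.sub.target a = y ∧
    ∃ (u : TangentSpace (𝓡 p) a) (l : P.big.algebroidFiber x) (l' : P.big.algebroidFiber y),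
      tangentMap (𝓡 p) (𝓡 m) P.sub.source ⟨a, u⟩ =
        tangentMap (𝓡 n) (𝓡 m) P.big.target (P.big.algebroidVector l) ∧
      (P.subFiber x).mkQ l = β ∧ (P.subFiber y).mkQ l' = β' ∧
      P.big.tangentMul
          (P.big.tangentMul (tangentMap (𝓡 p) (𝓡 n) P.incl ⟨a, u⟩) (P.big.algebroidVector l))
          ⟨P.big.inv (P.incl a), 0⟩ =
        P.big.algebroidVector l'

/-- The connection extends the infinitesimal action of the Lie algebroid of the subgroupoid on the
quotient bundle: if `l` is a section of that Lie algebroid, then `∇_l e` at `x` is the derivative at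
`t = 0` of the curve `c(t)⁻¹ · e_{target (c t)}` in the fibre over `x`, for any smooth curve `c` of
arrows of the subgroupoid with source `x` that starts at `1_x` with velocity `l x`. The derivative of
a curve in that finite-dimensional space is expressed through linear functionals. -/
def ExtendsAction [IsManifold (𝓡 n) ∞ G] (P : LieGroupoidPair m n p M G A)
    (D : P.QuotConnection) : Prop :=
  ∀ (l : P.big.algebroidSections) (e : P.quotSections), (∀ x, l.1 x ∈ P.subFiber x) →
    ∀ (x : M) (c : ℝ → A), ContMDiff 𝓘(ℝ, ℝ) (𝓡 p) ∞ c → c 0 = P.sub.unit x →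
      (∀ t, P.sub.source (c t) = x) →
      tangentMap 𝓘(ℝ, ℝ) (𝓡 n) (P.incl ∘ c) ⟨0, (1 : ℝ)⟩ = P.big.algebroidVector (l.1 x) →
      ∀ w : ℝ → P.QuotFiber x,
        (∀ t, P.IsAd (P.sub.inv (c t)) (e.1 (P.sub.target (c t))) (w t)) →
        ∀ φ : P.QuotFiber x →ₗ[ℝ] ℝ,
          HasDerivAt (fun t => φ (w t)) (φ ((D.nabla l e).1 x)) 0

/-- The connection is invariant under the local bisections `Σ` of the subgroupoid:
`Σ ⋆ ∇_{Ad_{Σ⁻¹} l} (Σ⁻¹ ⋆ e) = ∇_l e` over the target of `Σ`. Here `l'` and `e'` are sections that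
agree with `Ad_{Σ⁻¹} l` and `Σ⁻¹ ⋆ e` over the source of `Σ`. -/
def BisectionEquivariant [IsManifold (𝓡 n) ∞ G] (P : LieGroupoidPair m n p M G A)
    (D : P.QuotConnection) : Prop :=
  ∀ (S : P.sub.LocalBisection) (l l' : P.big.algebroidSections) (e e' : P.quotSections),
    (∀ x ∈ S.base.source,
      tangentMap (𝓡 n) (𝓡 n) (P.big.conj (P.incl ∘ S.sec)) (P.big.algebroidVector (l'.1 x)) =
        P.big.algebroidVector (l.1 (S.base x))) →
    (∀ x ∈ S.base.source, P.IsAd (S.sec x) (e'.1 x) (e.1 (S.base x))) →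
    ∀ x ∈ S.base.source,
      P.IsAd (S.sec x) ((D.nabla l' e').1 x) ((D.nabla l e).1 (S.base x))

/-- Compatibility with the subgroupoid of a connection on the quotient bundle. -/
def IsCompatible [IsManifold (𝓡 n) ∞ G] (P : LieGroupoidPair m n p M G A)
    (D : P.QuotConnection) : Prop :=
  P.ExtendsAction D ∧ P.BisectionEquivariant D

/-! ### The homogeneous space -/

/-- Two arrows are equivalent if they differ by right translation by an arrow of the subgroupoid. -/
def orbitSetoid (P : LieGroupoidPair m n p M G A) : Setoid G where
  r g h := ∃ a : A, P.big.source g = P.sub.target a ∧ h = P.big.mul g (P.incl a)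
  iseqv := by
    refine ⟨fun g => ⟨P.sub.unit (P.big.source g), (P.sub.target_unit _).symm, ?_⟩, ?_, ?_⟩
    · rw [P.incl_unit, P.big.mul_unit]
    · rintro g h ⟨a, ha, rfl⟩
      have ha' : P.big.source g = P.big.target (P.incl a) := by rw [ha, P.target_incl]
      refine ⟨P.sub.inv a, ?_, ?_⟩
      · rw [P.big.source_mul _ _ ha', P.source_incl, P.sub.target_inv]
      · rw [P.incl_inv, P.big.mul_assoc _ _ _ ha' (P.big.target_inv _).symm, P.big.mul_inv,
          ← ha', P.big.mul_unit]
    · rintro g h j ⟨a, ha, rfl⟩ ⟨b, hb, rfl⟩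
      have ha' : P.big.source g = P.big.target (P.incl a) := by rw [ha, P.target_incl]
      rw [P.big.source_mul _ _ ha', P.source_incl] at hb
      refine ⟨P.sub.mul a b, ?_, ?_⟩
      · rw [P.sub.target_mul _ _ hb, ha]
      · rw [P.incl_mul _ _ hb, P.big.mul_assoc _ _ _ ha']
        rw [P.source_incl, P.target_incl, hb]

/-- The homogeneous space, the quotient of the big groupoid by right translations by the
subgroupoid. -/
def HomogeneousSpace (P : LieGroupoidPair m n p M G A) : Type _ := Quotient P.orbitSetoid

/-- The homogeneous space carries the quotient topology. -/
instance (P : LieGroupoidPair m n p M G A) : TopologicalSpace P.HomogeneousSpace :=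
  inferInstanceAs (TopologicalSpace (Quotient P.orbitSetoid))

/-- The projection to the homogeneous space. -/
def proj (P : LieGroupoidPair m n p M G A) (g : G) : P.HomogeneousSpace :=
  Quotient.mk P.orbitSetoid g

/-- The map from the homogeneous space to `M` induced by the target map. -/
def homTarget (P : LieGroupoidPair m n p M G A) : P.HomogeneousSpace → M :=
  Quotient.lift P.big.target (by
    rintro g h ⟨a, ha, rfl⟩
    rw [P.big.target_mul _ _ (by rw [ha, P.target_incl])])

open Classical in
/-- The left translation `[h] ↦ [g · h]` on the homogeneous space, defined on the fibre over the
source of `g`, and extended by the identity. -/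
def leftAction (P : LieGroupoidPair m n p M G A) (g : G) :
    P.HomogeneousSpace → P.HomogeneousSpace :=
  Quotient.lift
    (fun h => if P.big.source g = P.big.target h then P.proj (P.big.mul g h) else P.proj h) (by
    rintro h j ⟨a, ha, rfl⟩
    have ha' : P.big.source h = P.big.target (P.incl a) := by rw [ha, P.target_incl]
    rw [P.big.target_mul _ _ ha']
    split_ifs with hg
    · refine Quotient.sound ⟨a, ?_, ?_⟩
      · rw [P.big.source_mul _ _ hg, ha]
      · rw [P.big.mul_assoc _ _ _ hg ha']
    · exact Quotient.sound ⟨a, ha, rfl⟩)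

/-- The translation of the homogeneous space by a local bisection. -/
def translate (P : LieGroupoidPair m n p M G A) (S : P.big.LocalBisection)
    (q : P.HomogeneousSpace) : P.HomogeneousSpace :=
  P.leftAction (S.sec (P.homTarget q)) q

section Vertical

variable (P : LieGroupoidPair m n p M G A)
  [ChartedSpace (EuclideanSpace ℝ (Fin k)) P.HomogeneousSpace]

/-- The vectors at `q` tangent to the fibres of the homogeneous space over `M`. -/
def verticalFiber (k : ℕ) [ChartedSpace (EuclideanSpace ℝ (Fin k)) P.HomogeneousSpace]
    (q : P.HomogeneousSpace) : Submodule ℝ (TangentSpace (𝓡 k) q) :=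
  LinearMap.ker (mfderiv (𝓡 k) (𝓡 m) P.homTarget q).toLinearMap

/-- The derivative of a function in a vertical direction. -/
def verticalDeriv (k : ℕ) [ChartedSpace (EuclideanSpace ℝ (Fin k)) P.HomogeneousSpace]
    (q : P.HomogeneousSpace) (v : P.verticalFiber k q) (f : P.HomogeneousSpace → ℝ) : ℝ :=
  NormedSpace.fromTangentSpace (𝕜 := ℝ) _ (mfderiv (𝓡 k) 𝓘(ℝ, ℝ) f q v.1)

/-- The smooth vertical vector fields on the homogeneous space. -/
def verticalFields (k : ℕ) [ChartedSpace (EuclideanSpace ℝ (Fin k)) P.HomogeneousSpace]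
    [IsManifold (𝓡 k) ∞ P.HomogeneousSpace] :
    Submodule ℝ (∀ q, P.verticalFiber k q) where
  carrier := {X | SmoothAlongOn k k (fun q => q) (fun q => (X q).1) Set.univ}
  add_mem' := by
    intro X Y hX hY
    have h := SmoothAlongOn.combine hX hY 1 1
    simpa using h
  zero_mem' := smoothAlongOn_zero contMDiffOn_id
  smul_mem' := by
    intro c X hX
    have h := SmoothAlongOn.combine hX hX c 0
    simpa using h

/-- Fibrewise affine connections on the homogeneous space over `M`: connections of the vertical
tangent bundle on itself. -/
abbrev FibrewiseAffineConnection (k : ℕ)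
    [ChartedSpace (EuclideanSpace ℝ (Fin k)) P.HomogeneousSpace]
    [IsManifold (𝓡 k) ∞ P.HomogeneousSpace] :=
  AnchoredConnection k (P.verticalFields k) (P.verticalFields k) (P.verticalDeriv k)

/-- The vertical fields `X` and `X'` are related by the translation by the local bisection `S`, over
the source of `S`. -/
def TranslateRelated (S : P.big.LocalBisection) (X X' : ∀ q, P.verticalFiber k q) : Prop :=
  ∀ q, P.homTarget q ∈ S.base.source →
    tangentMap (𝓡 k) (𝓡 k) (P.translate S) ⟨q, (X q).1⟩ =
      ⟨P.translate S q, (X' (P.translate S q)).1⟩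

/-- Invariance under the big groupoid: the translations by local bisections preserve the
connection. -/
def IsInvariant [IsManifold (𝓡 k) ∞ P.HomogeneousSpace]
    (D : P.FibrewiseAffineConnection k) : Prop :=
  ∀ (S : P.big.LocalBisection) (X X' Y Y' : P.verticalFields k),
    P.TranslateRelated S X.1 X'.1 → P.TranslateRelated S Y.1 Y'.1 →
      P.TranslateRelated S (D.nabla X Y).1 (D.nabla X' Y').1

end Vertical

/-! ### The correspondence -/

/-- The vector `0_g • l⁻¹` at `g`, tangent to the target fibre, for `l` in the fibre of the Lie
algebroid at the source of `g`. -/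
def leftVector (P : LieGroupoidPair m n p M G A) (g : G)
    (l : P.big.algebroidFiber (P.big.source g)) : TangentSpace (𝓡 n) g :=
  tangentCast (show P.big.mul g (P.big.inv (P.big.unit (P.big.source g))) = g by
      have h := P.big.mul_inv (P.big.unit (P.big.source g))
      have h' := P.big.unit_mul (P.big.inv (P.big.unit (P.big.source g)))
      rw [P.big.target_inv, P.big.source_unit] at h'
      rw [P.big.target_unit, h'] at h
      rw [h, P.big.mul_unit])
    (P.big.tangentMul ⟨g, 0⟩ (tangentMap (𝓡 n) (𝓡 n) P.big.inv (P.big.algebroidVector l))).2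

/-- The canonical isomorphism from the fibre of the quotient bundle at the source of `g` to the
vertical tangent space of the homogeneous space at `[g]`: the class of `l` is sent to the projection
of `0_g • l⁻¹`, whatever the representative `l`. -/
def theta (P : LieGroupoidPair m n p M G A) (k : ℕ)
    [ChartedSpace (EuclideanSpace ℝ (Fin k)) P.HomogeneousSpace]
    (g : G) (β : P.QuotFiber (P.big.source g)) : TangentSpace (𝓡 k) (P.proj g) :=
  mfderiv (𝓡 n) (𝓡 k) P.proj g (P.leftVector g (Quotient.out β))

/-- The fibrewise affine connection `D` corresponds to the connection `D₀` on the quotient bundle if,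
along the projection and the identification `theta`, the pullback of `D` is the pullback of `D₀` by
the source map: if the pullback of the vertical field `Y` is `∑ hᵢ · s^* eᵢ` near `g`, and `X` at `[g]`
is the projection of the vector `v = 0_g • l⁻¹`, then `D_X Y` at `[g]` is the image of
`∑ (v(hᵢ) eᵢ + hᵢ(g) (D₀)_l eᵢ)`. -/
def Corresponds [IsManifold (𝓡 n) ∞ G] (P : LieGroupoidPair m n p M G A) {k : ℕ}
    [ChartedSpace (EuclideanSpace ℝ (Fin k)) P.HomogeneousSpace]
    [IsManifold (𝓡 k) ∞ P.HomogeneousSpace]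
    (D₀ : P.QuotConnection) (D : P.FibrewiseAffineConnection k) : Prop :=
  ∀ (g : G) (l : P.big.algebroidSections) (X Y : P.verticalFields k),
    (X.1 (P.proj g)).1 =
      mfderiv (𝓡 n) (𝓡 k) P.proj g (P.leftVector g (l.1 (P.big.source g))) →
    ∀ (r : ℕ) (h : Fin r → G → ℝ) (e : Fin r → P.quotSections),
      (∀ i, ContMDiffAt (𝓡 n) 𝓘(ℝ, ℝ) ∞ (h i) g) →
      (∀ᶠ g' in 𝓝 g, (Y.1 (P.proj g')).1 =
        ∑ i, h i g' • P.theta k g' ((e i).1 (P.big.source g'))) →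
      ((D.nabla X Y).1 (P.proj g)).1 =
        ∑ i, (NormedSpace.fromTangentSpace (𝕜 := ℝ) _
              (mfderiv (𝓡 n) 𝓘(ℝ, ℝ) (h i) g (P.leftVector g (l.1 (P.big.source g)))) •
            P.theta k g ((e i).1 (P.big.source g)) +
          h i g • P.theta k g ((D₀.nabla l (e i)).1 (P.big.source g)))

end LieGroupoidPair

end

/-!
# Connections on the quotient of Lie algebroids and on the homogeneous space

Write `L` for the big groupoid, `A` for the subgroupoid, `ℓ/𝔞` for the quotient of the Lie
algebroids, `π : L → L/A` for the projection, and `V` for the vertical bundle of `L/A → M`.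

**The homogeneous space.** Right translations by arrows of `A` extend locally to smooth maps of `L`,
so that `π` is open, and `L/A` is Hausdorff because its equivalence relation is closed in `L × L`
(`homogeneousSpace_t2Space`). Near an arrow, let `κ` parametrize a submanifold transverse to its
class, and let `α` be coordinates along the target fibres of `A`. By the inverse function theorem,
`(z, w) ↦ κ(z) · α(s(κ(z)), w)` gives coordinates on `L`; since `A` is embedded, equivalent
points of a small piece of the transverse submanifold coincide, so that `z` is a coordinate on `L/A`
(`exists_slice`). Different slices are compared by means of right translations, which gives
`exists_quot_manifold`.

**The correspondence.** The isomorphisms `theta` identify the pullback of `ℓ/𝔞` by the source map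
`s : L → M` with the pullback of `V` by `π`: one bundle over `L` is pulled back from two base
spaces (`isPulledBundle_quot`, `isPulledBundle_vert`). A connection on either base differentiates
the sections of the pulled back bundle in the directions tangent to the target fibres, by the
Leibniz rule; the relation `PullsTo` expresses this for a single tangent vector of `L`, and
`PullsTo.unique` shows that the result is well defined. Two connections correspond if and only if
they induce the same derivative over `L` (`corresponds_iff`), and this condition is symmetric in the
two base spaces (`PullbackAgrees.symm`). As `s` and `π` are surjective, each connection determines
the other (`PullbackAgrees.unique`), and a connection on one base descends to the other one precisely
if the derivative that it induces is constant along the fibres of the other map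
(`exists_pullbackAgrees`).

It remains to see what this condition means.

* The fibres of `π` are the orbits of right translation by `A`. The vectors tangent to them lift the
  zero vector field of `L/A`, so that the connection has to differentiate pullbacks from `L/A` to
  zero in these directions; this holds if it extends the action of `𝔞` (`ExtendsAction.eq_zero`).
  Two arrows in a fibre of `π` are related by the right translation by a local bisection of `A`, which
  maps left-invariant fields to left-invariant fields (`tmap_rightMap`) and realizes the canonical
  action on `ℓ/𝔞` (`isAd_rightMap`). Hence the derivatives induced by a compatible connection
  agree (`IsCompatible.eq_of_pullsTo`).
* Two arrows with the same source are related by the left translation by a local bisection of `L`,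
  which preserves `theta` (`tmap_translate`) and the left-invariant fields (`tmap_leftMap`). Hence
  the derivatives induced by an invariant connection agree (`IsInvariant.eq_of_pullsTo`).

Conversely, a connection on `L/A` which corresponds to one on `ℓ/𝔞` is invariant
(`PullbackAgrees.isInvariant`), and a connection on `ℓ/𝔞` which corresponds to one on `L/A` is
compatible (`PullbackAgrees.extendsAction`, `PullbackAgrees.bisectionEquivariant`), by the same
computations.
-/

open scoped Manifold ContDiff Topology

noncomputable section

set_option linter.unusedSectionVars false

/-! ### Smooth families of tangent vectors along a map -/

/-- The derivative of a map between manifolds, as a map between the model spaces. -/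
def tmap (n b : ℕ) {N B : Type*} [TopologicalSpace N] [ChartedSpace (EuclideanSpace ℝ (Fin n)) N]
    [TopologicalSpace B] [ChartedSpace (EuclideanSpace ℝ (Fin b)) B] (f : N → B) (x : N) :
    EuclideanSpace ℝ (Fin n) →L[ℝ] EuclideanSpace ℝ (Fin b) :=
  mfderiv (𝓡 n) (𝓡 b) f x

/-- The derivative of a real-valued function on a manifold, as a functional on the model space. -/
def tfun (n : ℕ) {N : Type*} [TopologicalSpace N] [ChartedSpace (EuclideanSpace ℝ (Fin n)) N]
    (f : N → ℝ) (x : N) : EuclideanSpace ℝ (Fin n) →L[ℝ] ℝ :=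
  mfderiv (𝓡 n) 𝓘(ℝ, ℝ) f x

section Fields

variable {EK : Type*} [NormedAddCommGroup EK] [NormedSpace ℝ EK] {HK : Type*} [TopologicalSpace HK]
  {IK : ModelWithCorners ℝ EK HK} {K : Type*} [TopologicalSpace K] [ChartedSpace HK K]
  {n b : ℕ} {N B : Type*}
  [TopologicalSpace N] [ChartedSpace (EuclideanSpace ℝ (Fin n)) N] [IsManifold (𝓡 n) ∞ N]
  [TopologicalSpace B] [ChartedSpace (EuclideanSpace ℝ (Fin b)) B] [IsManifold (𝓡 b) ∞ B]

/-- The family of tangent vectors `v x ∈ T_{f x} N` depends smoothly on `x` near `x₀`. All tangent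
spaces are identified with the model space, so that `v` is a plain function. -/
def SmoothFieldAt {EK : Type*} [NormedAddCommGroup EK] [NormedSpace ℝ EK] {HK : Type*}
    [TopologicalSpace HK] (IK : ModelWithCorners ℝ EK HK) {K : Type*} [TopologicalSpace K]
    [ChartedSpace HK K] (n : ℕ) {N : Type*} [TopologicalSpace N]
    [ChartedSpace (EuclideanSpace ℝ (Fin n)) N] [IsManifold (𝓡 n) ∞ N]
    (f : K → N) (v : K → EuclideanSpace ℝ (Fin n)) (x₀ : K) : Prop :=
  ContMDiffAt IK (𝓡 n).tangent ∞ (fun x => (⟨f x, v x⟩ : TangentBundle (𝓡 n) N)) x₀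

/-- The coordinates at `y₀` of a vector `v ∈ T_y N`. -/
def fieldCoord {n : ℕ} {N : Type*} [TopologicalSpace N]
    [ChartedSpace (EuclideanSpace ℝ (Fin n)) N] [IsManifold (𝓡 n) ∞ N] (y₀ y : N)
    (v : EuclideanSpace ℝ (Fin n)) : EuclideanSpace ℝ (Fin n) :=
  (trivializationAt (EuclideanSpace ℝ (Fin n)) (TangentSpace (𝓡 n) : N → Type _) y₀
    (⟨y, v⟩ : TangentBundle (𝓡 n) N)).2

theorem exists_fieldCoord_equiv (y₀ : N) : ∀ᶠ y in 𝓝 y₀,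
    ∃ L : EuclideanSpace ℝ (Fin n) ≃ₗ[ℝ] EuclideanSpace ℝ (Fin n), ∀ v,
      fieldCoord y₀ y v = L v := by
  set e := trivializationAt (EuclideanSpace ℝ (Fin n)) (TangentSpace (𝓡 n) : N → Type _) y₀
    with he
  filter_upwards [e.open_baseSet.mem_nhds (FiberBundle.mem_baseSet_trivializationAt' y₀)] with y hy
  exact ⟨e.linearEquivAt ℝ y hy, fun v => rfl⟩

theorem eventually_contMDiffAt_fieldCoord {f : K → N} {v : K → EuclideanSpace ℝ (Fin n)} {x₀ : K}
    (hf : ContinuousAt f x₀) (hv : ∀ᶠ x in 𝓝 x₀, SmoothFieldAt IK n f v x) : ∀ᶠ x in 𝓝 x₀,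
      ContMDiffAt IK 𝓘(ℝ, EuclideanSpace ℝ (Fin n)) ∞
        (fun x => fieldCoord (f x₀) (f x) (v x)) x := by
  set e := trivializationAt (EuclideanSpace ℝ (Fin n)) (TangentSpace (𝓡 n) : N → Type _) (f x₀)
    with he
  filter_upwards [hv, hf.eventually
    (e.open_baseSet.mem_nhds (FiberBundle.mem_baseSet_trivializationAt' (f x₀)))] with x hx hb
  exact ((e.contMDiffAt_iff (IB := 𝓡 n) (by rw [e.mem_source]; exact hb)).1 hx).2

theorem smoothFieldAt_iff {f : K → N} {v : K → EuclideanSpace ℝ (Fin n)} {x₀ : K} :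
    SmoothFieldAt IK n f v x₀ ↔ ContMDiffAt IK (𝓡 n) ∞ f x₀ ∧
      ContMDiffAt IK 𝓘(ℝ, EuclideanSpace ℝ (Fin n)) ∞ (fun x => fieldCoord (f x₀) (f x) (v x)) x₀ :=
  Bundle.contMDiffAt_totalSpace

theorem SmoothFieldAt.base {f : K → N} {v : K → EuclideanSpace ℝ (Fin n)} {x₀ : K}
    (h : SmoothFieldAt IK n f v x₀) : ContMDiffAt IK (𝓡 n) ∞ f x₀ :=
  (smoothFieldAt_iff.1 h).1

theorem SmoothFieldAt.congr {f f' : K → N} {v v' : K → EuclideanSpace ℝ (Fin n)} {x₀ : K}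
    (h : SmoothFieldAt IK n f v x₀) (hf : ∀ᶠ x in 𝓝 x₀, f' x = f x)
    (hv : ∀ᶠ x in 𝓝 x₀, v' x = v x) : SmoothFieldAt IK n f' v' x₀ := by
  refine ContMDiffAt.congr_of_eventuallyEq h ?_
  filter_upwards [hf, hv] with x h1 h2
  rw [h1, h2]

theorem SmoothFieldAt.sum {f : K → N} {x₀ : K} {ι : Type*} [Fintype ι]
    {v : ι → K → EuclideanSpace ℝ (Fin n)} {h : ι → K → ℝ} (hf : ContMDiffAt IK (𝓡 n) ∞ f x₀)
    (hv : ∀ i, SmoothFieldAt IK n f (v i) x₀) (hh : ∀ i, ContMDiffAt IK 𝓘(ℝ, ℝ) ∞ (h i) x₀) :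
    SmoothFieldAt IK n f (fun x => ∑ i, h i x • v i x) x₀ := by
  refine smoothFieldAt_iff.2 ⟨hf, ?_⟩
  have h1 : ContMDiffAt IK 𝓘(ℝ, EuclideanSpace ℝ (Fin n)) ∞
      (fun x => ∑ i, h i x • fieldCoord (f x₀) (f x) (v i x)) x₀ :=
    contMDiffAt_finsetSum fun i _ => (hh i).smul (smoothFieldAt_iff.1 (hv i)).2
  refine h1.congr_of_eventuallyEq ?_
  filter_upwards [hf.continuousAt.eventually (exists_fieldCoord_equiv (n := n) (f x₀))]
    with x ⟨L, hL⟩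
  simp only [hL, map_sum, map_smul]

theorem SmoothFieldAt.zero {f : K → N} {x₀ : K} (hf : ContMDiffAt IK (𝓡 n) ∞ f x₀) :
    SmoothFieldAt IK n f (fun _ => 0) x₀ := by
  have := SmoothFieldAt.sum (ι := Fin 0) (v := fun _ _ => 0) (h := fun _ _ => 0) hf
    (fun i => i.elim0) (fun i => i.elim0)
  simpa using this

theorem SmoothFieldAt.smul {f : K → N} {x₀ : K} {v : K → EuclideanSpace ℝ (Fin n)} {h : K → ℝ}
    (hv : SmoothFieldAt IK n f v x₀) (hh : ContMDiffAt IK 𝓘(ℝ, ℝ) ∞ h x₀) :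
    SmoothFieldAt IK n f (fun x => h x • v x) x₀ := by
  have := SmoothFieldAt.sum (ι := Fin 1) (v := fun _ => v) (h := fun _ => h) hv.base
    (fun _ => hv) (fun _ => hh)
  simpa using this

theorem SmoothFieldAt.add {f : K → N} {x₀ : K} {v w : K → EuclideanSpace ℝ (Fin n)}
    (hv : SmoothFieldAt IK n f v x₀) (hw : SmoothFieldAt IK n f w x₀) :
    SmoothFieldAt IK n f (fun x => v x + w x) x₀ := by
  have := SmoothFieldAt.sum (ι := Fin 2) (v := ![v, w]) (h := fun _ _ => 1) (n := n) hv.base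
    (fun i => by fin_cases i <;> assumption) (fun _ => contMDiffAt_const)
  simpa using this

/-- The image of a smooth family of vectors under the derivatives of a smooth family of maps. -/
theorem SmoothFieldAt.push_param {p : ℕ} {K : Type*} [TopologicalSpace K]
    [ChartedSpace (EuclideanSpace ℝ (Fin p)) K] [IsManifold (𝓡 p) ∞ K] {g : K → N}
    {v : K → EuclideanSpace ℝ (Fin n)} {x₀ : K}
    (hv : SmoothFieldAt (𝓡 p) n g v x₀) {f : K → N → B}
    (hf : ContMDiffAt ((𝓡 p).prod (𝓡 n)) (𝓡 b) ∞ (Function.uncurry f) (x₀, g x₀)) :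
    SmoothFieldAt (𝓡 p) b (fun x => f x (g x)) (fun x => tmap n b (f x) (g x) (v x))
      x₀ := by
  have h1 := ContMDiffAt.mfderiv (m := ∞) f g hf hv.base (by simp)
  have h2 : ContMDiffAt (𝓡 p) (𝓡 b) ∞ (fun x => f x (g x)) x₀ :=
    hf.comp x₀ (contMDiffAt_id.prodMk hv.base)
  have h3 : SmoothFieldAt (𝓡 p) b (fun x => f x (g x))
      (fun x => mfderiv (𝓡 n) (𝓡 b) (f x) (g x) (v x)) x₀ :=
    ContMDiffAt.clm_apply_of_inCoordinates h1 hv h2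
  exact h3

theorem SmoothFieldAt.push {p : ℕ} {K : Type*} [TopologicalSpace K]
    [ChartedSpace (EuclideanSpace ℝ (Fin p)) K] [IsManifold (𝓡 p) ∞ K] {g : K → N}
    {v : K → EuclideanSpace ℝ (Fin n)} {x₀ : K}
    (hv : SmoothFieldAt (𝓡 p) n g v x₀) {f : N → B} (hf : ContMDiffAt (𝓡 n) (𝓡 b) ∞ f (g x₀)) :
    SmoothFieldAt (𝓡 p) b (fun x => f (g x)) (fun x => tmap n b f (g x) (v x)) x₀ :=
  hv.push_param (f := fun _ => f) (hf.comp (x₀, g x₀) contMDiffAt_snd)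

/-- The derivative of a smooth function along a smooth family of vectors. -/
theorem SmoothFieldAt.push_real {p : ℕ} {K : Type*} [TopologicalSpace K]
    [ChartedSpace (EuclideanSpace ℝ (Fin p)) K] [IsManifold (𝓡 p) ∞ K] {g : K → N}
    {v : K → EuclideanSpace ℝ (Fin n)} {x₀ : K}
    (hv : SmoothFieldAt (𝓡 p) n g v x₀) {f : N → ℝ} (hf : ContMDiffAt (𝓡 n) 𝓘(ℝ, ℝ) ∞ f (g x₀)) :
    ContMDiffAt (𝓡 p) 𝓘(ℝ, ℝ) ∞
      (fun x => tfun n f (g x) (v x)) x₀ := by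
  have h0 : ContMDiffAt ((𝓡 p).prod (𝓡 n)) 𝓘(ℝ, ℝ) ∞ (Function.uncurry fun (_ : K) => f)
      (x₀, g x₀) := hf.comp (x₀, g x₀) contMDiffAt_snd
  have h1 := ContMDiffAt.mfderiv (m := ∞) (fun _ => f) g h0 hv.base (by simp)
  have h2 : ContMDiffAt (𝓡 p) 𝓘(ℝ, ℝ) ∞ (fun x => f (g x)) x₀ := hf.comp x₀ hv.base
  have h3 := ContMDiffAt.clm_apply_of_inCoordinates h1 hv h2
  have h4 := (Bundle.contMDiffAt_totalSpace.1 h3).2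
  refine h4.congr_of_eventuallyEq (Filter.Eventually.of_forall fun x => ?_)
  simp
  rfl

theorem SmoothFieldAt.comp {EL : Type*} [NormedAddCommGroup EL] [NormedSpace ℝ EL] {HL : Type*}
    [TopologicalSpace HL] {IL : ModelWithCorners ℝ EL HL} {L : Type*} [TopologicalSpace L]
    [ChartedSpace HL L] {f : K → N} {v : K → EuclideanSpace ℝ (Fin n)} {y₀ : L} {g : L → K}
    (hv : SmoothFieldAt IK n f v (g y₀)) (hg : ContMDiffAt IL IK ∞ g y₀) :
    SmoothFieldAt IL n (fun y => f (g y)) (fun y => v (g y)) y₀ :=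
  ContMDiffAt.comp y₀ hv hg

/-- If a smooth family lies in the span of smooth families which are linearly independent at a
point, then its coefficients are smooth. -/
theorem exists_smooth_coefficients {f : K → N} {r : ℕ} {σ : Fin r → K → EuclideanSpace ℝ (Fin n)}
    {x₀ : K} (hf : ContMDiffAt IK (𝓡 n) ∞ f x₀)
    (hσ : ∀ i, ∀ᶠ x in 𝓝 x₀, SmoothFieldAt IK n f (σ i) x)
    (hli : LinearIndependent ℝ (fun i => σ i x₀)) :
    (∀ᶠ x in 𝓝 x₀, LinearIndependent ℝ (fun i => σ i x)) ∧
    ∀ τ : K → EuclideanSpace ℝ (Fin n), (∀ᶠ x in 𝓝 x₀, SmoothFieldAt IK n f τ x) →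
      (∀ᶠ x in 𝓝 x₀, τ x ∈ Submodule.span ℝ (Set.range fun i => σ i x)) →
      ∃ h : Fin r → K → ℝ, (∀ i, ∀ᶠ x in 𝓝 x₀, ContMDiffAt IK 𝓘(ℝ, ℝ) ∞ (h i) x) ∧
        ∀ᶠ x in 𝓝 x₀, τ x = ∑ i, h i x • σ i x := by
  set S : Fin r → K → EuclideanSpace ℝ (Fin n) := fun i x => fieldCoord (f x₀) (f x) (σ i x) with hS
  have hSsm : ∀ i, ∀ᶠ x in 𝓝 x₀, ContMDiffAt IK 𝓘(ℝ, EuclideanSpace ℝ (Fin n)) ∞ (S i) x :=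
    fun i => eventually_contMDiffAt_fieldCoord hf.continuousAt (hσ i)
  have hcoord := hf.continuousAt.eventually (exists_fieldCoord_equiv (n := n) (f x₀))
  have hS0 : LinearIndependent ℝ (fun i => S i x₀) := by
    obtain ⟨L, hL⟩ := hcoord.self_of_nhds
    rw [show (fun i => S i x₀) = L.toLinearMap ∘ fun i => σ i x₀ from funext fun i => hL _]
    exact hli.map' L.toLinearMap L.ker
  obtain ⟨Λ₀, hΛ₀⟩ := LinearMap.exists_leftInverse_of_injective
    (Fintype.linearCombination ℝ (fun i => S i x₀)) (by
      rw [LinearMap.ker_eq_bot']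
      intro g hg
      exact funext (Fintype.linearIndependent_iff.1 hS0 g hg))
  set Λ := LinearMap.toContinuousLinearMap Λ₀ with hΛ
  set T : K → (Fin r → ℝ) →L[ℝ] (Fin r → ℝ) := fun x =>
    ∑ i, ContinuousLinearMap.smulRightL ℝ _ _ (ContinuousLinearMap.proj i) (Λ (S i x)) with hT
  have hTapp : ∀ x (c : Fin r → ℝ), T x c = Λ (∑ i, c i • S i x) := by
    intro x c
    simp [hT, map_sum]
  have hTsm : ∀ᶠ x in 𝓝 x₀, ContMDiffAt IK 𝓘(ℝ, (Fin r → ℝ) →L[ℝ] (Fin r → ℝ)) ∞ T x := by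
    filter_upwards [Filter.eventually_all.2 hSsm] with x hx
    refine contMDiffAt_finsetSum fun i _ => ?_
    exact ((ContinuousLinearMap.contMDiff
      ((ContinuousLinearMap.smulRightL ℝ (Fin r → ℝ) (Fin r → ℝ)
        (ContinuousLinearMap.proj i)).comp Λ)).contMDiffAt).comp x (hx i)
  have hT0 : T x₀ = 1 := by
    ext1 c
    rw [hTapp]
    exact LinearMap.congr_fun hΛ₀ c
  have hunit : ∀ᶠ x in 𝓝 x₀, IsUnit (T x) := by
    have : {u | IsUnit u} ∈ 𝓝 (T x₀) := Units.isOpen.mem_nhds (by rw [hT0]; exact isUnit_one)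
    exact hTsm.self_of_nhds.continuousAt.eventually this
  refine ⟨?_, fun τ hτ hspan => ?_⟩
  · filter_upwards [hunit, hcoord] with x ⟨u, hu⟩ ⟨L, hL⟩
    rw [Fintype.linearIndependent_iff]
    intro g hg i
    have h1 : T x g = 0 := by
      have : ∑ i, g i • S i x = L (∑ i, g i • σ i x) := by simp [hS, hL, map_sum]
      rw [hTapp, this, hg, map_zero, map_zero]
    have h2 : g = 0 := by
      have : (u⁻¹ : ((Fin r → ℝ) →L[ℝ] (Fin r → ℝ))ˣ).1 (u.1 g) = g := by
        rw [← mul_apply_eq_comp, Units.inv_mul, one_apply_eq_self]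
      rw [← this, hu, h1, map_zero]
    rw [h2, Pi.zero_apply]
  · set θ : K → EuclideanSpace ℝ (Fin n) := fun x => fieldCoord (f x₀) (f x) (τ x) with hθ
    have hθsm : ∀ᶠ x in 𝓝 x₀, ContMDiffAt IK 𝓘(ℝ, EuclideanSpace ℝ (Fin n)) ∞ θ x :=
      eventually_contMDiffAt_fieldCoord hf.continuousAt hτ
    refine ⟨fun i x => (Ring.inverse (T x) (Λ (θ x))) i, fun i => ?_, ?_⟩
    · filter_upwards [hunit, hTsm, hθsm] with x ⟨u, hu⟩ h1 h2
      have h3 : ContMDiffAt IK 𝓘(ℝ, (Fin r → ℝ) →L[ℝ] (Fin r → ℝ)) ∞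
          (fun x => Ring.inverse (T x)) x :=
        ContDiffAt.comp_contMDiffAt (by rw [← hu]; exact contDiffAt_ringInverse ℝ u) h1
      have h4 : ContMDiffAt IK 𝓘(ℝ, Fin r → ℝ) ∞ (fun x => Λ (θ x)) x :=
        (ContinuousLinearMap.contMDiff Λ).contMDiffAt.comp x h2
      exact contMDiffAt_pi_space.1 (h3.clm_apply h4) i
    · filter_upwards [hunit, hcoord, hspan] with x ⟨u, hu⟩ ⟨L, hL⟩ hx
      obtain ⟨c, hc⟩ := (Submodule.mem_span_range_iff_exists_fun ℝ).1 hx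
      have h1 : Λ (θ x) = T x c := by
        rw [hTapp]
        simp only [hθ, ← hc, hS, hL, map_sum, map_smul]
      have h2 : Ring.inverse (T x) (Λ (θ x)) = c := by
        rw [h1, ← hu, Ring.inverse_unit, ← mul_apply_eq_comp, Units.inv_mul,
          one_apply_eq_self]
      simp only [h2, hc]

end Fields

section Bump

variable {b : ℕ} {B : Type*}
  [TopologicalSpace B] [ChartedSpace (EuclideanSpace ℝ (Fin b)) B] [IsManifold (𝓡 b) ∞ B]
  [T2Space B]

theorem exists_cutoff {x₀ : B} {U : Set B} (hU : U ∈ 𝓝 x₀) :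
    ∃ χ : B → ℝ, ContMDiff (𝓡 b) 𝓘(ℝ, ℝ) ∞ χ ∧ (∀ᶠ x in 𝓝 x₀, χ x = 1) ∧ tsupport χ ⊆ U := by
  obtain ⟨χ, -, hχ⟩ := (SmoothBumpFunction.nhds_basis_tsupport (I := 𝓡 b) x₀).mem_iff.1 hU
  exact ⟨χ, χ.contMDiff, χ.eventuallyEq_one, hχ⟩

/-- A function which is smooth near `x₀` agrees near `x₀` with a globally smooth one. -/
theorem exists_global_function {x₀ : B} {f : B → ℝ}
    (hf : ∀ᶠ x in 𝓝 x₀, ContMDiffAt (𝓡 b) 𝓘(ℝ, ℝ) ∞ f x) :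
    ∃ g : B → ℝ, ContMDiff (𝓡 b) 𝓘(ℝ, ℝ) ∞ g ∧ ∀ᶠ x in 𝓝 x₀, g x = f x := by
  obtain ⟨χ, hχ, h1, hs⟩ := exists_cutoff (b := b) hf
  refine ⟨fun x => χ x * f x, fun x => ?_, ?_⟩
  · by_cases hx : x ∈ tsupport χ
    · exact (hχ x).mul (hs hx)
    · refine (contMDiffAt_const (c := (0 : ℝ))).congr_of_eventuallyEq ?_
      filter_upwards [(isClosed_tsupport χ).isOpen_compl.mem_nhds hx] with y hy
      rw [image_eq_zero_of_notMem_tsupport hy, zero_mul]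
  · filter_upwards [h1] with x hx
    rw [hx, one_mul]

theorem SmoothFieldAt.cutoff {n : ℕ} {N : Type*} [TopologicalSpace N]
    [ChartedSpace (EuclideanSpace ℝ (Fin n)) N] [IsManifold (𝓡 n) ∞ N] {f : B → N}
    (hf : ContMDiff (𝓡 b) (𝓡 n) ∞ f) {v : B → EuclideanSpace ℝ (Fin n)} {χ : B → ℝ}
    (hχ : ContMDiff (𝓡 b) 𝓘(ℝ, ℝ) ∞ χ) (hv : ∀ x ∈ tsupport χ, SmoothFieldAt (𝓡 b) n f v x)
    (x : B) :
    SmoothFieldAt (𝓡 b) n f (fun x => χ x • v x) x := by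
  by_cases hx : x ∈ tsupport χ
  · exact (hv x hx).smul (hχ x)
  · refine (SmoothFieldAt.zero (hf x)).congr (Filter.Eventually.of_forall fun _ => rfl) ?_
    filter_upwards [(isClosed_tsupport χ).isOpen_compl.mem_nhds hx] with y hy
    rw [image_eq_zero_of_notMem_tsupport hy, zero_smul]

end Bump

/-! ### Velocities of curves -/

section Velocity

variable {n b : ℕ} {N B : Type*}
  [TopologicalSpace N] [ChartedSpace (EuclideanSpace ℝ (Fin n)) N]
  [TopologicalSpace B] [ChartedSpace (EuclideanSpace ℝ (Fin b)) B]

/-- The velocity at time `0` of a curve, as an element of the model space. -/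
def vel (n : ℕ) {N : Type*} [TopologicalSpace N] [ChartedSpace (EuclideanSpace ℝ (Fin n)) N]
    (c : ℝ → N) : EuclideanSpace ℝ (Fin n) :=
  mfderiv 𝓘(ℝ, ℝ) (𝓡 n) c 0 (1 : ℝ)

theorem tangentVector_ext {x y : N} {v w : EuclideanSpace ℝ (Fin n)} (h : x = y) (h' : v = w) :
    (⟨x, v⟩ : TangentBundle (𝓡 n) N) = ⟨y, w⟩ := by
  subst h h'
  rfl

theorem tangentVector_eq_iff {x y : N} {v w : EuclideanSpace ℝ (Fin n)} :
    (⟨x, v⟩ : TangentBundle (𝓡 n) N) = ⟨y, w⟩ ↔ x = y ∧ v = w := by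
  refine ⟨fun h => ?_, fun h => tangentVector_ext h.1 h.2⟩
  have h1 : x = y := congrArg Bundle.TotalSpace.proj h
  subst h1
  exact ⟨rfl, eq_of_heq (Bundle.TotalSpace.mk.inj h).2⟩

theorem tangentCast_eq {x y : N} (h : x = y) (v : TangentSpace (𝓡 n) x) :
    (tangentCast h v : EuclideanSpace ℝ (Fin n)) = v := by
  subst h
  rfl

theorem vel_congr {c d : ℝ → N} (h : ∀ᶠ t in 𝓝 0, c t = d t) : vel n c = vel n d := by
  have : c =ᶠ[𝓝 0] d := h
  exact congrArg (fun L : ℝ →L[ℝ] EuclideanSpace ℝ (Fin n) => L 1) this.mfderiv_eq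

theorem vel_const (x : N) : vel n (fun _ => x) = 0 := by
  have : mfderiv 𝓘(ℝ, ℝ) (𝓡 n) (fun _ : ℝ => x) 0 = 0 := mfderiv_const
  exact congrArg (fun L : ℝ →L[ℝ] EuclideanSpace ℝ (Fin n) => L 1) this

theorem vel_comp {f : N → B} {c : ℝ → N} {x : N} (hx : c 0 = x)
    (hf : ContMDiffAt (𝓡 n) (𝓡 b) ∞ f x)
    (hc : ContMDiffAt 𝓘(ℝ, ℝ) (𝓡 n) ∞ c 0) :
    tmap n b f x (vel n c) = vel b (fun t => f (c t)) := by
  subst hx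
  have := mfderiv_comp (0 : ℝ) (hf.mdifferentiableAt (by simp)) (hc.mdifferentiableAt (by simp))
  exact (congrArg (fun L : ℝ →L[ℝ] EuclideanSpace ℝ (Fin b) => L 1) this).symm

theorem vel_comp_real {f : N → ℝ} {c : ℝ → N} {x : N} (hx : c 0 = x)
    (hf : ContMDiffAt (𝓡 n) 𝓘(ℝ, ℝ) ∞ f x)
    (hc : ContMDiffAt 𝓘(ℝ, ℝ) (𝓡 n) ∞ c 0) :
    HasDerivAt (fun t => f (c t))
      (tfun n f x (vel n c)) 0 := by
  subst hx
  have h1 := (hf.mdifferentiableAt (by simp)).hasMFDerivAt.comp (0 : ℝ)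
    (hc.mdifferentiableAt (by simp)).hasMFDerivAt
  have key : ∀ D : ℝ →L[ℝ] ℝ, HasFDerivAt (fun t => f (c t)) D 0 →
      HasDerivAt (fun t => f (c t)) (D 1) 0 := fun D h => h.hasDerivAt
  exact key _ (hasMFDerivAt_iff_hasFDerivAt.1 h1)

/-- The chain rule for a map of two variables. -/
theorem vel_comp₂ {p : ℕ} {K : Type*} [TopologicalSpace K]
    [ChartedSpace (EuclideanSpace ℝ (Fin p)) K]
    {f : K → N → B} {c : ℝ → K} {d : ℝ → N}
    (hf : ContMDiffAt ((𝓡 p).prod (𝓡 n)) (𝓡 b) ∞ (Function.uncurry f) (c 0, d 0))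
    (hc : ContMDiffAt 𝓘(ℝ, ℝ) (𝓡 p) ∞ c 0) (hd : ContMDiffAt 𝓘(ℝ, ℝ) (𝓡 n) ∞ d 0) :
    mfderiv ((𝓡 p).prod (𝓡 n)) (𝓡 b) (Function.uncurry f) (c 0, d 0) (vel p c, vel n d) =
      vel b (fun t => f (c t) (d t)) := by
  have h1 := (hf.mdifferentiableAt (by simp)).hasMFDerivAt.comp (0 : ℝ)
    ((hc.mdifferentiableAt (by simp)).hasMFDerivAt.prodMk
      (hd.mdifferentiableAt (by simp)).hasMFDerivAt)
  exact (congrArg (fun L : ℝ →L[ℝ] EuclideanSpace ℝ (Fin b) => L 1) h1.mfderiv).symm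

/-- Every tangent vector is the velocity of a smooth curve, defined for all times. -/
theorem exists_curve [IsManifold (𝓡 n) ∞ N] (x : N) (v : EuclideanSpace ℝ (Fin n)) :
    ∃ c : ℝ → N, ContMDiff 𝓘(ℝ, ℝ) (𝓡 n) ∞ c ∧ c 0 = x ∧ vel n c = v := by
  set φ := chartAt (EuclideanSpace ℝ (Fin n)) x with hφ
  have hx : x ∈ φ.source := mem_chart_source _ x
  obtain ⟨ε, hε, hball⟩ := Metric.isOpen_iff.1 φ.open_target _ (φ.map_source hx)
  set δ : ℝ := ε / (‖v‖ + 1) with hδ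
  have hv1 : 0 < ‖v‖ + 1 := by positivity
  have hδ0 : 0 < δ := by positivity
  set γ : ℝ → EuclideanSpace ℝ (Fin n) := fun t => φ x + (δ * Real.sin (t / δ)) • v with hγ
  have hmem : ∀ t, γ t ∈ φ.target := by
    intro t
    refine hball ?_
    rw [Metric.mem_ball, dist_eq_norm, hγ, add_sub_cancel_left, norm_smul, Real.norm_eq_abs,
      abs_mul,
      abs_of_pos hδ0]
    have h1 : δ * |Real.sin (t / δ)| ≤ δ := mul_le_of_le_one_right hδ0.le (Real.abs_sin_le_one _)
    calc δ * |Real.sin (t / δ)| * ‖v‖ ≤ δ * ‖v‖ := by gcongr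
      _ < δ * (‖v‖ + 1) := by gcongr; linarith
      _ = ε := by rw [hδ]; field_simp
  have hγd : HasDerivAt γ v 0 := by
    have h1 : HasDerivAt (fun t : ℝ => δ * Real.sin (t / δ)) (δ * (Real.cos (0 / δ) * (1 / δ))) 0 :=
      ((hasDerivAt_id (0 : ℝ)).div_const δ).sin.const_mul δ
    have h2 : δ * (Real.cos (0 / δ) * (1 / δ)) = 1 := by
      rw [zero_div, Real.cos_zero]
      field_simp
    rw [h2] at h1
    have h3 := (h1.smul_const v).const_add (φ x)
    rwa [one_smul] at h3
  have hγs : ContDiff ℝ ∞ γ := by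
    rw [hγ]
    fun_prop
  have hγ0 : γ 0 = φ x := by simp [hγ]
  have hc0 : φ.symm (γ 0) = x := by rw [hγ0, φ.left_inv hx]
  have hsm : ContMDiff 𝓘(ℝ, ℝ) (𝓡 n) ∞ fun t => φ.symm (γ t) := fun t =>
    ((contMDiffOn_chart_symm (I := 𝓡 n) (x := x) (n := ∞)).contMDiffAt
      (φ.open_target.mem_nhds (hmem t))).comp t hγs.contMDiff.contMDiffAt
  refine ⟨fun t => φ.symm (γ t), hsm, hc0, ?_⟩
  have hd : HasMFDerivAt 𝓘(ℝ, ℝ) (𝓡 n) (fun t => φ.symm (γ t)) 0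
      (ContinuousLinearMap.toSpanSingleton ℝ v) := by
    refine ⟨(hsm 0).continuousAt, ?_⟩
    refine (hγd.hasFDerivAt.congr_of_eventuallyEq
      (Filter.Eventually.of_forall fun t => ?_)).hasFDerivWithinAt
    simp only [writtenInExtChartAt, mfld_simps, hc0]
    exact φ.right_inv (hmem t)
  have := congrArg (fun L : ℝ →L[ℝ] EuclideanSpace ℝ (Fin n) => L 1) hd.mfderiv
  exact this.trans (one_smul ℝ v)

end Velocity

/-! ### Submersions and the inverse function theorem -/

section Submersion

open Manifold

variable {n b : ℕ} {N B : Type*}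
  [TopologicalSpace N] [ChartedSpace (EuclideanSpace ℝ (Fin n)) N] [IsManifold (𝓡 n) ∞ N]
  [TopologicalSpace B] [ChartedSpace (EuclideanSpace ℝ (Fin b)) B] [IsManifold (𝓡 b) ∞ B]

/-- A submersion `f` admits local transport maps: `ρ x z` is a point of the fibre over `x`, depends
smoothly on `x` and `z`, and is `z` itself if `x = f z`. -/
theorem exists_transport {f : N → B} {y : N} (hf : IsSubmersionAt (𝓡 n) (𝓡 b) ∞ f y) :
    ∃ (ρ : B → N → N) (U : Set (B × N)), IsOpen U ∧ (f y, y) ∈ U ∧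
      ContMDiffOn ((𝓡 b).prod (𝓡 n)) (𝓡 n) ∞ (Function.uncurry ρ) U ∧
      (∀ x z, (x, z) ∈ U → f (ρ x z) = x) ∧ ∀ z, (f z, z) ∈ U → ρ (f z) z = z := by
  set φ := hf.domChart with hφ
  set ψ := hf.codChart with hψ
  set e := hf.equiv with he
  have hw : ∀ w ∈ φ.target, ψ (f (φ.symm w)) = (e w).1 := by
    intro w h
    have h' : w ∈ (φ.extend (𝓡 n)).target := by simpa using h
    simpa using hf.writtenInCharts h'
  have hsub : ∀ z ∈ φ.source, f z ∈ ψ.source := fun z hz => hf.source_subset_preimage_source hz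
  set g : B × N → EuclideanSpace ℝ (Fin n) := fun p => e.symm (ψ p.1, (e (φ p.2)).2) with hg
  have hgs : ContMDiffOn ((𝓡 b).prod (𝓡 n)) 𝓘(ℝ, EuclideanSpace ℝ (Fin n)) ∞ g
      (ψ.source ×ˢ φ.source) := by
    have h1 : ContMDiffOn ((𝓡 b).prod (𝓡 n)) 𝓘(ℝ, EuclideanSpace ℝ (Fin b)) ∞
        (fun p : B × N => ψ p.1) (ψ.source ×ˢ φ.source) :=
      (contMDiffOn_of_mem_maximalAtlas hf.codChart_mem_maximalAtlas).comp contMDiffOn_fst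
        fun p hp => hp.1
    have h2 : ContMDiffOn ((𝓡 b).prod (𝓡 n)) 𝓘(ℝ, EuclideanSpace ℝ (Fin n)) ∞
        (fun p : B × N => φ p.2) (ψ.source ×ˢ φ.source) :=
      (contMDiffOn_of_mem_maximalAtlas hf.domChart_mem_maximalAtlas).comp contMDiffOn_snd
        fun p hp => hp.2
    have h3 := ((ContinuousLinearMap.snd ℝ (EuclideanSpace ℝ (Fin b)) hf.complement).comp
      e.toContinuousLinearMap).contMDiff.comp_contMDiffOn h2
    exact e.symm.toContinuousLinearMap.contMDiff.comp_contMDiffOn (h1.prodMk_space h3)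
  -- in adapted charts, `ρ x z` has the base coordinates of `x` and the fibre coordinates of `z`
  refine ⟨fun x z => φ.symm (g (x, z)), (ψ.source ×ˢ φ.source) ∩ g ⁻¹' φ.target,
    hgs.continuousOn.isOpen_inter_preimage (ψ.open_source.prod φ.open_source) φ.open_target,
    ⟨⟨hf.mem_codChart_source, hf.mem_domChart_source⟩, ?_⟩, ?_, ?_, ?_⟩
  · have : g (f y, y) = φ y := by
      have h1 := hw (φ y) (φ.map_source hf.mem_domChart_source)
      rw [φ.left_inv hf.mem_domChart_source] at h1
      rw [hg]
      simp only
      rw [h1]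
      exact e.symm_apply_apply _
    rw [Set.mem_preimage, this]
    exact φ.map_source hf.mem_domChart_source
  · exact (contMDiffOn_symm_of_mem_maximalAtlas hf.domChart_mem_maximalAtlas).comp
      (hgs.mono Set.inter_subset_left) fun p hp => hp.2
  · rintro x z ⟨⟨hx, hz⟩, ht⟩
    refine ψ.injOn (hsub _ (φ.map_target ht)) hx ?_
    rw [hw _ ht]
    simp [hg]
  · rintro z ⟨⟨hx, hz⟩, ht⟩
    have h1 := hw (φ z) (φ.map_source hz)
    rw [φ.left_inv hz] at h1
    have : g (f z, z) = φ z := by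
      simp only [hg]
      rw [h1]
      exact e.symm_apply_apply _
    simp only [this, φ.left_inv hz]

/-- Near a point, a map into a manifold which factors through an embedding is smooth if the
composite is. -/
theorem Manifold.IsSmoothEmbedding.lift {EK : Type*} [NormedAddCommGroup EK] [NormedSpace ℝ EK]
    {HK : Type*}
    [TopologicalSpace HK] {IK : ModelWithCorners ℝ EK HK} {K : Type*} [TopologicalSpace K]
    [ChartedSpace HK K] {f : N → B} (hf : IsSmoothEmbedding (𝓡 n) (𝓡 b) ∞ f) {a : K → N} {x₀ : K}
    (ha : ContMDiffAt IK (𝓡 b) ∞ (fun x => f (a x)) x₀) : ContMDiffAt IK (𝓡 n) ∞ a x₀ := by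
  have h := hf.isImmersion.isImmersionAt (a x₀)
  set φ := h.domChart with hφ
  set ψ := h.codChart with hψ
  set e := h.equiv with he
  have hcont : ContinuousAt a x₀ := hf.isEmbedding.isInducing.continuousAt_iff.2 ha.continuousAt
  have hw : ∀ z ∈ φ.source, ψ (f z) = e (φ z, 0) := by
    intro z hz
    have h' : φ z ∈ (φ.extend (𝓡 n)).target := by simpa using φ.map_source hz
    have h2 : ψ (f (φ.symm (φ z))) = e (φ z, 0) := by simpa using h.writtenInCharts h'
    rwa [φ.left_inv hz] at h2
  have h1 : ContMDiffAt IK 𝓘(ℝ, EuclideanSpace ℝ (Fin b)) ∞ (fun x => ψ (f (a x))) x₀ :=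
    ((contMDiffOn_of_mem_maximalAtlas h.codChart_mem_maximalAtlas).contMDiffAt
      (ψ.open_source.mem_nhds h.mem_codChart_source)).comp x₀ ha
  have h2 : ContMDiffAt IK 𝓘(ℝ, EuclideanSpace ℝ (Fin n)) ∞
      (fun x => (e.symm (ψ (f (a x)))).1) x₀ :=
    ((ContinuousLinearMap.fst ℝ (EuclideanSpace ℝ (Fin n)) h.complement).comp
      e.symm.toContinuousLinearMap).contMDiff.contMDiffAt.comp x₀ h1
  have h4 : (e.symm (ψ (f (a x₀)))).1 = φ (a x₀) := by
    rw [hw _ h.mem_domChart_source, e.symm_apply_apply]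
  have h3 : ContMDiffAt IK (𝓡 n) ∞ (fun x => φ.symm (e.symm (ψ (f (a x)))).1) x₀ := by
    refine ContMDiffAt.comp x₀ ?_ h2
    rw [h4]
    exact (contMDiffOn_symm_of_mem_maximalAtlas h.domChart_mem_maximalAtlas).contMDiffAt
      (φ.open_target.mem_nhds (φ.map_source h.mem_domChart_source))
  refine h3.congr_of_eventuallyEq ?_
  filter_upwards [hcont (φ.open_source.mem_nhds h.mem_domChart_source)] with x hx
  have hx' : a x ∈ φ.source := hx
  rw [hw _ hx', e.symm_apply_apply, φ.left_inv hx']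

/-- The inverse function theorem. -/
theorem exists_local_diffeo {F : N → B} (hnb : n = b) {y : N}
    (hF : ∀ᶠ z in 𝓝 y, ContMDiffAt (𝓡 n) (𝓡 b) ∞ F z)
    (hd : Function.Injective (tmap n b F y)) :
    ∃ Φ : OpenPartialHomeomorph N B, y ∈ Φ.source ∧ (∀ z ∈ Φ.source, Φ z = F z) ∧
      ContMDiffOn (𝓡 n) (𝓡 b) ∞ Φ Φ.source ∧ ContMDiffOn (𝓡 b) (𝓡 n) ∞ Φ.symm Φ.target := by
  subst hnb
  set φ := chartAt (EuclideanSpace ℝ (Fin n)) y with hφ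
  set ψ := chartAt (EuclideanSpace ℝ (Fin n)) (F y) with hψ
  have hy : y ∈ φ.source := mem_chart_source _ y
  have hFy : F y ∈ ψ.source := mem_chart_source _ (F y)
  set F' : EuclideanSpace ℝ (Fin n) → EuclideanSpace ℝ (Fin n) := fun u => ψ (F (φ.symm u)) with hF'
  obtain ⟨W, hWs, hWo, hyW⟩ := eventually_nhds_iff.1
    (hF.and (hF.self_of_nhds.continuousAt.eventually (ψ.open_source.mem_nhds hFy)))
  -- the open set on which the map is smooth in the charts
  set O := φ.target ∩ φ.symm ⁻¹' W with hO
  have hOo : IsOpen O := φ.isOpen_inter_preimage_symm hWo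
  have hyO : φ y ∈ O := ⟨φ.map_source hy, by rw [Set.mem_preimage, φ.left_inv hy]; exact hyW⟩
  have hsm : ∀ u ∈ O, ContDiffAt ℝ ∞ F' u := by
    intro u hu
    have h1 := hWs _ hu.2
    have h2 : ContMDiffAt (𝓡 n) (𝓡 n) ∞ F' u := by
      refine ((contMDiffOn_chart (I := 𝓡 n) (x := F y)).contMDiffAt
        (ψ.open_source.mem_nhds h1.2)).comp u ?_
      exact h1.1.comp u ((contMDiffOn_chart_symm (I := 𝓡 n) (x := y)).contMDiffAt
        (φ.open_target.mem_nhds hu.1))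
    exact h2.contDiffAt
  obtain ⟨D, hD⟩ : ∃ D : EuclideanSpace ℝ (Fin n) →L[ℝ] EuclideanSpace ℝ (Fin n),
      D = mfderiv (𝓡 n) (𝓡 n) F y := ⟨_, rfl⟩
  have h0 : HasFDerivAt F' D (φ y) := by
    have := (hF.self_of_nhds.mdifferentiableAt (by simp)).hasMFDerivAt.2
    simp only [mfld_simps] at this
    rw [← hasFDerivWithinAt_univ, hD]
    exact this
  have hinj : Function.Injective (fderiv ℝ F' (φ y)) := by
    rw [h0.fderiv, hD]
    exact hd
  obtain ⟨L, hL⟩ : ∃ L : EuclideanSpace ℝ (Fin n) ≃L[ℝ] EuclideanSpace ℝ (Fin n),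
      (L : _ →L[ℝ] _) = fderiv ℝ F' (φ y) :=
    ⟨(LinearEquiv.ofInjectiveEndo (fderiv ℝ F' (φ y)).toLinearMap hinj).toContinuousLinearEquiv,
      by ext1 v; rfl⟩
  have hstrict : HasFDerivAt F' (L : _ →L[ℝ] _) (φ y) := by
    rw [hL]
    exact ((hsm _ hyO).differentiableAt (by simp)).hasFDerivAt
  set Θ := (hsm _ hyO).toOpenPartialHomeomorph F' hstrict (by simp) with hΘ
  have hΘF : ∀ u, Θ u = F' u := fun u => rfl
  -- the open set on which moreover the derivative is invertible
  set O' := O ∩ (fderiv ℝ F') ⁻¹' Set.range ContinuousLinearEquiv.toContinuousLinearMap with hO'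
  have hO'o : IsOpen O' := by
    refine ContinuousOn.isOpen_inter_preimage (fun u hu => ?_) hOo ContinuousLinearEquiv.isOpen
    exact ((hsm u hu).fderiv_right (m := 0) (by simp)).continuousAt.continuousWithinAt
  have hyO' : φ y ∈ O' := ⟨hyO, L, hL⟩
  set Φ := ((φ.trans (Θ.restrOpen O' hO'o)).trans ψ.symm) with hΦ
  have hsrc : ∀ z ∈ Φ.source, z ∈ φ.source ∧ φ z ∈ Θ.source ∧ φ z ∈ O' := by
    intro z hz
    simp only [hΦ, mfld_simps] at hz
    exact ⟨hz.1.1, hz.1.2⟩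
  have hΦF : ∀ z ∈ Φ.source, Φ z = F z := by
    intro z hz
    obtain ⟨h1, h2, h3⟩ := hsrc z hz
    have h4 : F z ∈ ψ.source := by
      have := (hWs _ h3.1.2).2
      rwa [φ.left_inv h1] at this
    change ψ.symm (ψ (F (φ.symm (φ z)))) = F z
    rw [φ.left_inv h1, ψ.left_inv h4]
  refine ⟨Φ, ?_, hΦF, ?_, ?_⟩
  · simp only [hΦ, mfld_simps]
    refine ⟨⟨hy, (hsm _ hyO).mem_toOpenPartialHomeomorph_source hstrict (by simp), hyO'⟩, ?_⟩
    rw [hΘF, hF']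
    simp only
    rw [φ.left_inv hy]
    exact ψ.map_source hFy
  · intro z hz
    refine ContMDiffAt.contMDiffWithinAt ?_
    have h3 := (hWs _ (hsrc z hz).2.2.1.2).1
    rw [φ.left_inv (hsrc z hz).1] at h3
    exact h3.congr_of_eventuallyEq (Filter.mem_of_superset (Φ.open_source.mem_nhds hz) hΦF)
  · intro w hw
    refine ContMDiffAt.contMDiffWithinAt ?_
    have hw' := Φ.map_target hw
    obtain ⟨h1, h2, h3⟩ := hsrc _ hw'
    have hwψ : w ∈ ψ.source := by
      have := hw
      simp only [hΦ, mfld_simps] at this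
      exact this.1
    have hwt : ψ w ∈ Θ.target := by
      have := hw
      simp only [hΦ, mfld_simps] at this
      exact this.2.1.1
    have hval : φ (Φ.symm w) = Θ.symm (ψ w) := by
      change φ (φ.symm (Θ.symm (ψ w))) = Θ.symm (ψ w)
      refine φ.right_inv ?_
      have := hw
      simp only [hΦ, mfld_simps] at this
      exact this.2.2
    rw [hval] at h3
    have h4 : ContDiffAt ℝ ∞ Θ.symm (ψ w) := by
      obtain ⟨⟨h5, h6⟩, L', hL'⟩ := h3
      refine Θ.contDiffAt_symm (f₀' := L') hwt ?_ (hsm _ ⟨h5, h6⟩)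
      rw [hL']
      exact ((hsm _ ⟨h5, h6⟩).differentiableAt (by simp)).hasFDerivAt
    have h5 : ContMDiffAt (𝓡 n) (𝓡 n) ∞ (fun w => Θ.symm (ψ w)) w :=
      h4.contMDiffAt.comp w ((contMDiffOn_chart (I := 𝓡 n) (x := F y)).contMDiffAt
        (ψ.open_source.mem_nhds hwψ))
    have h6 : ContMDiffAt (𝓡 n) (𝓡 n) ∞ φ.symm (Θ.symm (ψ w)) :=
      (contMDiffOn_chart_symm (I := 𝓡 n) (x := y)).contMDiffAt (φ.open_target.mem_nhds h3.1.1)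
    have h7 := ContMDiffAt.comp w h6 h5
    exact h7

end Submersion

section LinearAlgebra

/-- Two surjections between the same finite-dimensional spaces have a common complement of their
kernels, here the range of `L`. -/
theorem exists_common_section {E F : Type*} [AddCommGroup E] [Module ℝ E] [FiniteDimensional ℝ E]
    [AddCommGroup F] [Module ℝ F] [FiniteDimensional ℝ F] (a b : E →ₗ[ℝ] F)
    (ha : Function.Surjective a) (hb : Function.Surjective b) :
    ∃ L : F →ₗ[ℝ] E, (∀ v, a (L v) = v) ∧ Function.Injective fun v => b (L v) := by
  -- a maximal subspace `C` which meets both kernels trivially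
  obtain ⟨C, ⟨hCa, hCb⟩, hmax⟩ := wellFounded_gt.has_min
    {C : Submodule ℝ E | Disjoint C a.ker ∧ Disjoint C b.ker}
    ⟨⊥, disjoint_bot_left, disjoint_bot_left⟩
  -- a vector outside both `C ⊔ ker a` and `C ⊔ ker b` would enlarge `C`, and a space is not the
  -- union of two proper subspaces
  have key : C ⊔ a.ker = ⊤ ∨ C ⊔ b.ker = ⊤ := by
    by_contra! hne
    obtain ⟨v, hva, hvb⟩ : ∃ v, v ∉ C ⊔ a.ker ∧ v ∉ C ⊔ b.ker := by
      obtain ⟨v, -, hv⟩ := SetLike.exists_of_lt (lt_top_iff_ne_top.2 hne.1)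
      obtain ⟨w, -, hw⟩ := SetLike.exists_of_lt (lt_top_iff_ne_top.2 hne.2)
      by_cases h1 : v ∈ C ⊔ b.ker
      · by_cases h2 : w ∈ C ⊔ a.ker
        · exact ⟨v + w, fun h => hv (by simpa using sub_mem h h2),
            fun h => hw (by simpa using sub_mem h h1)⟩
        · exact ⟨w, h2, hw⟩
      · exact ⟨v, hv, h1⟩
    have hstep : ∀ K : Submodule ℝ E, Disjoint C K → v ∉ C ⊔ K → Disjoint (C ⊔ ℝ ∙ v) K := by
      intro K hK hv
      rw [Submodule.disjoint_def]
      intro x hx hxK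
      obtain ⟨c, hc, w, hw, rfl⟩ := Submodule.mem_sup.1 hx
      obtain ⟨t, rfl⟩ := Submodule.mem_span_singleton.1 hw
      have ht : t = 0 := by
        by_contra ht
        refine hv ?_
        have h1 : t • v ∈ C ⊔ K := by
          have := sub_mem (Submodule.mem_sup_right (S := C) hxK)
            (Submodule.mem_sup_left (T := K) hc)
          simpa using this
        simpa [ht] using Submodule.smul_mem _ t⁻¹ h1
      rw [ht, zero_smul, add_zero] at hxK ⊢
      exact Submodule.disjoint_def.1 hK c hc hxK
    refine hmax (C ⊔ ℝ ∙ v) ⟨hstep _ hCa hva, hstep _ hCb hvb⟩ ?_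
    refine lt_of_le_of_ne le_sup_left fun h => hva ?_
    rw [h]
    exact Submodule.mem_sup_left (Submodule.mem_sup_right (Submodule.mem_span_singleton_self v))
  have hrange : ∀ d : E →ₗ[ℝ] F, Function.Surjective d → C ⊔ d.ker = ⊤ →
      Module.finrank ℝ F ≤ Module.finrank ℝ C := by
    intro d hd h
    have h1 := LinearMap.finrank_range_add_finrank_ker d
    rw [LinearMap.range_eq_top.2 hd, finrank_top] at h1
    have h2 := Submodule.finrank_add_le_finrank_add_finrank C d.ker
    rw [h, finrank_top] at h2
    omega
  have hdim : Module.finrank ℝ F ≤ Module.finrank ℝ C :=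
    key.elim (hrange a ha) (hrange b hb)
  have hinj : ∀ d : E →ₗ[ℝ] F, Disjoint C d.ker → Function.Injective (d.comp C.subtype) := by
    intro d hd
    rw [← LinearMap.ker_eq_bot, LinearMap.ker_eq_bot']
    intro x hx
    exact Subtype.ext (Submodule.disjoint_def.1 hd x.1 x.2 hx)
  have hdim' : Module.finrank ℝ C = Module.finrank ℝ F :=
    le_antisymm (LinearMap.finrank_le_finrank_of_injective (hinj a hCa)) hdim
  set e := LinearEquiv.ofBijective (a.comp C.subtype) ⟨hinj a hCa,
    (LinearMap.injective_iff_surjective_of_finrank_eq_finrank hdim').1 (hinj a hCa)⟩ with he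
  refine ⟨C.subtype.comp e.symm.toLinearMap, fun v => e.apply_symm_apply v, ?_⟩
  exact (hinj b hCb).comp e.symm.injective

end LinearAlgebra

/-! ### Curves, sections and fields in a submersion -/

section SubmersionConsequences

open Manifold

variable {n b : ℕ} {N B : Type*}
  [TopologicalSpace N] [ChartedSpace (EuclideanSpace ℝ (Fin n)) N] [IsManifold (𝓡 n) ∞ N]
  [TopologicalSpace B] [ChartedSpace (EuclideanSpace ℝ (Fin b)) B] [IsManifold (𝓡 b) ∞ B]

/-- A local transport map of `f` at `y` moves a curve `d` through `y` to a curve with the same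
velocity, if it lies over a curve with the velocity of `f ∘ d`. -/
theorem vel_transport {f : N → B} {y : N} {ρ : B → N → N}
    (hf : ContMDiffAt (𝓡 n) (𝓡 b) ∞ f y)
    (hρ : ContMDiffAt ((𝓡 b).prod (𝓡 n)) (𝓡 n) ∞ (Function.uncurry ρ) (f y, y))
    (hρf : ∀ᶠ z in 𝓝 y, ρ (f z) z = z) {β : ℝ → B} {d : ℝ → N}
    (hβ : ContMDiffAt 𝓘(ℝ, ℝ) (𝓡 b) ∞ β 0) (hβ0 : β 0 = f y)
    (hd : ContMDiffAt 𝓘(ℝ, ℝ) (𝓡 n) ∞ d 0) (hd0 : d 0 = y)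
    (hv : tmap n b f y (vel n d) = vel b β) :
    vel n (fun t => ρ (β t) (d t)) = vel n d := by
  subst hd0
  rw [← hβ0] at hρ
  have hfd : ContMDiffAt 𝓘(ℝ, ℝ) (𝓡 b) ∞ (fun t => f (d t)) 0 := hf.comp 0 hd
  have h1 := vel_comp₂ hρ hβ hd
  rw [hβ0] at hρ h1
  have h2 := vel_comp₂ (c := fun t => f (d t)) hρ hfd hd
  rw [← h1, ← hv, vel_comp rfl hf hd]
  refine h2.trans (vel_congr ?_)
  exact hd.continuousAt.eventually hρf

theorem Manifold.IsSubmersionAt.exists_lift_curve {f : N → B} {y : N}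
    (hf : IsSubmersionAt (𝓡 n) (𝓡 b) ∞ f y)
    {β : ℝ → B} (hβ : ContMDiffAt 𝓘(ℝ, ℝ) (𝓡 b) ∞ β 0) (hβ0 : β 0 = f y)
    {u : EuclideanSpace ℝ (Fin n)} (hu : tmap n b f y u = vel b β) :
    ∃ c : ℝ → N, ContMDiffAt 𝓘(ℝ, ℝ) (𝓡 n) ∞ c 0 ∧ c 0 = y ∧ vel n c = u ∧
      ∀ᶠ t in 𝓝 0, f (c t) = β t := by
  obtain ⟨ρ, U, hU, hyU, hρ, hfρ, hρf⟩ := exists_transport hf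
  obtain ⟨d, hd, rfl, rfl⟩ := exists_curve y u
  have hρ' : ContMDiffAt ((𝓡 b).prod (𝓡 n)) (𝓡 n) ∞ (Function.uncurry ρ) (β 0, d 0) := by
    rw [hβ0]
    exact hρ.contMDiffAt (hU.mem_nhds hyU)
  have hβd : ContMDiffAt 𝓘(ℝ, ℝ) ((𝓡 b).prod (𝓡 n)) ∞ (fun t => (β t, d t)) 0 := hβ.prodMk (hd 0)
  have hmem : ∀ᶠ t in 𝓝 0, (β t, d t) ∈ U :=
    hβd.continuousAt.eventually (hU.mem_nhds (show (β 0, d 0) ∈ U by rw [hβ0]; exact hyU))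
  have hnear : ∀ᶠ z in 𝓝 (d 0), ρ (f z) z = z := by
    have : ContinuousAt (fun z => (f z, z)) (d 0) :=
      hf.contMDiffAt.continuousAt.prodMk continuousAt_id
    filter_upwards [this.eventually (hU.mem_nhds hyU)] with z hz using hρf z hz
  refine ⟨fun t => ρ (β t) (d t), hρ'.comp 0 hβd, ?_, ?_, ?_⟩
  · simp only [hβ0]
    exact hρf _ hyU
  · exact vel_transport hf.contMDiffAt (hρ.contMDiffAt (hU.mem_nhds hyU)) hnear hβ hβ0 (hd 0) rfl hu
  · filter_upwards [hmem] with t ht using hfρ _ _ ht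

theorem Manifold.IsSubmersionAt.exists_fibre_curve {f : N → B} {y : N}
    (hf : IsSubmersionAt (𝓡 n) (𝓡 b) ∞ f y)
    {u : EuclideanSpace ℝ (Fin n)} (hu : tmap n b f y u = 0) :
    ∃ c : ℝ → N, ContMDiffAt 𝓘(ℝ, ℝ) (𝓡 n) ∞ c 0 ∧ c 0 = y ∧ vel n c = u ∧
      ∀ᶠ t in 𝓝 0, f (c t) = f y :=
  hf.exists_lift_curve (β := fun _ => f y) contMDiffAt_const rfl (hu.trans (vel_const _).symm)

theorem Manifold.IsSubmersionAt.exists_section {f : N → B} {y : N}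
    (hf : IsSubmersionAt (𝓡 n) (𝓡 b) ∞ f y) :
    ∃ τ : B → N, (∀ᶠ x in 𝓝 (f y), ContMDiffAt (𝓡 b) (𝓡 n) ∞ τ x) ∧ τ (f y) = y ∧
      ∀ᶠ x in 𝓝 (f y), f (τ x) = x := by
  obtain ⟨ρ, U, hU, hyU, hρ, hfρ, hρf⟩ := exists_transport hf
  have hc : Continuous fun x : B => (x, y) := by fun_prop
  have hmem : ∀ᶠ x in 𝓝 (f y), (x, y) ∈ U := hc.continuousAt.eventually (hU.mem_nhds hyU)
  refine ⟨fun x => ρ x y, ?_, hρf _ hyU, ?_⟩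
  · filter_upwards [hmem] with x hx
    have h1 : ContMDiffAt ((𝓡 b).prod (𝓡 n)) (𝓡 n) ∞ (Function.uncurry ρ) (x, y) :=
      hρ.contMDiffAt (hU.mem_nhds hx)
    have h2 : ContMDiffAt (𝓡 b) ((𝓡 b).prod (𝓡 n)) ∞ (fun x => (x, y)) x :=
      contMDiffAt_id.prodMk contMDiffAt_const
    exact h1.comp x h2
  · filter_upwards [hmem] with x hx using hfρ _ _ hx

theorem Manifold.IsSubmersionAt.mfderiv_surjective {f : N → B} {y : N}
    (hf : IsSubmersionAt (𝓡 n) (𝓡 b) ∞ f y) (w : EuclideanSpace ℝ (Fin b)) :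
    ∃ u : EuclideanSpace ℝ (Fin n), tmap n b f y u = w := by
  obtain ⟨τ, hτ, hτy, hτf⟩ := hf.exists_section
  obtain ⟨c, hc, hc0, rfl⟩ := exists_curve (f y) w
  have h1 : ContMDiffAt (𝓡 b) (𝓡 n) ∞ τ (c 0) := by rw [hc0]; exact hτ.self_of_nhds
  refine ⟨vel n (fun t => τ (c t)), ?_⟩
  rw [vel_comp (c := fun t => τ (c t)) (by rw [hc0, hτy]) hf.contMDiffAt (h1.comp 0 (hc 0))]
  rw [← hc0] at hτf
  exact vel_congr ((hc 0).continuousAt.eventually hτf)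

/-- A map on the base of a submersion is smooth if its pullback is. -/
theorem Manifold.IsSubmersionAt.descend {EX : Type*} [NormedAddCommGroup EX]
    [NormedSpace ℝ EX] {HX : Type*} [TopologicalSpace HX] {IX : ModelWithCorners ℝ EX HX}
    {X : Type*}
    [TopologicalSpace X] [ChartedSpace HX X] {f : N → B} {y : N}
    (hf : IsSubmersionAt (𝓡 n) (𝓡 b) ∞ f y) {F : B → X}
    (hF : ContMDiffAt (𝓡 n) IX ∞ (fun z => F (f z)) y) : ContMDiffAt (𝓡 b) IX ∞ F (f y) := by
  obtain ⟨τ, hτ, hτy, hτf⟩ := hf.exists_section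
  have h1 : ContMDiffAt (𝓡 b) IX ∞ (fun x => F (f (τ x))) (f y) :=
    ContMDiffAt.comp (f y) (g := fun z => F (f z)) (by rw [hτy]; exact hF) hτ.self_of_nhds
  refine h1.congr_of_eventuallyEq ?_
  filter_upwards [hτf] with x hx
  rw [hx]

theorem exists_local_field (y : N) (v : EuclideanSpace ℝ (Fin n)) :
    ∃ Z : N → EuclideanSpace ℝ (Fin n),
      (∀ᶠ z in 𝓝 y, SmoothFieldAt (𝓡 n) n (fun z : N => z) Z z) ∧ Z y = v := by
  set e := trivializationAt (EuclideanSpace ℝ (Fin n)) (TangentSpace (𝓡 n) : N → Type _) y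
    with he
  have hy : y ∈ e.baseSet := FiberBundle.mem_baseSet_trivializationAt' y
  refine ⟨fun z => e.symm z (e (⟨y, v⟩ : TangentBundle (𝓡 n) N)).2, ?_, ?_⟩
  · filter_upwards [e.open_baseSet.mem_nhds hy] with z hz
    have h1 : ContMDiffAt ((𝓡 n).prod (𝓡 n)) (𝓡 n).tangent ∞
        e.toOpenPartialHomeomorph.symm (z, (e (⟨y, v⟩ : TangentBundle (𝓡 n) N)).2) :=
      (e.contMDiffOn_symm (IB := 𝓡 n) (n := ∞)).contMDiffAt
        (e.open_target.mem_nhds (by rw [e.mem_target]; exact hz))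
    have h2 : ContMDiffAt (𝓡 n) ((𝓡 n).prod (𝓡 n)) ∞
        (fun z : N => (z, (e (⟨y, v⟩ : TangentBundle (𝓡 n) N)).2)) z :=
      contMDiffAt_id.prodMk contMDiffAt_const
    refine (h1.comp z h2).congr_of_eventuallyEq ?_
    filter_upwards [e.open_baseSet.mem_nhds hz] with w hw
    exact e.mk_symm hw _
  · exact e.symm_apply_apply_mk hy v

/-- A vector tangent to the fibre of a submersion extends to a smooth field along the fibres. -/
theorem Manifold.IsSubmersionAt.exists_fibre_field {f : N → B} {y : N}
    (hf : IsSubmersionAt (𝓡 n) (𝓡 b) ∞ f y)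
    {v : EuclideanSpace ℝ (Fin n)} (hv : tmap n b f y v = 0) :
    ∃ X : N → EuclideanSpace ℝ (Fin n),
      (∀ᶠ z in 𝓝 y, SmoothFieldAt (𝓡 n) n (fun z : N => z) X z) ∧ X y = v ∧
      ∀ᶠ z in 𝓝 y, tmap n b f z (X z) = 0 := by
  obtain ⟨ρ, U, hU, hyU, hρ, hfρ, hρf⟩ := exists_transport hf
  obtain ⟨Z, hZ, rfl⟩ := exists_local_field y v
  have hfs : ∀ᶠ z in 𝓝 y, ContMDiffAt (𝓡 n) (𝓡 b) ∞ f z :=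
    Filter.mem_of_superset (hf.domChart.open_source.mem_nhds hf.mem_domChart_source)
      fun z hz => hf.contMDiffOn.contMDiffAt (hf.domChart.open_source.mem_nhds hz)
  have hcont : ContinuousAt (fun z => (f z, z)) y :=
    hf.contMDiffAt.continuousAt.prodMk continuousAt_id
  have hmem := hcont.eventually (hU.mem_nhds hyU)
  have hslice : ∀ z, (f z, z) ∈ U → ContMDiffAt (𝓡 n) (𝓡 n) ∞ (ρ (f z)) z := by
    intro z hz
    have h1 : ContMDiffAt ((𝓡 b).prod (𝓡 n)) (𝓡 n) ∞ (Function.uncurry ρ) (f z, z) :=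
      hρ.contMDiffAt (hU.mem_nhds hz)
    have h2 : ContMDiffAt (𝓡 n) ((𝓡 b).prod (𝓡 n)) ∞ (fun w => (f z, w)) z :=
      contMDiffAt_const.prodMk contMDiffAt_id
    exact h1.comp z h2
  -- the projection of an arbitrary field `Z` along the transport maps
  refine ⟨fun z => tmap n n (ρ (f z)) z (Z z), ?_, ?_, ?_⟩
  · filter_upwards [hZ, hfs, hmem, hmem.eventually_nhds] with z h1 h2 h3 h4
    have h5 : ContMDiffAt ((𝓡 n).prod (𝓡 n)) (𝓡 n) ∞
        (Function.uncurry fun (x w : N) => ρ (f x) w) (z, z) := by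
      have h6 : ContMDiffAt ((𝓡 b).prod (𝓡 n)) (𝓡 n) ∞ (Function.uncurry ρ) (f z, z) :=
        hρ.contMDiffAt (hU.mem_nhds h3)
      have h7 : ContMDiffAt ((𝓡 n).prod (𝓡 n)) ((𝓡 b).prod (𝓡 n)) ∞
          (fun p : N × N => (f p.1, p.2)) (z, z) :=
        (ContMDiffAt.comp (z, z) h2 contMDiffAt_fst).prodMk contMDiffAt_snd
      exact ContMDiffAt.comp (z, z) h6 h7
    refine (h1.push_param h5).congr ?_ (Filter.Eventually.of_forall fun _ => rfl)
    filter_upwards [h4] with w hw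
    exact (hρf w hw).symm
  · obtain ⟨c, hc, hc0, hcv, hcf⟩ := hf.exists_fibre_curve hv
    simp only
    rw [← hcv, vel_comp hc0 (hslice y hyU) hc]
    refine vel_congr ?_
    filter_upwards [hcf, hc.continuousAt.eventually (by rw [hc0]; exact hmem)] with t h1 h2
    rw [← h1]
    exact hρf _ h2
  · filter_upwards [hfs, hmem] with z h2 h3
    obtain ⟨c, hc, hc0, hcv⟩ := exists_curve z (Z z)
    have h4 : ContMDiffAt 𝓘(ℝ, ℝ) (𝓡 n) ∞ (fun t => ρ (f z) (c t)) 0 :=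
      ContMDiffAt.comp (0 : ℝ) (by rw [hc0]; exact hslice z h3) (hc 0)
    rw [← hcv, vel_comp hc0 (hslice z h3) (hc 0), vel_comp (by rw [hc0]; exact hρf z h3) h2 h4]
    refine (vel_congr ?_).trans (vel_const (f z))
    have h5 : ContinuousAt (fun t => (f z, c t)) 0 := continuousAt_const.prodMk (hc 0).continuousAt
    filter_upwards [h5.eventually (hU.mem_nhds
      (show (f z, c 0) ∈ U by rw [hc0]; exact h3))] with t ht
    exact hfρ _ _ ht

/-- Every linear map between tangent spaces is the derivative of a local smooth map. -/
theorem exists_map_with_mfderiv (x : B) (y : N)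
    (L : EuclideanSpace ℝ (Fin b) →L[ℝ] EuclideanSpace ℝ (Fin n)) :
    ∃ κ : B → N, (∀ᶠ z in 𝓝 x, ContMDiffAt (𝓡 b) (𝓡 n) ∞ κ z) ∧ κ x = y ∧
      ∀ v : EuclideanSpace ℝ (Fin b), tmap b n κ x v = L v := by
  set φ := chartAt (EuclideanSpace ℝ (Fin n)) y with hφ
  set ψ := chartAt (EuclideanSpace ℝ (Fin b)) x with hψ
  have hx : x ∈ ψ.source := mem_chart_source _ x
  have hy : y ∈ φ.source := mem_chart_source _ y
  set A : EuclideanSpace ℝ (Fin b) → EuclideanSpace ℝ (Fin n) := fun u => φ y + L (u - ψ x) with hA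
  have hAs : ContDiff ℝ ∞ A := by
    rw [hA]
    fun_prop
  have hAx : A (ψ x) = φ y := by simp [hA]
  have hAd : HasFDerivAt A L (ψ x) := by
    have h1 : HasFDerivAt (fun u : EuclideanSpace ℝ (Fin b) => u - ψ x)
      (ContinuousLinearMap.id ℝ _) (ψ x) := (hasFDerivAt_id _).sub_const _
    exact (L.hasFDerivAt.comp (ψ x) h1).const_add (φ y)
  have hψc : ContMDiffOn (𝓡 b) (𝓡 b) ∞ ψ ψ.source := contMDiffOn_chart
  have hsm : ∀ z ∈ ψ.source, A (ψ z) ∈ φ.target →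
      ContMDiffAt (𝓡 b) (𝓡 n) ∞ (fun z => φ.symm (A (ψ z))) z := by
    intro z hz hz'
    have h1 : ContMDiffAt (𝓡 n) (𝓡 n) ∞ φ.symm (A (ψ z)) :=
      (contMDiffOn_chart_symm (I := 𝓡 n) (x := y) (n := ∞)).contMDiffAt (φ.open_target.mem_nhds hz')
    have h2 : ContMDiffAt (𝓡 b) (𝓡 n) ∞ (fun z => A (ψ z)) z :=
      hAs.contMDiff.contMDiffAt.comp z (hψc.contMDiffAt (ψ.open_source.mem_nhds hz))
    have h3 := ContMDiffAt.comp z h1 h2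
    exact h3
  have hκx : φ.symm (A (ψ x)) = y := by rw [hAx, φ.left_inv hy]
  have hmem : A (ψ x) ∈ φ.target := by rw [hAx]; exact φ.map_source hy
  refine ⟨fun z => φ.symm (A (ψ z)), ?_, hκx, ?_⟩
  · have hc : ContinuousAt (fun z => A (ψ z)) x :=
      hAs.continuous.continuousAt.comp (ψ.continuousAt hx)
    filter_upwards [ψ.open_source.mem_nhds hx, hc (φ.open_target.mem_nhds hmem)] with z h1 h2
    exact hsm z h1 h2
  · have hd : HasMFDerivAt (𝓡 b) (𝓡 n) (fun z => φ.symm (A (ψ z))) x L := by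
      refine ⟨(hsm x hx hmem).continuousAt, ?_⟩
      refine (hAd.congr_of_eventuallyEq ?_).hasFDerivWithinAt
      have h1 : ∀ᶠ u in 𝓝 (ψ x), A u ∈ φ.target :=
        hAs.continuous.continuousAt (φ.open_target.mem_nhds hmem)
      filter_upwards [h1, ψ.open_target.mem_nhds (ψ.map_source hx)] with u h2 h3
      simp only [writtenInExtChartAt, mfld_simps, hκx]
      rw [ψ.right_inv h3]
      exact φ.right_inv h2
    intro v
    exact congrArg (fun L : EuclideanSpace ℝ (Fin b) →L[ℝ] EuclideanSpace ℝ (Fin n) => L v)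
      hd.mfderiv

end SubmersionConsequences

/-! ### Calculus in a Lie groupoid -/

namespace LieGroupoid

open Manifold

variable {m n : ℕ} {M G : Type*}
  [TopologicalSpace M] [ChartedSpace (EuclideanSpace ℝ (Fin m)) M] [IsManifold (𝓡 m) ∞ M]
  [TopologicalSpace G] [ChartedSpace (EuclideanSpace ℝ (Fin n)) G] [IsManifold (𝓡 n) ∞ G]
  (𝒢 : LieGroupoid m n M G)

theorem inv_mul_cancel_left {g h : G} (hgh : 𝒢.source g = 𝒢.target h) :
    𝒢.mul (𝒢.inv g) (𝒢.mul g h) = h := by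
  rw [← 𝒢.mul_assoc _ _ _ (𝒢.source_inv g) hgh, 𝒢.inv_mul, hgh, 𝒢.unit_mul]

theorem mul_inv_cancel_left {g h : G} (hgh : 𝒢.target g = 𝒢.target h) :
    𝒢.mul g (𝒢.mul (𝒢.inv g) h) = h := by
  rw [← 𝒢.mul_assoc _ _ _ (𝒢.target_inv g).symm (by rw [𝒢.source_inv, hgh]), 𝒢.mul_inv, hgh,
    𝒢.unit_mul]

theorem mul_inv_cancel_right {g h : G} (hgh : 𝒢.source g = 𝒢.target h) :
    𝒢.mul (𝒢.mul g h) (𝒢.inv h) = g := by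
  rw [𝒢.mul_assoc _ _ _ hgh (𝒢.target_inv h).symm, 𝒢.mul_inv, ← hgh, 𝒢.mul_unit]

theorem inv_mul_cancel_right {g h : G} (hgh : 𝒢.source g = 𝒢.source h) :
    𝒢.mul (𝒢.mul g (𝒢.inv h)) h = g := by
  rw [𝒢.mul_assoc _ _ _ (by rw [𝒢.target_inv, hgh]) (𝒢.source_inv h), 𝒢.inv_mul, ← hgh,
    𝒢.mul_unit]

theorem inv_unit (x : M) : 𝒢.inv (𝒢.unit x) = 𝒢.unit x := by
  have h := 𝒢.mul_inv (𝒢.unit x)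
  have h' := 𝒢.unit_mul (𝒢.inv (𝒢.unit x))
  rw [𝒢.target_inv, 𝒢.source_unit] at h'
  rwa [𝒢.target_unit, h'] at h

theorem eq_inv_of_mul {g h : G} (hgh : 𝒢.source g = 𝒢.target h)
    (h1 : 𝒢.mul g h = 𝒢.unit (𝒢.target g)) : h = 𝒢.inv g := by
  rw [← 𝒢.inv_mul_cancel_left hgh, h1]
  have := 𝒢.mul_unit (𝒢.inv g)
  rwa [𝒢.source_inv] at this

theorem inv_inv (g : G) : 𝒢.inv (𝒢.inv g) = g :=
  (𝒢.eq_inv_of_mul (𝒢.source_inv g) (by rw [𝒢.inv_mul, 𝒢.target_inv])).symm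

theorem inv_mul_rev {g h : G} (hgh : 𝒢.source g = 𝒢.target h) :
    𝒢.inv (𝒢.mul g h) = 𝒢.mul (𝒢.inv h) (𝒢.inv g) := by
  have h1 : 𝒢.source (𝒢.inv h) = 𝒢.target (𝒢.inv g) := by
    rw [𝒢.source_inv, 𝒢.target_inv, hgh]
  refine (𝒢.eq_inv_of_mul ?_ ?_).symm
  · rw [𝒢.source_mul _ _ hgh, 𝒢.target_mul _ _ h1, 𝒢.target_inv]
  · rw [← 𝒢.mul_assoc _ _ _ (by rw [𝒢.source_mul _ _ hgh, 𝒢.target_inv]) h1,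
      𝒢.mul_inv_cancel_right hgh, 𝒢.mul_inv, 𝒢.target_mul _ _ hgh]

theorem source_smooth : ContMDiff (𝓡 n) (𝓡 m) ∞ 𝒢.source := 𝒢.source_submersion.contMDiff

theorem target_smooth : ContMDiff (𝓡 n) (𝓡 m) ∞ 𝒢.target := 𝒢.target_submersion.contMDiff

theorem contMDiffAt_mul {EK : Type*} [NormedAddCommGroup EK] [NormedSpace ℝ EK] {HK : Type*}
    [TopologicalSpace HK] {IK : ModelWithCorners ℝ EK HK} {K : Type*} [TopologicalSpace K]
    [ChartedSpace HK K] {f g : K → G} {x₀ : K} (hf : ContMDiffAt IK (𝓡 n) ∞ f x₀)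
    (hg : ContMDiffAt IK (𝓡 n) ∞ g x₀) (h : ∀ᶠ x in 𝓝 x₀, 𝒢.source (f x) = 𝒢.target (g x)) :
    ContMDiffAt IK (𝓡 n) ∞ (fun x => 𝒢.mul (f x) (g x)) x₀ := by
  have h1 := ContMDiffWithinAt.comp x₀ (𝒢.mul_smooth (f x₀, g x₀) h.self_of_nhds)
    ((hf.prodMk hg).contMDiffWithinAt (s := {x | 𝒢.source (f x) = 𝒢.target (g x)}))
    (fun x hx => hx)
  exact h1.contMDiffAt h

theorem contMDiffAt_inv {EK : Type*} [NormedAddCommGroup EK] [NormedSpace ℝ EK] {HK : Type*}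
    [TopologicalSpace HK] {IK : ModelWithCorners ℝ EK HK} {K : Type*} [TopologicalSpace K]
    [ChartedSpace HK K] {f : K → G} {x₀ : K} (hf : ContMDiffAt IK (𝓡 n) ∞ f x₀) :
    ContMDiffAt IK (𝓡 n) ∞ (fun x => 𝒢.inv (f x)) x₀ :=
  𝒢.inv_smooth.contMDiffAt.comp x₀ hf

/-- The product in the tangent groupoid of the velocities of two curves is the velocity of the
product of the curves. -/
theorem tangentMul_vel {c d : ℝ → G} (hc : ContMDiffAt 𝓘(ℝ, ℝ) (𝓡 n) ∞ c 0)
    (hd : ContMDiffAt 𝓘(ℝ, ℝ) (𝓡 n) ∞ d 0) (h : ∀ᶠ t in 𝓝 0, 𝒢.source (c t) = 𝒢.target (d t)) :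
    𝒢.tangentMul ⟨c 0, vel n c⟩ ⟨d 0, vel n d⟩ =
      ⟨𝒢.mul (c 0) (d 0), vel n fun t => 𝒢.mul (c t) (d t)⟩ := by
  refine tangentVector_ext rfl ?_
  have h1 := ((𝒢.mul_smooth (c 0, d 0) h.self_of_nhds).mdifferentiableWithinAt
    (by simp)).hasMFDerivWithinAt
  have h2 := ((hc.mdifferentiableAt (by simp)).hasMFDerivAt.prodMk
    (hd.mdifferentiableAt (by simp)).hasMFDerivAt).hasMFDerivWithinAt
      (s := {t | 𝒢.source (c t) = 𝒢.target (d t)})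
  have h3 := (HasMFDerivWithinAt.comp (0 : ℝ) h1 h2
    (show _ ⊆ (fun t => (c t, d t)) ⁻¹' {p : G × G | 𝒢.source p.1 = 𝒢.target p.2} from
      fun t ht => ht)).hasMFDerivAt h
  exact (congrArg (fun L : ℝ →L[ℝ] EuclideanSpace ℝ (Fin n) => L 1) h3.mfderiv).symm

theorem mem_algebroidFiber_iff {x : M} {v : EuclideanSpace ℝ (Fin n)} :
    v ∈ 𝒢.algebroidFiber x ↔ tmap n m 𝒢.source (𝒢.unit x) v = 0 := Iff.rfl

theorem vel_mem_algebroidFiber {x : M} {c : ℝ → G} (hc : ContMDiffAt 𝓘(ℝ, ℝ) (𝓡 n) ∞ c 0)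
    (h0 : c 0 = 𝒢.unit x) (hs : ∀ᶠ t in 𝓝 0, 𝒢.source (c t) = x) :
    vel n c ∈ 𝒢.algebroidFiber x := by
  rw [mem_algebroidFiber_iff, vel_comp h0 𝒢.source_smooth.contMDiffAt hc]
  exact (vel_congr hs).trans (vel_const x)

/-- Every element of the Lie algebroid is the velocity of a curve in a source fibre. -/
theorem exists_source_curve {x : M} {v : EuclideanSpace ℝ (Fin n)} (hv : v ∈ 𝒢.algebroidFiber x) :
    ∃ c : ℝ → G, ContMDiffAt 𝓘(ℝ, ℝ) (𝓡 n) ∞ c 0 ∧ c 0 = 𝒢.unit x ∧ vel n c = v ∧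
      ∀ᶠ t in 𝓝 0, 𝒢.source (c t) = x := by
  have h := (𝒢.source_submersion.isSubmersionAt (𝒢.unit x)).exists_fibre_curve
    (𝒢.mem_algebroidFiber_iff.1 hv)
  simpa only [𝒢.source_unit] using h

/-- The vector `0_g • v⁻¹` at `g`, as an element of the model space, for a vector `v` at the unit
over the source of `g`. -/
def leftVec (g : G) (v : EuclideanSpace ℝ (Fin n)) : EuclideanSpace ℝ (Fin n) :=
  (𝒢.tangentMul ⟨g, (0 : EuclideanSpace ℝ (Fin n))⟩
    ⟨𝒢.inv (𝒢.unit (𝒢.source g)), tmap n n 𝒢.inv (𝒢.unit (𝒢.source g)) v⟩).2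

theorem leftVec_eq_apply (g : G) : ∃ L : EuclideanSpace ℝ (Fin n) →ₗ[ℝ] EuclideanSpace ℝ (Fin n),
    ∀ v, 𝒢.leftVec g v = L v := by
  obtain ⟨D, hD⟩ : ∃ D : (EuclideanSpace ℝ (Fin n) × EuclideanSpace ℝ (Fin n)) →L[ℝ]
      EuclideanSpace ℝ (Fin n), D = mfderivWithin ((𝓡 n).prod (𝓡 n)) (𝓡 n)
        (fun p : G × G => 𝒢.mul p.1 p.2) {p | 𝒢.source p.1 = 𝒢.target p.2}
        (g, 𝒢.inv (𝒢.unit (𝒢.source g))) := ⟨_, rfl⟩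
  refine ⟨(D.comp ((ContinuousLinearMap.inr ℝ _ _).comp
    (tmap n n 𝒢.inv (𝒢.unit (𝒢.source g))))).toLinearMap, fun v => ?_⟩
  exact congrArg (fun D : (EuclideanSpace ℝ (Fin n) × EuclideanSpace ℝ (Fin n)) →L[ℝ]
      EuclideanSpace ℝ (Fin n) => D (0, tmap n n 𝒢.inv (𝒢.unit (𝒢.source g)) v)) hD.symm

/-- `leftVec` as a linear map. -/
def leftLin (g : G) : EuclideanSpace ℝ (Fin n) →ₗ[ℝ] EuclideanSpace ℝ (Fin n) :=
  (𝒢.leftVec_eq_apply g).choose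

theorem leftVec_eq (g : G) (v : EuclideanSpace ℝ (Fin n)) : 𝒢.leftVec g v = 𝒢.leftLin g v :=
  (𝒢.leftVec_eq_apply g).choose_spec v

theorem leftVec_vel {g : G} {c : ℝ → G} (hc : ContMDiffAt 𝓘(ℝ, ℝ) (𝓡 n) ∞ c 0)
    (h0 : c 0 = 𝒢.unit (𝒢.source g)) (hs : ∀ᶠ t in 𝓝 0, 𝒢.source (c t) = 𝒢.source g) :
    𝒢.leftVec g (vel n c) = vel n fun t => 𝒢.mul g (𝒢.inv (c t)) := by
  have h1 := 𝒢.tangentMul_vel (c := fun _ => g) (d := fun t => 𝒢.inv (c t)) contMDiffAt_const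
    (𝒢.contMDiffAt_inv hc) (hs.mono fun t ht => by rw [𝒢.target_inv, ht])
  rw [vel_const, ← vel_comp rfl 𝒢.inv_smooth.contMDiffAt hc, h0] at h1
  exact (tangentVector_eq_iff.1 h1).2

/-- The product extends, near a composable pair, to a smooth map of two independent variables. -/
theorem exists_mul_extension {g₀ h₀ : G} (h : 𝒢.source g₀ = 𝒢.target h₀) :
    ∃ (μ : G → G → G) (O : Set (G × G)), IsOpen O ∧ (g₀, h₀) ∈ O ∧
      ContMDiffOn ((𝓡 n).prod (𝓡 n)) (𝓡 n) ∞ (Function.uncurry μ) O ∧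
      ∀ g k, (g, k) ∈ O → 𝒢.source g = 𝒢.target k → μ g k = 𝒢.mul g k := by
  obtain ⟨ρ, U, hU, hyU, hρ, hfρ, hρf⟩ :=
    exists_transport (𝒢.target_submersion.isSubmersionAt h₀)
  have hq : ContMDiff ((𝓡 n).prod (𝓡 n)) ((𝓡 m).prod (𝓡 n)) ∞
      (fun p : G × G => (𝒢.source p.1, p.2)) :=
    (𝒢.source_smooth.comp contMDiff_fst).prodMk contMDiff_snd
  refine ⟨fun g k => 𝒢.mul g (ρ (𝒢.source g) k), (fun p : G × G => (𝒢.source p.1, p.2)) ⁻¹' U,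
    hU.preimage hq.continuous, ?_, ?_, ?_⟩
  · change (𝒢.source g₀, h₀) ∈ U
    rwa [h]
  · intro p hp
    refine ContMDiffAt.contMDiffWithinAt ?_
    have h1 : ContMDiffAt ((𝓡 n).prod (𝓡 n)) (𝓡 n) ∞
        (fun p : G × G => ρ (𝒢.source p.1) p.2) p :=
      (hρ.contMDiffAt (hU.mem_nhds hp)).comp p hq.contMDiffAt
    refine 𝒢.contMDiffAt_mul contMDiffAt_fst h1 ?_
    filter_upwards [(hU.preimage hq.continuous).mem_nhds hp] with q hq
    exact (hfρ _ _ hq).symm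
  · intro g k hgk hs
    have : (𝒢.target k, k) ∈ U := by rw [← hs]; exact hgk
    simp only [hs, hρf k this]

/-- The left-invariant extension of a smooth family of elements of the Lie algebroid is smooth. -/
theorem leftVec_smooth {p : ℕ} {K : Type*} [TopologicalSpace K]
    [ChartedSpace (EuclideanSpace ℝ (Fin p)) K] [IsManifold (𝓡 p) ∞ K] {γ : K → G} {k₀ : K}
    (hγ : ContMDiffAt (𝓡 p) (𝓡 n) ∞ γ k₀) {v : K → EuclideanSpace ℝ (Fin n)}
    (hv : SmoothFieldAt (𝓡 p) n (fun k => 𝒢.unit (𝒢.source (γ k))) v k₀)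
    (hmem : ∀ᶠ k in 𝓝 k₀, v k ∈ 𝒢.algebroidFiber (𝒢.source (γ k))) :
    SmoothFieldAt (𝓡 p) n γ (fun k => 𝒢.leftVec (γ k) (v k)) k₀ := by
  obtain ⟨μ, O, hO, hgO, hμ, hμm⟩ := 𝒢.exists_mul_extension
    (g₀ := γ k₀) (h₀ := 𝒢.inv (𝒢.unit (𝒢.source (γ k₀)))) (by rw [𝒢.target_inv, 𝒢.source_unit])
  have h1 := hv.push (f := 𝒢.inv) 𝒢.inv_smooth.contMDiffAt
  have hO1 : ∀ᶠ k in 𝓝 k₀, (γ k, 𝒢.inv (𝒢.unit (𝒢.source (γ k)))) ∈ O :=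
    (hγ.continuousAt.prodMk h1.base.continuousAt).eventually (hO.mem_nhds hgO)
  have h2 : ContMDiffAt ((𝓡 p).prod (𝓡 n)) (𝓡 n) ∞
      (Function.uncurry fun (k : K) (h : G) => μ (γ k) h)
      (k₀, 𝒢.inv (𝒢.unit (𝒢.source (γ k₀)))) := by
    have h3 : ContMDiffAt ((𝓡 p).prod (𝓡 n)) ((𝓡 n).prod (𝓡 n)) ∞
        (fun q : K × G => (γ q.1, q.2)) (k₀, 𝒢.inv (𝒢.unit (𝒢.source (γ k₀)))) :=
      (ContMDiffAt.comp (k₀, 𝒢.inv (𝒢.unit (𝒢.source (γ k₀)))) hγ contMDiffAt_fst).prodMk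
        contMDiffAt_snd
    exact ContMDiffAt.comp (k₀, 𝒢.inv (𝒢.unit (𝒢.source (γ k₀))))
      (hμ.contMDiffAt (hO.mem_nhds hgO)) h3
  refine (h1.push_param h2).congr ?_ ?_
  · filter_upwards [hO1] with k hk
    rw [hμm _ _ hk (by rw [𝒢.target_inv, 𝒢.source_unit]), 𝒢.inv_unit, 𝒢.mul_unit]
  · filter_upwards [hO1, hmem] with k hk hm
    obtain ⟨c, hc, hc0, hcv, hcs⟩ := 𝒢.exists_source_curve hm
    rw [← hcv, 𝒢.leftVec_vel hc hc0 hcs, vel_comp hc0 𝒢.inv_smooth.contMDiffAt hc]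
    have h4 : ContMDiffAt (𝓡 n) (𝓡 n) ∞ (μ (γ k)) (𝒢.inv (𝒢.unit (𝒢.source (γ k)))) := by
      have h5 : ContMDiffAt (𝓡 n) ((𝓡 n).prod (𝓡 n)) ∞ (fun h : G => (γ k, h))
          (𝒢.inv (𝒢.unit (𝒢.source (γ k)))) := contMDiffAt_const.prodMk contMDiffAt_id
      have h6 := ContMDiffAt.comp _ (hμ.contMDiffAt (hO.mem_nhds hk)) h5
      exact h6
    have h5 := 𝒢.contMDiffAt_inv hc
    rw [vel_comp (c := fun t => 𝒢.inv (c t)) (by simp only [hc0]) h4 h5]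
    refine vel_congr ?_
    have h6 : ContinuousAt (fun t => (γ k, 𝒢.inv (c t))) 0 :=
      continuousAt_const.prodMk h5.continuousAt
    filter_upwards [hcs, h6.eventually (hO.mem_nhds (by simpa only [hc0] using hk))] with t ht ht'
    exact (hμm _ _ ht' (by rw [𝒢.target_inv, ht])).symm

/-- Every arrow lies on a local bisection. -/
theorem exists_localBisection (g : G) :
    ∃ S : 𝒢.LocalBisection, 𝒢.source g ∈ S.base.source ∧ S.sec (𝒢.source g) = g := by
  have hs := 𝒢.source_submersion.isSubmersionAt g
  have ht := 𝒢.target_submersion.isSubmersionAt g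
  -- the tangent space of the bisection at `g` is a common complement of the kernels of `Ts` and
  -- `Tt`
  obtain ⟨L, hLs, hLt⟩ := exists_common_section (tmap n m 𝒢.source g).toLinearMap
    (tmap n m 𝒢.target g).toLinearMap hs.mfderiv_surjective ht.mfderiv_surjective
  obtain ⟨κ, hκ, hκg, hκd⟩ := exists_map_with_mfderiv (𝒢.source g) g
    (LinearMap.toContinuousLinearMap L)
  obtain ⟨ρ, U, hU, hyU, hρ, hfρ, hρf⟩ := exists_transport hs
  -- the map `κ` with derivative `L` is corrected to a section of the source map
  set σ : M → G := fun x => ρ x (κ x) with hσ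
  have hxk : ∀ᶠ x in 𝓝 (𝒢.source g), (x, κ x) ∈ U :=
    (continuousAt_id.prodMk hκ.self_of_nhds.continuousAt).eventually
      (hU.mem_nhds (show (𝒢.source g, κ (𝒢.source g)) ∈ U by rw [hκg]; exact hyU))
  have hσs : ∀ᶠ x in 𝓝 (𝒢.source g), ContMDiffAt (𝓡 m) (𝓡 n) ∞ σ x := by
    filter_upwards [hxk, hκ] with x h1 h2
    have h3 : ContMDiffAt ((𝓡 m).prod (𝓡 n)) (𝓡 n) ∞ (Function.uncurry ρ) (x, κ x) :=
      hρ.contMDiffAt (hU.mem_nhds h1)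
    have h4 : ContMDiffAt (𝓡 m) ((𝓡 m).prod (𝓡 n)) ∞ (fun x => (x, κ x)) x :=
      contMDiffAt_id.prodMk h2
    exact h3.comp x h4
  have hσg : σ (𝒢.source g) = g := by
    simp only [hσ, hκg]
    exact hρf _ hyU
  have hnear : ∀ᶠ z in 𝓝 g, ρ (𝒢.source z) z = z := by
    have : ContinuousAt (fun z => (𝒢.source z, z)) g :=
      hs.contMDiffAt.continuousAt.prodMk continuousAt_id
    filter_upwards [this.eventually (hU.mem_nhds hyU)] with z hz using hρf z hz
  have hσd : ∀ v, tmap m n σ (𝒢.source g) v = L v := by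
    intro v
    obtain ⟨b, hb, hb0, rfl⟩ := exists_curve (𝒢.source g) v
    have h1 : ContMDiffAt 𝓘(ℝ, ℝ) (𝓡 n) ∞ (fun t => κ (b t)) 0 :=
      ContMDiffAt.comp (0 : ℝ) (by rw [hb0]; exact hκ.self_of_nhds) (hb 0)
    have h2 : vel n (fun t => κ (b t)) = L (vel m b) := by
      rw [← vel_comp hb0 hκ.self_of_nhds (hb 0), hκd]
      rfl
    rw [vel_comp hb0 hσs.self_of_nhds (hb 0), ← h2]
    refine vel_transport hs.contMDiffAt (hρ.contMDiffAt (hU.mem_nhds hyU)) hnear (hb 0) hb0 h1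
      (by simp only [hb0, hκg]) ?_
    rw [h2]
    exact hLs _
  have hts : ∀ᶠ x in 𝓝 (𝒢.source g), ContMDiffAt (𝓡 m) (𝓡 m) ∞ (fun x => 𝒢.target (σ x)) x := by
    filter_upwards [hσs] with x hx using 𝒢.target_smooth.contMDiffAt.comp x hx
  have htd : Function.Injective (tmap m m (fun x => 𝒢.target (σ x)) (𝒢.source g)) := by
    have : ∀ v, tmap m m (fun x => 𝒢.target (σ x)) (𝒢.source g) v = tmap n m 𝒢.target g (L v) := by
      intro v
      obtain ⟨b, hb, hb0, rfl⟩ := exists_curve (𝒢.source g) v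
      rw [vel_comp hb0 hts.self_of_nhds (hb 0), ← hσd, vel_comp hb0 hσs.self_of_nhds (hb 0),
        vel_comp (c := fun t => σ (b t)) (by simp only [hb0, hσg]) ht.contMDiffAt
          (ContMDiffAt.comp (0 : ℝ) (by rw [hb0]; exact hσs.self_of_nhds) (hb 0))]
    intro v w hvw
    rw [this, this] at hvw
    exact hLt hvw
  obtain ⟨Φ, hΦ, hΦt, -, hΦs⟩ := exists_local_diffeo rfl hts htd
  obtain ⟨W, hW, hWo, hgW⟩ := eventually_nhds_iff.1 (hσs.and hxk)
  refine ⟨⟨Φ.restrOpen W hWo, σ, ?_, ?_, ?_, ?_⟩, ⟨hΦ, hgW⟩, hσg⟩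
  · rintro x ⟨-, hx⟩
    exact hfρ _ _ (hW x hx).2
  · rintro x ⟨hx, -⟩
    exact (hΦt x hx).symm
  · rintro x ⟨-, hx⟩
    exact (hW x hx).1.contMDiffWithinAt
  · refine hΦs.mono fun x hx => ?_
    simp only [mfld_simps] at hx
    exact hx.1

end LieGroupoid

/-! ### The manifold structure of the homogeneous space -/

open Manifold

section Charts

variable {n b : ℕ} {N B : Type*}
  [TopologicalSpace N] [ChartedSpace (EuclideanSpace ℝ (Fin n)) N] [IsManifold (𝓡 n) ∞ N]
  [TopologicalSpace B] [ChartedSpace (EuclideanSpace ℝ (Fin b)) B] [IsManifold (𝓡 b) ∞ B]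

/-- Near a section `σ`, a submersion `f` has coordinates `β` along its fibres which are centred at
the section; the inverse of `(f, β)` is `α`. -/
theorem Manifold.IsSubmersionAt.exists_fibre_coordinates {f : N → B} {x₀ : B} {σ : B → N}
    (hf : IsSubmersionAt (𝓡 n) (𝓡 b) ∞ f (σ x₀)) (hσ : ContMDiff (𝓡 b) (𝓡 n) ∞ σ)
    (hσf : ∀ x, f (σ x) = x) :
    ∃ (α : B → EuclideanSpace ℝ (Fin (n - b)) → N) (β : N → EuclideanSpace ℝ (Fin (n - b)))
      (U : Set (B × EuclideanSpace ℝ (Fin (n - b)))), IsOpen U ∧ (x₀, 0) ∈ U ∧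
      ContMDiffOn ((𝓡 b).prod (𝓡 (n - b))) (𝓡 n) ∞ (Function.uncurry α) U ∧
      (∀ x w, (x, w) ∈ U → f (α x w) = x) ∧ (∀ x, (x, 0) ∈ U → α x 0 = σ x) ∧
      ContMDiffAt (𝓡 n) (𝓡 (n - b)) ∞ β (σ x₀) ∧
      (∀ x w, (x, w) ∈ U → β (α x w) = w) ∧
      ∀ᶠ z in 𝓝 (σ x₀), (f z, β z) ∈ U ∧ α (f z) (β z) = z := by
  set φ := hf.domChart with hφ
  set ψ := hf.codChart with hψ
  set e := hf.equiv with he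
  have hw : ∀ z ∈ φ.source, ψ (f z) = (e (φ z)).1 := by
    intro z hz
    have h' : φ z ∈ (φ.extend (𝓡 n)).target := by simpa using φ.map_source hz
    have h2 : ψ (f (φ.symm (φ z))) = (e (φ z)).1 := by simpa using hf.writtenInCharts h'
    rwa [φ.left_inv hz] at h2
  have hsub : ∀ z ∈ φ.source, f z ∈ ψ.source := fun z hz => hf.source_subset_preimage_source hz
  have hfin : FiniteDimensional ℝ hf.complement := by
    have h1 : FiniteDimensional ℝ (EuclideanSpace ℝ (Fin b) × hf.complement) :=
      LinearEquiv.finiteDimensional e.toLinearEquiv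
    exact Module.Finite.of_surjective (LinearMap.snd ℝ (EuclideanSpace ℝ (Fin b)) hf.complement)
      LinearMap.snd_surjective
  have hdim : Module.finrank ℝ hf.complement = n - b := by
    have h1 := e.toLinearEquiv.finrank_eq
    rw [Module.finrank_prod] at h1
    simp only [finrank_euclideanSpace, Fintype.card_fin] at h1
    omega
  have κ : hf.complement ≃L[ℝ] EuclideanSpace ℝ (Fin (n - b)) :=
    ContinuousLinearEquiv.ofFinrankEq (by rw [hdim, finrank_euclideanSpace, Fintype.card_fin])
  have hφs := contMDiffOn_of_mem_maximalAtlas hf.domChart_mem_maximalAtlas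
  have hψs := contMDiffOn_of_mem_maximalAtlas hf.codChart_mem_maximalAtlas
  have hφt := contMDiffOn_symm_of_mem_maximalAtlas hf.domChart_mem_maximalAtlas
  -- the fibre coordinates of the section, which are subtracted to centre the coordinates at it
  set γ : B → EuclideanSpace ℝ (Fin (n - b)) := fun x => κ (e (φ (σ x))).2 with hγ
  set W : Set B := ψ.source ∩ σ ⁻¹' φ.source with hW
  have hWo : IsOpen W := ψ.open_source.inter (φ.open_source.preimage hσ.continuous)
  have hx₀W : x₀ ∈ W := by
    refine ⟨?_, hf.mem_domChart_source⟩
    have := hf.mem_codChart_source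
    rwa [hσf] at this
  have hpr : ContMDiff (𝓡 n) (𝓡 (n - b)) ∞ (fun u : EuclideanSpace ℝ (Fin n) => κ (e u).2) :=
    (κ.toContinuousLinearMap.comp ((ContinuousLinearMap.snd ℝ (EuclideanSpace ℝ (Fin b))
      hf.complement).comp e.toContinuousLinearMap)).contMDiff
  have hγs : ContMDiffOn (𝓡 b) (𝓡 (n - b)) ∞ γ W := by
    have h1 : ContMDiffOn (𝓡 b) (𝓡 n) ∞ (fun x => φ (σ x)) W :=
      hφs.comp hσ.contMDiffOn fun x hx => hx.2
    exact hpr.comp_contMDiffOn h1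
  set g : B × EuclideanSpace ℝ (Fin (n - b)) → EuclideanSpace ℝ (Fin n) :=
    fun p => e.symm (ψ p.1, κ.symm (p.2 + γ p.1)) with hg
  have hgs : ContMDiffOn ((𝓡 b).prod (𝓡 (n - b))) (𝓡 n) ∞ g (W ×ˢ Set.univ) := by
    have h1 : ContMDiffOn ((𝓡 b).prod (𝓡 (n - b))) 𝓘(ℝ, EuclideanSpace ℝ (Fin b)) ∞
        (fun p : B × EuclideanSpace ℝ (Fin (n - b)) => ψ p.1) (W ×ˢ Set.univ) :=
      hψs.comp contMDiffOn_fst fun p hp => hp.1.1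
    have h2 : ContMDiffOn ((𝓡 b).prod (𝓡 (n - b))) (𝓡 (n - b)) ∞
        (fun p : B × EuclideanSpace ℝ (Fin (n - b)) => p.2 + γ p.1) (W ×ˢ Set.univ) :=
      contMDiffOn_snd.add (hγs.comp contMDiffOn_fst fun p hp => hp.1)
    have h3 := κ.symm.toContinuousLinearMap.contMDiff.comp_contMDiffOn h2
    exact e.symm.toContinuousLinearMap.contMDiff.comp_contMDiffOn (h1.prodMk_space h3)
  have hgσ : ∀ x ∈ W, g (x, 0) = φ (σ x) := by
    intro x hx
    have h1 := hw _ hx.2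
    rw [hσf] at h1
    simp only [hg, hγ, zero_add, ContinuousLinearEquiv.symm_apply_apply]
    rw [h1]
    exact e.symm_apply_apply _
  have hUo : IsOpen ((W ×ˢ Set.univ) ∩ g ⁻¹' φ.target) :=
    hgs.continuousOn.isOpen_inter_preimage (hWo.prod isOpen_univ) φ.open_target
  have hU0 : (x₀, 0) ∈ (W ×ˢ Set.univ) ∩ g ⁻¹' φ.target := by
    refine ⟨⟨hx₀W, trivial⟩, ?_⟩
    rw [Set.mem_preimage, hgσ _ hx₀W]
    exact φ.map_source hx₀W.2
  have hfα : ∀ x w, (x, w) ∈ (W ×ˢ Set.univ) ∩ g ⁻¹' φ.target → f (φ.symm (g (x, w))) = x := by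
    rintro x w ⟨⟨hx, -⟩, ht⟩
    refine ψ.injOn (hsub _ (φ.map_target ht)) hx.1 ?_
    rw [hw _ (φ.map_target ht), φ.right_inv ht]
    simp [hg]
  have hβs : ContMDiffAt (𝓡 n) (𝓡 (n - b)) ∞ (fun z => κ (e (φ z)).2 - γ (f z)) (σ x₀) := by
    have h1 : ContMDiffAt (𝓡 n) (𝓡 (n - b)) ∞ (fun z => κ (e (φ z)).2) (σ x₀) :=
      hpr.contMDiffAt.comp _ (hφs.contMDiffAt (φ.open_source.mem_nhds hx₀W.2))
    have h2 : ContMDiffAt (𝓡 n) (𝓡 (n - b)) ∞ (fun z => γ (f z)) (σ x₀) := by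
      refine ContMDiffAt.comp (σ x₀) (g := γ) ?_ hf.contMDiffAt
      rw [hσf]
      exact hγs.contMDiffAt (hWo.mem_nhds hx₀W)
    exact h1.sub h2
  refine ⟨fun x w => φ.symm (g (x, w)), fun z => κ (e (φ z)).2 - γ (f z),
    (W ×ˢ Set.univ) ∩ g ⁻¹' φ.target, hUo, hU0, hφt.comp (hgs.mono Set.inter_subset_left)
    fun p hp => hp.2, hfα, ?_, hβs, ?_, ?_⟩
  · rintro x ⟨⟨hx, -⟩, ht⟩
    simp only [hgσ x hx, φ.left_inv hx.2]
  · intro x w hxw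
    simp only [hfα x w hxw, φ.right_inv hxw.2]
    simp [hg]
  · have hcf : ContinuousAt (fun z => (f z, κ (e (φ z)).2 - γ (f z))) (σ x₀) :=
      hf.contMDiffAt.continuousAt.prodMk hβs.continuousAt
    have hval : (f (σ x₀), κ (e (φ (σ x₀))).2 - γ (f (σ x₀))) = (x₀, 0) := by
      rw [hσf]
      simp [hγ]
    have h1 := hcf.eventually (hUo.mem_nhds (by
      change (f (σ x₀), κ (e (φ (σ x₀))).2 - γ (f (σ x₀))) ∈ _
      rw [hval]
      exact hU0))
    filter_upwards [h1, φ.open_source.mem_nhds hx₀W.2] with z hz hz'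
    refine ⟨hz, ?_⟩
    have h2 : g (f z, κ (e (φ z)).2 - γ (f z)) = φ z := by
      simp only [hg, sub_add_cancel, ContinuousLinearEquiv.symm_apply_apply]
      rw [hw _ hz']
      exact e.symm_apply_apply _
    simp only [h2, φ.left_inv hz']

/-- An embedding has a smooth left inverse near each point, so that its derivative is injective. -/
theorem Manifold.IsSmoothEmbedding.mfderiv_injective {f : N → B}
    (hf : IsSmoothEmbedding (𝓡 n) (𝓡 b) ∞ f) (y : N) : Function.Injective (tmap n b f y) := by
  have h := hf.isImmersion.isImmersionAt y
  set φ := h.domChart with hφ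
  set ψ := h.codChart with hψ
  set e := h.equiv with he
  have hw : ∀ z ∈ φ.source, ψ (f z) = e (φ z, 0) := by
    intro z hz
    have h' : φ z ∈ (φ.extend (𝓡 n)).target := by simpa using φ.map_source hz
    have h2 : ψ (f (φ.symm (φ z))) = e (φ z, 0) := by simpa using h.writtenInCharts h'
    rwa [φ.left_inv hz] at h2
  have h1 : ContMDiffAt (𝓡 b) 𝓘(ℝ, EuclideanSpace ℝ (Fin b)) ∞ ψ (f y) :=
    (contMDiffOn_of_mem_maximalAtlas h.codChart_mem_maximalAtlas).contMDiffAt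
      (ψ.open_source.mem_nhds h.mem_codChart_source)
  have h2 : ContMDiffAt (𝓡 b) (𝓡 n) ∞ (fun x => (e.symm (ψ x)).1) (f y) :=
    ((ContinuousLinearMap.fst ℝ (EuclideanSpace ℝ (Fin n)) h.complement).comp
      e.symm.toContinuousLinearMap).contMDiff.contMDiffAt.comp _ h1
  have hr : ContMDiffAt (𝓡 b) (𝓡 n) ∞ (fun x => φ.symm (e.symm (ψ x)).1) (f y) := by
    refine ContMDiffAt.comp (f y) ?_ h2
    rw [hw _ h.mem_domChart_source, e.symm_apply_apply]
    exact (contMDiffOn_symm_of_mem_maximalAtlas h.domChart_mem_maximalAtlas).contMDiffAt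
      (φ.open_target.mem_nhds (φ.map_source h.mem_domChart_source))
  refine (injective_iff_map_eq_zero (tmap n b f y)).2 fun v hv => ?_
  obtain ⟨c, hc, hc0, rfl⟩ := exists_curve y v
  have hfs := h.contMDiffAt
  have hfc : ContMDiffAt 𝓘(ℝ, ℝ) (𝓡 b) ∞ (fun t => f (c t)) 0 :=
    ContMDiffAt.comp (0 : ℝ) (by rw [hc0]; exact hfs) (hc 0)
  rw [vel_comp hc0 hfs (hc 0)] at hv
  have h3 := vel_comp (c := fun t => f (c t)) (by simp only [hc0]) hr hfc
  rw [hv, map_zero] at h3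
  rw [h3]
  refine vel_congr ?_
  have hcy : ∀ᶠ t in 𝓝 0, c t ∈ φ.source :=
    (hc 0).continuousAt.eventually (φ.open_source.mem_nhds
      (by rw [hc0]; exact h.mem_domChart_source))
  filter_upwards [hcy] with t ht
  rw [hw _ ht, e.symm_apply_apply, φ.left_inv ht]

end Charts

section Topology

theorem comp_invFunOn_of_same_fibres {X Y Z : Type*} [Nonempty X] {a : X → Y} {c : X → Z}
    {U : Set X}
    (h : ∀ x ∈ U, ∀ y ∈ U, a x = a y → c x = c y) {x : X} (hx : x ∈ U) :
    c (Function.invFunOn a U (a x)) = c x :=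
  h _ (Function.invFunOn_mem ⟨x, hx, rfl⟩) _ hx (Function.invFunOn_eq ⟨x, hx, rfl⟩)

/-- If `c` is constant on the fibres of the open map `a`, the map that it induces on the image of
`a` is continuous. -/
theorem continuousOn_comp_invFunOn {X Y Z : Type*} [Nonempty X] [TopologicalSpace X]
    [TopologicalSpace Y] [TopologicalSpace Z] {a : X → Y} {c : X → Z} {U : Set X} (hU : IsOpen U)
    (hc : ContinuousOn c U) (hao : ∀ V ⊆ U, IsOpen V → IsOpen (a '' V))
    (h : ∀ x ∈ U, ∀ y ∈ U, a x = a y → c x = c y) :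
    ContinuousOn (fun y => c (Function.invFunOn a U y)) (a '' U) := by
  refine (continuousOn_open_iff (hao U subset_rfl hU)).2 fun V hV => ?_
  have : a '' U ∩ (fun y => c (Function.invFunOn a U y)) ⁻¹' V = a '' (U ∩ c ⁻¹' V) := by
    ext y
    constructor
    · rintro ⟨⟨x, hx, rfl⟩, hy⟩
      refine ⟨x, ⟨hx, ?_⟩, rfl⟩
      rw [Set.mem_preimage, ← comp_invFunOn_of_same_fibres h hx]
      exact hy
    · rintro ⟨x, ⟨hx, hxV⟩, rfl⟩
      refine ⟨⟨x, hx, rfl⟩, ?_⟩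
      rw [Set.mem_preimage, comp_invFunOn_of_same_fibres h hx]
      exact hxV
  rw [this]
  exact hao _ Set.inter_subset_left (hc.isOpen_inter_preimage hU hV)

/-- Two continuous open maps with the same fibres on an open set identify their images. -/
theorem exists_openPartialHomeomorph_of_same_fibres {X Y Z : Type*} [TopologicalSpace X]
    [TopologicalSpace Y] [TopologicalSpace Z] {a : X → Y} {c : X → Z} {U : Set X} (hU : IsOpen U)
    (hne : U.Nonempty)
    (ha : ContinuousOn a U) (hc : ContinuousOn c U) (hao : ∀ V ⊆ U, IsOpen V → IsOpen (a '' V))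
    (hco : ∀ V ⊆ U, IsOpen V → IsOpen (c '' V)) (h : ∀ x ∈ U, ∀ y ∈ U, a x = a y ↔ c x = c y) :
    ∃ Φ : OpenPartialHomeomorph Y Z, Φ.source = a '' U ∧ Φ.target = c '' U ∧
      ∀ x ∈ U, Φ (a x) = c x := by
  have : Nonempty X := ⟨hne.some⟩
  have h1 : ∀ x ∈ U, ∀ y ∈ U, a x = a y → c x = c y := fun x hx y hy => (h x hx y hy).1
  have h2 : ∀ x ∈ U, ∀ y ∈ U, c x = c y → a x = a y := fun x hx y hy => (h x hx y hy).2
  have k1 : ∀ x ∈ U, c (Function.invFunOn a U (a x)) = c x := fun x =>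
    comp_invFunOn_of_same_fibres h1
  have k2 : ∀ x ∈ U, a (Function.invFunOn c U (c x)) = a x := fun x =>
    comp_invFunOn_of_same_fibres h2
  let e : PartialEquiv Y Z :=
    { toFun := fun y => c (Function.invFunOn a U y)
      invFun := fun z => a (Function.invFunOn c U z)
      source := a '' U
      target := c '' U
      map_source' := by
        rintro _ ⟨x, hx, rfl⟩
        exact ⟨x, hx, (k1 x hx).symm⟩
      map_target' := by
        rintro _ ⟨x, hx, rfl⟩
        exact ⟨x, hx, (k2 x hx).symm⟩
      left_inv' := by
        rintro _ ⟨x, hx, rfl⟩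
        simp only [k1 x hx, k2 x hx]
      right_inv' := by
        rintro _ ⟨x, hx, rfl⟩
        simp only [k1 x hx, k2 x hx] }
  exact ⟨{ e with
    open_source := hao U subset_rfl hU
    open_target := hco U subset_rfl hU
    continuousOn_toFun := continuousOn_comp_invFunOn hU hc hao h1
    continuousOn_invFun := continuousOn_comp_invFunOn hU ha hco h2 }, rfl, rfl, k1⟩

end Topology

namespace LieGroupoidPair

open Manifold

variable {m n p : ℕ} {M G A : Type*}
  [TopologicalSpace M] [ChartedSpace (EuclideanSpace ℝ (Fin m)) M] [IsManifold (𝓡 m) ∞ M]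
  [TopologicalSpace G] [ChartedSpace (EuclideanSpace ℝ (Fin n)) G] [IsManifold (𝓡 n) ∞ G]
  [TopologicalSpace A] [ChartedSpace (EuclideanSpace ℝ (Fin p)) A] [IsManifold (𝓡 p) ∞ A]
  (P : LieGroupoidPair m n p M G A)

theorem incl_injective : Function.Injective P.incl := P.incl_embedding.isEmbedding.injective

theorem incl_smooth : ContMDiff (𝓡 p) (𝓡 n) ∞ P.incl := P.incl_embedding.isImmersion.contMDiff

theorem proj_eq_iff {g h : G} : P.proj g = P.proj h ↔
    ∃ a, P.big.source g = P.sub.target a ∧ h = P.big.mul g (P.incl a) :=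
  ⟨fun h => Quotient.exact h, fun h => Quotient.sound h⟩

theorem proj_mul {g : G} {a : A} (h : P.big.source g = P.sub.target a) :
    P.proj (P.big.mul g (P.incl a)) = P.proj g :=
  (P.proj_eq_iff.2 ⟨a, h, rfl⟩).symm

theorem homTarget_proj (g : G) : P.homTarget (P.proj g) = P.big.target g := rfl

theorem proj_surjective : Function.Surjective P.proj := Quotient.mk_surjective

theorem proj_continuous : Continuous P.proj := continuous_quot_mk

/-- Near any arrow, right translation by an arrow of the subgroupoid extends to a smooth map which
preserves the classes. -/
theorem exists_right_translation {g : G} {a : A} (h : P.big.source g = P.sub.target a) :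
    ∃ R : G → G, (∀ᶠ k in 𝓝 g, ContMDiffAt (𝓡 n) (𝓡 n) ∞ R k) ∧ R g = P.big.mul g (P.incl a) ∧
      ∀ᶠ k in 𝓝 g, P.proj (R k) = P.proj k := by
  obtain ⟨τ, hτ, hτa, hτt⟩ := (P.sub.target_submersion.isSubmersionAt a).exists_section
  rw [← h] at hτ hτa hτt
  have hs : Filter.Tendsto P.big.source (𝓝 g) (𝓝 (P.big.source g)) :=
    P.big.source_smooth.continuous.continuousAt
  refine ⟨fun k => P.big.mul k (P.incl (τ (P.big.source k))), ?_, by simp only [hτa], ?_⟩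
  · filter_upwards [hs.eventually hτ, (hs.eventually hτt).eventually_nhds] with k h1 h2
    refine P.big.contMDiffAt_mul contMDiffAt_id ?_ ?_
    · have h3 := ContMDiffAt.comp k h1 (P.big.source_smooth k)
      have h4 := ContMDiffAt.comp k P.incl_smooth.contMDiffAt h3
      exact h4
    · filter_upwards [h2] with j hj
      rw [P.target_incl, hj]
  · filter_upwards [hs.eventually hτt] with k hk
    exact P.proj_mul hk.symm

/-- The saturation of an open set is open, because right translations extend to smooth maps of
neighbourhoods. -/
theorem proj_isOpenMap : IsOpenMap P.proj := by
  intro U hU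
  have : P.proj ⁻¹' (P.proj '' U) ∈ {s : Set G | IsOpen s} := by
    refine isOpen_iff_mem_nhds.2 fun k hk => ?_
    obtain ⟨g, hg, hgk⟩ := hk
    obtain ⟨a, ha, hga⟩ := P.proj_eq_iff.1 hgk.symm
    obtain ⟨R, hR, hRk, hRp⟩ := P.exists_right_translation ha
    have h1 : ∀ᶠ j in 𝓝 k, R j ∈ U :=
      hR.self_of_nhds.continuousAt.eventually (hU.mem_nhds (by rw [hRk, ← hga]; exact hg))
    filter_upwards [h1, hRp] with j h2 h3
    exact ⟨R j, h2, h3⟩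
  exact this

theorem proj_isOpenQuotientMap : IsOpenQuotientMap P.proj :=
  ⟨P.proj_surjective, P.proj_continuous, P.proj_isOpenMap⟩

theorem homogeneousSpace_secondCountableTopology [SecondCountableTopology G] :
    SecondCountableTopology P.HomogeneousSpace :=
  P.proj_isOpenQuotientMap.isQuotientMap.secondCountableTopology P.proj_isOpenMap

theorem continuousOn_inv_mul : ContinuousOn (fun q : G × G => P.big.mul (P.big.inv q.1) q.2)
    {q | P.big.target q.1 = P.big.target q.2} := by
  have h := P.big.mul_smooth.continuousOn.comp
    (f := fun q : G × G => (P.big.inv q.1, q.2)) (s := {q | P.big.target q.1 = P.big.target q.2})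
    ((P.big.inv_smooth.continuous.comp continuous_fst).prodMk continuous_snd).continuousOn
    (fun q hq => by
      rw [Set.mem_ofPred_eq, P.big.source_inv]
      exact hq)
  exact h

/-- The graph of the equivalence relation is closed: `g` and `h` are equivalent if `t(g) = t(h)` and
`g⁻¹ h` lies in the closed subset of arrows of the subgroupoid. -/
theorem homogeneousSpace_t2Space [T2Space M] : T2Space P.HomogeneousSpace := by
  refine (t2Space_iff_of_isOpenQuotientMap P.proj_isOpenQuotientMap).2 ?_
  have h1 : IsClosed {q : G × G | P.big.target q.1 = P.big.target q.2} :=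
    isClosed_eq (P.big.target_smooth.continuous.comp continuous_fst)
      (P.big.target_smooth.continuous.comp continuous_snd)
  have h2 := P.continuousOn_inv_mul.preimage_isClosed_of_isClosed h1 P.incl_closed
  convert h2 using 1
  ext ⟨g, h⟩
  rw [Set.mem_ofPred_eq, P.proj_eq_iff]
  constructor
  · rintro ⟨a, ha, h⟩
    dsimp only at ha h
    subst h
    have ha' : P.big.source g = P.big.target (P.incl a) := by rw [ha, P.target_incl]
    refine ⟨(P.big.target_mul _ _ ha').symm, a, ?_⟩
    exact (P.big.inv_mul_cancel_left ha').symm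
  · rintro ⟨ht, a, ha⟩
    have ht' : P.big.target g = P.big.target h := ht
    change P.incl a = P.big.mul (P.big.inv g) h at ha
    refine ⟨a, ?_, ?_⟩
    · rw [← P.target_incl, ha, P.big.target_mul _ _
      (by rw [P.big.source_inv, ht']), P.big.target_inv]
    · rw [ha, P.big.mul_inv_cancel_left ht']

/-- The dimension of the homogeneous space. -/
abbrev quotDim (_ : LieGroupoidPair m n p M G A) : ℕ := n - (p - m)

/-- A linear injection has a complement, presented as the range of an injection. -/
theorem exists_complementary_injection {n q : ℕ}
    (J : EuclideanSpace ℝ (Fin q) →L[ℝ] EuclideanSpace ℝ (Fin n)) (hJ : Function.Injective J) :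
    q ≤ n ∧ ∃ ι : EuclideanSpace ℝ (Fin (n - q)) →L[ℝ] EuclideanSpace ℝ (Fin n),
      ∀ z w, ι z + J w = 0 → z = 0 ∧ w = 0 := by
  have hJ' : Function.Injective J.toLinearMap := hJ
  have h1 : Module.finrank ℝ (LinearMap.range J.toLinearMap) = q := by
    rw [LinearMap.finrank_range_of_inj hJ', finrank_euclideanSpace, Fintype.card_fin]
  have h2 := Submodule.finrank_le (LinearMap.range J.toLinearMap)
  rw [h1, finrank_euclideanSpace, Fintype.card_fin] at h2
  refine ⟨h2, ?_⟩
  obtain ⟨C, hC⟩ := Submodule.exists_isCompl (LinearMap.range J.toLinearMap)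
  have h3 := Submodule.finrank_add_eq_of_isCompl hC
  rw [h1, finrank_euclideanSpace, Fintype.card_fin] at h3
  have κ : EuclideanSpace ℝ (Fin (n - q)) ≃ₗ[ℝ] C :=
    LinearEquiv.ofFinrankEq _ _ (by rw [finrank_euclideanSpace, Fintype.card_fin]; omega)
  refine ⟨LinearMap.toContinuousLinearMap (C.subtype.comp κ.toLinearMap), fun z w h => ?_⟩
  have h4 : (κ z : EuclideanSpace ℝ (Fin n)) + J w = 0 := h
  have h5 : (κ z : EuclideanSpace ℝ (Fin n)) = J.toLinearMap (-w) := by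
    rw [map_neg]
    exact eq_neg_of_add_eq_zero_left h4
  have h6 : (κ z : EuclideanSpace ℝ (Fin n)) = 0 :=
    Submodule.disjoint_def.1 hC.disjoint _ (by rw [h5]; exact ⟨_, rfl⟩) (κ z).2
  refine ⟨?_, ?_⟩
  · exact (LinearEquiv.map_eq_zero_iff κ).1 (Subtype.ext h6)
  · rw [h6, zero_add] at h4
    exact hJ (by rw [h4, map_zero])

/-- The orbit map `w ↦ g · α(s(g), w)` in coordinates along the target fibres of the subgroupoid has
injective derivative. -/
theorem orbit_mfderiv_injective {q : ℕ} (g : G) {a : EuclideanSpace ℝ (Fin q) → A}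
    {β : A → EuclideanSpace ℝ (Fin q)} (ha0 : a 0 = P.sub.unit (P.big.source g))
    (ha : ContMDiffAt (𝓡 q) (𝓡 p) ∞ a 0)
    (hat : ∀ᶠ w in 𝓝 0, P.sub.target (a w) = P.big.source g)
    (hβ : ContMDiffAt (𝓡 p) (𝓡 q) ∞ β (P.sub.unit (P.big.source g)))
    (hβa : ∀ᶠ w in 𝓝 0, β (a w) = w) :
    ContMDiffAt (𝓡 q) (𝓡 n) ∞ (fun w => P.big.mul g (P.incl (a w))) 0 ∧
    Function.Injective (tmap q n (fun w => P.big.mul g (P.incl (a w))) 0) := by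
  have hia : ContMDiffAt (𝓡 q) (𝓡 n) ∞ (fun w => P.incl (a w)) 0 :=
    ContMDiffAt.comp _ P.incl_smooth.contMDiffAt ha
  have hs : ContMDiffAt (𝓡 q) (𝓡 n) ∞ (fun w => P.big.mul g (P.incl (a w))) 0 :=
    P.big.contMDiffAt_mul contMDiffAt_const hia
      (hat.mono fun w hw => by rw [P.target_incl, hw])
  refine ⟨hs, (injective_iff_map_eq_zero (tmap q n (fun w => P.big.mul g (P.incl (a w))) 0)).2
    fun v hv => ?_⟩
  obtain ⟨c, hc, hc0, rfl⟩ := exists_curve (0 : EuclideanSpace ℝ (Fin q)) v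
  have hct : Filter.Tendsto c (𝓝 0) (𝓝 0) := by
    have := (hc 0).continuousAt
    rwa [ContinuousAt, hc0] at this
  have hac : ContMDiffAt 𝓘(ℝ, ℝ) (𝓡 p) ∞ (fun t => a (c t)) 0 :=
    ContMDiffAt.comp (0 : ℝ) (by rw [hc0]; exact ha) (hc 0)
  have hiac : ContMDiffAt 𝓘(ℝ, ℝ) (𝓡 n) ∞ (fun t => P.incl (a (c t))) 0 :=
    ContMDiffAt.comp (0 : ℝ) P.incl_smooth.contMDiffAt hac
  have hgc : ContMDiffAt 𝓘(ℝ, ℝ) (𝓡 n) ∞ (fun t => P.big.mul g (P.incl (a (c t)))) 0 :=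
    ContMDiffAt.comp (0 : ℝ) (g := fun w => P.big.mul g (P.incl (a w)))
      (by rw [hc0]; exact hs) (hc 0)
  rw [vel_comp hc0 hs (hc 0)] at hv
  have hcat := hct.eventually hat
  have e1 : (fun t => P.incl (a (c t))) 0 = P.big.unit (P.big.source g) := by
    simp only [hc0, ha0, P.incl_unit]
  -- the velocity is recovered by left translation by the inverse of `g`
  have h1 := P.big.tangentMul_vel (c := fun _ => P.big.inv g)
    (d := fun t => P.big.mul g (P.incl (a (c t)))) contMDiffAt_const hgc (by
      filter_upwards [hcat] with t ht
      rw [P.big.source_inv, P.big.target_mul _ _ (by rw [P.target_incl, ht])])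
  have h2 := P.big.tangentMul_vel (c := fun _ => P.big.inv g)
    (d := fun _ => P.big.mul g (P.incl (a (c 0)))) contMDiffAt_const contMDiffAt_const (by
      refine Filter.Eventually.of_forall fun t => ?_
      rw [P.big.source_inv, P.big.target_mul _ _ (by rw [P.target_incl, hcat.self_of_nhds])])
  have e2 : vel n (fun _ : ℝ => P.big.mul g (P.incl (a (c 0)))) = 0 := vel_const _
  rw [hv] at h1
  rw [e2] at h2
  have h3 := (tangentVector_eq_iff.1 (h1.symm.trans h2)).2
  have h4 : vel n (fun t => P.incl (a (c t))) = 0 := by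
    rw [vel_const] at h3
    rw [← h3]
    refine vel_congr ?_
    filter_upwards [hcat] with t ht
    exact (P.big.inv_mul_cancel_left (by rw [P.target_incl, ht])).symm
  have h5 : vel p (fun t => a (c t)) = 0 := by
    refine P.incl_embedding.mfderiv_injective (a (c 0)) ?_
    rw [vel_comp (c := fun t => a (c t)) rfl P.incl_smooth.contMDiffAt hac, map_zero, h4]
  have h6 := vel_comp (c := fun t => a (c t)) (by simp only [hc0, ha0]) hβ hac
  rw [h5, map_zero] at h6
  rw [h6]
  refine vel_congr ?_
  filter_upwards [hct.eventually hβa] with t ht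
  exact ht.symm

/-- Every arrow has a neighbourhood with coordinates in which the classes are the fibres of a linear
projection. The coordinates are those of `(z, w) ↦ κ(z) · α(s(κ(z)), w)`, where `κ` parametrizes a
submanifold transverse to the class of the arrow, and `α` the target fibres of the subgroupoid. -/
theorem exists_slice (g₀ : G) :
    ∃ (Φ : OpenPartialHomeomorph G (EuclideanSpace ℝ (Fin n)))
      (e : EuclideanSpace ℝ (Fin n) ≃L[ℝ]
        EuclideanSpace ℝ (Fin P.quotDim) × EuclideanSpace ℝ (Fin (p - m))),
      g₀ ∈ Φ.source ∧ ContMDiffOn (𝓡 n) (𝓡 n) ∞ Φ Φ.source ∧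
      ContMDiffOn (𝓡 n) (𝓡 n) ∞ Φ.symm Φ.target ∧
      ∀ g ∈ Φ.source, ∀ h ∈ Φ.source, P.proj g = P.proj h ↔ (e (Φ g)).1 = (e (Φ h)).1 := by
  set x₀ := P.big.source g₀ with hx₀
  obtain ⟨α, β, U, hU, hxU, hα, hαt, hα0, hβ, hβα, hαβ⟩ :=
    (P.sub.target_submersion.isSubmersionAt (P.sub.unit x₀)).exists_fibre_coordinates
      P.sub.unit_smooth P.sub.target_unit
  have hαx : ∀ᶠ w in 𝓝 (0 : EuclideanSpace ℝ (Fin (p - m))), (x₀, w) ∈ U :=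
    (Continuous.prodMk_right x₀).continuousAt.eventually (hU.mem_nhds hxU)
  have hαs : ContMDiffAt (𝓡 (p - m)) (𝓡 p) ∞ (α x₀) 0 := by
    have h1 : ContMDiffAt (𝓡 (p - m)) ((𝓡 m).prod (𝓡 (p - m))) ∞
        (fun w : EuclideanSpace ℝ (Fin (p - m)) => (x₀, w)) 0 :=
      contMDiffAt_const.prodMk contMDiffAt_id
    have h2 := ContMDiffAt.comp _ (hα.contMDiffAt (hU.mem_nhds hxU)) h1
    exact h2
  obtain ⟨hJs, hJ⟩ := P.orbit_mfderiv_injective g₀ (a := α x₀) (β := β) (hα0 _ hxU) hαs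
    (hαx.mono fun w hw => hαt _ _ hw) hβ (hαx.mono fun w hw => hβα _ _ hw)
  -- the submanifold is tangent at `g₀` to a complement of the image of `J`, the tangent space of
  -- the class
  set J := tmap (p - m) n (fun w => P.big.mul g₀ (P.incl (α x₀ w))) 0 with hJd
  obtain ⟨hle, ι, hι⟩ := exists_complementary_injection J hJ
  obtain ⟨κ, hκ, hκ0, hκd⟩ := exists_map_with_mfderiv (0 : EuclideanSpace ℝ (Fin P.quotDim)) g₀ ι
  have e : EuclideanSpace ℝ (Fin n) ≃L[ℝ]
      EuclideanSpace ℝ (Fin P.quotDim) × EuclideanSpace ℝ (Fin (p - m)) :=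
    ContinuousLinearEquiv.ofFinrankEq (by
      rw [Module.finrank_prod]
      simp only [finrank_euclideanSpace, Fintype.card_fin, quotDim]
      omega)
  set F : EuclideanSpace ℝ (Fin P.quotDim) → EuclideanSpace ℝ (Fin (p - m)) → G :=
    fun z w => P.big.mul (κ z) (P.incl (α (P.big.source (κ z)) w)) with hF
  have hκt : Filter.Tendsto κ (𝓝 0) (𝓝 g₀) := by
    have := hκ.self_of_nhds.continuousAt
    rwa [ContinuousAt, hκ0] at this
  -- the set where `F` is well-behaved
  have hq : ∀ᶠ u in 𝓝 ((0, 0) : EuclideanSpace ℝ (Fin P.quotDim) × EuclideanSpace ℝ (Fin (p - m))),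
      ContMDiffAt (𝓡 P.quotDim) (𝓡 n) ∞ κ u.1 ∧ (P.big.source (κ u.1), u.2) ∈ U := by
    have h1 : Filter.Tendsto (fun u : EuclideanSpace ℝ (Fin P.quotDim) ×
        EuclideanSpace ℝ (Fin (p - m)) => (P.big.source (κ u.1), u.2)) (𝓝 (0, 0)) (𝓝 (x₀, 0)) :=
      Filter.Tendsto.prodMk_nhds ((P.big.source_smooth.continuous.tendsto g₀).comp
        (hκt.comp (continuous_fst.tendsto _))) (continuous_snd.tendsto _)
    exact ((continuous_fst.tendsto _).eventually hκ).and (h1.eventually (hU.mem_nhds hxU))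
  have hFs : ∀ᶠ u in 𝓝 ((0, 0) : EuclideanSpace ℝ (Fin P.quotDim) ×
      EuclideanSpace ℝ (Fin (p - m))),
      ContMDiffAt ((𝓡 P.quotDim).prod (𝓡 (p - m))) (𝓡 n) ∞ (Function.uncurry F) u := by
    filter_upwards [hq.eventually_nhds] with u hu
    have h1 : ContMDiffAt ((𝓡 P.quotDim).prod (𝓡 (p - m))) (𝓡 n) ∞
        (fun u : EuclideanSpace ℝ (Fin P.quotDim) × EuclideanSpace ℝ (Fin (p - m)) => κ u.1) u :=
      ContMDiffAt.comp u hu.self_of_nhds.1 contMDiffAt_fst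
    have h2 := (ContMDiffAt.comp u P.big.source_smooth.contMDiffAt h1).prodMk contMDiffAt_snd
    have h3 := ContMDiffAt.comp u (hα.contMDiffAt (hU.mem_nhds hu.self_of_nhds.2)) h2
    have h4 := ContMDiffAt.comp u P.incl_smooth.contMDiffAt h3
    refine P.big.contMDiffAt_mul h1 h4 ?_
    filter_upwards [hu] with v hv
    exact (hαt _ _ hv.2).symm.trans (P.target_incl _).symm
  have het : Filter.Tendsto e (𝓝 0) (𝓝 (0, 0)) := by
    have := e.continuous.continuousAt (x := 0)
    rwa [ContinuousAt, map_zero] at this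
  set Ψ : EuclideanSpace ℝ (Fin n) → G := fun u => F (e u).1 (e u).2 with hΨ
  have hes : ContMDiff (𝓡 n) ((𝓡 P.quotDim).prod (𝓡 (p - m))) ∞ (fun u => ((e u).1, (e u).2)) :=
    ((ContinuousLinearMap.fst ℝ _ _).comp e.toContinuousLinearMap).contMDiff.prodMk
      ((ContinuousLinearMap.snd ℝ _ _).comp e.toContinuousLinearMap).contMDiff
  have hΨs : ∀ᶠ u in 𝓝 0, ContMDiffAt (𝓡 n) (𝓡 n) ∞ Ψ u := by
    filter_upwards [het.eventually hFs] with u hu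
    have h1 : ContMDiffAt ((𝓡 P.quotDim).prod (𝓡 (p - m))) (𝓡 n) ∞ (Function.uncurry F)
      ((e u).1, (e u).2) := hu
    have h2 := ContMDiffAt.comp u h1 hes.contMDiffAt
    exact h2
  have hF0 : ∀ᶠ z in 𝓝 (0 : EuclideanSpace ℝ (Fin P.quotDim)), F z 0 = κ z := by
    have h1 : ContinuousAt (fun z : EuclideanSpace ℝ (Fin P.quotDim) =>
      (z, (0 : EuclideanSpace ℝ (Fin (p - m))))) 0 := continuousAt_id.prodMk continuousAt_const
    filter_upwards [h1.eventually hq] with z hz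
    simp only [hF]
    rw [hα0 _ hz.2, P.incl_unit, P.big.mul_unit]
  have hFx : ∀ w, F 0 w = P.big.mul g₀ (P.incl (α x₀ w)) := fun w => by
    simp only [hF, hκ0, hx₀]
  -- at the origin, the derivative of `F` is `ι` in the first variable and `J` in the second
  have hΨd : Function.Injective (tmap n n Ψ 0) := by
    refine (injective_iff_map_eq_zero (tmap n n Ψ 0)).2 fun v hv => ?_
    obtain ⟨c, hc, hc0, rfl⟩ := exists_curve (0 : EuclideanSpace ℝ (Fin n)) v
    have hf1 : ContMDiff (𝓡 n) (𝓡 P.quotDim) ∞ (fun u => (e u).1) :=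
      ((ContinuousLinearMap.fst ℝ _ _).comp e.toContinuousLinearMap).contMDiff
    have hf2 : ContMDiff (𝓡 n) (𝓡 (p - m)) ∞ (fun u => (e u).2) :=
      ((ContinuousLinearMap.snd ℝ _ _).comp e.toContinuousLinearMap).contMDiff
    have hz : ContMDiff 𝓘(ℝ, ℝ) (𝓡 P.quotDim) ∞ (fun t => (e (c t)).1) := hf1.comp hc
    have hw : ContMDiff 𝓘(ℝ, ℝ) (𝓡 (p - m)) ∞ (fun t => (e (c t)).2) := hf2.comp hc
    have hz0 : (e (c 0)).1 = 0 := by rw [hc0, map_zero]; rfl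
    have hw0 : (e (c 0)).2 = 0 := by rw [hc0, map_zero]; rfl
    rw [vel_comp hc0 hΨs.self_of_nhds (hc 0)] at hv
    obtain ⟨D, hD⟩ : ∃ D : EuclideanSpace ℝ (Fin P.quotDim) × EuclideanSpace ℝ (Fin (p - m)) →L[ℝ]
        EuclideanSpace ℝ (Fin n), ∀ (z : ℝ → EuclideanSpace ℝ (Fin P.quotDim))
        (w : ℝ → EuclideanSpace ℝ (Fin (p - m))), z 0 = 0 → w 0 = 0 →
        ContMDiffAt 𝓘(ℝ, ℝ) (𝓡 P.quotDim) ∞ z 0 → ContMDiffAt 𝓘(ℝ, ℝ) (𝓡 (p - m)) ∞ w 0 →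
        D (vel _ z, vel _ w) = vel n (fun t => F (z t) (w t)) := by
      refine ⟨mfderiv ((𝓡 P.quotDim).prod (𝓡 (p - m))) (𝓡 n) (Function.uncurry F) (0, 0),
        fun z w h1 h2 hz hw => ?_⟩
      have h3 := vel_comp₂ (f := F) (c := z) (d := w) (by rw [h1, h2]; exact hFs.self_of_nhds) hz hw
      rw [h1, h2] at h3
      exact h3
    have d1 := hD _ _ hz0 hw0 (hz 0) (hw 0)
    have d2 := hD (fun t => (e (c t)).1) (fun _ => 0) hz0 rfl (hz 0) contMDiffAt_const
    have d3 := hD (fun _ => 0) (fun t => (e (c t)).2) rfl hw0 contMDiffAt_const (hw 0)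
    have hzt : Filter.Tendsto (fun t => (e (c t)).1) (𝓝 0) (𝓝 0) := by
      have := (hz 0).continuousAt
      rwa [ContinuousAt, hz0] at this
    have e2 : vel n (fun t => F (e (c t)).1 0) = ι (vel _ (fun t => (e (c t)).1)) := by
      rw [← hκd, vel_comp (c := fun t => (e (c t)).1) hz0 hκ.self_of_nhds (hz 0)]
      refine vel_congr ?_
      filter_upwards [hzt.eventually hF0] with t ht using ht
    have e3 : vel n (fun t => F 0 (e (c t)).2) = J (vel _ (fun t => (e (c t)).2)) := by
      rw [hJd, vel_comp (c := fun t => (e (c t)).2) hw0 hJs (hw 0)]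
      exact vel_congr (Filter.Eventually.of_forall fun t => hFx _)
    rw [vel_const, e2] at d2
    rw [vel_const, e3] at d3
    have d4 : ι (vel _ (fun t => (e (c t)).1)) + J (vel _ (fun t => (e (c t)).2)) = 0 := by
      rw [← d2, ← d3, ← map_add, Prod.mk_add_mk, add_zero, zero_add, d1]
      exact hv
    obtain ⟨h1, h2⟩ := hι _ _ d4
    have h3 := vel_comp hc0 hf1.contMDiffAt (hc 0)
    have h4 := vel_comp hc0 hf2.contMDiffAt (hc 0)
    rw [h1] at h3
    rw [h2] at h4
    have h5 : tmap n P.quotDim (fun u => (e u).1) 0 =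
        (ContinuousLinearMap.fst ℝ _ _).comp e.toContinuousLinearMap :=
      ((ContinuousLinearMap.fst ℝ _ _).comp e.toContinuousLinearMap).hasMFDerivAt.mfderiv
    have h6 : tmap n (p - m) (fun u => (e u).2) 0 =
        (ContinuousLinearMap.snd ℝ _ _).comp e.toContinuousLinearMap :=
      ((ContinuousLinearMap.snd ℝ _ _).comp e.toContinuousLinearMap).hasMFDerivAt.mfderiv
    rw [h5] at h3
    rw [h6] at h4
    have h7 : e (vel n c) = 0 := Prod.ext h3 h4
    exact e.map_eq_zero_iff.1 h7
  obtain ⟨Θ, hΘ0, hΘ, hΘs, hΘt⟩ := exists_local_diffeo rfl hΨs hΨd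
  have hΨ0 : Ψ 0 = g₀ := by
    simp only [hΨ, map_zero]
    exact hF0.self_of_nhds.trans hκ0
  -- if `κ z` and `κ z'` are equivalent, they differ by a small arrow of the subgroupoid
  have hgood : ∀ᶠ r in 𝓝 ((0 : EuclideanSpace ℝ (Fin P.quotDim)), P.sub.unit x₀),
      α (P.sub.target r.2) (β r.2) = r.2 ∧ e.symm (r.1, β r.2) ∈ Θ.source := by
    refine ((continuous_snd.tendsto ((0 : EuclideanSpace ℝ (Fin P.quotDim)),
      P.sub.unit x₀)).eventually (hαβ.mono fun b hb => hb.2)).and ?_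
    have h1 : ContinuousAt (fun r : EuclideanSpace ℝ (Fin P.quotDim) × A => e.symm (r.1, β r.2))
        (0, P.sub.unit x₀) :=
      ContinuousAt.comp (g := e.symm) e.symm.continuous.continuousAt
        (continuousAt_fst.prodMk (ContinuousAt.comp (g := β) hβ.continuousAt continuousAt_snd))
    refine h1.eventually (Θ.open_source.mem_nhds ?_)
    have h2 : β (P.sub.unit x₀) = 0 := by rw [← hα0 _ hxU, hβα _ _ hxU]
    change e.symm (0, β (P.sub.unit x₀)) ∈ _
    rw [h2]
    change e.symm 0 ∈ _
    rw [map_zero]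
    exact hΘ0
  -- as the subgroupoid is embedded, an arrow of it close to a unit in `G` is close to the unit in
  -- `A`
  have hcomap : 𝓝 ((0 : EuclideanSpace ℝ (Fin P.quotDim)), P.sub.unit x₀) =
      Filter.comap (Prod.map id P.incl) (𝓝 (0, P.big.unit x₀)) := by
    rw [(Topology.IsInducing.id.prodMap P.incl_embedding.isEmbedding.isInducing).nhds_eq_comap]
    simp only [Prod.map, id, P.incl_unit]
  rw [hcomap, Filter.eventually_comap] at hgood
  have hδ : Filter.Tendsto (fun r : EuclideanSpace ℝ (Fin P.quotDim) ×
      EuclideanSpace ℝ (Fin P.quotDim) => (r.1, P.big.mul (P.big.inv (κ r.1)) (κ r.2)))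
      (𝓝[{r | P.big.target (κ r.1) = P.big.target (κ r.2)}] (0, 0)) (𝓝 (0, P.big.unit x₀)) := by
    refine Filter.Tendsto.prodMk_nhds (continuousAt_fst.tendsto.mono_left nhdsWithin_le_nhds) ?_
    have h1 := P.continuousOn_inv_mul (g₀, g₀) rfl
    rw [ContinuousWithinAt, P.big.inv_mul] at h1
    refine h1.comp (f := fun r : EuclideanSpace ℝ (Fin P.quotDim) ×
      EuclideanSpace ℝ (Fin P.quotDim) => (κ r.1, κ r.2))
      (tendsto_nhdsWithin_iff.2 ⟨?_, eventually_mem_nhdsWithin⟩)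
    have h2 : Filter.Tendsto (fun r : EuclideanSpace ℝ (Fin P.quotDim) ×
      EuclideanSpace ℝ (Fin P.quotDim) => (κ r.1, κ r.2)) (𝓝 (0, 0)) (𝓝 (g₀, g₀)) :=
      (hκt.comp (continuous_fst.tendsto _)).prodMk_nhds (hκt.comp (continuous_snd.tendsto _))
    exact h2.mono_left nhdsWithin_le_nhds
  have hpair := eventually_nhdsWithin_iff.1 (hδ.eventually hgood)
  rw [nhds_prod_eq] at hpair
  obtain ⟨T, hT, hTT⟩ := Filter.mem_prod_self_iff.1 hpair
  have hez : Filter.Tendsto (fun u => (e u).1) (𝓝 0) (𝓝 0) := by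
    have h1 := (continuous_fst.continuousAt (x := ((0, 0) : EuclideanSpace ℝ (Fin P.quotDim) ×
      EuclideanSpace ℝ (Fin (p - m))))).tendsto
    exact h1.comp het
  have hsrc : ∀ᶠ z in 𝓝 (0 : EuclideanSpace ℝ (Fin P.quotDim)), e.symm (z, 0) ∈ Θ.source := by
    have h1 : ContinuousAt (fun z : EuclideanSpace ℝ (Fin P.quotDim) => e.symm (z, 0)) 0 :=
      ContinuousAt.comp (g := e.symm) e.symm.continuous.continuousAt
        (continuousAt_id.prodMk continuousAt_const)
    refine h1.eventually (Θ.open_source.mem_nhds ?_)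
    change e.symm 0 ∈ _
    rw [map_zero]
    exact hΘ0
  obtain ⟨W, hW, hWo, h0W⟩ := eventually_nhds_iff.1
    ((het.eventually hq).and ((hez.eventually hT).and
      ((hez.eventually hF0).and (hez.eventually hsrc))))
  set Φ := (Θ.restrOpen W hWo).symm with hΦ
  have hΦs : ∀ g ∈ Φ.source, ∃ u, u ∈ Θ.source ∧ u ∈ W ∧ Ψ u = g ∧ Φ g = u := by
    intro g hg
    have h1 := Φ.map_source hg
    have h2 := Φ.left_inv hg
    refine ⟨Φ g, h1.1, h1.2, ?_, rfl⟩
    rw [← hΘ _ h1.1]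
    exact h2
  refine ⟨Φ, e, ?_, ?_, ?_, ?_⟩
  · have h1 : (0 : EuclideanSpace ℝ (Fin n)) ∈ (Θ.restrOpen W hWo).source := ⟨hΘ0, h0W⟩
    have h2 := (Θ.restrOpen W hWo).map_source h1
    have h3 : (Θ.restrOpen W hWo) 0 = g₀ := (hΘ 0 hΘ0).trans hΨ0
    rw [h3] at h2
    exact h2
  · refine hΘt.mono fun g hg => ?_
    obtain ⟨u, hu, -, rfl, -⟩ := hΦs g hg
    rw [← hΘ u hu]
    exact Θ.map_source hu
  · exact hΘs.mono fun u hu => hu.1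
  · intro g hg h hh
    obtain ⟨u, hu, huW, rfl, hgu⟩ := hΦs g hg
    obtain ⟨v, hv, hvW, rfl, hhv⟩ := hΦs h hh
    rw [hgu, hhv]
    obtain ⟨uq, uT, uF, us⟩ := hW u huW
    obtain ⟨vq, vT, vF, vs⟩ := hW v hvW
    have pu : P.proj (Ψ u) = P.proj (κ (e u).1) := P.proj_mul (hαt _ _ uq.2).symm
    have pv : P.proj (Ψ v) = P.proj (κ (e v).1) := P.proj_mul (hαt _ _ vq.2).symm
    constructor
    · intro huv
      rw [pu, pv] at huv
      obtain ⟨b, hb, hbv⟩ := P.proj_eq_iff.1 huv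
      have hb' : P.big.source (κ (e u).1) = P.big.target (P.incl b) := by rw [hb, P.target_incl]
      obtain ⟨h1, h2⟩ := hTT (Set.mk_mem_prod uT vT) (by
        change P.big.target (κ (e u).1) = P.big.target (κ (e v).1)
        rw [hbv, P.big.target_mul _ _ hb']) ((e u).1, b) (by
          refine Prod.ext rfl ?_
          change P.incl b = P.big.mul (P.big.inv (κ (e u).1)) (κ (e v).1)
          rw [hbv, P.big.inv_mul_cancel_left hb'])
      have h3 : Ψ (e.symm ((e u).1, β b)) = κ (e v).1 := by
        simp only [hΨ, ContinuousLinearEquiv.apply_symm_apply, hF]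
        rw [hb, h1, hbv]
      have h4 : Ψ (e.symm ((e v).1, 0)) = κ (e v).1 := by
        simp only [hΨ, ContinuousLinearEquiv.apply_symm_apply]
        exact vF
      -- `κ(z')` has the coordinates `(z', 0)` and `(z, β(b))`
      have h5 := Θ.injOn h2 vs (by rw [hΘ _ h2, hΘ _ vs, h3, h4])
      have h6 := e.symm.injective (a₁ := ((e u).1, β b)) (a₂ := ((e v).1, 0)) h5
      exact (Prod.mk.inj h6).1
    · intro huv
      rw [pu, pv, huv]

end LieGroupoidPair

namespace LieGroupoidPair

open Manifold

variable {m n p : ℕ} {M G A : Type*}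
  [TopologicalSpace M] [ChartedSpace (EuclideanSpace ℝ (Fin m)) M] [IsManifold (𝓡 m) ∞ M]
  [TopologicalSpace G] [ChartedSpace (EuclideanSpace ℝ (Fin n)) G] [IsManifold (𝓡 n) ∞ G]
  [TopologicalSpace A] [ChartedSpace (EuclideanSpace ℝ (Fin p)) A] [IsManifold (𝓡 p) ∞ A]
  (P : LieGroupoidPair m n p M G A)

/-- Coordinates `Φ`, `e` on the arrows near `g`, and a chart `c` of the homogeneous space near the
class of `g`, in which the projection to the homogeneous space is linear. -/
structure Slice (g : G) where
  Φ : OpenPartialHomeomorph G (EuclideanSpace ℝ (Fin n))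
  e : EuclideanSpace ℝ (Fin n) ≃L[ℝ]
    EuclideanSpace ℝ (Fin P.quotDim) × EuclideanSpace ℝ (Fin (p - m))
  c : OpenPartialHomeomorph P.HomogeneousSpace (EuclideanSpace ℝ (Fin P.quotDim))
  mem_source : g ∈ Φ.source
  smooth : ContMDiffOn (𝓡 n) (𝓡 n) ∞ Φ Φ.source
  symm_smooth : ContMDiffOn (𝓡 n) (𝓡 n) ∞ Φ.symm Φ.target
  source_eq : c.source = P.proj '' Φ.source
  apply_proj : ∀ h ∈ Φ.source, c (P.proj h) = (e (Φ h)).1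
  target_eq : ∀ y ∈ c.target, ∃ h ∈ Φ.source, (e (Φ h)).1 = y

theorem exists_chart (g : G) : Nonempty (P.Slice g) := by
  obtain ⟨Φ, e, hg, hΦ, hΦs, h⟩ := P.exists_slice g
  have hco : ContinuousOn (fun h => (e (Φ h)).1) Φ.source :=
    (continuous_fst.comp e.continuous).comp_continuousOn Φ.continuousOn
  obtain ⟨c, hcs, hct, hc⟩ := exists_openPartialHomeomorph_of_same_fibres Φ.open_source ⟨g, hg⟩
    (a := P.proj) (c := fun h => (e (Φ h)).1) P.proj_continuous.continuousOn hco
    (fun V _ hV => P.proj_isOpenMap V hV) (fun V hV hVo => by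
      have h1 := Φ.isOpen_image_of_subset_source hVo hV
      have h2 := isOpenMap_fst _ (e.isOpenMap _ h1)
      rwa [Set.image_image, Set.image_image] at h2) h
  refine ⟨⟨Φ, e, c, hg, hΦ, hΦs, hcs, hc, fun y hy => ?_⟩⟩
  rw [hct] at hy
  obtain ⟨h, hh, rfl⟩ := hy
  exact ⟨h, hh, rfl⟩

/-- A choice of a slice at each arrow. -/
def slice (g : G) : P.Slice g := (P.exists_chart g).some

/-- The atlas given by the slices. -/
@[reducible]
def quotChartedSpace : ChartedSpace (EuclideanSpace ℝ (Fin P.quotDim)) P.HomogeneousSpace where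
  atlas := Set.range fun g => (P.slice g).c
  chartAt q := (P.slice (P.proj_surjective q).choose).c
  mem_chart_source q := by
    rw [(P.slice _).source_eq]
    exact ⟨_, (P.slice _).mem_source, (P.proj_surjective q).choose_spec⟩
  chart_mem_atlas q := ⟨_, rfl⟩

/-- Two slices need not meet: the change of charts is computed by a right translation from one to
the other. -/
theorem Slice.transition_smooth {g₁ g₂ : G} (S₁ : P.Slice g₁) (S₂ : P.Slice g₂) :
    ContDiffOn ℝ ∞ (fun y => S₂.c (S₁.c.symm y)) (S₁.c.symm ≫ₕ S₂.c).source := by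
  intro y hy
  refine ContDiffAt.contDiffWithinAt ?_
  simp only [OpenPartialHomeomorph.trans_source, OpenPartialHomeomorph.symm_source,
    Set.mem_inter_iff, Set.mem_preimage] at hy
  obtain ⟨hy1, hy2⟩ := hy
  obtain ⟨g, hg, rfl⟩ := S₁.target_eq y hy1
  have h1 : S₁.c.symm (S₁.e (S₁.Φ g)).1 = P.proj g := by
    rw [← S₁.apply_proj g hg, S₁.c.left_inv (by rw [S₁.source_eq]; exact ⟨g, hg, rfl⟩)]
  rw [h1, S₂.source_eq] at hy2
  obtain ⟨h, hh, hhg⟩ := hy2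
  obtain ⟨a, ha, rfl⟩ := P.proj_eq_iff.1 hhg.symm
  obtain ⟨R, hR, hRg, hRp⟩ := P.exists_right_translation ha
  rw [← hRg] at hh
  set w := (S₁.e (S₁.Φ g)).2 with hw
  -- lift to the first slice, translate to the second, and project
  set j : EuclideanSpace ℝ (Fin P.quotDim) → G := fun z => S₁.Φ.symm (S₁.e.symm (z, w)) with hj
  have hj0 : S₁.e.symm ((S₁.e (S₁.Φ g)).1, w) = S₁.Φ g := S₁.e.symm_apply_apply _
  have hjg : j (S₁.e (S₁.Φ g)).1 = g := by
    simp only [hj, hj0]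
    exact S₁.Φ.left_inv hg
  have hl : ContMDiff (𝓡 P.quotDim) (𝓡 n) ∞
      (fun z : EuclideanSpace ℝ (Fin P.quotDim) => S₁.e.symm (z, w)) :=
    S₁.e.symm.toContinuousLinearMap.contMDiff.comp
      (contMDiff_id.prodMk_space (contMDiff_const (c := w)))
  have hjs : ContMDiffAt (𝓡 P.quotDim) (𝓡 n) ∞ j (S₁.e (S₁.Φ g)).1 := by
    refine ContMDiffAt.comp (S₁.e (S₁.Φ g)).1 (g := S₁.Φ.symm) ?_ hl.contMDiffAt
    rw [hj0]
    exact S₁.symm_smooth.contMDiffAt (S₁.Φ.open_target.mem_nhds (S₁.Φ.map_source hg))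
  have hRj : ContMDiffAt (𝓡 P.quotDim) (𝓡 n) ∞ (fun z => R (j z)) (S₁.e (S₁.Φ g)).1 :=
    ContMDiffAt.comp _ (by rw [hjg]; exact hR.self_of_nhds) hjs
  have hΦR : ContMDiffAt (𝓡 P.quotDim) (𝓡 n) ∞ (fun z => S₂.Φ (R (j z))) (S₁.e (S₁.Φ g)).1 :=
    ContMDiffAt.comp _ (by
      rw [hjg]
      exact S₂.smooth.contMDiffAt (S₂.Φ.open_source.mem_nhds hh)) hRj
  have hfin : ContMDiffAt (𝓡 P.quotDim) (𝓡 P.quotDim) ∞ (fun z => (S₂.e (S₂.Φ (R (j z)))).1)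
      (S₁.e (S₁.Φ g)).1 :=
    ((ContinuousLinearMap.fst ℝ _ _).comp
      S₂.e.toContinuousLinearMap).contMDiff.contMDiffAt.comp _ hΦR
  refine (contMDiffAt_iff_contDiffAt.1 hfin).congr_of_eventuallyEq ?_
  have hjt : Filter.Tendsto j (𝓝 (S₁.e (S₁.Φ g)).1) (𝓝 g) := by
    have := hjs.continuousAt
    rwa [ContinuousAt, hjg] at this
  have hl0 : ∀ᶠ z in 𝓝 (S₁.e (S₁.Φ g)).1, S₁.e.symm (z, w) ∈ S₁.Φ.target :=
    hl.continuous.continuousAt.eventually (S₁.Φ.open_target.mem_nhds (by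
      change S₁.e.symm ((S₁.e (S₁.Φ g)).1, w) ∈ _
      rw [hj0]
      exact S₁.Φ.map_source hg))
  have hRs : ∀ᶠ k in 𝓝 g, R k ∈ S₂.Φ.source :=
    hR.self_of_nhds.continuousAt.eventually (S₂.Φ.open_source.mem_nhds hh)
  filter_upwards [hl0, hjt.eventually hRs, hjt.eventually hRp] with z h1 h2 h3
  have h4 : j z ∈ S₁.Φ.source := S₁.Φ.map_target h1
  have h5 : S₁.c (P.proj (j z)) = z := by
    rw [S₁.apply_proj _ h4]
    simp only [hj]
    rw [S₁.Φ.right_inv h1, ContinuousLinearEquiv.apply_symm_apply]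
  have h6 : S₁.c.symm z = P.proj (j z) := by
    rw [← h5, S₁.c.left_inv (by rw [S₁.source_eq]; exact ⟨_, h4, rfl⟩), h5]
  rw [h6, ← h3, S₂.apply_proj _ h2]

theorem quot_isManifold :
    @IsManifold ℝ _ _ _ _ _ _ (𝓡 P.quotDim) ∞ P.HomogeneousSpace _ P.quotChartedSpace := by
  let _ := P.quotChartedSpace
  refine isManifold_of_contDiffOn (𝓡 P.quotDim) ∞ P.HomogeneousSpace ?_
  rintro _ _ ⟨g₁, rfl⟩ ⟨g₂, rfl⟩
  have h := Slice.transition_smooth P (P.slice g₁) (P.slice g₂)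
  refine ContDiffOn.congr_mono h (fun y hy => rfl) ?_
  intro y hy
  simpa using hy.1

theorem quot_isSubmersion :
    letI := P.quotChartedSpace
    IsSubmersion (𝓡 n) (𝓡 P.quotDim) ∞ P.proj := by
  let _ := P.quotChartedSpace
  have := P.quot_isManifold
  refine IsSubmersionOfComplement.isSubmersion (F := EuclideanSpace ℝ (Fin (p - m))) fun g => ?_
  set S := P.slice g with hS
  refine IsSubmersionAtOfComplement.mk_of_charts S.e S.Φ S.c S.mem_source ?_ ?_ ?_ ?_ ?_
  · rw [S.source_eq]
    exact ⟨g, S.mem_source, rfl⟩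
  · exact S.Φ.mem_maximalAtlas_of_contMDiffOn S.smooth S.symm_smooth
  · exact IsManifold.subset_maximalAtlas ⟨g, rfl⟩
  · intro h hh
    rw [Set.mem_preimage, S.source_eq]
    exact ⟨h, hh, rfl⟩
  · intro u hu
    have hu' : u ∈ S.Φ.target := by simpa using hu
    have h1 : S.c (P.proj (S.Φ.symm u)) = (S.e u).1 := by
      rw [S.apply_proj _ (S.Φ.map_target hu'), S.Φ.right_inv hu']
    simpa using h1

/-- The homogeneous space is a smooth manifold, and the projection to it is a submersion. -/
theorem exists_quot_manifold :
    ∃ (k : ℕ) (_ : ChartedSpace (EuclideanSpace ℝ (Fin k)) P.HomogeneousSpace),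
      IsManifold (𝓡 k) ∞ P.HomogeneousSpace ∧ IsSubmersion (𝓡 n) (𝓡 k) ∞ P.proj :=
  ⟨P.quotDim, P.quotChartedSpace, P.quot_isManifold, P.quot_isSubmersion⟩

end LieGroupoidPair

/-! ### The isomorphism between the quotient bundle and the vertical bundle -/

namespace LieGroupoid

open Manifold

variable {m n : ℕ} {M G : Type*}
  [TopologicalSpace M] [ChartedSpace (EuclideanSpace ℝ (Fin m)) M] [IsManifold (𝓡 m) ∞ M]
  [TopologicalSpace G] [ChartedSpace (EuclideanSpace ℝ (Fin n)) G] [IsManifold (𝓡 n) ∞ G]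
  (𝒢 : LieGroupoid m n M G)

/-- The velocity of a left translate of a curve depends only on the velocity of the curve. -/
theorem vel_mul_left_congr {g : G} {c d : ℝ → G} (hc : ContMDiffAt 𝓘(ℝ, ℝ) (𝓡 n) ∞ c 0)
    (hd : ContMDiffAt 𝓘(ℝ, ℝ) (𝓡 n) ∞ d 0) (h0 : c 0 = d 0) (hv : vel n c = vel n d)
    (hct : ∀ᶠ t in 𝓝 0, 𝒢.source g = 𝒢.target (c t))
    (hdt : ∀ᶠ t in 𝓝 0, 𝒢.source g = 𝒢.target (d t)) :
    vel n (fun t => 𝒢.mul g (c t)) = vel n fun t => 𝒢.mul g (d t) := by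
  have h1 := 𝒢.tangentMul_vel (c := fun _ => g) contMDiffAt_const hc hct
  have h2 := 𝒢.tangentMul_vel (c := fun _ => g) contMDiffAt_const hd hdt
  rw [h0, hv] at h1
  exact (tangentVector_eq_iff.1 (h1.symm.trans h2)).2

theorem target_leftVec {g : G} {v : EuclideanSpace ℝ (Fin n)}
    (hv : v ∈ 𝒢.algebroidFiber (𝒢.source g)) : tmap n m 𝒢.target g (𝒢.leftVec g v) = 0 := by
  obtain ⟨c, hc, hc0, rfl, hcs⟩ := 𝒢.exists_source_curve hv
  have h1 : ContMDiffAt 𝓘(ℝ, ℝ) (𝓡 n) ∞ (fun t => 𝒢.mul g (𝒢.inv (c t))) 0 :=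
    𝒢.contMDiffAt_mul contMDiffAt_const (𝒢.contMDiffAt_inv hc)
      (hcs.mono fun t ht => by rw [𝒢.target_inv, ht])
  rw [𝒢.leftVec_vel hc hc0 hcs, vel_comp (c := fun t => 𝒢.mul g (𝒢.inv (c t)))
    (by simp only [hc0, 𝒢.inv_unit, 𝒢.mul_unit]) 𝒢.target_smooth.contMDiffAt h1]
  refine (vel_congr (d := fun _ => 𝒢.target g) ?_).trans (vel_const _)
  filter_upwards [hcs] with t ht
  rw [𝒢.target_mul _ _ (by rw [𝒢.target_inv, ht])]

/-- The curve `d` at the unit which corresponds to a curve `c = g · d⁻¹` in a target fibre. -/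
theorem leftVec_inv_curve {g : G} {c : ℝ → G} (hc : ContMDiffAt 𝓘(ℝ, ℝ) (𝓡 n) ∞ c 0)
    (h0 : c 0 = g) (ht : ∀ᶠ t in 𝓝 0, 𝒢.target (c t) = 𝒢.target g) :
    vel n (fun t => 𝒢.inv (𝒢.mul (𝒢.inv g) (c t))) ∈ 𝒢.algebroidFiber (𝒢.source g) ∧
    𝒢.leftVec g (vel n fun t => 𝒢.inv (𝒢.mul (𝒢.inv g) (c t))) = vel n c := by
  have h1 : ContMDiffAt 𝓘(ℝ, ℝ) (𝓡 n) ∞ (fun t => 𝒢.inv (𝒢.mul (𝒢.inv g) (c t))) 0 :=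
    𝒢.contMDiffAt_inv (𝒢.contMDiffAt_mul contMDiffAt_const hc
      (ht.mono fun t h => by rw [𝒢.source_inv, h]))
  have h2 : 𝒢.inv (𝒢.mul (𝒢.inv g) (c 0)) = 𝒢.unit (𝒢.source g) := by
    rw [h0, 𝒢.inv_mul, 𝒢.inv_unit]
  have h3 : ∀ᶠ t in 𝓝 0, 𝒢.source (𝒢.inv (𝒢.mul (𝒢.inv g) (c t))) = 𝒢.source g := by
    filter_upwards [ht] with t h
    rw [𝒢.source_inv, 𝒢.target_mul _ _ (by rw [𝒢.source_inv, h]), 𝒢.target_inv]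
  refine ⟨𝒢.vel_mem_algebroidFiber h1 h2 h3, ?_⟩
  rw [𝒢.leftVec_vel h1 h2 h3]
  refine vel_congr ?_
  filter_upwards [ht] with t h
  rw [𝒢.inv_inv, 𝒢.mul_inv_cancel_left h.symm]

theorem exists_leftVec_eq {g : G} {u : EuclideanSpace ℝ (Fin n)}
    (hu : tmap n m 𝒢.target g u = 0) :
    ∃ v ∈ 𝒢.algebroidFiber (𝒢.source g), 𝒢.leftVec g v = u := by
  obtain ⟨c, hc, hc0, rfl, hct⟩ := (𝒢.target_submersion.isSubmersionAt g).exists_fibre_curve hu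
  obtain ⟨h1, h2⟩ := 𝒢.leftVec_inv_curve hc hc0 hct
  exact ⟨_, h1, h2⟩

/-- If `leftVec g v` is the velocity of a curve `c`, then `v` is the velocity of the curve
`(g⁻¹ · c)⁻¹`. -/
theorem eq_vel_of_leftVec_eq {g : G} {v : EuclideanSpace ℝ (Fin n)}
    (hv : v ∈ 𝒢.algebroidFiber (𝒢.source g)) {c : ℝ → G}
    (hc : ContMDiffAt 𝓘(ℝ, ℝ) (𝓡 n) ∞ c 0)
    (h0 : c 0 = g) (ht : ∀ᶠ t in 𝓝 0, 𝒢.target (c t) = 𝒢.target g)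
    (h : 𝒢.leftVec g v = vel n c) : v = vel n fun t => 𝒢.inv (𝒢.mul (𝒢.inv g) (c t)) := by
  obtain ⟨d, hd, hd0, rfl, hds⟩ := 𝒢.exists_source_curve hv
  rw [𝒢.leftVec_vel hd hd0 hds] at h
  have hdi := 𝒢.contMDiffAt_inv hd
  have hgd : ContMDiffAt 𝓘(ℝ, ℝ) (𝓡 n) ∞ (fun t => 𝒢.mul g (𝒢.inv (d t))) 0 :=
    𝒢.contMDiffAt_mul contMDiffAt_const hdi (hds.mono fun t ht => by rw [𝒢.target_inv, ht])
  have hgd0 : 𝒢.mul g (𝒢.inv (d 0)) = c 0 := by rw [hd0, h0, 𝒢.inv_unit, 𝒢.mul_unit]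
  have h1 := 𝒢.vel_mul_left_congr (g := 𝒢.inv g) hgd hc hgd0 h
    (by
      filter_upwards [hds] with t ht
      rw [𝒢.source_inv, 𝒢.target_mul _ _ (by rw [𝒢.target_inv, ht])])
    (ht.mono fun t ht => by rw [𝒢.source_inv, ht])
  have h2 : vel n (fun t => 𝒢.mul (𝒢.inv g) (𝒢.mul g (𝒢.inv (d t)))) =
      vel n fun t => 𝒢.inv (d t) := by
    refine vel_congr ?_
    filter_upwards [hds] with t ht
    rw [𝒢.inv_mul_cancel_left (by rw [𝒢.target_inv, ht])]
  have hgc : ContMDiffAt 𝓘(ℝ, ℝ) (𝓡 n) ∞ (fun t => 𝒢.mul (𝒢.inv g) (c t)) 0 :=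
    𝒢.contMDiffAt_mul contMDiffAt_const hc (ht.mono fun t h => by rw [𝒢.source_inv, h])
  have h3 := vel_comp (c := fun t => 𝒢.inv (d t)) (f := 𝒢.inv) rfl 𝒢.inv_smooth.contMDiffAt hdi
  have h4 := vel_comp (c := fun t => 𝒢.mul (𝒢.inv g) (c t)) (f := 𝒢.inv) rfl
    𝒢.inv_smooth.contMDiffAt hgc
  have h5 : 𝒢.mul (𝒢.inv g) (c 0) = 𝒢.inv (d 0) := by
    rw [h0, hd0, 𝒢.inv_mul, 𝒢.inv_unit]
  rw [← h4, h5, ← h1, h2, h3]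
  simp only [𝒢.inv_inv]

theorem leftVec_injective {g : G} {v w : EuclideanSpace ℝ (Fin n)}
    (hv : v ∈ 𝒢.algebroidFiber (𝒢.source g)) (hw : w ∈ 𝒢.algebroidFiber (𝒢.source g))
    (h : 𝒢.leftVec g v = 𝒢.leftVec g w) : v = w := by
  obtain ⟨c, hc, hc0, hcv, hct⟩ :=
    (𝒢.target_submersion.isSubmersionAt g).exists_fibre_curve (𝒢.target_leftVec hv)
  rw [𝒢.eq_vel_of_leftVec_eq hv hc hc0 hct hcv.symm,
    𝒢.eq_vel_of_leftVec_eq hw hc hc0 hct (h.symm.trans hcv.symm)]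

/-- The vector `leftVec g v` differentiates functions pulled back by the source map along the
anchor. -/
theorem source_leftVec {g : G} {v : EuclideanSpace ℝ (Fin n)}
    (hv : v ∈ 𝒢.algebroidFiber (𝒢.source g)) :
    tmap n m 𝒢.source g (𝒢.leftVec g v) = tmap n m 𝒢.target (𝒢.unit (𝒢.source g)) v := by
  obtain ⟨c, hc, hc0, rfl, hcs⟩ := 𝒢.exists_source_curve hv
  have h1 : ContMDiffAt 𝓘(ℝ, ℝ) (𝓡 n) ∞ (fun t => 𝒢.mul g (𝒢.inv (c t))) 0 :=
    𝒢.contMDiffAt_mul contMDiffAt_const (𝒢.contMDiffAt_inv hc)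
      (hcs.mono fun t ht => by rw [𝒢.target_inv, ht])
  rw [𝒢.leftVec_vel hc hc0 hcs, vel_comp (c := fun t => 𝒢.mul g (𝒢.inv (c t)))
    (by simp only [hc0, 𝒢.inv_unit, 𝒢.mul_unit]) 𝒢.source_smooth.contMDiffAt h1,
    vel_comp hc0 𝒢.target_smooth.contMDiffAt hc]
  refine vel_congr ?_
  filter_upwards [hcs] with t ht
  rw [𝒢.source_mul _ _ (by rw [𝒢.target_inv, ht]), 𝒢.source_inv]

end LieGroupoid

namespace LieGroupoidPair

open Manifold

variable {m n p k : ℕ} {M G A : Type*}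
  [TopologicalSpace M] [ChartedSpace (EuclideanSpace ℝ (Fin m)) M] [IsManifold (𝓡 m) ∞ M]
  [TopologicalSpace G] [ChartedSpace (EuclideanSpace ℝ (Fin n)) G] [IsManifold (𝓡 n) ∞ G]
  [TopologicalSpace A] [ChartedSpace (EuclideanSpace ℝ (Fin p)) A] [IsManifold (𝓡 p) ∞ A]
  (P : LieGroupoidPair m n p M G A)

theorem leftVector_eq (g : G) (l : P.big.algebroidFiber (P.big.source g)) :
    (P.leftVector g l : EuclideanSpace ℝ (Fin n)) = P.big.leftVec g l.1 :=
  tangentCast_eq (n := n) _ _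

theorem mem_subFiber_iff {x : M} {l : P.big.algebroidFiber x} : l ∈ P.subFiber x ↔
    ∃ b : ℝ → A, ContMDiffAt 𝓘(ℝ, ℝ) (𝓡 p) ∞ b 0 ∧ b 0 = P.sub.unit x ∧
      (∀ᶠ t in 𝓝 0, P.sub.source (b t) = x) ∧ vel n (fun t => P.incl (b t)) = l.1 := by
  constructor
  · rintro ⟨a, ha⟩
    obtain ⟨b, hb, hb0, hbv, hbs⟩ := P.sub.exists_source_curve a.2
    refine ⟨b, hb, hb0, hbs, ?_⟩
    have h1 := vel_comp hb0 P.incl_smooth.contMDiffAt hb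
    rw [hbv] at h1
    rw [← h1, ← ha]
    exact (tangentCast_eq (n := n) (P.incl_unit x) _).symm
  · rintro ⟨b, hb, hb0, hbs, hbv⟩
    refine ⟨⟨vel p b, P.sub.vel_mem_algebroidFiber hb hb0 hbs⟩, ?_⟩
    refine Eq.trans (b := tmap p n P.incl (P.sub.unit x) (vel p b))
      (tangentCast_eq (n := n) (P.incl_unit x) _) ?_
    exact (vel_comp hb0 P.incl_smooth.contMDiffAt hb).trans hbv

variable [ChartedSpace (EuclideanSpace ℝ (Fin k)) P.HomogeneousSpace]
  [IsManifold (𝓡 k) ∞ P.HomogeneousSpace] (hπ : IsSubmersion (𝓡 n) (𝓡 k) ∞ P.proj)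

include hπ in
theorem vel_proj_mul_inv {g : G} {c : ℝ → G} (hc : ContMDiffAt 𝓘(ℝ, ℝ) (𝓡 n) ∞ c 0)
    (h0 : c 0 = P.big.unit (P.big.source g))
    (hs : ∀ᶠ t in 𝓝 0, P.big.source (c t) = P.big.source g) :
    tmap n k P.proj g (P.big.leftVec g (vel n c)) =
      vel k fun t => P.proj (P.big.mul g (P.big.inv (c t))) := by
  have h1 : ContMDiffAt 𝓘(ℝ, ℝ) (𝓡 n) ∞ (fun t => P.big.mul g (P.big.inv (c t))) 0 :=
    P.big.contMDiffAt_mul contMDiffAt_const (P.big.contMDiffAt_inv hc)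
      (hs.mono fun t ht => by rw [P.big.target_inv, ht])
  rw [P.big.leftVec_vel hc h0 hs]
  exact vel_comp (c := fun t => P.big.mul g (P.big.inv (c t)))
    (by simp only [h0, P.big.inv_unit, P.big.mul_unit]) hπ.contMDiff.contMDiffAt h1

include hπ in
/-- The kernel of the differential of the projection consists of the left translates of the Lie
algebroid of the subgroupoid. -/
theorem proj_leftVec_eq_zero_iff {g : G} (l : P.big.algebroidFiber (P.big.source g)) :
    tmap n k P.proj g (P.big.leftVec g l.1) = 0 ↔ l ∈ P.subFiber (P.big.source g) := by
  rw [P.mem_subFiber_iff]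
  constructor
  · intro h
    obtain ⟨c, hc, hc0, hcv, hcp⟩ := (hπ.isSubmersionAt g).exists_fibre_curve h
    have hex : ∀ t, ∃ a : A, P.proj (c t) = P.proj g →
        P.big.source g = P.sub.target a ∧ c t = P.big.mul g (P.incl a) := by
      intro t
      by_cases ht : P.proj (c t) = P.proj g
      · obtain ⟨a, ha⟩ := P.proj_eq_iff.1 ht.symm
        exact ⟨a, fun _ => ha⟩
      · exact ⟨P.sub.unit (P.big.source g), fun h => absurd h ht⟩
    choose a ha using hex
    have hct : ∀ᶠ t in 𝓝 0, P.big.target (c t) = P.big.target g :=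
      hcp.mono fun t ht => congrArg P.homTarget ht
    have hia : ∀ᶠ t in 𝓝 0, P.incl (a t) = P.big.mul (P.big.inv g) (c t) := by
      filter_upwards [hcp] with t ht
      obtain ⟨h1, h2⟩ := ha t ht
      rw [h2, P.big.inv_mul_cancel_left (by rw [h1, P.target_incl])]
    have hgc : ContMDiffAt 𝓘(ℝ, ℝ) (𝓡 n) ∞ (fun t => P.big.mul (P.big.inv g) (c t)) 0 :=
      P.big.contMDiffAt_mul contMDiffAt_const hc (hct.mono fun t h => by rw [P.big.source_inv, h])
    have has : ContMDiffAt 𝓘(ℝ, ℝ) (𝓡 p) ∞ a 0 :=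
      P.incl_embedding.lift (hgc.congr_of_eventuallyEq hia)
    refine ⟨fun t => P.sub.inv (a t), P.sub.contMDiffAt_inv has, ?_, ?_, ?_⟩
    · refine P.incl_injective ?_
      rw [P.incl_inv, hia.self_of_nhds, hc0, P.big.inv_mul, P.big.inv_unit, P.incl_unit]
    · filter_upwards [hcp] with t ht
      rw [P.sub.source_inv, (ha t ht).1]
    · rw [P.big.eq_vel_of_leftVec_eq l.2 hc hc0 hct hcv.symm]
      refine vel_congr ?_
      filter_upwards [hia] with t ht
      rw [P.incl_inv, ht]
  · rintro ⟨b, hb, hb0, hbs, hbv⟩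
    have hib : ContMDiffAt 𝓘(ℝ, ℝ) (𝓡 n) ∞ (fun t => P.incl (b t)) 0 :=
      ContMDiffAt.comp (0 : ℝ) P.incl_smooth.contMDiffAt hb
    rw [← hbv, P.vel_proj_mul_inv hπ hib (by simp only [hb0, P.incl_unit])
      (hbs.mono fun t ht => by rw [P.source_incl, ht])]
    refine (vel_congr (d := fun _ => P.proj g) ?_).trans (vel_const _)
    filter_upwards [hbs] with t ht
    rw [← P.incl_inv, P.proj_mul (by rw [P.sub.target_inv, ht])]

include hπ in
theorem homTarget_smooth : ContMDiff (𝓡 k) (𝓡 m) ∞ P.homTarget := by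
  intro q
  obtain ⟨g, rfl⟩ := P.proj_surjective q
  exact (hπ.isSubmersionAt g).descend P.big.target_smooth.contMDiffAt

include hπ in
theorem homTarget_tmap_proj (g : G) (u : EuclideanSpace ℝ (Fin n)) :
    tmap k m P.homTarget (P.proj g) (tmap n k P.proj g u) = tmap n m P.big.target g u := by
  obtain ⟨c, hc, hc0, rfl⟩ := exists_curve g u
  have h1 : ContMDiffAt 𝓘(ℝ, ℝ) (𝓡 k) ∞ (fun t => P.proj (c t)) 0 :=
    ContMDiffAt.comp (0 : ℝ) hπ.contMDiff.contMDiffAt (hc 0)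
  rw [vel_comp hc0 hπ.contMDiff.contMDiffAt (hc 0), vel_comp (c := fun t => P.proj (c t))
    (by simp only [hc0]) (P.homTarget_smooth hπ).contMDiffAt h1,
    vel_comp hc0 P.big.target_smooth.contMDiffAt (hc 0)]
  rfl

/-- The vertical space at `[g]`, as a subspace of the model space. -/
def vert (k : ℕ) [ChartedSpace (EuclideanSpace ℝ (Fin k)) P.HomogeneousSpace]
    (q : P.HomogeneousSpace) : Submodule ℝ (EuclideanSpace ℝ (Fin k)) :=
  LinearMap.ker (tmap k m P.homTarget q).toLinearMap

theorem mem_vert {q : P.HomogeneousSpace} {w : EuclideanSpace ℝ (Fin k)} :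
    w ∈ P.vert k q ↔ tmap k m P.homTarget q w = 0 := Iff.rfl

/-- The isomorphism `theta`, as a linear map on the fibre of the quotient bundle over any `x` equal
to the source of `g`. -/
def thetaLin {g : G} {x : M} (h : P.big.source g = x) :
    P.QuotFiber x →ₗ[ℝ] EuclideanSpace ℝ (Fin k) :=
  (P.subFiber x).liftQ ((tmap n k P.proj g).toLinearMap.comp
    ((P.big.leftLin g).comp (P.big.algebroidFiber x).subtype)) (by
      subst h
      intro l hl
      have h1 := (P.proj_leftVec_eq_zero_iff hπ l).2 hl
      rw [P.big.leftVec_eq _ l.1] at h1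
      exact h1)

theorem thetaLin_mkQ {g : G} {x : M} (h : P.big.source g = x) (l : P.big.algebroidFiber x) :
    P.thetaLin hπ h ((P.subFiber x).mkQ l) = tmap n k P.proj g (P.big.leftVec g l.1) := by
  rw [P.big.leftVec_eq _ l.1]
  rfl

theorem theta_eq (g : G) (β : P.QuotFiber (P.big.source g)) :
    (P.theta k g β : EuclideanSpace ℝ (Fin k)) = P.thetaLin hπ rfl β := by
  conv_rhs => rw [← Quotient.out_eq β]
  refine Eq.trans ?_ (P.thetaLin_mkQ hπ rfl _).symm
  exact congrArg (tmap n k P.proj g) (P.leftVector_eq g _)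

theorem thetaLin_injective {g : G} {x : M} (h : P.big.source g = x) :
    Function.Injective (P.thetaLin hπ h) := by
  subst h
  refine (injective_iff_map_eq_zero _).2 fun β hβ => ?_
  obtain ⟨l, rfl⟩ := Submodule.mkQ_surjective _ β
  rw [thetaLin_mkQ, proj_leftVec_eq_zero_iff _ hπ] at hβ
  exact (Submodule.Quotient.mk_eq_zero _).2 hβ

theorem thetaLin_mem_vert {g : G} {x : M} (h : P.big.source g = x) (β : P.QuotFiber x) :
    P.thetaLin hπ h β ∈ P.vert k (P.proj g) := by
  subst h
  obtain ⟨l, rfl⟩ := Submodule.mkQ_surjective _ β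
  rw [thetaLin_mkQ, mem_vert, P.homTarget_tmap_proj hπ, P.big.target_leftVec l.2]

theorem exists_thetaLin_eq {g : G} {x : M} (h : P.big.source g = x)
    {w : EuclideanSpace ℝ (Fin k)} (hw : w ∈ P.vert k (P.proj g)) :
    ∃ β, P.thetaLin hπ h β = w := by
  subst h
  obtain ⟨u, rfl⟩ := (hπ.isSubmersionAt g).mfderiv_surjective w
  rw [mem_vert, P.homTarget_tmap_proj hπ] at hw
  obtain ⟨v, hv, rfl⟩ := P.big.exists_leftVec_eq hw
  exact ⟨(P.subFiber _).mkQ ⟨v, hv⟩, P.thetaLin_mkQ hπ rfl _⟩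

end LieGroupoidPair

/-! ### The canonical action and translations -/

namespace LieGroupoidPair

open Manifold

variable {m n p k : ℕ} {M G A : Type*}
  [TopologicalSpace M] [ChartedSpace (EuclideanSpace ℝ (Fin m)) M] [IsManifold (𝓡 m) ∞ M]
  [TopologicalSpace G] [ChartedSpace (EuclideanSpace ℝ (Fin n)) G] [IsManifold (𝓡 n) ∞ G]
  [TopologicalSpace A] [ChartedSpace (EuclideanSpace ℝ (Fin p)) A] [IsManifold (𝓡 p) ∞ A]
  (P : LieGroupoidPair m n p M G A)

/-- Tangent vectors which can be multiplied are velocities of curves which can be multiplied. -/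
theorem exists_conj_curve {a : A} {u : EuclideanSpace ℝ (Fin p)} {l : EuclideanSpace ℝ (Fin n)}
    (hl : l ∈ P.big.algebroidFiber (P.sub.source a))
    (hu : tmap p m P.sub.source a u = tmap n m P.big.target (P.big.unit (P.sub.source a)) l) :
    ∃ (b : ℝ → A) (c : ℝ → G), ContMDiffAt 𝓘(ℝ, ℝ) (𝓡 p) ∞ b 0 ∧
      ContMDiffAt 𝓘(ℝ, ℝ) (𝓡 n) ∞ c 0 ∧ b 0 = a ∧ vel p b = u ∧
      c 0 = P.big.unit (P.sub.source a) ∧ vel n c = l ∧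
      (∀ᶠ t in 𝓝 0, P.big.source (c t) = P.sub.source a) ∧
      ∀ᶠ t in 𝓝 0, P.sub.source (b t) = P.big.target (c t) := by
  obtain ⟨c, hc, hc0, rfl, hcs⟩ := P.big.exists_source_curve hl
  have htc : ContMDiffAt 𝓘(ℝ, ℝ) (𝓡 m) ∞ (fun t => P.big.target (c t)) 0 :=
    ContMDiffAt.comp (0 : ℝ) P.big.target_smooth.contMDiffAt hc
  rw [vel_comp hc0 P.big.target_smooth.contMDiffAt hc] at hu
  obtain ⟨b, hb, hb0, hbu, hbs⟩ := (P.sub.source_submersion.isSubmersionAt a).exists_lift_curve htc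
    (by simp only [hc0, P.big.target_unit]) hu
  exact ⟨b, c, hb, hc, hb0, hbu, hc0, rfl, hcs, hbs⟩

/-- The product `u • l • 0_{a⁻¹}` which defines the canonical action is the velocity of a curve in a
source fibre. -/
theorem tangentMul_conj {a : A} {b : ℝ → A} {c : ℝ → G} (hb : ContMDiffAt 𝓘(ℝ, ℝ) (𝓡 p) ∞ b 0)
    (hc : ContMDiffAt 𝓘(ℝ, ℝ) (𝓡 n) ∞ c 0) (hb0 : b 0 = a)
    (hc0 : c 0 = P.big.unit (P.sub.source a))
    (hcs : ∀ᶠ t in 𝓝 0, P.big.source (c t) = P.sub.source a)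
    (hbc : ∀ᶠ t in 𝓝 0, P.sub.source (b t) = P.big.target (c t)) :
    (ContMDiffAt 𝓘(ℝ, ℝ) (𝓡 n) ∞
      (fun t => P.big.mul (P.big.mul (P.incl (b t)) (c t)) (P.big.inv (P.incl a))) 0 ∧
    P.big.mul (P.big.mul (P.incl (b 0)) (c 0)) (P.big.inv (P.incl a)) =
      P.big.unit (P.sub.target a) ∧
    ∀ᶠ t in 𝓝 0, P.big.source (P.big.mul (P.big.mul (P.incl (b t)) (c t)) (P.big.inv (P.incl a))) =
      P.sub.target a) ∧
    P.big.tangentMul (P.big.tangentMul ⟨P.incl a, tmap p n P.incl a (vel p b)⟩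
      ⟨P.big.unit (P.sub.source a), vel n c⟩)
        ⟨P.big.inv (P.incl a), (0 : EuclideanSpace ℝ (Fin n))⟩ =
      ⟨P.big.unit (P.sub.target a),
        vel n fun t => P.big.mul (P.big.mul (P.incl (b t)) (c t)) (P.big.inv (P.incl a))⟩ := by
  have hib : ContMDiffAt 𝓘(ℝ, ℝ) (𝓡 n) ∞ (fun t => P.incl (b t)) 0 :=
    ContMDiffAt.comp (0 : ℝ) P.incl_smooth.contMDiffAt hb
  have hbc' : ∀ᶠ t in 𝓝 0, P.big.source (P.incl (b t)) = P.big.target (c t) :=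
    hbc.mono fun t ht => by rw [P.source_incl, ht]
  have h1 := P.big.tangentMul_vel hib hc hbc'
  have hm := P.big.contMDiffAt_mul hib hc hbc'
  have hms : ∀ᶠ t in 𝓝 0, P.big.source (P.big.mul (P.incl (b t)) (c t)) =
      P.big.target (P.big.inv (P.incl a)) := by
    filter_upwards [hbc', hcs] with t h1 h2
    rw [P.big.source_mul _ _ h1, P.big.target_inv, P.source_incl, h2]
  have h2 := P.big.tangentMul_vel (d := fun _ => P.big.inv (P.incl a)) hm contMDiffAt_const hms
  have h0 : P.big.mul (P.big.mul (P.incl (b 0)) (c 0)) (P.big.inv (P.incl a)) =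
      P.big.unit (P.sub.target a) := by
    rw [hb0, hc0, ← P.source_incl, P.big.mul_unit, P.big.mul_inv, P.target_incl]
  refine ⟨⟨P.big.contMDiffAt_mul hm contMDiffAt_const hms, h0, ?_⟩, ?_⟩
  · filter_upwards [hms] with t ht
    rw [P.big.source_mul _ _ ht, P.big.source_inv, P.target_incl]
  · rw [vel_const] at h2
    have h3 := vel_comp hb0 P.incl_smooth.contMDiffAt hb
    rw [hb0, hc0, ← h3] at h1
    rw [h1]
    rw [hb0, hc0] at h2
    rw [h2]
    refine tangentVector_ext ?_ rfl
    rw [← h0, hb0, hc0]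

variable [ChartedSpace (EuclideanSpace ℝ (Fin k)) P.HomogeneousSpace]
  [IsManifold (𝓡 k) ∞ P.HomogeneousSpace] (hπ : IsSubmersion (𝓡 n) (𝓡 k) ∞ P.proj)

/-- The value of `theta` on the class of the velocity of a curve. -/
theorem thetaLin_vel {g : G} {x : M} (h : P.big.source g = x) {c : ℝ → G}
    (hc : ContMDiffAt 𝓘(ℝ, ℝ) (𝓡 n) ∞ c 0) (h0 : c 0 = P.big.unit x)
    (hs : ∀ᶠ t in 𝓝 0, P.big.source (c t) = x) (hm : vel n c ∈ P.big.algebroidFiber x) :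
    P.thetaLin hπ h ((P.subFiber x).mkQ ⟨vel n c, hm⟩) =
      vel k fun t => P.proj (P.big.mul g (P.big.inv (c t))) := by
  subst h
  rw [thetaLin_mkQ]
  exact P.vel_proj_mul_inv hπ hc h0 hs

theorem source_mul_incl {γ : G} {a : A} (hγ : P.big.source γ = P.sub.target a) :
    P.big.source (P.big.mul γ (P.incl a)) = P.sub.source a := by
  rw [P.big.source_mul _ _ (by rw [hγ, P.target_incl]), P.source_incl]

theorem thetaLin_conj {a : A} {γ : G} (hγ : P.big.source γ = P.sub.target a) {b : ℝ → A} {c : ℝ → G}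
    (hb : ContMDiffAt 𝓘(ℝ, ℝ) (𝓡 p) ∞ b 0)
    (hc : ContMDiffAt 𝓘(ℝ, ℝ) (𝓡 n) ∞ c 0) (hb0 : b 0 = a)
    (hc0 : c 0 = P.big.unit (P.sub.source a))
    (hcs : ∀ᶠ t in 𝓝 0, P.big.source (c t) = P.sub.source a)
    (hbc : ∀ᶠ t in 𝓝 0, P.sub.source (b t) = P.big.target (c t))
    (hm : vel n c ∈ P.big.algebroidFiber (P.sub.source a))
    (hm' : (vel n fun t => P.big.mul (P.big.mul (P.incl (b t)) (c t)) (P.big.inv (P.incl a))) ∈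
      P.big.algebroidFiber (P.sub.target a)) :
    P.thetaLin hπ hγ ((P.subFiber _).mkQ ⟨_, hm'⟩) =
      P.thetaLin hπ (P.source_mul_incl hγ) ((P.subFiber _).mkQ ⟨vel n c, hm⟩) := by
  obtain ⟨⟨h1, h2, h3⟩, -⟩ := P.tangentMul_conj hb hc hb0 hc0 hcs hbc
  rw [P.thetaLin_vel hπ hγ h1 h2 h3, P.thetaLin_vel hπ _ hc hc0 hcs]
  refine vel_congr ?_
  filter_upwards [hcs, hbc] with t hs ht
  have e1 : P.big.source (P.incl (b t)) = P.big.target (c t) := by rw [P.source_incl, ht]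
  have e2 : P.big.source (P.big.mul (P.incl (b t)) (c t)) =
      P.big.target (P.big.inv (P.incl a)) := by
    rw [P.big.source_mul _ _ e1, P.big.target_inv, P.source_incl, hs]
  have e3 : P.big.target (P.big.inv (c t)) = P.sub.source a := by rw [P.big.target_inv, hs]
  have e4 : P.big.source (P.big.inv (c t)) = P.sub.target (P.sub.inv (b t)) := by
    rw [P.big.source_inv, P.sub.target_inv, ht]
  have e5 : P.big.source (P.big.mul γ (P.incl a)) = P.big.target (P.big.inv (c t)) := by
    rw [P.source_mul_incl hγ, e3]
  have e6 : P.big.source γ = P.big.target (P.incl a) := by rw [hγ, P.target_incl]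
  have e7 : P.big.source (P.big.inv (c t)) = P.big.target (P.incl (P.sub.inv (b t))) := by
    rw [e4, P.target_incl]
  have e8 : P.big.source (P.incl a) = P.big.target (P.big.inv (c t)) := by rw [P.source_incl, e3]
  rw [P.big.inv_mul_rev e2, P.big.inv_inv, P.big.inv_mul_rev e1, ← P.incl_inv,
    ← P.big.mul_assoc _ _ _ e8 e7, ← P.big.mul_assoc, ← P.big.mul_assoc _ _ _ e6 e8, P.proj_mul]
  · rw [P.big.source_mul _ _ e5, e4]
  · rw [P.big.target_mul _ _ e8, ← e6]
  · rw [P.big.source_mul _ _ e8, e7]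

/-- The canonical action in terms of `theta`. -/
theorem isAd_iff {a : A} {x y : M} {γ : G} (hx : P.sub.source a = x) (hy : P.sub.target a = y)
    (hγ : P.big.source γ = y) (hγa : P.big.source (P.big.mul γ (P.incl a)) = x)
    (β : P.QuotFiber x) (β' : P.QuotFiber y) :
    P.IsAd a β β' ↔ P.thetaLin hπ hγ β' = P.thetaLin hπ hγa β := by
  subst hx hy
  have key : ∀ β' : P.QuotFiber (P.sub.target a), P.IsAd a β β' →
      P.thetaLin hπ hγ β' = P.thetaLin hπ hγa β := by
    rintro β' ⟨-, -, u, l, l', hu, rfl, rfl, hm⟩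
    obtain ⟨b, c, hb, hc, hb0, hbu, hc0, hcl, hcs, hbc⟩ :=
      P.exists_conj_curve l.2 ((tangentVector_eq_iff (n := m)).1 hu).2
    obtain ⟨⟨h1, h2, h3⟩, h4⟩ := P.tangentMul_conj hb hc hb0 hc0 hcs hbc
    rw [hbu, hcl] at h4
    have h5 := (tangentVector_eq_iff.1 (h4.symm.trans hm)).2
    have h6 := P.big.vel_mem_algebroidFiber h1 h2 h3
    have h7 := P.thetaLin_conj hπ hγ hb hc hb0 hc0 hcs hbc
      (P.big.vel_mem_algebroidFiber hc hc0 hcs) h6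
    have h8 : (⟨vel n c, P.big.vel_mem_algebroidFiber hc hc0 hcs⟩ :
      P.big.algebroidFiber (P.sub.source a)) = l := Subtype.ext hcl
    have h9 : (⟨_, h6⟩ : P.big.algebroidFiber (P.sub.target a)) = l' := Subtype.ext h5
    rwa [h8, h9] at h7
  refine ⟨key β', fun h => ?_⟩
  obtain ⟨l, rfl⟩ := Submodule.mkQ_surjective _ β
  obtain ⟨u, hu⟩ := (P.sub.source_submersion.isSubmersionAt a).mfderiv_surjective
    (tmap n m P.big.target (P.big.unit (P.sub.source a)) l.1)
  obtain ⟨b, c, hb, hc, hb0, hbu, hc0, hcl, hcs, hbc⟩ := P.exists_conj_curve l.2 hu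
  obtain ⟨⟨h1, h2, h3⟩, h4⟩ := P.tangentMul_conj hb hc hb0 hc0 hcs hbc
  rw [hbu, hcl] at h4
  have h6 := P.big.vel_mem_algebroidFiber h1 h2 h3
  have h5 : P.IsAd a ((P.subFiber (P.sub.source a)).mkQ l)
      ((P.subFiber (P.sub.target a)).mkQ ⟨_, h6⟩) := by
    refine ⟨rfl, rfl, u, l, ⟨_, h6⟩, ?_, rfl, rfl, h4⟩
    exact (tangentVector_eq_iff (n := m)).2 ⟨(P.big.target_unit _).symm, hu⟩
  have h7 : β' = (P.subFiber (P.sub.target a)).mkQ ⟨_, h6⟩ :=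
    P.thetaLin_injective hπ hγ (h.trans (key _ h5).symm)
  rw [h7]
  exact h5

include hπ in
theorem exists_isAd {a : A} {x : M} (hx : P.sub.source a = x) {y : M} (hy : P.sub.target a = y)
    (β : P.QuotFiber x) : ∃ β' : P.QuotFiber y, P.IsAd a β β' := by
  subst hx hy
  have hγ := P.big.source_unit (P.sub.target a)
  obtain ⟨β', h⟩ := P.exists_thetaLin_eq hπ hγ (w := P.thetaLin hπ (P.source_mul_incl hγ) β) (by
    have h1 := P.thetaLin_mem_vert hπ (P.source_mul_incl hγ) β
    rwa [P.proj_mul hγ] at h1)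
  exact ⟨β', (P.isAd_iff hπ rfl rfl hγ (P.source_mul_incl hγ) _ _).2 h⟩

/-- The left translation of the arrows by a local bisection. -/
def leftMap (S : P.big.LocalBisection) (g : G) : G := P.big.mul (S.sec (P.big.target g)) g

variable {P}

theorem source_leftMap {S : P.big.LocalBisection} {g : G} (h : P.big.target g ∈ S.base.source) :
    P.big.source (P.leftMap S g) = P.big.source g :=
  P.big.source_mul _ _ (S.source_sec _ h)

theorem target_leftMap {S : P.big.LocalBisection} {g : G} (h : P.big.target g ∈ S.base.source) :
    P.big.target (P.leftMap S g) = S.base (P.big.target g) := by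
  rw [leftMap, P.big.target_mul _ _ (S.source_sec _ h), S.target_sec _ h]

theorem eventually_target_mem {S : P.big.LocalBisection} {g : G}
    (h : P.big.target g ∈ S.base.source) : ∀ᶠ g' in 𝓝 g, P.big.target g' ∈ S.base.source :=
  P.big.target_smooth.continuous.continuousAt.eventually (S.base.open_source.mem_nhds h)

theorem leftMap_smooth {S : P.big.LocalBisection} {g : G} (h : P.big.target g ∈ S.base.source) :
    ContMDiffAt (𝓡 n) (𝓡 n) ∞ (P.leftMap S) g := by
  have h1 : ContMDiffAt (𝓡 n) (𝓡 n) ∞ (fun g => S.sec (P.big.target g)) g :=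
    ContMDiffAt.comp g (S.sec_smooth.contMDiffAt (S.base.open_source.mem_nhds h))
      P.big.target_smooth.contMDiffAt
  refine P.big.contMDiffAt_mul h1 contMDiffAt_id ?_
  filter_upwards [eventually_target_mem h] with g' h'
  exact S.source_sec _ h'

theorem translate_proj {S : P.big.LocalBisection} {g : G} (h : P.big.target g ∈ S.base.source) :
    P.translate S (P.proj g) = P.proj (P.leftMap S g) :=
  if_pos (S.source_sec _ h)

include hπ in
theorem translate_smooth {S : P.big.LocalBisection} {q : P.HomogeneousSpace}
    (h : P.homTarget q ∈ S.base.source) : ContMDiffAt (𝓡 k) (𝓡 k) ∞ (P.translate S) q := by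
  obtain ⟨g, rfl⟩ := P.proj_surjective q
  refine (hπ.isSubmersionAt g).descend ?_
  have h1 : ContMDiffAt (𝓡 n) (𝓡 k) ∞ (fun g => P.proj (P.leftMap S g)) g :=
    ContMDiffAt.comp g hπ.contMDiff.contMDiffAt (leftMap_smooth h)
  refine h1.congr_of_eventuallyEq ?_
  filter_upwards [eventually_target_mem h] with g' h'
  exact translate_proj h'

/-- Left translations intertwine the left-invariant vector fields. -/
theorem tmap_leftMap {S : P.big.LocalBisection} {g : G} (h : P.big.target g ∈ S.base.source)
    {v : EuclideanSpace ℝ (Fin n)} (hv : v ∈ P.big.algebroidFiber (P.big.source g)) :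
    tmap n n (P.leftMap S) g (P.big.leftVec g v) = P.big.leftVec (P.leftMap S g) v := by
  obtain ⟨c, hc, hc0, rfl, hcs⟩ := P.big.exists_source_curve hv
  have h1 : ContMDiffAt 𝓘(ℝ, ℝ) (𝓡 n) ∞ (fun t => P.big.mul g (P.big.inv (c t))) 0 :=
    P.big.contMDiffAt_mul contMDiffAt_const (P.big.contMDiffAt_inv hc)
      (hcs.mono fun t ht => by rw [P.big.target_inv, ht])
  rw [P.big.leftVec_vel hc hc0 hcs, P.big.leftVec_vel hc (by rw [hc0, source_leftMap h])
    (by rwa [source_leftMap h]), vel_comp (c := fun t => P.big.mul g (P.big.inv (c t)))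
    (by simp only [hc0, P.big.inv_unit, P.big.mul_unit]) (leftMap_smooth h) h1]
  refine vel_congr ?_
  filter_upwards [hcs] with t ht
  have e1 : P.big.source g = P.big.target (P.big.inv (c t)) := by rw [P.big.target_inv, ht]
  rw [leftMap, leftMap, P.big.target_mul _ _ e1, P.big.mul_assoc _ _ _ (S.source_sec _ h) e1]

/-- Translations of the homogeneous space preserve `theta`. -/
theorem tmap_translate {S : P.big.LocalBisection} {g : G} (h : P.big.target g ∈ S.base.source)
    {x : M} (hx : P.big.source g = x) (hx' : P.big.source (P.leftMap S g) = x) (β : P.QuotFiber x) :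
    tmap k k (P.translate S) (P.proj g) (P.thetaLin hπ hx β) = P.thetaLin hπ hx' β := by
  subst hx
  obtain ⟨l, rfl⟩ := Submodule.mkQ_surjective _ β
  rw [thetaLin_mkQ, thetaLin_mkQ, ← tmap_leftMap h l.2]
  obtain ⟨c, hc, hc0, hcv⟩ := exists_curve g (P.big.leftVec g l.1)
  have h1 : ContMDiffAt 𝓘(ℝ, ℝ) (𝓡 k) ∞ (fun t => P.proj (c t)) 0 :=
    ContMDiffAt.comp (0 : ℝ) hπ.contMDiff.contMDiffAt (hc 0)
  have h2 : ContMDiffAt 𝓘(ℝ, ℝ) (𝓡 n) ∞ (fun t => P.leftMap S (c t)) 0 :=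
    ContMDiffAt.comp (0 : ℝ) (by rw [hc0]; exact leftMap_smooth h) (hc 0)
  have hct : ∀ᶠ t in 𝓝 0, P.big.target (c t) ∈ S.base.source := by
    have := (hc 0).continuousAt
    rw [ContinuousAt, hc0] at this
    exact this.eventually (eventually_target_mem h)
  rw [← hcv, vel_comp hc0 hπ.contMDiff.contMDiffAt (hc 0), vel_comp (c := fun t => P.proj (c t))
    (by simp only [hc0]) (translate_smooth hπ (S := S) (q := P.proj g) h) h1,
    vel_comp hc0 (leftMap_smooth h) (hc 0), vel_comp (c := fun t => P.leftMap S (c t))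
    (by simp only [hc0]) hπ.contMDiff.contMDiffAt h2]
  refine vel_congr ?_
  filter_upwards [hct] with t ht
  exact translate_proj ht

/-- The inverse of a local bisection. -/
def inverseBisection (S : P.big.LocalBisection) : P.big.LocalBisection where
  base := S.base.symm
  sec y := P.big.inv (S.sec (S.base.symm y))
  source_sec y hy := by
    rw [P.big.source_inv, S.target_sec _ (S.base.map_target hy), S.base.right_inv hy]
  target_sec y hy := by
    rw [P.big.target_inv, S.source_sec _ (S.base.map_target hy)]
  sec_smooth := P.big.inv_smooth.comp_contMDiffOn
    (S.sec_smooth.comp S.symm_smooth fun y hy => S.base.map_target hy)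
  symm_smooth := by
    have h := P.big.target_smooth.comp_contMDiffOn S.sec_smooth
    exact h.congr fun x hx => (S.target_sec x hx).symm

theorem leftMap_inverseBisection {S : P.big.LocalBisection} {g : G}
    (h : P.big.target g ∈ S.base.source) :
    P.leftMap (inverseBisection S) (P.leftMap S g) = g := by
  have h1 : P.big.target (P.leftMap S g) = S.base (P.big.target g) := target_leftMap h
  rw [leftMap, h1]
  simp only [inverseBisection, leftMap]
  rw [S.base.left_inv h, P.big.inv_mul_cancel_left (S.source_sec _ h)]

theorem leftMap_inverseBisection' {S : P.big.LocalBisection} {g : G}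
    (h : P.big.target g ∈ S.base.target) :
    P.leftMap S (P.leftMap (inverseBisection S) g) = g := by
  have h1 : P.big.target (P.leftMap (inverseBisection S) g) = S.base.symm (P.big.target g) :=
    target_leftMap (S := inverseBisection S) h
  rw [leftMap, h1]
  simp only [inverseBisection, leftMap]
  rw [P.big.mul_inv_cancel_left]
  rw [S.target_sec _ (S.base.map_target h), S.base.right_inv h]

/-- The right translation of the arrows by a local bisection of the subgroupoid. -/
def rightMap (P : LieGroupoidPair m n p M G A) (S : P.sub.LocalBisection) (g : G) : G :=
  P.big.mul g (P.incl (S.sec (S.base.symm (P.big.source g))))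

section RightMap

variable {S : P.sub.LocalBisection} {g : G} (h : P.big.source g ∈ S.base.target)
include h

theorem source_eq_target_sec :
    P.big.source g = P.sub.target (S.sec (S.base.symm (P.big.source g))) := by
  rw [S.target_sec _ (S.base.map_target h), S.base.right_inv h]

theorem source_rightMap : P.big.source (P.rightMap S g) = S.base.symm (P.big.source g) := by
  rw [rightMap, P.source_mul_incl (source_eq_target_sec h), S.source_sec _ (S.base.map_target h)]

theorem proj_rightMap : P.proj (P.rightMap S g) = P.proj g :=
  P.proj_mul (source_eq_target_sec h)

theorem eventually_source_mem_target : ∀ᶠ g' in 𝓝 g, P.big.source g' ∈ S.base.target :=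
  P.big.source_smooth.continuous.continuousAt.eventually (S.base.open_target.mem_nhds h)

theorem rightMap_smooth : ContMDiffAt (𝓡 n) (𝓡 n) ∞ (P.rightMap S) g := by
  have h1 : ContMDiffAt (𝓡 n) (𝓡 m) ∞ (fun g => S.base.symm (P.big.source g)) g :=
    ContMDiffAt.comp g (S.symm_smooth.contMDiffAt (S.base.open_target.mem_nhds h))
      P.big.source_smooth.contMDiffAt
  have h2 : ContMDiffAt (𝓡 n) (𝓡 p) ∞ (fun g => S.sec (S.base.symm (P.big.source g))) g :=
    ContMDiffAt.comp g (S.sec_smooth.contMDiffAt (S.base.open_source.mem_nhds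
      (S.base.map_target h))) h1
  have h3 := ContMDiffAt.comp g P.incl_smooth.contMDiffAt h2
  refine P.big.contMDiffAt_mul contMDiffAt_id h3 ?_
  filter_upwards [eventually_source_mem_target h] with g' h'
  exact (source_eq_target_sec h').trans (P.target_incl _).symm

omit h in
theorem conj_smooth {x : M} (hx : x ∈ S.base.source) :
    ContMDiffAt (𝓡 n) (𝓡 n) ∞ (P.big.conj (P.incl ∘ S.sec)) (P.big.unit x) := by
  have hs : ∀ x ∈ S.base.source, ContMDiffAt (𝓡 m) (𝓡 n) ∞ (fun y => P.incl (S.sec y)) x :=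
    fun x hx => ContMDiffAt.comp x P.incl_smooth.contMDiffAt
      (S.sec_smooth.contMDiffAt (S.base.open_source.mem_nhds hx))
  have h1 : ContMDiffAt (𝓡 n) (𝓡 n) ∞ (fun g => P.incl (S.sec (P.big.target g))) (P.big.unit x) :=
    ContMDiffAt.comp (P.big.unit x) (g := fun y => P.incl (S.sec y))
      (by rw [P.big.target_unit]; exact hs x hx) P.big.target_smooth.contMDiffAt
  have h2 : ContMDiffAt (𝓡 n) (𝓡 n) ∞ (fun g => P.incl (S.sec (P.big.source g))) (P.big.unit x) :=
    ContMDiffAt.comp (P.big.unit x) (g := fun y => P.incl (S.sec y))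
      (by rw [P.big.source_unit]; exact hs x hx) P.big.source_smooth.contMDiffAt
  have e1 : ∀ᶠ g in 𝓝 (P.big.unit x), P.big.target g ∈ S.base.source :=
    P.big.target_smooth.continuous.continuousAt.eventually
      (S.base.open_source.mem_nhds (by rwa [P.big.target_unit]))
  have e2 : ∀ᶠ g in 𝓝 (P.big.unit x), P.big.source g ∈ S.base.source :=
    P.big.source_smooth.continuous.continuousAt.eventually
      (S.base.open_source.mem_nhds (by rwa [P.big.source_unit]))
  have e3 : ∀ᶠ g in 𝓝 (P.big.unit x),
      P.big.source (P.incl (S.sec (P.big.target g))) = P.big.target g := by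
    filter_upwards [e1] with g hg
    rw [P.source_incl, S.source_sec _ hg]
  have h3 : ContMDiffAt (𝓡 n) (𝓡 n) ∞
      (fun g => P.big.mul (P.incl (S.sec (P.big.target g))) g) (P.big.unit x) :=
    P.big.contMDiffAt_mul h1 contMDiffAt_id e3
  refine P.big.contMDiffAt_mul h3 (P.big.contMDiffAt_inv h2) ?_
  filter_upwards [e2, e3] with g h2 h3
  refine (P.big.source_mul _ _ h3).trans ?_
  rw [P.big.target_inv]
  exact (S.source_sec _ h2).symm.trans (P.source_incl _).symm

omit h in
theorem conj_curve {x : M} (hx : x ∈ S.base.source) {c : ℝ → G}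
    (hc : ContMDiffAt 𝓘(ℝ, ℝ) (𝓡 n) ∞ c 0) (hc0 : c 0 = P.big.unit x)
    (hcs : ∀ᶠ t in 𝓝 0, P.big.source (c t) = x) :
    ContMDiffAt 𝓘(ℝ, ℝ) (𝓡 n) ∞ (fun t => P.big.conj (P.incl ∘ S.sec) (c t)) 0 ∧
    P.big.conj (P.incl ∘ S.sec) (c 0) = P.big.unit (S.base x) ∧
    (∀ᶠ t in 𝓝 0, P.big.source (P.big.conj (P.incl ∘ S.sec) (c t)) = S.base x) ∧
    (∀ᶠ t in 𝓝 0, P.big.target (c t) ∈ S.base.source) ∧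
    tmap n n (P.big.conj (P.incl ∘ S.sec)) (P.big.unit x) (vel n c) =
      vel n (fun t => P.big.conj (P.incl ∘ S.sec) (c t)) := by
  have e1 : ∀ᶠ t in 𝓝 0, P.big.target (c t) ∈ S.base.source :=
    (P.big.target_smooth.continuous.continuousAt.comp hc.continuousAt).eventually
      (S.base.open_source.mem_nhds (by
        change P.big.target (c 0) ∈ _
        rwa [hc0, P.big.target_unit]))
  have e2 : ∀ g, P.big.source g = x → P.big.target g ∈ S.base.source →
      P.big.source (P.big.conj (P.incl ∘ S.sec) g) = S.base x := by
    intro g hs ht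
    have e3 : P.big.source (P.incl (S.sec (P.big.target g))) = P.big.target g := by
      rw [P.source_incl, S.source_sec _ ht]
    rw [LieGroupoid.conj, P.big.source_mul, P.big.source_inv, hs]
    · exact (P.target_incl _).trans (S.target_sec _ hx)
    · rw [P.big.target_inv]
      refine (P.big.source_mul _ _ e3).trans ?_
      rw [hs]
      exact ((P.source_incl _).trans (S.source_sec _ hx)).symm
  refine ⟨ContMDiffAt.comp (0 : ℝ) (by rw [hc0]; exact conj_smooth hx) hc, ?_, ?_, e1,
    vel_comp hc0 (conj_smooth hx) hc⟩
  · rw [hc0, LieGroupoid.conj, P.big.target_unit, P.big.source_unit]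
    have e4 : P.big.source ((P.incl ∘ S.sec) x) = x := (P.source_incl _).trans (S.source_sec _ hx)
    have e5 := P.big.mul_unit ((P.incl ∘ S.sec) x)
    rw [e4] at e5
    rw [e5, P.big.mul_inv]
    exact congrArg _ ((P.target_incl _).trans (S.target_sec _ hx))
  · filter_upwards [e1, hcs] with t h1 h2 using e2 _ h2 h1

omit h in
theorem conj_mem {x : M} (hx : x ∈ S.base.source) {v : EuclideanSpace ℝ (Fin n)}
    (hv : v ∈ P.big.algebroidFiber x) :
    tmap n n (P.big.conj (P.incl ∘ S.sec)) (P.big.unit x) v ∈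
      P.big.algebroidFiber (S.base x) := by
  obtain ⟨c, hc, hc0, rfl, hcs⟩ := P.big.exists_source_curve hv
  obtain ⟨h1, h2, h3, -, h4⟩ := conj_curve hx hc hc0 hcs
  rw [h4]
  exact P.big.vel_mem_algebroidFiber h1 h2 h3

/-- Right translation by a local bisection of the subgroupoid intertwines the left-invariant vector
fields of sections of the Lie algebroid which are related by the adjoint action. -/
theorem tmap_rightMap {v : EuclideanSpace ℝ (Fin n)}
    (hv : v ∈ P.big.algebroidFiber (S.base.symm (P.big.source g))) :
    tmap n n (P.rightMap S) g (P.big.leftVec g (tmap n n (P.big.conj (P.incl ∘ S.sec))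
      (P.big.unit (S.base.symm (P.big.source g))) v)) = P.big.leftVec (P.rightMap S g) v := by
  obtain ⟨c, hc, hc0, rfl, hcs⟩ := P.big.exists_source_curve hv
  have hx := S.base.map_target h
  obtain ⟨h1, h2, h3, h5, h4⟩ := conj_curve hx hc hc0 hcs
  rw [S.base.right_inv h] at h2 h3
  have h6 : ContMDiffAt 𝓘(ℝ, ℝ) (𝓡 n) ∞
      (fun t => P.big.mul g (P.big.inv (P.big.conj (P.incl ∘ S.sec) (c t)))) 0 :=
    P.big.contMDiffAt_mul contMDiffAt_const (P.big.contMDiffAt_inv h1)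
      (h3.mono fun t ht => by rw [P.big.target_inv, ht])
  rw [h4, P.big.leftVec_vel h1 h2 h3, P.big.leftVec_vel hc (by rw [hc0, source_rightMap h])
    (by rwa [source_rightMap h]),
    vel_comp (c := fun t => P.big.mul g (P.big.inv (P.big.conj (P.incl ∘ S.sec) (c t))))
    (by simp only [h2, P.big.inv_unit, P.big.mul_unit]) (rightMap_smooth h) h6]
  refine vel_congr ?_
  filter_upwards [hcs, h3, h5] with t hs hs' ht
  set σ : M → G := fun y => P.incl (S.sec y) with hσ
  set x := S.base.symm (P.big.source g) with hxd
  have f1 : P.big.source (σ (P.big.target (c t))) = P.big.target (c t) := by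
    simp only [hσ]
    rw [P.source_incl, S.source_sec _ ht]
  have f2 : P.big.source (σ x) = x := by
    simp only [hσ]
    rw [P.source_incl, S.source_sec _ hx]
  have f3 : P.big.target (σ x) = P.big.source g := by
    simp only [hσ]
    rw [P.target_incl, S.target_sec _ hx, S.base.right_inv h]
  have f4 : P.big.target (σ (P.big.target (c t))) = S.base (P.big.target (c t)) := by
    simp only [hσ]
    rw [P.target_incl, S.target_sec _ ht]
  have f5 : P.big.conj (P.incl ∘ S.sec) (c t) =
      P.big.mul (P.big.mul (σ (P.big.target (c t))) (c t)) (P.big.inv (σ x)) := by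
    rw [LieGroupoid.conj, hs]
    rfl
  have f6 : P.big.source (P.big.mul (σ (P.big.target (c t))) (c t)) =
      P.big.target (P.big.inv (σ x)) := by
    rw [P.big.source_mul _ _ f1, P.big.target_inv, hs, f2]
  have f7 : P.big.inv (P.big.conj (P.incl ∘ S.sec) (c t)) =
      P.big.mul (P.big.mul (σ x) (P.big.inv (c t))) (P.big.inv (σ (P.big.target (c t)))) := by
    rw [f5, P.big.inv_mul_rev f6, P.big.inv_inv, P.big.inv_mul_rev f1, P.big.mul_assoc]
    · rw [f2, P.big.target_inv, hs]
    · rw [P.big.source_inv, P.big.target_inv, f1]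
  have f8 : P.big.source g = P.big.target (P.big.inv (P.big.conj (P.incl ∘ S.sec) (c t))) := by
    rw [P.big.target_inv, hs']
  have f9 : P.big.source (P.big.mul g (P.big.inv (P.big.conj (P.incl ∘ S.sec) (c t)))) =
      S.base (P.big.target (c t)) := by
    rw [P.big.source_mul _ _ f8, P.big.source_inv, f5, P.big.target_mul _ _ f6,
      P.big.target_mul _ _ f1, f4]
  have f10 : P.big.source (σ x) = P.big.target (P.big.inv (c t)) := by
    rw [f2, P.big.target_inv, hs]
  have f11 : P.rightMap S (P.big.mul g (P.big.inv (P.big.conj (P.incl ∘ S.sec) (c t)))) =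
      P.big.mul (P.big.mul g (P.big.inv (P.big.conj (P.incl ∘ S.sec) (c t))))
        (σ (P.big.target (c t))) := by
    rw [rightMap, f9, S.base.left_inv ht]
  have f12 : P.rightMap S g = P.big.mul g (σ x) := rfl
  rw [f11, f12, P.big.mul_assoc _ _ _ f8, f7, P.big.inv_mul_cancel_right, P.big.mul_assoc]
  · exact f3.symm
  · exact f10
  · rw [P.big.source_mul _ _ f10, P.big.source_inv, f1]
  · rw [P.big.source_inv, f5, P.big.target_mul _ _ f6, P.big.target_mul _ _ f1]

/-- The action of a local bisection of the subgroupoid in terms of right translations. -/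
theorem isAd_rightMap {x : M} (hx : x = S.base.symm (P.big.source g)) (β : P.QuotFiber x)
    (β' : P.QuotFiber (P.big.source g)) :
    P.IsAd (S.sec x) β β' ↔ P.thetaLin hπ rfl β' =
      P.thetaLin hπ (g := P.rightMap S g) ((source_rightMap h).trans hx.symm) β := by
  subst hx
  exact P.isAd_iff hπ (S.source_sec _ (S.base.map_target h)) (source_eq_target_sec h).symm rfl
    (source_rightMap h) β β'

end RightMap

end LieGroupoidPair

/-! ### Derivatives of functions -/

section Functions

variable {n : ℕ} {N : Type*} [TopologicalSpace N] [ChartedSpace (EuclideanSpace ℝ (Fin n)) N]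
  [IsManifold (𝓡 n) ∞ N]

theorem tfun_eq_of_hasDerivAt {f : N → ℝ} {c : ℝ → N} {x : N} {d : ℝ} (hx : c 0 = x)
    (hf : ContMDiffAt (𝓡 n) 𝓘(ℝ, ℝ) ∞ f x)
    (hc : ContMDiffAt 𝓘(ℝ, ℝ) (𝓡 n) ∞ c 0) (h : HasDerivAt (fun t => f (c t)) d 0) :
    tfun n f x (vel n c) = d :=
  (vel_comp_real hx hf hc).unique h

theorem tfun_congr {f h : N → ℝ} {x : N} (hfh : ∀ᶠ y in 𝓝 x, f y = h y) : tfun n f x = tfun n h x :=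
  Filter.EventuallyEq.mfderiv_eq hfh

theorem tfun_const (a : ℝ) (x : N) : tfun n (fun _ : N => a) x = 0 := mfderiv_const

theorem tfun_mul {f h : N → ℝ} {x : N} (hf : ContMDiffAt (𝓡 n) 𝓘(ℝ, ℝ) ∞ f x)
    (hh : ContMDiffAt (𝓡 n) 𝓘(ℝ, ℝ) ∞ h x) (v : EuclideanSpace ℝ (Fin n)) :
    tfun n (fun y => f y * h y) x v = tfun n f x v * h x + f x * tfun n h x v := by
  obtain ⟨c, hc, hc0, rfl⟩ := exists_curve x v
  refine tfun_eq_of_hasDerivAt hc0 (hf.mul hh) (hc 0) ?_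
  have h1 := (vel_comp_real hc0 hf (hc 0)).mul (vel_comp_real hc0 hh (hc 0))
  rw [hc0] at h1
  exact h1

theorem tfun_sum {ι : Type*} [Fintype ι] {f : ι → N → ℝ} {x : N}
    (hf : ∀ i, ContMDiffAt (𝓡 n) 𝓘(ℝ, ℝ) ∞ (f i) x) (v : EuclideanSpace ℝ (Fin n)) :
    tfun n (fun y => ∑ i, f i y) x v = ∑ i, tfun n (f i) x v := by
  obtain ⟨c, hc, hc0, rfl⟩ := exists_curve x v
  exact tfun_eq_of_hasDerivAt hc0 (contMDiffAt_finsetSum fun i _ => hf i) (hc 0)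
    (HasDerivAt.fun_sum fun i _ => vel_comp_real hc0 (hf i) (hc 0))

end Functions

/-! ### Vector bundles embedded in the pullback of a tangent bundle -/

section Pulled

variable {n k b : ℕ} {N Q B : Type*}
  [TopologicalSpace N] [ChartedSpace (EuclideanSpace ℝ (Fin n)) N] [IsManifold (𝓡 n) ∞ N]
  [TopologicalSpace Q] [ChartedSpace (EuclideanSpace ℝ (Fin k)) Q] [IsManifold (𝓡 k) ∞ Q]
  [TopologicalSpace B] [ChartedSpace (EuclideanSpace ℝ (Fin b)) B] [IsManifold (𝓡 b) ∞ B]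
  {W : B → Type*} [∀ x, AddCommGroup (W x)] [∀ x, Module ℝ (W x)]

open Manifold

/-- The fibres `W x` and the sections `Γ` are those of a vector bundle over `B`, whose pullback
along the submersion `f : N → B` is identified by `Θ` with the subbundle `R` of the pullback of the
tangent bundle of `Q` along `pr : N → Q`. -/
structure IsPulledBundle (n k b : ℕ) {N Q B : Type*}
    [TopologicalSpace N] [ChartedSpace (EuclideanSpace ℝ (Fin n)) N]
    [TopologicalSpace Q] [ChartedSpace (EuclideanSpace ℝ (Fin k)) Q] [IsManifold (𝓡 k) ∞ Q]
    [TopologicalSpace B] [ChartedSpace (EuclideanSpace ℝ (Fin b)) B]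
    {W : B → Type*} [∀ x, AddCommGroup (W x)] [∀ x, Module ℝ (W x)]
    (pr : N → Q) (R : N → Submodule ℝ (EuclideanSpace ℝ (Fin k)))
    (f : N → B) (Γ : Submodule ℝ (∀ x, W x))
    (Θ : ∀ (g : N) (x : B), f g = x → W x →ₗ[ℝ] EuclideanSpace ℝ (Fin k)) : Prop where
  submersion : ∀ g, IsSubmersionAt (𝓡 n) (𝓡 b) ∞ f g
  surjective : Function.Surjective f
  injective : ∀ g x h, Function.Injective (Θ g x h)
  range_eq : ∀ g x h, LinearMap.range (Θ g x h) = R g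
  smooth_pr : ContMDiff (𝓡 n) (𝓡 k) ∞ pr
  mem_iff : ∀ e, e ∈ Γ ↔ ∀ g, SmoothFieldAt (𝓡 n) k pr (fun g' => Θ g' (f g') rfl (e (f g'))) g
  exists_section : ∀ x (β : W x), ∃ e ∈ Γ, e x = β
  finrank_eq : ∃ r, ∀ g, Module.finrank ℝ (R g) = r

namespace IsPulledBundle

variable {pr : N → Q} {R : N → Submodule ℝ (EuclideanSpace ℝ (Fin k))} {f : N → B}
  {Γ : Submodule ℝ (∀ x, W x)}
  {Θ : ∀ (g : N) (x : B), f g = x → W x →ₗ[ℝ] EuclideanSpace ℝ (Fin k)}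
  (H : IsPulledBundle n k b pr R f Γ Θ)
include H

theorem mem (g : N) (x : B) (h : f g = x) (β : W x) : Θ g x h β ∈ R g := by
  rw [← H.range_eq g x h]
  exact ⟨β, rfl⟩

theorem smooth : ContMDiff (𝓡 n) (𝓡 b) ∞ f := fun g => (H.submersion g).contMDiffAt

theorem smul_mem {φ : B → ℝ} (hφ : ContMDiff (𝓡 b) 𝓘(ℝ, ℝ) ∞ φ) {e : ∀ x, W x} (he : e ∈ Γ) :
    (fun x => φ x • e x) ∈ Γ := by
  refine (H.mem_iff _).2 fun g => ?_
  have h1 : ContMDiffAt (𝓡 n) 𝓘(ℝ, ℝ) ∞ (fun g => φ (f g)) g :=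
    ContMDiffAt.comp g hφ.contMDiffAt H.smooth.contMDiffAt
  refine (((H.mem_iff e).1 he g).smul h1).congr (Filter.Eventually.of_forall fun _ => rfl) ?_
  exact Filter.Eventually.of_forall fun g' => map_smul _ _ _

/-- Multiplication of a section by a smooth function. -/
theorem exists_smul {φ : B → ℝ} (hφ : ContMDiff (𝓡 b) 𝓘(ℝ, ℝ) ∞ φ) (e : Γ) :
    ∃ e' : Γ, ∀ x, e'.1 x = φ x • e.1 x :=
  ⟨⟨_, H.smul_mem hφ e.2⟩, fun _ => rfl⟩

theorem smooth_section (e : Γ) (g : N) :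
    SmoothFieldAt (𝓡 n) k pr (fun g' => Θ g' (f g') rfl (e.1 (f g'))) g :=
  (H.mem_iff e.1).1 e.2 g

/-- A family of sections is a frame near `g`: it trivializes the pulled back bundle near `g` and the
bundle itself near `f g`. -/
structure IsFrame (g₀ : N) {r : ℕ} (ε : Fin r → Γ) : Prop where
  linearIndependent : ∀ᶠ g in 𝓝 g₀,
    LinearIndependent ℝ (fun i => Θ g (f g) rfl ((ε i).1 (f g)))
  exists_coeff : ∀ τ : N → EuclideanSpace ℝ (Fin k),
    (∀ᶠ g in 𝓝 g₀, SmoothFieldAt (𝓡 n) k pr τ g) → (∀ᶠ g in 𝓝 g₀, τ g ∈ R g) →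
    ∃ h : Fin r → N → ℝ, (∀ i, ∀ᶠ g in 𝓝 g₀, ContMDiffAt (𝓡 n) 𝓘(ℝ, ℝ) ∞ (h i) g) ∧
      ∀ᶠ g in 𝓝 g₀, τ g = ∑ i, h i g • Θ g (f g) rfl ((ε i).1 (f g))
  exists_global_coeff : ∀ e : Γ, ∃ c : Fin r → B → ℝ, (∀ i, ContMDiff (𝓡 b) 𝓘(ℝ, ℝ) ∞ (c i)) ∧
      ∀ᶠ x in 𝓝 (f g₀), e.1 x = ∑ i, c i x • (ε i).1 x

theorem exists_frame [T2Space B] (g₀ : N) :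
    ∃ (r : ℕ) (ε : Fin r → Γ), IsFrame (n := n) (k := k) (b := b) (Θ := Θ) (pr := pr)
      (R := R) g₀ ε := by
  obtain ⟨r, hr⟩ := H.finrank_eq
  set bs := Module.finBasisOfFinrankEq ℝ (R g₀) (hr g₀) with hbs
  have h1 : ∀ i, ∃ e : Γ, Θ g₀ (f g₀) rfl (e.1 (f g₀)) = bs i := by
    intro i
    have h2 : (bs i : EuclideanSpace ℝ (Fin k)) ∈ LinearMap.range (Θ g₀ (f g₀) rfl) := by
      rw [H.range_eq]
      exact (bs i).2
    obtain ⟨β, hβ⟩ := h2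
    obtain ⟨e, he, heβ⟩ := H.exists_section _ β
    exact ⟨⟨e, he⟩, by rw [← hβ, ← heβ]⟩
  choose ε hε using h1
  have hli : LinearIndependent ℝ (fun i => Θ g₀ (f g₀) rfl ((ε i).1 (f g₀))) := by
    simp only [hε]
    exact bs.linearIndependent.map' (R g₀).subtype (Submodule.ker_subtype _)
  obtain ⟨h2, h3⟩ := exists_smooth_coefficients
    (σ := fun i g => Θ g (f g) rfl ((ε i).1 (f g))) H.smooth_pr.contMDiffAt
    (fun i => Filter.Eventually.of_forall fun g => H.smooth_section (ε i) g) hli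
  have hspan : ∀ g, LinearIndependent ℝ (fun i => Θ g (f g) rfl ((ε i).1 (f g))) →
      ∀ w ∈ R g, w ∈ Submodule.span ℝ (Set.range fun i => Θ g (f g) rfl ((ε i).1 (f g))) := by
    intro g hg w hw
    have h4 : Submodule.span ℝ (Set.range fun i => Θ g (f g) rfl ((ε i).1 (f g))) ≤ R g := by
      rw [Submodule.span_le]
      rintro _ ⟨i, rfl⟩
      exact H.mem _ _ _ _
    have h5 := Submodule.eq_of_le_of_finrank_eq h4 (by
      rw [finrank_span_eq_card hg, hr, Fintype.card_fin])
    rw [h5]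
    exact hw
  refine ⟨r, ε, h2, fun τ hτ hτR => h3 τ hτ ?_, fun e => ?_⟩
  · filter_upwards [h2, hτR] with g h4 h5 using hspan g h4 _ h5
  · -- the coefficients on the base are obtained along a local section of `f`
    obtain ⟨τ, hτ, hτg, hτf⟩ := (H.submersion g₀).exists_section
    have hτs := hτ.self_of_nhds
    have hev : ∀ e : Γ, ∀ᶠ x in 𝓝 (f g₀), SmoothFieldAt (𝓡 b) k (fun x => pr (τ x))
        (fun x => Θ (τ x) (f (τ x)) rfl (e.1 (f (τ x)))) x := by
      intro e
      filter_upwards [hτ] with x hx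
      exact (H.smooth_section e (τ x)).comp hx
    have hprτ : ContMDiffAt (𝓡 b) (𝓡 k) ∞ (fun x => pr (τ x)) (f g₀) :=
      ContMDiffAt.comp _ H.smooth_pr.contMDiffAt hτs
    have hli' : ∀ g, g = g₀ → LinearIndependent ℝ
        (fun i => Θ g (f g) rfl ((ε i).1 (f g))) := by
      rintro g rfl
      exact hli
    obtain ⟨-, h4⟩ := exists_smooth_coefficients
      (σ := fun i x => Θ (τ x) (f (τ x)) rfl ((ε i).1 (f (τ x)))) hprτ
      (fun i => hev (ε i)) (hli' _ hτg)
    have hτt : Filter.Tendsto τ (𝓝 (f g₀)) (𝓝 g₀) := by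
      have := hτs.continuousAt
      rwa [ContinuousAt, hτg] at this
    obtain ⟨c, hc, hce⟩ := h4 _ (hev e) (by
      filter_upwards [hτt.eventually h2] with x hx
      exact hspan _ hx _ (H.mem _ _ _ _))
    choose c' hc' hcc' using fun i => exists_global_function (hc i)
    refine ⟨c', hc', ?_⟩
    filter_upwards [hce, hτf, Filter.eventually_all.2 hcc'] with x hx hfx hcx
    have h5 : Θ (τ x) (f (τ x)) rfl (e.1 (f (τ x)) - ∑ i, c' i x • (ε i).1 (f (τ x))) = 0 := by
      rw [map_sub, map_sum, hx, sub_eq_zero]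
      exact Finset.sum_congr rfl fun i _ => by rw [map_smul, hcx]
    have h6 := H.injective _ _ _ (h5.trans (map_zero _).symm)
    rw [hfx] at h6
    exact sub_eq_zero.1 h6

omit H in
/-- An operator on sections with values in the fibre of the pulled back bundle at `g`, which
satisfies the Leibniz rule in the direction `v`. -/
def IsDerivationAt (Θ : ∀ (g : N) (x : B), f g = x → W x →ₗ[ℝ] EuclideanSpace ℝ (Fin k)) (g : N)
    (v : EuclideanSpace ℝ (Fin n)) (δ : Γ →ₗ[ℝ] EuclideanSpace ℝ (Fin k)) : Prop :=
  ∀ φ : B → ℝ, ContMDiff (𝓡 b) 𝓘(ℝ, ℝ) ∞ φ → ∀ e e' : Γ, (∀ x, e'.1 x = φ x • e.1 x) →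
    δ e' = φ (f g) • δ e + tfun n (fun g => φ (f g)) g v • Θ g (f g) rfl (e.1 (f g))

/-- A derivation is local. -/
theorem eq_zero_of_eventually [T2Space B] {g : N} {v : EuclideanSpace ℝ (Fin n)}
    {δ : Γ →ₗ[ℝ] EuclideanSpace ℝ (Fin k)} (hδ : IsDerivationAt (b := b) Θ g v δ) {e : Γ}
    (he : ∀ᶠ x in 𝓝 (f g), e.1 x = 0) : δ e = 0 := by
  obtain ⟨χ, hχ, hχ1, hχs⟩ := exists_cutoff (b := b) he
  obtain ⟨e', he'⟩ := H.exists_smul hχ e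
  have h1 := hδ χ hχ e e' he'
  have h2 : e' = 0 := by
    refine Subtype.ext (funext fun x => ?_)
    rw [he']
    by_cases hx : x ∈ tsupport χ
    · rw [hχs hx, smul_zero]
      rfl
    · rw [image_eq_zero_of_notMem_tsupport hx, zero_smul]
      rfl
  rw [h2, map_zero, hχ1.self_of_nhds, one_smul, he.self_of_nhds, map_zero, smul_zero,
    add_zero] at h1
  exact h1.symm

omit H in
/-- The section `τ` of the pulled back bundle is near `g` a combination of pullbacks of sections,
and `w` is the value at `g` given by the Leibniz rule in the direction `v` which extends `δ`. -/
def PullsTo (Θ : ∀ (g : N) (x : B), f g = x → W x →ₗ[ℝ] EuclideanSpace ℝ (Fin k)) (g : N)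
    (v : EuclideanSpace ℝ (Fin n)) (δ : Γ →ₗ[ℝ] EuclideanSpace ℝ (Fin k))
    (τ : N → EuclideanSpace ℝ (Fin k)) (w : EuclideanSpace ℝ (Fin k)) : Prop :=
  ∃ (ι : Type) (_ : Fintype ι) (h : ι → N → ℝ) (e : ι → Γ),
    (∀ i, ContMDiffAt (𝓡 n) 𝓘(ℝ, ℝ) ∞ (h i) g) ∧
    (∀ᶠ g' in 𝓝 g, τ g' = ∑ i, h i g' • Θ g' (f g') rfl ((e i).1 (f g'))) ∧
    w = ∑ i, (tfun n (h i) g v • Θ g (f g) rfl ((e i).1 (f g)) + h i g • δ (e i))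

section PullsTo

variable {g : N} {v : EuclideanSpace ℝ (Fin n)} {δ : Γ →ₗ[ℝ] EuclideanSpace ℝ (Fin k)}

omit H in
theorem pullsTo_section (e : Γ) :
    PullsTo Θ g v δ (fun g' => Θ g' (f g') rfl (e.1 (f g'))) (δ e) := by
  refine ⟨Unit, inferInstance, fun _ _ => 1, fun _ => e, fun _ => contMDiffAt_const, ?_, ?_⟩
  · exact Filter.Eventually.of_forall fun g' => by simp
  · simp [tfun_const]

omit H in
theorem PullsTo.congr {τ τ' : N → EuclideanSpace ℝ (Fin k)} {w : EuclideanSpace ℝ (Fin k)}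
    (h : PullsTo Θ g v δ τ w) (hτ : ∀ᶠ g' in 𝓝 g, τ' g' = τ g') : PullsTo Θ g v δ τ' w := by
  obtain ⟨ι, _, c, e, hc, hτc, hw⟩ := h
  refine ⟨ι, inferInstance, c, e, hc, ?_, hw⟩
  filter_upwards [hτ, hτc] with g' h1 h2
  rw [h1, h2]

omit H in
/-- The Leibniz rule. -/
theorem PullsTo.sum {ι : Type} [Fintype ι] {c : ι → N → ℝ}
    (hc : ∀ i, ContMDiffAt (𝓡 n) 𝓘(ℝ, ℝ) ∞ (c i) g) {τ : ι → N → EuclideanSpace ℝ (Fin k)}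
    {w : ι → EuclideanSpace ℝ (Fin k)} (h : ∀ i, PullsTo Θ g v δ (τ i) (w i)) :
    PullsTo Θ g v δ (fun g' => ∑ i, c i g' • τ i g')
      (∑ i, (tfun n (c i) g v • τ i g + c i g • w i)) := by
  choose κ hκ a e ha hτ hw using h
  refine ⟨Σ i, κ i, inferInstance, fun q g' => c q.1 g' * a q.1 q.2 g', fun q => e q.1 q.2,
    fun q => (hc q.1).mul (ha q.1 q.2), ?_, ?_⟩
  · filter_upwards [Filter.eventually_all.2 hτ] with g' hg'
    rw [Fintype.sum_sigma]
    refine Finset.sum_congr rfl fun i _ => ?_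
    rw [hg', Finset.smul_sum]
    exact Finset.sum_congr rfl fun j _ => smul_smul _ _ _
  · rw [Fintype.sum_sigma]
    refine Finset.sum_congr rfl fun i _ => ?_
    rw [hw, (hτ i).self_of_nhds, Finset.smul_sum, Finset.smul_sum, ← Finset.sum_add_distrib]
    refine Finset.sum_congr rfl fun j _ => ?_
    simp only
    rw [tfun_mul (hc i) (ha i j), add_smul, smul_add, smul_smul, smul_smul, smul_smul, add_assoc]

omit H in
theorem PullsTo.smul {c : N → ℝ}
    (hc : ContMDiffAt (𝓡 n) 𝓘(ℝ, ℝ) ∞ c g) {τ : N → EuclideanSpace ℝ (Fin k)}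
    {w : EuclideanSpace ℝ (Fin k)} (h : PullsTo Θ g v δ τ w) :
    PullsTo Θ g v δ (fun g' => c g' • τ g') (tfun n c g v • τ g + c g • w) := by
  have h1 := PullsTo.sum (ι := Unit) (c := fun _ => c) (τ := fun _ => τ) (w := fun _ => w)
    (fun _ => hc) (fun _ => h)
  simpa using h1

omit H in
theorem PullsTo.add {τ τ' : N → EuclideanSpace ℝ (Fin k)} {w w' : EuclideanSpace ℝ (Fin k)}
    (h : PullsTo Θ g v δ τ w) (h' : PullsTo Θ g v δ τ' w') :
    PullsTo Θ g v δ (fun g' => τ g' + τ' g') (w + w') := by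
  have h1 := PullsTo.sum (ι := Bool) (c := fun _ _ => 1) (g := g) (v := v) (δ := δ) (Θ := Θ)
    (τ := fun i => if i then τ else τ') (w := fun i => if i then w else w')
    (fun _ => contMDiffAt_const) (fun i => by cases i <;> simpa)
  simpa [tfun_const] using h1

theorem PullsTo.mem {τ : N → EuclideanSpace ℝ (Fin k)} {w : EuclideanSpace ℝ (Fin k)}
    (h : PullsTo Θ g v δ τ w) (hδ : ∀ e, δ e ∈ R g) : w ∈ R g := by
  obtain ⟨ι, _, c, e, hc, hτc, rfl⟩ := h
  exact Submodule.sum_mem _ fun i _ => Submodule.add_mem _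
    (Submodule.smul_mem _ _ (H.mem _ _ _ _)) (Submodule.smul_mem _ _ (hδ _))

/-- A derivation is determined by its values on a frame. -/
theorem derivation_expand [T2Space B] (hδ : IsDerivationAt (b := b) Θ g v δ) {r : ℕ}
    {ε : Fin r → Γ} {e : Γ}
    {c : Fin r → B → ℝ} (hc : ∀ i, ContMDiff (𝓡 b) 𝓘(ℝ, ℝ) ∞ (c i))
    (he : ∀ᶠ x in 𝓝 (f g), e.1 x = ∑ i, c i x • (ε i).1 x) :
    δ e = ∑ i, (c i (f g) • δ (ε i) +
      tfun n (fun g => c i (f g)) g v • Θ g (f g) rfl ((ε i).1 (f g))) := by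
  choose e' he' using fun i => H.exists_smul (hc i) (ε i)
  have h1 : δ (e - ∑ i, e' i) = 0 := by
    refine H.eq_zero_of_eventually hδ ?_
    filter_upwards [he] with x hx
    have h2 : (e - ∑ i, e' i).1 x = e.1 x - ∑ i, (e' i).1 x := by
      rw [Submodule.coe_sub, Submodule.coe_sum, Pi.sub_apply, Finset.sum_apply]
    rw [h2, hx, sub_eq_zero]
    exact Finset.sum_congr rfl fun i _ => (he' i x).symm
  rw [map_sub, map_sum, sub_eq_zero] at h1
  rw [h1]
  exact Finset.sum_congr rfl fun i _ => hδ _ (hc i) _ _ (he' i)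

/-- The combination in `PullsTo` can be taken with respect to a given frame. -/
theorem PullsTo.normal_form [T2Space B] (hδ : IsDerivationAt (b := b) Θ g v δ) {r : ℕ}
    {ε : Fin r → Γ}
    (hε : IsFrame (n := n) (k := k) (b := b) (Θ := Θ) (pr := pr) (R := R) g ε)
    {τ : N → EuclideanSpace ℝ (Fin k)}
    {w : EuclideanSpace ℝ (Fin k)} (h : PullsTo Θ g v δ τ w) :
    ∃ a : Fin r → N → ℝ, (∀ᶠ g' in 𝓝 g, τ g' = ∑ i, a i g' • Θ g' (f g') rfl ((ε i).1 (f g'))) ∧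
      w = ∑ i, (tfun n (a i) g v • Θ g (f g) rfl ((ε i).1 (f g)) + a i g • δ (ε i)) := by
  obtain ⟨ι, _, a, e, ha, hτ, rfl⟩ := h
  choose c hc hce using fun j => hε.exists_global_coeff (e j)
  have hcf : ∀ j i, ContMDiffAt (𝓡 n) 𝓘(ℝ, ℝ) ∞ (fun g => c j i (f g)) g := fun j i =>
    ContMDiffAt.comp g (hc j i).contMDiffAt H.smooth.contMDiffAt
  refine ⟨fun i g => ∑ j, a j g * c j i (f g), ?_, ?_⟩
  · have h1 := (H.smooth.continuous.continuousAt (x := g)).eventually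
      (Filter.eventually_all.2 hce)
    filter_upwards [hτ, h1] with g' h2 h3
    rw [h2]
    simp only [Finset.sum_smul]
    rw [Finset.sum_comm]
    refine Finset.sum_congr rfl fun j _ => ?_
    rw [h3 j, map_sum, Finset.smul_sum]
    exact Finset.sum_congr rfl fun i _ => by rw [map_smul, smul_smul]
  · have h1 : ∀ i, tfun n (fun g => ∑ j, a j g * c j i (f g)) g v =
        ∑ j, (tfun n (a j) g v * c j i (f g) + a j g * tfun n (fun g => c j i (f g)) g v) := by
      intro i
      refine (tfun_sum (f := fun j g => a j g * c j i (f g))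
        (fun j => (ha j).mul (hcf j i)) v).trans ?_
      exact Finset.sum_congr rfl fun j _ => tfun_mul (ha j) (hcf j i) v
    simp only [h1, Finset.sum_smul, ← Finset.sum_add_distrib]
    rw [Finset.sum_comm]
    refine Finset.sum_congr rfl fun j _ => ?_
    rw [H.derivation_expand hδ (hc j) (hce j), (hce j).self_of_nhds, map_sum, Finset.smul_sum,
      Finset.smul_sum, ← Finset.sum_add_distrib]
    refine Finset.sum_congr rfl fun i _ => ?_
    rw [map_smul, smul_add, add_smul, smul_smul, smul_smul, smul_smul]
    abel

/-- The value given by the Leibniz rule does not depend on the presentation of the section: the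
coefficients with respect to a frame are unique. -/
theorem PullsTo.unique [T2Space B] (hδ : IsDerivationAt (b := b) Θ g v δ)
    {τ : N → EuclideanSpace ℝ (Fin k)}
    {w w' : EuclideanSpace ℝ (Fin k)} (h : PullsTo Θ g v δ τ w) (h' : PullsTo Θ g v δ τ w') :
    w = w' := by
  obtain ⟨r, ε, hε⟩ := H.exists_frame g
  obtain ⟨a, ha, rfl⟩ := PullsTo.normal_form H hδ hε h
  obtain ⟨a', ha', rfl⟩ := PullsTo.normal_form H hδ hε h'
  have h1 : ∀ᶠ g' in 𝓝 g, ∀ i, a i g' = a' i g' := by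
    filter_upwards [ha, ha', hε.linearIndependent] with g' h1 h2 h3
    have h4 : ∑ i, (a i g' - a' i g') • Θ g' (f g') rfl ((ε i).1 (f g')) = 0 := by
      simp only [sub_smul, Finset.sum_sub_distrib]
      rw [← h1, ← h2, sub_self]
    intro i
    exact sub_eq_zero.1 (Fintype.linearIndependent_iff.1 h3 _ h4 i)
  refine Finset.sum_congr rfl fun i _ => ?_
  rw [tfun_congr (h1.mono fun g' hg' => hg' i), h1.self_of_nhds i]

theorem PullsTo.exists [T2Space B] {τ : N → EuclideanSpace ℝ (Fin k)}
    (hτ : ∀ᶠ g' in 𝓝 g, SmoothFieldAt (𝓡 n) k pr τ g') (hR : ∀ᶠ g' in 𝓝 g, τ g' ∈ R g') :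
    ∃ w, PullsTo Θ g v δ τ w := by
  obtain ⟨r, ε, hε⟩ := H.exists_frame g
  obtain ⟨h, hh, hτh⟩ := hε.exists_coeff τ hτ hR
  exact ⟨_, Fin r, inferInstance, h, ε, fun i => (hh i).self_of_nhds, hτh, rfl⟩

end PullsTo

end IsPulledBundle

end Pulled

/-! ### Transfer of connections -/

section Transfer

open IsPulledBundle

variable {n k b₁ b₂ : ℕ} {N Q B₁ B₂ : Type*}
  [TopologicalSpace N] [ChartedSpace (EuclideanSpace ℝ (Fin n)) N] [IsManifold (𝓡 n) ∞ N]
  [TopologicalSpace Q] [ChartedSpace (EuclideanSpace ℝ (Fin k)) Q] [IsManifold (𝓡 k) ∞ Q]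
  [TopologicalSpace B₁] [ChartedSpace (EuclideanSpace ℝ (Fin b₁)) B₁] [IsManifold (𝓡 b₁) ∞ B₁]
  [TopologicalSpace B₂] [ChartedSpace (EuclideanSpace ℝ (Fin b₂)) B₂] [IsManifold (𝓡 b₂) ∞ B₂]
  {V₁ W₁ : B₁ → Type*} [∀ x, AddCommGroup (V₁ x)] [∀ x, Module ℝ (V₁ x)]
  [∀ x, AddCommGroup (W₁ x)] [∀ x, Module ℝ (W₁ x)]
  {V₂ W₂ : B₂ → Type*} [∀ x, AddCommGroup (V₂ x)] [∀ x, Module ℝ (V₂ x)]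
  [∀ x, AddCommGroup (W₂ x)] [∀ x, Module ℝ (W₂ x)]
  {pr : N → Q} {R : N → Submodule ℝ (EuclideanSpace ℝ (Fin k))} {f₁ : N → B₁} {f₂ : N → B₂}
  {ΓV₁ : Submodule ℝ (∀ x, V₁ x)} {Γ₁ : Submodule ℝ (∀ x, W₁ x)}
  {ΓV₂ : Submodule ℝ (∀ x, V₂ x)} {Γ₂ : Submodule ℝ (∀ x, W₂ x)}
  {anchor₁ : ∀ x, V₁ x → (B₁ → ℝ) → ℝ} {anchor₂ : ∀ x, V₂ x → (B₂ → ℝ) → ℝ}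
  {Θ₁ : ∀ (g : N) (x : B₁), f₁ g = x → W₁ x →ₗ[ℝ] EuclideanSpace ℝ (Fin k)}
  {Θ₂ : ∀ (g : N) (x : B₂), f₂ g = x → W₂ x →ₗ[ℝ] EuclideanSpace ℝ (Fin k)}

/-- The covariant derivative along `l` at the point below `g`, as a vector of the pulled back
bundle. -/
def pulledNabla (Θ₁ : ∀ (g : N) (x : B₁), f₁ g = x → W₁ x →ₗ[ℝ] EuclideanSpace ℝ (Fin k))
    (C : AnchoredConnection b₁ ΓV₁ Γ₁ anchor₁) (g : N) (l : ΓV₁) :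
    Γ₁ →ₗ[ℝ] EuclideanSpace ℝ (Fin k) :=
  (Θ₁ g (f₁ g) rfl).comp ((LinearMap.proj (f₁ g)).comp (Γ₁.subtype.comp (C.nabla l)))

theorem pulledNabla_apply (C : AnchoredConnection b₁ ΓV₁ Γ₁ anchor₁) (g : N) (l : ΓV₁) (e : Γ₁) :
    pulledNabla Θ₁ C g l e = Θ₁ g (f₁ g) rfl ((C.nabla l e).1 (f₁ g)) := rfl

theorem pulledNabla_add (C : AnchoredConnection b₁ ΓV₁ Γ₁ anchor₁) (g : N) (l l' : ΓV₁) (e : Γ₁) :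
    pulledNabla Θ₁ C g (l + l') e = pulledNabla Θ₁ C g l e + pulledNabla Θ₁ C g l' e := by
  simp [pulledNabla]

theorem pulledNabla_smul (C : AnchoredConnection b₁ ΓV₁ Γ₁ anchor₁) (g : N) (c : ℝ) (l : ΓV₁)
    (e : Γ₁) : pulledNabla Θ₁ C g (c • l) e = c • pulledNabla Θ₁ C g l e := by
  simp [pulledNabla]

theorem pulledNabla_sum (C : AnchoredConnection b₁ ΓV₁ Γ₁ anchor₁) (g : N) {r : ℕ} (c : Fin r → ℝ)
    (l : Fin r → ΓV₁) (e : Γ₁) :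
    pulledNabla Θ₁ C g (∑ j, c j • l j) e = ∑ j, c j • pulledNabla Θ₁ C g (l j) e := by
  simp [pulledNabla]

theorem isDerivationAt_pulledNabla (C : AnchoredConnection b₁ ΓV₁ Γ₁ anchor₁) {g : N} {l : ΓV₁}
    {v : EuclideanSpace ℝ (Fin n)}
    (hv : ∀ φ : B₁ → ℝ, ContMDiff (𝓡 b₁) 𝓘(ℝ, ℝ) ∞ φ →
      tfun n (fun g => φ (f₁ g)) g v = anchor₁ (f₁ g) (l.1 (f₁ g)) φ) :
    IsDerivationAt (b := b₁) Θ₁ g v (pulledNabla Θ₁ C g l) := by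
  intro φ hφ e e' he
  rw [pulledNabla_apply, C.leibniz φ hφ l e e' he, map_add, map_smul, map_smul, hv φ hφ]
  rfl

/-- A correspondence `ℒ g l₁ l₂ v` between the directions `l₁`, `l₂` of differentiation over two
base spaces, and the tangent vectors `v` at `g` which they lift to. -/
structure IsLink (f₁ : N → B₁) (f₂ : N → B₂) (anchor₁ : ∀ x, V₁ x → (B₁ → ℝ) → ℝ)
    (anchor₂ : ∀ x, V₂ x → (B₂ → ℝ) → ℝ)
    (ℒ : N → ΓV₁ → ΓV₂ → EuclideanSpace ℝ (Fin n) → Prop) : Prop where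
  anchor₁_eq : ∀ g l₁ l₂ v, ℒ g l₁ l₂ v → ∀ φ : B₁ → ℝ, ContMDiff (𝓡 b₁) 𝓘(ℝ, ℝ) ∞ φ →
    tfun n (fun g => φ (f₁ g)) g v = anchor₁ (f₁ g) (l₁.1 (f₁ g)) φ
  anchor₂_eq : ∀ g l₁ l₂ v, ℒ g l₁ l₂ v → ∀ φ : B₂ → ℝ, ContMDiff (𝓡 b₂) 𝓘(ℝ, ℝ) ∞ φ →
    tfun n (fun g => φ (f₂ g)) g v = anchor₂ (f₂ g) (l₂.1 (f₂ g)) φ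
  add : ∀ g l₁ l₂ v l₁' l₂' v', ℒ g l₁ l₂ v → ℒ g l₁' l₂' v' → ℒ g (l₁ + l₁') (l₂ + l₂') (v + v')
  smul : ∀ g (c : ℝ) l₁ l₂ l₂' v, l₂'.1 (f₂ g) = c • l₂.1 (f₂ g) → ℒ g l₁ l₂ v →
    ℒ g (c • l₁) l₂' (c • v)
  exists_local : ∀ l₂ g₀, ∃ (r : ℕ) (l₁ : Fin r → ΓV₁) (c : Fin r → N → ℝ)
    (v : N → EuclideanSpace ℝ (Fin n)), (∀ j, ContMDiffAt (𝓡 n) 𝓘(ℝ, ℝ) ∞ (c j) g₀) ∧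
      SmoothFieldAt (𝓡 n) n (fun g : N => g) v g₀ ∧
      ∀ᶠ g in 𝓝 g₀, ℒ g (∑ j, c j g • l₁ j) l₂ (v g)

variable (H₁ : IsPulledBundle n k b₁ pr R f₁ Γ₁ Θ₁) (H₂ : IsPulledBundle n k b₂ pr R f₂ Γ₂ Θ₂)
  {ℒ : N → ΓV₁ → ΓV₂ → EuclideanSpace ℝ (Fin n) → Prop}
  (hℒ : IsLink (n := n) (b₁ := b₁) (b₂ := b₂) f₁ f₂ anchor₁ anchor₂ ℒ)

/-- The pullbacks to `N` of the connections `C₁` and `C₂` coincide, as far as the covariant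
derivatives of sections pulled back from `B₂` are concerned. -/
def PullbackAgrees
    (Θ₁ : ∀ (g : N) (x : B₁), f₁ g = x → W₁ x →ₗ[ℝ] EuclideanSpace ℝ (Fin k))
    (Θ₂ : ∀ (g : N) (x : B₂), f₂ g = x → W₂ x →ₗ[ℝ] EuclideanSpace ℝ (Fin k))
    (ℒ : N → ΓV₁ → ΓV₂ → EuclideanSpace ℝ (Fin n) → Prop)
    (C₁ : AnchoredConnection b₁ ΓV₁ Γ₁ anchor₁) (C₂ : AnchoredConnection b₂ ΓV₂ Γ₂ anchor₂) :
    Prop :=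
  ∀ g l₁ l₂ v, ℒ g l₁ l₂ v → ∀ (e : Γ₂) (w : EuclideanSpace ℝ (Fin k)),
    PullsTo Θ₁ g v (pulledNabla Θ₁ C₁ g l₁) (fun g' => Θ₂ g' (f₂ g') rfl (e.1 (f₂ g'))) w →
      w = pulledNabla Θ₂ C₂ g l₂ e

include H₁ H₂ hℒ in
/-- The condition that the pullbacks of two connections coincide is symmetric. -/
theorem PullbackAgrees.symm [T2Space B₁] {C₁ : AnchoredConnection b₁ ΓV₁ Γ₁ anchor₁}
    {C₂ : AnchoredConnection b₂ ΓV₂ Γ₂ anchor₂} (h : PullbackAgrees Θ₁ Θ₂ ℒ C₁ C₂) :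
    PullbackAgrees Θ₂ Θ₁ (fun g l₂ l₁ v => ℒ g l₁ l₂ v) C₂ C₁ := by
  intro g l₂ l₁ v hl e w hw
  have hδ := isDerivationAt_pulledNabla (Θ₁ := Θ₁) C₁ (hℒ.anchor₁_eq g l₁ l₂ v hl)
  obtain ⟨ι, _, c, Y, hc, hτ, rfl⟩ := hw
  have h1 : ∀ i, PullsTo Θ₁ g v (pulledNabla Θ₁ C₁ g l₁)
      (fun g' => Θ₂ g' (f₂ g') rfl ((Y i).1 (f₂ g'))) (pulledNabla Θ₂ C₂ g l₂ (Y i)) := by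
    intro i
    obtain ⟨w, hw⟩ := PullsTo.exists H₁ (g := g) (v := v) (δ := pulledNabla Θ₁ C₁ g l₁)
      (τ := fun g' => Θ₂ g' (f₂ g') rfl ((Y i).1 (f₂ g')))
      (Filter.Eventually.of_forall fun g' => H₂.smooth_section (Y i) g')
      (Filter.Eventually.of_forall fun g' => H₂.mem _ _ _ _)
    rwa [h g l₁ l₂ v hl (Y i) w hw] at hw
  exact PullsTo.unique H₁ hδ ((PullsTo.sum hc h1).congr hτ) (pullsTo_section e)

include H₁ H₂ hℒ in
/-- At every `g`, the pulled back connection differentiates sections pulled back from `B₂`. -/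
theorem exists_pullsTo [T2Space B₁] (C₁ : AnchoredConnection b₁ ΓV₁ Γ₁ anchor₁) (l₂ : ΓV₂) (e : Γ₂)
    (g : N) : ∃ l₁ v β, ℒ g l₁ l₂ v ∧ PullsTo Θ₁ g v (pulledNabla Θ₁ C₁ g l₁)
      (fun g' => Θ₂ g' (f₂ g') rfl (e.1 (f₂ g'))) (Θ₂ g (f₂ g) rfl β) := by
  obtain ⟨r, l₁, c, v, -, -, hl⟩ := hℒ.exists_local l₂ g
  obtain ⟨w, hw⟩ := PullsTo.exists H₁ (g := g) (v := v g)
    (δ := pulledNabla Θ₁ C₁ g (∑ j, c j g • l₁ j))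
    (τ := fun g' => Θ₂ g' (f₂ g') rfl (e.1 (f₂ g')))
    (Filter.Eventually.of_forall fun g' => H₂.smooth_section e g')
    (Filter.Eventually.of_forall fun g' => H₂.mem _ _ _ _)
  have hwR : w ∈ R g := PullsTo.mem H₁ hw fun e => H₁.mem _ _ _ _
  rw [← H₂.range_eq g (f₂ g) rfl] at hwR
  obtain ⟨β, rfl⟩ := hwR
  exact ⟨_, _, β, hl.self_of_nhds, hw⟩

include H₁ H₂ hℒ in
theorem PullbackAgrees.unique [T2Space B₁] {C₁ : AnchoredConnection b₁ ΓV₁ Γ₁ anchor₁}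
    {C₂ C₂' : AnchoredConnection b₂ ΓV₂ Γ₂ anchor₂} (h : PullbackAgrees Θ₁ Θ₂ ℒ C₁ C₂)
    (h' : PullbackAgrees Θ₁ Θ₂ ℒ C₁ C₂') : C₂ = C₂' := by
  refine AnchoredConnection.ext (LinearMap.ext fun l => LinearMap.ext fun e =>
    Subtype.ext (funext fun x => ?_))
  obtain ⟨g, rfl⟩ := H₂.surjective x
  obtain ⟨l₁, v, β, hl, hw⟩ := exists_pullsTo H₁ H₂ hℒ C₁ l e g
  exact H₂.injective g _ rfl ((h g l₁ l v hl e _ hw).symm.trans (h' g l₁ l v hl e _ hw))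

include H₁ H₂ hℒ in
/-- If the pulled back connection is constant along the fibres of `f₂`, it descends to `B₂`. -/
theorem exists_pullbackAgrees [T2Space B₁] (C₁ : AnchoredConnection b₁ ΓV₁ Γ₁ anchor₁)
    (hC₁ : ∀ (l₂ : ΓV₂) (e : Γ₂) (x : B₂) (g g' : N) (h : f₂ g = x) (h' : f₂ g' = x)
      (l₁ l₁' : ΓV₁) (v v' : EuclideanSpace ℝ (Fin n)) (β β' : W₂ x),
      ℒ g l₁ l₂ v → ℒ g' l₁' l₂ v' →
      PullsTo Θ₁ g v (pulledNabla Θ₁ C₁ g l₁)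
        (fun g' => Θ₂ g' (f₂ g') rfl (e.1 (f₂ g'))) (Θ₂ g x h β) →
      PullsTo Θ₁ g' v' (pulledNabla Θ₁ C₁ g' l₁')
        (fun g' => Θ₂ g' (f₂ g') rfl (e.1 (f₂ g'))) (Θ₂ g' x h' β') → β = β') :
    ∃ C₂ : AnchoredConnection b₂ ΓV₂ Γ₂ anchor₂, PullbackAgrees Θ₁ Θ₂ ℒ C₁ C₂ := by
  have hex : ∀ (l₂ : ΓV₂) (e : Γ₂) (x : B₂), ∃ β : W₂ x, ∃ (g : N) (h : f₂ g = x) (l₁ : ΓV₁)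
      (v : EuclideanSpace ℝ (Fin n)), ℒ g l₁ l₂ v ∧ PullsTo Θ₁ g v (pulledNabla Θ₁ C₁ g l₁)
        (fun g' => Θ₂ g' (f₂ g') rfl (e.1 (f₂ g'))) (Θ₂ g x h β) := by
    intro l₂ e x
    obtain ⟨g, rfl⟩ := H₂.surjective x
    obtain ⟨l₁, v, β, hl, hw⟩ := exists_pullsTo H₁ H₂ hℒ C₁ l₂ e g
    exact ⟨β, g, rfl, l₁, v, hl, hw⟩
  -- by `hC₁`, the chosen values do not depend on the point `g` and on the lifts
  choose nab hnab using hex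
  have spec : ∀ g l₁ l₂ v, ℒ g l₁ l₂ v → ∀ (e : Γ₂) (w : EuclideanSpace ℝ (Fin k)),
      PullsTo Θ₁ g v (pulledNabla Θ₁ C₁ g l₁) (fun g' => Θ₂ g' (f₂ g') rfl (e.1 (f₂ g'))) w →
        w = Θ₂ g (f₂ g) rfl (nab l₂ e (f₂ g)) := by
    intro g l₁ l₂ v hl e w hw
    have hwR : w ∈ R g := PullsTo.mem H₁ hw fun e => H₁.mem _ _ _ _
    rw [← H₂.range_eq g (f₂ g) rfl] at hwR
    obtain ⟨β, rfl⟩ := hwR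
    obtain ⟨g', h', l₁', v', hl', hw'⟩ := hnab l₂ e (f₂ g)
    rw [hC₁ l₂ e (f₂ g) g g' rfl h' l₁ l₁' v v' _ _ hl hl' hw hw']
  -- smoothness is read off from an expansion in a frame of the bundle over `B₁`
  have hmem : ∀ l₂ e, nab l₂ e ∈ Γ₂ := by
    intro l₂ e
    refine (H₂.mem_iff _).2 fun g₀ => ?_
    obtain ⟨r, l₁, c, v, hc, hv, hl⟩ := hℒ.exists_local l₂ g₀
    obtain ⟨s, ε, hε⟩ := H₁.exists_frame g₀
    obtain ⟨a, ha, hτ⟩ := hε.exists_coeff (fun g' => Θ₂ g' (f₂ g') rfl (e.1 (f₂ g')))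
      (Filter.Eventually.of_forall fun g' => H₂.smooth_section e g')
      (Filter.Eventually.of_forall fun g' => H₂.mem _ _ _ _)
    have h1 : ∀ᶠ g in 𝓝 g₀, Θ₂ g (f₂ g) rfl (nab l₂ e (f₂ g)) =
        ∑ i, (tfun n (a i) g (v g) • Θ₁ g (f₁ g) rfl ((ε i).1 (f₁ g)) +
          a i g • ∑ j, c j g • Θ₁ g (f₁ g) rfl ((C₁.nabla (l₁ j) (ε i)).1 (f₁ g))) := by
      filter_upwards [hl, hτ.eventually_nhds, Filter.eventually_all.2 ha] with g h1 h2 h3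
      rw [← spec g _ l₂ (v g) h1 e _ ⟨Fin s, inferInstance, a, ε, h3, h2, rfl⟩]
      refine Finset.sum_congr rfl fun i _ => ?_
      rw [pulledNabla_sum]
      rfl
    refine SmoothFieldAt.congr ?_ (Filter.Eventually.of_forall fun _ => rfl) h1
    have hpr : ContMDiffAt (𝓡 n) (𝓡 k) ∞ pr g₀ := H₁.smooth_pr.contMDiffAt
    have h2 : ∀ i, SmoothFieldAt (𝓡 n) k pr (fun g =>
        tfun n (a i) g (v g) • Θ₁ g (f₁ g) rfl ((ε i).1 (f₁ g)) +
          a i g • ∑ j, c j g • Θ₁ g (f₁ g) rfl ((C₁.nabla (l₁ j) (ε i)).1 (f₁ g))) g₀ := by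
      intro i
      refine SmoothFieldAt.add ((H₁.smooth_section (ε i) g₀).smul
        (hv.push_real (ha i).self_of_nhds)) (SmoothFieldAt.smul ?_ (ha i).self_of_nhds)
      exact SmoothFieldAt.sum hpr (fun j => H₁.smooth_section (C₁.nabla (l₁ j) (ε i)) g₀) hc
    have h3 := SmoothFieldAt.sum (h := fun _ _ => (1 : ℝ)) hpr h2 fun _ => contMDiffAt_const
    simpa only [one_smul] using h3
  have hrep : ∀ (l₂ : ΓV₂) (e : Γ₂) (x : B₂), ∃ (g : N) (l₁ : ΓV₁) (v : EuclideanSpace ℝ (Fin n)),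
      f₂ g = x ∧ ℒ g l₁ l₂ v := by
    intro l₂ e x
    obtain ⟨g, rfl⟩ := H₂.surjective x
    obtain ⟨l₁, v, β, hl, hw⟩ := exists_pullsTo H₁ H₂ hℒ C₁ l₂ e g
    exact ⟨g, l₁, v, rfl, hl⟩
  -- linearity in the direction
  have hdir : ∀ (g : N) (e : Γ₂) l₁ l₂ v l₁' l₂' v' l₁'' l₂'' v'' (c c' : ℝ), ℒ g l₁ l₂ v →
      ℒ g l₁' l₂' v' → ℒ g l₁'' l₂'' v'' → l₁'' = c • l₁ + c' • l₁' → v'' = c • v + c' • v' →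
      nab l₂'' e (f₂ g) = c • nab l₂ e (f₂ g) + c' • nab l₂' e (f₂ g) := by
    rintro g e l₁ l₂ v l₁' l₂' v' _ l₂'' _ c c' hl hl' hl'' rfl rfl
    obtain ⟨w, ι, _, a, ε, ha, hτ, -⟩ := PullsTo.exists H₁ (g := g) (v := v)
      (δ := pulledNabla Θ₁ C₁ g l₁)
      (τ := fun g' => Θ₂ g' (f₂ g') rfl (e.1 (f₂ g')))
      (Filter.Eventually.of_forall fun g' => H₂.smooth_section e g')
      (Filter.Eventually.of_forall fun g' => H₂.mem _ _ _ _)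
    refine H₂.injective g _ rfl ?_
    rw [map_add, map_smul, map_smul, ← spec g _ l₂ v hl e _ ⟨ι, inferInstance, a, ε, ha, hτ, rfl⟩,
      ← spec g _ l₂' v' hl' e _ ⟨ι, inferInstance, a, ε, ha, hτ, rfl⟩,
      ← spec g _ l₂'' _ hl'' e _ ⟨ι, inferInstance, a, ε, ha, hτ, rfl⟩, Finset.smul_sum,
      Finset.smul_sum, ← Finset.sum_add_distrib]
    refine Finset.sum_congr rfl fun i _ => ?_
    rw [pulledNabla_add, pulledNabla_smul, pulledNabla_smul, map_add, map_smul, map_smul,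
      smul_eq_mul, smul_eq_mul]
    module
  have hsm : ∀ (g : N) (e : Γ₂) l₁ l₂ v (c : ℝ) l₂', ℒ g l₁ l₂ v →
      l₂'.1 (f₂ g) = c • l₂.1 (f₂ g) → nab l₂' e (f₂ g) = c • nab l₂ e (f₂ g) := by
    intro g e l₁ l₂ v c l₂' hl h
    have h1 := hdir g e l₁ l₂ v l₁ l₂ v (c • l₁) l₂' (c • v) c 0 hl hl
      (hℒ.smul g c l₁ l₂ l₂' v h hl) (by module) (by module)
    rwa [zero_smul, add_zero] at h1
  have hval : ∀ (g : N) l₁ l₂ v (e : Γ₂), ℒ g l₁ l₂ v →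
      PullsTo Θ₁ g v (pulledNabla Θ₁ C₁ g l₁) (fun g' => Θ₂ g' (f₂ g') rfl (e.1 (f₂ g')))
        (Θ₂ g (f₂ g) rfl (nab l₂ e (f₂ g))) := by
    intro g l₁ l₂ v e hl
    obtain ⟨w, hw⟩ := PullsTo.exists H₁ (g := g) (v := v)
      (δ := pulledNabla Θ₁ C₁ g l₁)
      (τ := fun g' => Θ₂ g' (f₂ g') rfl (e.1 (f₂ g')))
      (Filter.Eventually.of_forall fun g' => H₂.smooth_section e g')
      (Filter.Eventually.of_forall fun g' => H₂.mem _ _ _ _)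
    rwa [spec g _ l₂ v hl e w hw] at hw
  refine ⟨⟨LinearMap.mk₂ ℝ (fun l e => ⟨nab l e, hmem l e⟩) ?_ ?_ ?_ ?_, ?_, ?_⟩, spec⟩
  · intro l l' e
    refine Subtype.ext (funext fun x => ?_)
    obtain ⟨g, rfl⟩ := H₂.surjective x
    obtain ⟨l₁, v, β, hl, -⟩ := exists_pullsTo H₁ H₂ hℒ C₁ l e g
    obtain ⟨l₁', v', β', hl', -⟩ := exists_pullsTo H₁ H₂ hℒ C₁ l' e g
    have h1 := hdir g e l₁ l v l₁' l' v' _ _ _ 1 1 hl hl' (hℒ.add g _ _ _ _ _ _ hl hl')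
      (by module) (by module)
    rw [one_smul, one_smul] at h1
    exact h1
  · intro c l e
    refine Subtype.ext (funext fun x => ?_)
    obtain ⟨g, rfl⟩ := H₂.surjective x
    obtain ⟨l₁, v, β, hl, -⟩ := exists_pullsTo H₁ H₂ hℒ C₁ l e g
    exact hsm g e l₁ l v c _ hl rfl
  · intro l e e'
    refine Subtype.ext (funext fun x => ?_)
    obtain ⟨g, rfl⟩ := H₂.surjective x
    obtain ⟨l₁, v, β, hl, -⟩ := exists_pullsTo H₁ H₂ hℒ C₁ l e g
    have h1 := ((hval g l₁ l v e hl).add (hval g l₁ l v e' hl)).congr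
      (τ' := fun g' => Θ₂ g' (f₂ g') rfl ((e + e').1 (f₂ g')))
      (Filter.Eventually.of_forall fun g' => map_add _ _ _)
    have h2 := spec g l₁ l v hl (e + e') _ h1
    rw [← map_add] at h2
    exact (H₂.injective _ _ _ h2).symm
  · intro c l e
    refine Subtype.ext (funext fun x => ?_)
    obtain ⟨g, rfl⟩ := H₂.surjective x
    obtain ⟨l₁, v, β, hl, -⟩ := exists_pullsTo H₁ H₂ hℒ C₁ l e g
    have h1 := ((hval g l₁ l v e hl).smul (c := fun _ => c) contMDiffAt_const).congr
      (τ' := fun g' => Θ₂ g' (f₂ g') rfl ((c • e).1 (f₂ g')))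
      (Filter.Eventually.of_forall fun g' => map_smul _ _ _)
    have h2 := spec g l₁ l v hl (c • e) _ h1
    rw [tfun_const, zero_apply, zero_smul, zero_add, ← map_smul] at h2
    exact (H₂.injective _ _ _ h2).symm
  · intro φ hφ l l' e h x
    obtain ⟨g, rfl⟩ := H₂.surjective x
    obtain ⟨l₁, v, β, hl, -⟩ := exists_pullsTo H₁ H₂ hℒ C₁ l e g
    exact hsm g e l₁ l v (φ (f₂ g)) l' hl (h _)
  · intro φ hφ l e e' h x
    obtain ⟨g, rfl⟩ := H₂.surjective x
    obtain ⟨l₁, v, β, hl, -⟩ := exists_pullsTo H₁ H₂ hℒ C₁ l e g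
    have hφf : ContMDiffAt (𝓡 n) 𝓘(ℝ, ℝ) ∞ (fun g => φ (f₂ g)) g :=
      ContMDiffAt.comp g hφ.contMDiffAt H₂.smooth.contMDiffAt
    have h1 := ((hval g l₁ l v e hl).smul hφf).congr
      (τ' := fun g' => Θ₂ g' (f₂ g') rfl (e'.1 (f₂ g')))
      (Filter.Eventually.of_forall fun g' => by
        rw [h, map_smul])
    have h2 := spec g l₁ l v hl e' _ h1
    rw [hℒ.anchor₂_eq g l₁ l v hl φ hφ, ← map_smul, ← map_smul, ← map_add] at h2
    refine (H₂.injective _ _ _ h2).symm.trans ?_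
    rw [add_comm]
    rfl

end Transfer

/-! ### The three vector bundles -/

open Manifold

section Cutoff

variable {n k b : ℕ} {N Q B : Type*}
  [TopologicalSpace N] [ChartedSpace (EuclideanSpace ℝ (Fin n)) N] [IsManifold (𝓡 n) ∞ N]
  [TopologicalSpace Q] [ChartedSpace (EuclideanSpace ℝ (Fin k)) Q] [IsManifold (𝓡 k) ∞ Q]
  [TopologicalSpace B] [ChartedSpace (EuclideanSpace ℝ (Fin b)) B] [IsManifold (𝓡 b) ∞ B]
  {W : B → Type*} [∀ x, AddCommGroup (W x)] [∀ x, Module ℝ (W x)]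
  {pr : N → Q} {R : N → Submodule ℝ (EuclideanSpace ℝ (Fin k))} {f : N → B}
  {Γ : Submodule ℝ (∀ x, W x)}
  {Θ : ∀ (g : N) (x : B), f g = x → W x →ₗ[ℝ] EuclideanSpace ℝ (Fin k)}

/-- A section defined near the support of a function gives a global section, after multiplication by
that function. -/
theorem smoothFieldAt_cutoff_section (hpr : ContMDiff (𝓡 n) (𝓡 k) ∞ pr)
    (hf : ContMDiff (𝓡 n) (𝓡 b) ∞ f) {χ : B → ℝ} (hχ : ContMDiff (𝓡 b) 𝓘(ℝ, ℝ) ∞ χ) {e : ∀ x, W x}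
    (he : ∀ g, f g ∈ tsupport χ →
      SmoothFieldAt (𝓡 n) k pr (fun g' => Θ g' (f g') rfl (e (f g'))) g) (g : N) :
    SmoothFieldAt (𝓡 n) k pr (fun g' => Θ g' (f g') rfl (χ (f g') • e (f g'))) g := by
  have h1 : ContMDiffAt (𝓡 n) 𝓘(ℝ, ℝ) ∞ (fun g => χ (f g)) g :=
    ContMDiffAt.comp g hχ.contMDiffAt hf.contMDiffAt
  by_cases hg : f g ∈ tsupport χ
  · exact ((he g hg).smul h1).congr (Filter.Eventually.of_forall fun _ => rfl)
      (Filter.Eventually.of_forall fun g' => map_smul _ _ _)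
  · refine (SmoothFieldAt.zero hpr.contMDiffAt).congr (Filter.Eventually.of_forall fun _ => rfl) ?_
    have h2 : ∀ᶠ g' in 𝓝 g, f g' ∉ tsupport χ :=
      hf.continuous.continuousAt.eventually
        ((isClosed_tsupport χ).isOpen_compl.mem_nhds hg)
    filter_upwards [h2] with g' hg'
    rw [image_eq_zero_of_notMem_tsupport hg', zero_smul, map_zero]

theorem IsPulledBundle.cutoff_mem (H : IsPulledBundle n k b pr R f Γ Θ) {χ : B → ℝ}
    (hχ : ContMDiff (𝓡 b) 𝓘(ℝ, ℝ) ∞ χ) {e : ∀ x, W x}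
    (he : ∀ g, f g ∈ tsupport χ →
      SmoothFieldAt (𝓡 n) k pr (fun g' => Θ g' (f g') rfl (e (f g'))) g) :
    (fun x => χ x • e x) ∈ Γ :=
  (H.mem_iff _).2 (smoothFieldAt_cutoff_section H.smooth_pr H.smooth hχ he)

theorem finrank_ker_of_surjective {a b : ℕ}
    {L : EuclideanSpace ℝ (Fin a) →L[ℝ] EuclideanSpace ℝ (Fin b)} (hL : ∀ w, ∃ u, L u = w) :
    Module.finrank ℝ (LinearMap.ker L.toLinearMap) = a - b := by
  have h1 := LinearMap.finrank_range_add_finrank_ker L.toLinearMap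
  rw [LinearMap.range_eq_top.2 hL, finrank_top, finrank_euclideanSpace_fin,
    finrank_euclideanSpace_fin] at h1
  omega

theorem tfun_comp {φ : B → ℝ} {g : N} (hφ : ContMDiffAt (𝓡 b) 𝓘(ℝ, ℝ) ∞ φ (f g))
    (hf : ContMDiffAt (𝓡 n) (𝓡 b) ∞ f g) (v : EuclideanSpace ℝ (Fin n)) :
    tfun n (fun g => φ (f g)) g v = tfun b φ (f g) (tmap n b f g v) := by
  obtain ⟨c, hc, hc0, rfl⟩ := exists_curve g v
  have h1 : ContMDiffAt 𝓘(ℝ, ℝ) (𝓡 b) ∞ (fun t => f (c t)) 0 :=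
    ContMDiffAt.comp (0 : ℝ) (by rwa [hc0]) (hc 0)
  rw [vel_comp hc0 hf (hc 0)]
  exact tfun_eq_of_hasDerivAt hc0 (ContMDiffAt.comp g hφ hf) (hc 0)
    (vel_comp_real (c := fun t => f (c t)) (by simp only [hc0]) hφ h1)

end Cutoff

namespace LieGroupoid

variable {m n : ℕ} {M G : Type*}
  [TopologicalSpace M] [ChartedSpace (EuclideanSpace ℝ (Fin m)) M] [IsManifold (𝓡 m) ∞ M]
  [TopologicalSpace G] [ChartedSpace (EuclideanSpace ℝ (Fin n)) G] [IsManifold (𝓡 n) ∞ G]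
  (𝒢 : LieGroupoid m n M G)

theorem leftVec_add (g : G) (v w : EuclideanSpace ℝ (Fin n)) :
    𝒢.leftVec g (v + w) = 𝒢.leftVec g v + 𝒢.leftVec g w := by
  rw [𝒢.leftVec_eq g v, 𝒢.leftVec_eq g w, 𝒢.leftVec_eq, map_add]

theorem leftVec_smul (g : G) (c : ℝ) (v : EuclideanSpace ℝ (Fin n)) :
    𝒢.leftVec g (c • v) = c • 𝒢.leftVec g v := by
  rw [𝒢.leftVec_eq g v, 𝒢.leftVec_eq, map_smul]

theorem leftVec_sum (g : G) {r : ℕ} (c : Fin r → ℝ) (v : Fin r → EuclideanSpace ℝ (Fin n)) :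
    𝒢.leftVec g (∑ j, c j • v j) = ∑ j, c j • 𝒢.leftVec g (v j) := by
  simp only [𝒢.leftVec_eq, map_sum, map_smul]

/-- The left translation of the fibre of the Lie algebroid at the source of `g` to the tangent space
of the target fibre at `g`. -/
def algTheta (g : G) (x : M) (_ : 𝒢.source g = x) :
    𝒢.algebroidFiber x →ₗ[ℝ] EuclideanSpace ℝ (Fin n) :=
  (𝒢.leftLin g).comp (𝒢.algebroidFiber x).subtype

theorem algTheta_apply (g : G) (x : M) (h : 𝒢.source g = x) (l : 𝒢.algebroidFiber x) :
    𝒢.algTheta g x h l = 𝒢.leftVec g l.1 :=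
  (𝒢.leftVec_eq g l.1).symm

theorem smoothAlongOn_iff {l : ∀ x, 𝒢.algebroidFiber x} : l ∈ 𝒢.algebroidSections ↔
    ∀ x, SmoothFieldAt (𝓡 m) n 𝒢.unit (fun x => (l x).1) x :=
  contMDiffOn_univ

theorem smooth_leftVec_section {l : ∀ x, 𝒢.algebroidFiber x} {g : G}
    (hl : SmoothFieldAt (𝓡 m) n 𝒢.unit (fun x => (l x).1) (𝒢.source g)) :
    SmoothFieldAt (𝓡 n) n (fun g : G => g) (fun g => 𝒢.leftVec g (l (𝒢.source g)).1) g :=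
  𝒢.leftVec_smooth (γ := fun g => g) contMDiffAt_id (hl.comp 𝒢.source_smooth.contMDiffAt)
    (Filter.Eventually.of_forall fun g => (l (𝒢.source g)).2)

theorem tmap_inv_leftVec_unit {x : M} {v : EuclideanSpace ℝ (Fin n)} (hv : v ∈ 𝒢.algebroidFiber x) :
    tmap n n 𝒢.inv (𝒢.unit x) (𝒢.leftVec (𝒢.unit x) v) = v := by
  obtain ⟨c, hc, hc0, rfl, hcs⟩ := 𝒢.exists_source_curve hv
  have h1 : ∀ᶠ t in 𝓝 0, 𝒢.mul (𝒢.unit x) (𝒢.inv (c t)) = 𝒢.inv (c t) := by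
    filter_upwards [hcs] with t ht
    have h := 𝒢.unit_mul (𝒢.inv (c t))
    rwa [𝒢.target_inv, ht] at h
  rw [𝒢.leftVec_vel hc (by rw [hc0, 𝒢.source_unit]) (by simpa only [𝒢.source_unit] using hcs),
    vel_congr h1, vel_comp (c := fun t => 𝒢.inv (c t)) (by rw [hc0, 𝒢.inv_unit])
      𝒢.inv_smooth.contMDiffAt (𝒢.contMDiffAt_inv hc)]
  exact vel_congr (Filter.Eventually.of_forall fun t => 𝒢.inv_inv _)

/-- A local section of the Lie algebroid, multiplied by a cutoff function. -/
theorem exists_algebroidSection [T2Space M] {x : M} {U : Set M} (hU : U ∈ 𝓝 x)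
    {v : M → EuclideanSpace ℝ (Fin n)} (hv : ∀ y ∈ U, SmoothFieldAt (𝓡 m) n 𝒢.unit v y)
    (hmem : ∀ y ∈ U, v y ∈ 𝒢.algebroidFiber y) :
    ∃ (l : 𝒢.algebroidSections) (χ : M → ℝ), (∀ᶠ y in 𝓝 x, χ y = 1) ∧ tsupport χ ⊆ U ∧
      ∀ y, ((l.1 y).1 : EuclideanSpace ℝ (Fin n)) = χ y • v y := by
  obtain ⟨χ, hχ, hχ1, hχs⟩ := exists_cutoff (b := m) hU
  have hm : ∀ y, χ y • v y ∈ 𝒢.algebroidFiber y := by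
    intro y
    by_cases hy : y ∈ tsupport χ
    · exact Submodule.smul_mem _ _ (hmem y (hχs hy))
    · rw [image_eq_zero_of_notMem_tsupport hy, zero_smul]
      exact Submodule.zero_mem _
  exact ⟨⟨fun y => ⟨χ y • v y, hm y⟩, 𝒢.smoothAlongOn_iff.2
    (SmoothFieldAt.cutoff 𝒢.unit_smooth hχ fun y hy => hv y (hχs hy))⟩, χ, hχ1, hχs, fun _ => rfl⟩

/-- The pullback of the Lie algebroid along the source map is the bundle of the vectors tangent to
the target fibres. -/
theorem isPulledBundle [T2Space M] : IsPulledBundle n n m (fun g : G => g)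
    (fun g => LinearMap.ker (tmap n m 𝒢.target g).toLinearMap) 𝒢.source 𝒢.algebroidSections
    𝒢.algTheta where
  submersion := 𝒢.source_submersion.isSubmersionAt
  surjective x := ⟨𝒢.unit x, 𝒢.source_unit x⟩
  injective g x h := by
    subst h
    intro l l' hll
    rw [𝒢.algTheta_apply, 𝒢.algTheta_apply] at hll
    exact Subtype.ext (𝒢.leftVec_injective l.2 l'.2 hll)
  range_eq g x h := by
    subst h
    ext u
    constructor
    · rintro ⟨l, rfl⟩
      rw [𝒢.algTheta_apply]
      exact 𝒢.target_leftVec l.2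
    · intro hu
      obtain ⟨v, hv, rfl⟩ := 𝒢.exists_leftVec_eq hu
      exact ⟨⟨v, hv⟩, 𝒢.algTheta_apply _ _ _ _⟩
  smooth_pr := contMDiff_id
  mem_iff l := by
    rw [𝒢.smoothAlongOn_iff]
    have h1 : (fun g => 𝒢.algTheta g (𝒢.source g) rfl (l (𝒢.source g))) =
      fun g => 𝒢.leftVec g (l (𝒢.source g)).1 := funext fun g => 𝒢.algTheta_apply _ _ _ _
    rw [h1]
    constructor
    · exact fun hl g => 𝒢.smooth_leftVec_section (hl _)
    · -- at a unit, left translation is the inversion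
      intro hl x
      have h2 := ((hl (𝒢.unit x)).comp 𝒢.unit_smooth.contMDiffAt).push
        (f := 𝒢.inv) 𝒢.inv_smooth.contMDiffAt
      refine h2.congr (Filter.Eventually.of_forall fun y => (𝒢.inv_unit y).symm)
        (Filter.Eventually.of_forall fun y => ?_)
      have h3 : ∀ z, z = y → ((l z).1 : EuclideanSpace ℝ (Fin n)) = (l y).1 := by
        rintro z rfl
        rfl
      have h4 := 𝒢.tmap_inv_leftVec_unit (l y).2
      rw [← h3 _ (𝒢.source_unit y)] at h4
      exact (h4.trans (h3 _ (𝒢.source_unit y))).symm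
  exists_section x β := by
    obtain ⟨X, hX, hXv, hXs⟩ := (𝒢.source_submersion.isSubmersionAt (𝒢.unit x)).exists_fibre_field
      (v := β.1) β.2
    have hu := 𝒢.unit_smooth.continuous.continuousAt (x := x)
    obtain ⟨l, χ, hχ, -, hl⟩ := 𝒢.exists_algebroidSection (v := fun y => X (𝒢.unit y))
      (hu.eventually (hX.and hXs))
      (fun y hy => (show SmoothFieldAt (𝓡 n) n (fun z : G => z) X (𝒢.unit y) from hy.1).comp
        𝒢.unit_smooth.contMDiffAt) fun y hy => hy.2
    refine ⟨l.1, l.2, Subtype.ext ((hl x).trans ?_)⟩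
    rw [hχ.self_of_nhds, one_smul, hXv]
  finrank_eq := ⟨n - m, fun g => finrank_ker_of_surjective
    (𝒢.target_submersion.isSubmersionAt g).mfderiv_surjective⟩

end LieGroupoid

namespace LieGroupoidPair

variable {m n p k : ℕ} {M G A : Type*}
  [TopologicalSpace M] [ChartedSpace (EuclideanSpace ℝ (Fin m)) M] [IsManifold (𝓡 m) ∞ M]
  [TopologicalSpace G] [ChartedSpace (EuclideanSpace ℝ (Fin n)) G] [IsManifold (𝓡 n) ∞ G]
  [TopologicalSpace A] [ChartedSpace (EuclideanSpace ℝ (Fin p)) A] [IsManifold (𝓡 p) ∞ A]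
  (P : LieGroupoidPair m n p M G A)

theorem mkQ_mem_quotSections (l : P.big.algebroidSections) :
    (fun x => (P.subFiber x).mkQ (l.1 x)) ∈ P.quotSections :=
  fun _ => ⟨Set.univ, Filter.univ_mem, l.1, l.2, fun _ _ => rfl⟩

theorem exists_lift_section [T2Space M] (e : P.quotSections) (x₀ : M) :
    ∃ l : P.big.algebroidSections, ∀ᶠ x in 𝓝 x₀, (P.subFiber x).mkQ (l.1 x) = e.1 x := by
  obtain ⟨U, hU, l, hl, hle⟩ := e.2 x₀
  obtain ⟨l', χ, hχ, -, hl'⟩ := P.big.exists_algebroidSection (interior_mem_nhds.2 hU)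
    (v := fun y => (l y).1)
    (fun y hy => ContMDiffOn.contMDiffAt hl (mem_interior_iff_mem_nhds.1 hy))
    fun y _ => (l y).2
  refine ⟨l', ?_⟩
  filter_upwards [hχ, hU] with x hx hxU
  rw [← hle x hxU]
  refine congrArg _ (Subtype.ext ((hl' x).trans ?_))
  rw [hx]
  exact one_smul ℝ (l x).1

variable [ChartedSpace (EuclideanSpace ℝ (Fin k)) P.HomogeneousSpace]
  [IsManifold (𝓡 k) ∞ P.HomogeneousSpace] (hπ : IsSubmersion (𝓡 n) (𝓡 k) ∞ P.proj)

include hπ in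
theorem homTarget_mfderiv_surjective (q : P.HomogeneousSpace) (w : EuclideanSpace ℝ (Fin m)) :
    ∃ u, tmap k m P.homTarget q u = w := by
  obtain ⟨g, rfl⟩ := P.proj_surjective q
  obtain ⟨u, rfl⟩ := (P.big.target_submersion.isSubmersionAt g).mfderiv_surjective w
  exact ⟨_, P.homTarget_tmap_proj hπ g u⟩

/-- The smoothness of the pullback of a local section of the quotient bundle. -/
theorem smooth_thetaLin_of_lift {e : ∀ x, P.QuotFiber x} {l : ∀ x, P.big.algebroidFiber x} {g : G}
    (hl : SmoothFieldAt (𝓡 m) n P.big.unit (fun x => (l x).1) (P.big.source g))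
    (hle : ∀ᶠ x in 𝓝 (P.big.source g), (P.subFiber x).mkQ (l x) = e x) :
    SmoothFieldAt (𝓡 n) k P.proj (fun g => P.thetaLin hπ (x := P.big.source g) rfl
      (e (P.big.source g))) g := by
  refine ((P.big.smooth_leftVec_section hl).push hπ.contMDiff.contMDiffAt).congr
    (Filter.Eventually.of_forall fun _ => rfl) ?_
  filter_upwards [P.big.source_smooth.continuous.continuousAt.eventually hle] with g' hg'
  rw [← hg']
  exact P.thetaLin_mkQ hπ rfl _

theorem thetaLin_congr {e : ∀ x, P.QuotFiber x} {g : G} {x : M} (h : P.big.source g = x) :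
    P.thetaLin hπ (x := P.big.source g) rfl (e (P.big.source g)) = P.thetaLin hπ h (e x) := by
  subst h
  rfl

/-- The family of the isomorphisms `theta`. -/
abbrev quotTheta (g : G) (x : M) (h : P.big.source g = x) :
    P.QuotFiber x →ₗ[ℝ] EuclideanSpace ℝ (Fin k) :=
  P.thetaLin hπ h

/-- The pullback of the quotient bundle along the source map is the pullback of the vertical bundle
along the projection. -/
theorem isPulledBundle_quot [T2Space M] : IsPulledBundle n k m P.proj (fun g => P.vert k (P.proj g))
    P.big.source P.quotSections (P.quotTheta hπ) where
  submersion := P.big.source_submersion.isSubmersionAt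
  surjective x := ⟨P.big.unit x, P.big.source_unit x⟩
  injective g x h := P.thetaLin_injective hπ h
  range_eq g x h := by
    ext w
    constructor
    · rintro ⟨β, rfl⟩
      exact P.thetaLin_mem_vert hπ h β
    · exact P.exists_thetaLin_eq hπ h
  smooth_pr := hπ.contMDiff
  mem_iff e := by
    have fwd : ∀ e' ∈ P.quotSections, ∀ g, SmoothFieldAt (𝓡 n) k P.proj
        (fun g => P.thetaLin hπ (x := P.big.source g) rfl (e' (P.big.source g))) g := by
      intro e' he g
      obtain ⟨U, hU, l, hl, hle⟩ := he (P.big.source g)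
      exact P.smooth_thetaLin_of_lift hπ (ContMDiffOn.contMDiffAt hl hU)
        (Filter.eventually_of_mem hU hle)
    -- conversely, the section is expanded along the units in the classes of sections of the Lie
    -- algebroid
    refine ⟨fwd e, fun he x₀ => ?_⟩
    have hsu : ∀ x, P.big.source (P.big.unit x) = x := P.big.source_unit
    have restr : ∀ e' : ∀ x, P.QuotFiber x, (∀ g, SmoothFieldAt (𝓡 n) k P.proj
        (fun g => P.thetaLin hπ (x := P.big.source g) rfl (e' (P.big.source g))) g) →
        ∀ x, SmoothFieldAt (𝓡 m) k (fun x => P.proj (P.big.unit x))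
          (fun x => P.thetaLin hπ (hsu x) (e' x)) x := fun e' he' x =>
      ((he' (P.big.unit x)).comp P.big.unit_smooth.contMDiffAt).congr
        (Filter.Eventually.of_forall fun _ => rfl)
        (Filter.Eventually.of_forall fun y => (P.thetaLin_congr hπ (hsu y)).symm)
    have hrank : ∀ x, Module.finrank ℝ (P.vert k (P.proj (P.big.unit x))) = k - m := fun x =>
      finrank_ker_of_surjective (P.homTarget_mfderiv_surjective hπ _)
    set bs := Module.finBasisOfFinrankEq ℝ _ (hrank x₀) with hbs
    have h1 : ∀ j, ∃ l : P.big.algebroidSections,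
        P.thetaLin hπ (hsu x₀) ((P.subFiber x₀).mkQ (l.1 x₀)) = bs j := by
      intro j
      obtain ⟨β, hβ⟩ := P.exists_thetaLin_eq hπ (hsu x₀) (bs j).2
      obtain ⟨l₀, rfl⟩ := Submodule.mkQ_surjective _ β
      obtain ⟨l, hl, hl₀⟩ := P.big.isPulledBundle.exists_section x₀ l₀
      exact ⟨⟨l, hl⟩, by rw [← hβ, ← hl₀]⟩
    choose l hl using h1
    have hσ : ∀ j x, SmoothFieldAt (𝓡 m) k (fun x => P.proj (P.big.unit x))
        (fun x => P.thetaLin hπ (hsu x) ((P.subFiber x).mkQ ((l j).1 x))) x := fun j =>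
      restr _ (fwd _ (P.mkQ_mem_quotSections (l j)))
    have hli : LinearIndependent ℝ
        (fun j => P.thetaLin hπ (hsu x₀) ((P.subFiber x₀).mkQ ((l j).1 x₀))) := by
      simp only [hl]
      exact bs.linearIndependent.map' (Submodule.subtype _) (Submodule.ker_subtype _)
    have hpu : ContMDiffAt (𝓡 m) (𝓡 k) ∞ (fun x => P.proj (P.big.unit x)) x₀ :=
      ContMDiffAt.comp x₀ hπ.contMDiff.contMDiffAt P.big.unit_smooth.contMDiffAt
    obtain ⟨h2, h3⟩ := exists_smooth_coefficients hpu
      (fun j => Filter.Eventually.of_forall (hσ j)) hli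
    obtain ⟨c, hc, hce⟩ := h3 _ (Filter.Eventually.of_forall (restr e he)) (by
      filter_upwards [h2] with x hx
      have h4 : Submodule.span ℝ (Set.range fun j =>
          P.thetaLin hπ (hsu x) ((P.subFiber x).mkQ ((l j).1 x))) ≤
            P.vert k (P.proj (P.big.unit x)) := by
        rw [Submodule.span_le]
        rintro _ ⟨i, rfl⟩
        exact P.thetaLin_mem_vert hπ _ _
      rw [Submodule.eq_of_le_of_finrank_eq h4 (by
        rw [finrank_span_eq_card hx, hrank, Fintype.card_fin])]
      exact P.thetaLin_mem_vert hπ _ _)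
    obtain ⟨V, hV, hVo, hxV⟩ := eventually_nhds_iff.1 ((Filter.eventually_all.2 hc).and hce)
    refine ⟨V, hVo.mem_nhds hxV, fun x => ∑ j, c j x • (l j).1 x, fun x hx => ?_, fun x hx => ?_⟩
    · have h4 := SmoothFieldAt.sum (v := fun j x => ((l j).1 x).1) P.big.unit_smooth.contMDiffAt
        (fun j => P.big.smoothAlongOn_iff.1 (l j).2 x) (fun j => (hV x hx).1 j)
      refine ContMDiffAt.contMDiffWithinAt (h4.congr (Filter.Eventually.of_forall fun _ => rfl)
        (Filter.Eventually.of_forall fun y => ?_))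
      rw [Submodule.coe_sum]
      rfl
    · refine P.thetaLin_injective hπ (hsu x) ?_
      rw [(hV x hx).2, map_sum, map_sum]
      exact Finset.sum_congr rfl fun j _ => by rw [map_smul, map_smul]
  exists_section x β := by
    obtain ⟨l₀, rfl⟩ := Submodule.mkQ_surjective _ β
    obtain ⟨l, hl, rfl⟩ := P.big.isPulledBundle.exists_section x l₀
    exact ⟨_, P.mkQ_mem_quotSections ⟨l, hl⟩, rfl⟩
  finrank_eq := ⟨k - m, fun g => finrank_ker_of_surjective (P.homTarget_mfderiv_surjective hπ _)⟩

end LieGroupoidPair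

/-! ### The vertical bundle and the correspondence -/

namespace LieGroupoidPair

open Manifold

variable {m n p k : ℕ} {M G A : Type*}
  [TopologicalSpace M] [ChartedSpace (EuclideanSpace ℝ (Fin m)) M] [IsManifold (𝓡 m) ∞ M]
  [TopologicalSpace G] [ChartedSpace (EuclideanSpace ℝ (Fin n)) G] [IsManifold (𝓡 n) ∞ G]
  [TopologicalSpace A] [ChartedSpace (EuclideanSpace ℝ (Fin p)) A] [IsManifold (𝓡 p) ∞ A]
  (P : LieGroupoidPair m n p M G A)
  [ChartedSpace (EuclideanSpace ℝ (Fin k)) P.HomogeneousSpace]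

/-- The inclusion of the vertical space at `q = [g]` in the model space. -/
def vertTheta (k : ℕ) [ChartedSpace (EuclideanSpace ℝ (Fin k)) P.HomogeneousSpace] (g : G)
    (q : P.HomogeneousSpace) (_ : P.proj g = q) :
    P.verticalFiber k q →ₗ[ℝ] EuclideanSpace ℝ (Fin k) :=
  (P.verticalFiber k q).subtype

/-- The vertical vector field `X` at `[g]` is the projection of the vector `v`, which is the left
translate to `g` of the Lie algebroid section `l`. -/
def LiftsTo [IsManifold (𝓡 k) ∞ P.HomogeneousSpace] (g : G)
    (l : P.big.algebroidSections) (X : P.verticalFields k) (v : EuclideanSpace ℝ (Fin n)) : Prop :=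
  v = P.big.leftVec g (l.1 (P.big.source g)).1 ∧ (X.1 (P.proj g)).1 = tmap n k P.proj g v

variable [IsManifold (𝓡 k) ∞ P.HomogeneousSpace]

theorem mem_verticalFields_iff {X : ∀ q, P.verticalFiber k q} : X ∈ P.verticalFields k ↔
    ∀ q, SmoothFieldAt (𝓡 k) k (fun q : P.HomogeneousSpace => q) (fun q => (X q).1) q :=
  contMDiffOn_univ

variable (hπ : IsSubmersion (𝓡 n) (𝓡 k) ∞ P.proj)

include hπ in
/-- A local vertical field, multiplied by a cutoff function. -/
theorem exists_verticalField [T2Space P.HomogeneousSpace] {q : P.HomogeneousSpace}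
    {v : P.HomogeneousSpace → EuclideanSpace ℝ (Fin k)}
    (hv : ∀ᶠ y in 𝓝 q, SmoothFieldAt (𝓡 k) k (fun y : P.HomogeneousSpace => y) v y)
    (hmem : ∀ᶠ y in 𝓝 q, v y ∈ P.verticalFiber k y) :
    ∃ X : P.verticalFields k, ∀ᶠ y in 𝓝 q, ((X.1 y).1 : EuclideanSpace ℝ (Fin k)) = v y := by
  obtain ⟨χ, hχ, hχ1, hχs⟩ := exists_cutoff (b := k) (hv.and hmem)
  have hm : ∀ y, χ y • v y ∈ P.verticalFiber k y := by
    intro y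
    by_cases hy : y ∈ tsupport χ
    · exact Submodule.smul_mem _ _ (hχs hy).2
    · rw [image_eq_zero_of_notMem_tsupport hy, zero_smul]
      exact Submodule.zero_mem _
  refine ⟨⟨fun y => ⟨χ y • v y, hm y⟩, P.mem_verticalFields_iff.2
    (SmoothFieldAt.cutoff contMDiff_id hχ fun y hy => (hχs hy).1)⟩, ?_⟩
  filter_upwards [hχ1] with y hy
  change χ y • v y = v y
  rw [hy, one_smul]

include hπ in
/-- The pullback of the vertical bundle along the projection. -/
theorem isPulledBundle_vert [T2Space M] [T2Space P.HomogeneousSpace] :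
    IsPulledBundle n k k P.proj (fun g => P.vert k (P.proj g))
      P.proj (P.verticalFields k) (P.vertTheta k) where
  submersion := hπ.isSubmersionAt
  surjective := P.proj_surjective
  injective g x h := Subtype.val_injective
  range_eq g x h := by
    subst h
    exact Submodule.range_subtype _
  smooth_pr := hπ.contMDiff
  mem_iff X := by
    rw [P.mem_verticalFields_iff]
    constructor
    · exact fun h g => (h (P.proj g)).comp hπ.contMDiff.contMDiffAt
    · intro h q
      obtain ⟨g, rfl⟩ := P.proj_surjective q
      exact (hπ.isSubmersionAt g).descend (h g)
  exists_section q β := by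
    obtain ⟨g, rfl⟩ := P.proj_surjective q
    obtain ⟨β', hβ'⟩ := P.exists_thetaLin_eq hπ (g := g) rfl β.2
    have H := P.isPulledBundle_quot hπ
    obtain ⟨e, he, rfl⟩ := H.exists_section _ β'
    obtain ⟨τ, hτ, hτg, hτp⟩ := (hπ.isSubmersionAt g).exists_section
    obtain ⟨X, hX⟩ := P.exists_verticalField hπ (q := P.proj g)
      (v := fun q => P.thetaLin hπ (g := τ q) rfl (e (P.big.source (τ q)))) (by
        filter_upwards [hτ, hτp.eventually_nhds] with q hq hqp
        exact ((H.smooth_section ⟨e, he⟩ (τ q)).comp hq).congr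
          (hqp.mono fun _ h => h.symm) (Filter.Eventually.of_forall fun _ => rfl)) (by
        filter_upwards [hτp] with q hq
        have h1 := P.thetaLin_mem_vert hπ (g := τ q) rfl (e (P.big.source (τ q)))
        rw [hq] at h1
        exact h1)
    refine ⟨X.1, X.2, Subtype.ext (hX.self_of_nhds.trans ?_)⟩
    have h1 : ∀ g', g' = g → P.thetaLin hπ (g := g') rfl (e (P.big.source g')) = β.1 := by
      rintro g' rfl
      exact hβ'
    exact h1 _ hτg
  finrank_eq := ⟨k - m, fun g => finrank_ker_of_surjective (P.homTarget_mfderiv_surjective hπ _)⟩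

theorem anchorDeriv_eq {g : G} {l : P.big.algebroidFiber (P.big.source g)} {φ : M → ℝ}
    (hφ : ContMDiff (𝓡 m) 𝓘(ℝ, ℝ) ∞ φ) :
    tfun n (fun g => φ (P.big.source g)) g (P.big.leftVec g l.1) =
      P.big.anchorDeriv (P.big.source g) l φ := by
  rw [tfun_comp hφ.contMDiffAt P.big.source_smooth.contMDiffAt, P.big.source_leftVec l.2]
  have h1 : ∀ y : M, tfun m φ (P.big.target (P.big.unit y)) = tfun m φ y := fun y => by
    rw [P.big.target_unit]
  rw [← h1 (P.big.source g)]
  exact (tfun_comp (f := P.big.target) (g := P.big.unit (P.big.source g)) hφ.contMDiffAt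
    P.big.target_smooth.contMDiffAt l.1).symm

include hπ in
theorem verticalDeriv_eq {g : G} {w : P.verticalFiber k (P.proj g)} {v : EuclideanSpace ℝ (Fin n)}
    (hw : w.1 = tmap n k P.proj g v) {φ : P.HomogeneousSpace → ℝ}
    (hφ : ContMDiff (𝓡 k) 𝓘(ℝ, ℝ) ∞ φ) :
    tfun n (fun g => φ (P.proj g)) g v = P.verticalDeriv k (P.proj g) w φ := by
  rw [tfun_comp hφ.contMDiffAt hπ.contMDiff.contMDiffAt, ← hw]
  rfl

theorem LiftsTo.add {g : G} {l l' : P.big.algebroidSections} {X X' : P.verticalFields k}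
    {v v' : EuclideanSpace ℝ (Fin n)} (h : P.LiftsTo g l X v) (h' : P.LiftsTo g l' X' v') :
    P.LiftsTo g (l + l') (X + X') (v + v') := by
  refine ⟨?_, ?_⟩
  · rw [h.1, h'.1]
    exact (P.big.leftVec_add g _ _).symm
  · rw [map_add, ← h.2, ← h'.2]
    rfl

theorem LiftsTo.smul {g : G} (c : ℝ) {l l' : P.big.algebroidSections} {X X' : P.verticalFields k}
    {v : EuclideanSpace ℝ (Fin n)} (hl : l'.1 (P.big.source g) = c • l.1 (P.big.source g))
    (hX : X'.1 (P.proj g) = c • X.1 (P.proj g)) (h : P.LiftsTo g l X v) :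
    P.LiftsTo g l' X' (c • v) := by
  refine ⟨?_, ?_⟩
  · rw [h.1, hl]
    exact (P.big.leftVec_smul g c _).symm
  · rw [map_smul, ← h.2, hX]
    rfl

include hπ in
/-- Every vertical field is locally the projection of combinations of left translates. -/
theorem isLink_quot [T2Space M] : IsLink (n := n) (b₁ := m) (b₂ := k) P.big.source P.proj
    P.big.anchorDeriv (P.verticalDeriv k) (ΓV₁ := P.big.algebroidSections)
    (ΓV₂ := P.verticalFields k) P.LiftsTo where
  anchor₁_eq g l X v h φ hφ := by
    rw [h.1]
    exact P.anchorDeriv_eq hφ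
  anchor₂_eq g l X v h φ hφ := P.verticalDeriv_eq hπ h.2 hφ
  add g l X v l' X' v' h h' := LiftsTo.add P h h'
  smul g c l X X' v hX h := LiftsTo.smul P c rfl hX h
  exists_local X g₀ := by
    have H := P.isPulledBundle_quot hπ
    have hL := P.big.isPulledBundle
    obtain ⟨r, ε, hε⟩ := H.exists_frame g₀
    obtain ⟨c, hc, hce⟩ := hε.exists_coeff (fun g => (X.1 (P.proj g)).1)
      (Filter.Eventually.of_forall fun g =>
        (P.mem_verticalFields_iff.1 X.2 (P.proj g)).comp hπ.contMDiff.contMDiffAt)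
      (Filter.Eventually.of_forall fun g => (X.1 (P.proj g)).2)
    choose l hl using fun j => P.exists_lift_section (ε j) (P.big.source g₀)
    have hsm : ∀ j, SmoothFieldAt (𝓡 n) n (fun g : G => g)
        (fun g => P.big.leftVec g ((l j).1 (P.big.source g)).1) g₀ := fun j =>
      P.big.smooth_leftVec_section (P.big.smoothAlongOn_iff.1 (l j).2 _)
    refine ⟨r, l, c, fun g => ∑ j, c j g • P.big.leftVec g ((l j).1 (P.big.source g)).1,
      fun j => (hc j).self_of_nhds, SmoothFieldAt.sum contMDiffAt_id hsm fun j =>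
      (hc j).self_of_nhds, ?_⟩
    filter_upwards [hce, P.big.source_smooth.continuous.continuousAt.eventually
      (Filter.eventually_all.2 hl)] with g h1 h2
    refine ⟨?_, ?_⟩
    · have h3 : (((∑ j, c j g • l j).1 (P.big.source g)).1 : EuclideanSpace ℝ (Fin n)) =
          ∑ j, c j g • ((l j).1 (P.big.source g)).1 := by
        rw [Submodule.coe_sum, Finset.sum_apply, Submodule.coe_sum]
        rfl
      rw [h3]
      exact (P.big.leftVec_sum g _ _).symm
    · rw [h1, map_sum]
      refine Finset.sum_congr rfl fun j _ => ?_
      rw [map_smul, ← h2 j]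
      exact congrArg _ (P.thetaLin_mkQ hπ rfl _)

include hπ in
/-- Every left translate of a section projects locally to combinations of vertical fields. -/
theorem isLink_vert [T2Space M] [T2Space P.HomogeneousSpace] :
    IsLink (n := n) (b₁ := k) (b₂ := m) P.proj P.big.source
      (P.verticalDeriv k) P.big.anchorDeriv (ΓV₁ := P.verticalFields k)
      (ΓV₂ := P.big.algebroidSections) (fun g X l v => P.LiftsTo g l X v) where
  anchor₁_eq g X l v h φ hφ := P.verticalDeriv_eq hπ h.2 hφ
  anchor₂_eq g X l v h φ hφ := by
    rw [h.1]
    exact P.anchorDeriv_eq hφ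
  add g X l v X' l' v' h h' := LiftsTo.add P h h'
  smul g c X l l' v hl h := LiftsTo.smul P c hl rfl h
  exists_local l g₀ := by
    have H := P.isPulledBundle_vert hπ
    have hsm : ∀ g, SmoothFieldAt (𝓡 n) n (fun g : G => g)
        (fun g => P.big.leftVec g (l.1 (P.big.source g)).1) g := fun g =>
      P.big.smooth_leftVec_section (P.big.smoothAlongOn_iff.1 l.2 _)
    obtain ⟨r, ε, hε⟩ := H.exists_frame g₀
    obtain ⟨c, hc, hce⟩ := hε.exists_coeff
      (fun g => tmap n k P.proj g (P.big.leftVec g (l.1 (P.big.source g)).1))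
      (Filter.Eventually.of_forall fun g => (hsm g).push hπ.contMDiff.contMDiffAt)
      (Filter.Eventually.of_forall fun g => by
        rw [P.mem_vert, P.homTarget_tmap_proj hπ, P.big.target_leftVec (l.1 (P.big.source g)).2])
    refine ⟨r, ε, c, _, fun j => (hc j).self_of_nhds, hsm g₀, ?_⟩
    filter_upwards [hce] with g h1
    refine ⟨rfl, ?_⟩
    rw [h1, Submodule.coe_sum, Finset.sum_apply, Submodule.coe_sum]
    rfl

/-- The correspondence of connections is the equality of their pullbacks to the big groupoid. -/
theorem corresponds_iff {D₀ : P.QuotConnection} {D : P.FibrewiseAffineConnection k} :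
    P.Corresponds D₀ D ↔
      PullbackAgrees (n := n) (P.quotTheta hπ) (P.vertTheta k) P.LiftsTo D₀ D := by
  constructor
  · rintro h g l X v ⟨rfl, hX⟩ Y w ⟨ι, _, c, e, hc, hτ, rfl⟩
    have h1 := h g l X Y (by rw [P.leftVector_eq]; exact hX) (Fintype.card ι)
      (fun i => c ((Fintype.equivFin ι).symm i)) (fun i => e ((Fintype.equivFin ι).symm i))
      (fun i => hc _) (by
        filter_upwards [hτ] with g' hg'
        refine hg'.trans ?_
        rw [← Equiv.sum_comp (Fintype.equivFin ι).symm]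
        refine Finset.sum_congr rfl fun i _ => ?_
        rw [P.theta_eq hπ]
        rfl)
    refine Eq.trans ?_ h1.symm
    rw [← Equiv.sum_comp (Fintype.equivFin ι).symm]
    refine Finset.sum_congr rfl fun i _ => ?_
    rw [P.theta_eq hπ, P.theta_eq hπ, P.leftVector_eq]
    rfl
  · intro h g l X Y hX r c e hc hτ
    rw [P.leftVector_eq] at hX
    refine (h g l X _ ⟨rfl, hX⟩ Y _ ⟨Fin r, inferInstance, c, e, hc, ?_, rfl⟩).symm.trans ?_
    · filter_upwards [hτ] with g' hg'
      refine Eq.trans hg' ?_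
      refine Finset.sum_congr rfl fun i _ => ?_
      rw [P.theta_eq hπ]
      rfl
    · refine Finset.sum_congr rfl fun i _ => ?_
      rw [P.theta_eq hπ, P.theta_eq hπ, P.leftVector_eq]
      rfl

end LieGroupoidPair

/-! ### Tensoriality, and curves in the fibres of a submersion -/

section Tensoriality

open Manifold IsPulledBundle

variable {n k b : ℕ} {N Q B : Type*}
  [TopologicalSpace N] [ChartedSpace (EuclideanSpace ℝ (Fin n)) N] [IsManifold (𝓡 n) ∞ N]
  [TopologicalSpace Q] [ChartedSpace (EuclideanSpace ℝ (Fin k)) Q] [IsManifold (𝓡 k) ∞ Q]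
  [TopologicalSpace B] [ChartedSpace (EuclideanSpace ℝ (Fin b)) B] [IsManifold (𝓡 b) ∞ B]
  {V W : B → Type*} [∀ x, AddCommGroup (V x)] [∀ x, Module ℝ (V x)]
  [∀ x, AddCommGroup (W x)] [∀ x, Module ℝ (W x)]
  {pr : N → Q} {R : N → Submodule ℝ (EuclideanSpace ℝ (Fin k))} {f : N → B}
  {ΓV : Submodule ℝ (∀ x, V x)} {ΓW : Submodule ℝ (∀ x, W x)}
  {anchor : ∀ x, V x → (B → ℝ) → ℝ}
  {Θ : ∀ (g : N) (x : B), f g = x → V x →ₗ[ℝ] EuclideanSpace ℝ (Fin k)}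

theorem AnchoredConnection.nabla_eq_zero [T2Space B] (H : IsPulledBundle n k b pr R f ΓV Θ)
    (C : AnchoredConnection b ΓV ΓW anchor) {l : ΓV} {x : B} (hl : l.1 x = 0) (e : ΓW) :
    (C.nabla l e).1 x = 0 := by
  have hloc : ∀ l : ΓV, (∀ᶠ y in 𝓝 x, l.1 y = 0) → (C.nabla l e).1 x = 0 := by
    intro l hl
    obtain ⟨χ, hχ, hχ1, hχs⟩ := exists_cutoff (b := b) hl
    rw [C.smul_left (fun y => 1 - χ y) (contMDiff_const.sub hχ) l l e (fun y => ?_) x,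
      hχ1.self_of_nhds, sub_self, zero_smul]
    by_cases hy : y ∈ tsupport χ
    · rw [hχs hy, smul_zero]
    · rw [image_eq_zero_of_notMem_tsupport hy, sub_zero, one_smul]
  obtain ⟨g, rfl⟩ := H.surjective x
  obtain ⟨r, ε, hε⟩ := H.exists_frame g
  obtain ⟨c, hc, hce⟩ := hε.exists_global_coeff l
  choose l' hl' using fun i => H.exists_smul (hc i) (ε i)
  have hc0 : ∀ i, c i (f g) = 0 := by
    refine Fintype.linearIndependent_iff.1 hε.linearIndependent.self_of_nhds _ ?_
    have h1 := congrArg (Θ g (f g) rfl) (hce.self_of_nhds.symm.trans hl)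
    rw [map_zero, map_sum] at h1
    rw [← h1]
    exact Finset.sum_congr rfl fun i _ => (map_smul _ _ _).symm
  have h2 : (C.nabla (l - ∑ i, l' i) e).1 (f g) = 0 := by
    refine hloc _ ?_
    filter_upwards [hce] with y hy
    have h3 : (l - ∑ i, l' i).1 y = l.1 y - ∑ i, (l' i).1 y := by
      rw [Submodule.coe_sub, Submodule.coe_sum, Pi.sub_apply, Finset.sum_apply]
    rw [h3, hy, sub_eq_zero]
    exact Finset.sum_congr rfl fun i _ => (hl' i y).symm
  rw [map_sub, map_sum, LinearMap.sub_apply, LinearMap.sum_apply, Submodule.coe_sub,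
    Submodule.coe_sum, Pi.sub_apply, Finset.sum_apply, sub_eq_zero] at h2
  rw [h2]
  refine Finset.sum_eq_zero fun i _ => ?_
  rw [C.smul_left (c i) (hc i) (ε i) (l' i) e (hl' i), hc0, zero_smul]

/-- A connection is differentiated in the direction of the value of a section. -/
theorem AnchoredConnection.nabla_congr [T2Space B] (H : IsPulledBundle n k b pr R f ΓV Θ)
    (C : AnchoredConnection b ΓV ΓW anchor) {l l' : ΓV} {x : B} (hl : l.1 x = l'.1 x) (e : ΓW) :
    (C.nabla l e).1 x = (C.nabla l' e).1 x := by
  have h1 := C.nabla_eq_zero H (l := l - l') (x := x)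
    (by rw [Submodule.coe_sub, Pi.sub_apply, hl, sub_self]) e
  rwa [map_sub, LinearMap.sub_apply, Submodule.coe_sub, Pi.sub_apply, sub_eq_zero] at h1

theorem pulledNabla_sub (C : AnchoredConnection b ΓV ΓW anchor) {k' : ℕ}
    (Θ' : ∀ (g : N) (x : B), f g = x → W x →ₗ[ℝ] EuclideanSpace ℝ (Fin k')) (g : N) (l l' : ΓV) :
    pulledNabla Θ' C g l - pulledNabla Θ' C g l' = pulledNabla Θ' C g (l - l') := by
  ext1 e
  simp [pulledNabla]

theorem IsPulledBundle.PullsTo.sub [T2Space B] (H : IsPulledBundle n k b pr R f ΓV Θ) {g : N}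
    {v v' : EuclideanSpace ℝ (Fin n)} {δ δ' : ΓV →ₗ[ℝ] EuclideanSpace ℝ (Fin k)}
    (hδ : IsDerivationAt (b := b) Θ g v δ) {τ : N → EuclideanSpace ℝ (Fin k)}
    {w w' : EuclideanSpace ℝ (Fin k)} (h : PullsTo Θ g v δ τ w) (h' : PullsTo Θ g v' δ' τ w') :
    PullsTo Θ g (v - v') (δ - δ') τ (w - w') := by
  obtain ⟨ι, _, c, e, hc, hτ, rfl⟩ := h'
  refine ⟨ι, inferInstance, c, e, hc, hτ, ?_⟩
  rw [PullsTo.unique H hδ h ⟨ι, inferInstance, c, e, hc, hτ, rfl⟩, ← Finset.sum_sub_distrib]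
  refine Finset.sum_congr rfl fun i _ => ?_
  rw [map_sub, LinearMap.sub_apply]
  module

theorem tmap_comp {d : ℕ} {D : Type*} [TopologicalSpace D]
    [ChartedSpace (EuclideanSpace ℝ (Fin d)) D]
    {φ : Q → D} {f : N → Q} {g : N} (hφ : ContMDiffAt (𝓡 k) (𝓡 d) ∞ φ (f g))
    (hf : ContMDiffAt (𝓡 n) (𝓡 k) ∞ f g) (v : EuclideanSpace ℝ (Fin n)) :
    tmap n d (fun g => φ (f g)) g v = tmap k d φ (f g) (tmap n k f g v) := by
  obtain ⟨c, hc, hc0, rfl⟩ := exists_curve g v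
  have h1 : ContMDiffAt 𝓘(ℝ, ℝ) (𝓡 k) ∞ (fun t => f (c t)) 0 :=
    ContMDiffAt.comp (0 : ℝ) (by rwa [hc0]) (hc 0)
  rw [vel_comp hc0 hf (hc 0), vel_comp (c := fun t => f (c t)) (by simp only [hc0]) hφ h1]
  exact vel_comp hc0 (ContMDiffAt.comp g hφ hf) (hc 0)

theorem tmap_congr {f h : N → Q} {x : N} (hfh : ∀ᶠ y in 𝓝 x, f y = h y) :
    tmap n k f x = tmap n k h x :=
  Filter.EventuallyEq.mfderiv_eq hfh

/-- A vector tangent to the fibre of a submersion is the velocity of a smooth curve in the fibre,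
which is defined for all times. -/
theorem Manifold.IsSubmersionAt.exists_global_fibre_curve {f : N → B} {y : N}
    (hf : IsSubmersionAt (𝓡 n) (𝓡 b) ∞ f y) {u : EuclideanSpace ℝ (Fin n)}
    (hu : tmap n b f y u = 0) :
    ∃ c : ℝ → N, ContMDiff 𝓘(ℝ, ℝ) (𝓡 n) ∞ c ∧ c 0 = y ∧ vel n c = u ∧ ∀ t, f (c t) = f y := by
  obtain ⟨ρ, U, hU, hyU, hρ, hρf, hρz⟩ := exists_transport hf
  obtain ⟨d, hd, hd0, rfl⟩ := exists_curve y u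
  have h1 : ∀ᶠ t in 𝓝 (0 : ℝ), (f y, d t) ∈ U := by
    refine (continuousAt_const.prodMk hd.continuous.continuousAt).eventually (hU.mem_nhds ?_)
    change (f y, d 0) ∈ U
    rwa [hd0]
  obtain ⟨ε, hε, hεU⟩ := Metric.eventually_nhds_iff.1 h1
  -- a reparametrization with bounded image and unit velocity at the origin
  set s : ℝ → ℝ := fun t => ε / 2 * Real.sin (t * (2 / ε)) with hs
  have hsU : ∀ t, (f y, d (s t)) ∈ U := by
    intro t
    refine hεU ?_
    rw [Real.dist_eq, sub_zero, hs, abs_mul, abs_of_pos (half_pos hε)]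
    have := Real.abs_sin_le_one (t * (2 / ε))
    nlinarith
  have hs0 : s 0 = 0 := by simp [hs]
  have hsd : ContDiff ℝ ∞ s := by fun_prop
  have hs1 : HasDerivAt s 1 0 := by
    have h2 := ((hasDerivAt_id (0 : ℝ)).mul_const (2 / ε)).sin.const_mul (ε / 2)
    refine h2.congr_deriv ?_
    simp only [id, zero_mul, Real.cos_zero]
    field_simp
  have hds : ContMDiff 𝓘(ℝ, ℝ) (𝓡 n) ∞ (fun t => d (s t)) := hd.comp hsd.contMDiff
  have hvel : vel n (fun t => d (s t)) = vel n d := by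
    have h3 : HasMFDerivAt 𝓘(ℝ, ℝ) 𝓘(ℝ, ℝ) s 0 (ContinuousLinearMap.toSpanSingleton ℝ (1 : ℝ)) :=
      hs1.hasFDerivAt.hasMFDerivAt
    have h4 : HasMFDerivAt 𝓘(ℝ, ℝ) (𝓡 n) d (s 0) (mfderiv 𝓘(ℝ, ℝ) (𝓡 n) d (s 0)) :=
      (hd.contMDiffAt.mdifferentiableAt (by simp)).hasMFDerivAt
    have h5 := (h4.comp (0 : ℝ) h3).mfderiv
    have h6 : ∀ r : ℝ, r = 0 → mfderiv 𝓘(ℝ, ℝ) (𝓡 n) d r (1 : ℝ) = vel n d := by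
      rintro r rfl
      rfl
    rw [← h6 _ hs0]
    have h7 := congrArg (fun L => L (1 : ℝ)) h5
    exact h7.trans (congrArg (mfderiv 𝓘(ℝ, ℝ) (𝓡 n) d (s 0)) (one_smul ℝ (1 : ℝ)))
  refine ⟨fun t => ρ (f y) (d (s t)), fun t => ?_, ?_, ?_, fun t => hρf _ _ (hsU t)⟩
  · have h8 : ContMDiffAt 𝓘(ℝ, ℝ) ((𝓡 b).prod (𝓡 n)) ∞ (fun t => (f y, d (s t))) t :=
      contMDiffAt_const.prodMk hds.contMDiffAt
    exact ContMDiffAt.comp t (g := Function.uncurry ρ) (hρ.contMDiffAt (hU.mem_nhds (hsU t))) h8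
  · simp only [hs0, hd0]
    exact hρz y hyU
  · rw [← hvel]
    refine vel_transport (β := fun _ => f y) hf.contMDiffAt (hρ.contMDiffAt (hU.mem_nhds hyU)) ?_
      contMDiffAt_const rfl hds.contMDiffAt (by rw [hs0, hd0]) ?_
    · have h9 : ContinuousAt (fun z => (f z, z)) y :=
        hf.contMDiffAt.continuousAt.prodMk continuousAt_id
      filter_upwards [h9.eventually (hU.mem_nhds hyU)] with z hz using hρz z hz
    · rw [hvel, hu, vel_const]

end Tensoriality

/-! ### Restriction of local bisections -/

namespace LieGroupoid

variable {m n : ℕ} {M G : Type*}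
  [TopologicalSpace M] [ChartedSpace (EuclideanSpace ℝ (Fin m)) M]
  [TopologicalSpace G] [ChartedSpace (EuclideanSpace ℝ (Fin n)) G]
  {𝒢 : LieGroupoid m n M G}

/-- The restriction of a local bisection to an open subset of the base. -/
def LocalBisection.restrict (S : 𝒢.LocalBisection) {V : Set M} (hV : IsOpen V) :
    𝒢.LocalBisection where
  base := (OpenPartialHomeomorph.ofSet V hV).trans S.base
  sec := S.sec
  source_sec x hx := S.source_sec x hx.2
  target_sec x hx := S.target_sec x hx.2
  sec_smooth := S.sec_smooth.mono Set.inter_subset_right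
  symm_smooth := S.symm_smooth.mono Set.inter_subset_left

end LieGroupoid

/-! ### Consequences of compatibility -/

namespace LieGroupoidPair

open Manifold IsPulledBundle

variable {m n p k : ℕ} {M G A : Type*}
  [TopologicalSpace M] [ChartedSpace (EuclideanSpace ℝ (Fin m)) M] [IsManifold (𝓡 m) ∞ M]
  [T2Space M]
  [TopologicalSpace G] [ChartedSpace (EuclideanSpace ℝ (Fin n)) G] [IsManifold (𝓡 n) ∞ G]
  [TopologicalSpace A] [ChartedSpace (EuclideanSpace ℝ (Fin p)) A] [IsManifold (𝓡 p) ∞ A]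
  (P : LieGroupoidPair m n p M G A)

theorem mem_subFiber_of_eq {x : M} {l : P.big.algebroidFiber x} {v : EuclideanSpace ℝ (Fin p)}
    (hv : v ∈ P.sub.algebroidFiber x) (h : l.1 = tmap p n P.incl (P.sub.unit x) v) :
    l ∈ P.subFiber x :=
  ⟨⟨v, hv⟩, (tangentCast_eq (n := n) (P.incl_unit x) _).trans h.symm⟩

theorem exists_of_mem_subFiber {x : M} {l : P.big.algebroidFiber x} (hl : l ∈ P.subFiber x) :
    ∃ v ∈ P.sub.algebroidFiber x, l.1 = tmap p n P.incl (P.sub.unit x) v := by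
  obtain ⟨a, ha⟩ := hl
  exact ⟨a.1, a.2, (ha.symm.trans (tangentCast_eq (n := n) (P.incl_unit x) _))⟩

/-- Every element of the Lie algebroid of the subgroupoid extends to a section. -/
theorem exists_sub_section {x : M} {l : P.big.algebroidFiber x} (hl : l ∈ P.subFiber x) :
    ∃ a : P.big.algebroidSections, (∀ y, a.1 y ∈ P.subFiber y) ∧ a.1 x = l := by
  obtain ⟨v, hv, hlv⟩ := P.exists_of_mem_subFiber hl
  obtain ⟨X, hX, hXv, hXs⟩ := (P.sub.source_submersion.isSubmersionAt
    (P.sub.unit x)).exists_fibre_field (v := v) hv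
  have hu := P.sub.unit_smooth.continuous.continuousAt (x := x)
  obtain ⟨a, χ, hχ, hχs, ha⟩ := P.big.exists_algebroidSection
    (v := fun y => tmap p n P.incl (P.sub.unit y) (X (P.sub.unit y)))
    (hu.eventually (hX.and hXs)) (fun y hy =>
      (((show SmoothFieldAt (𝓡 p) p (fun z : A => z) X (P.sub.unit y) from hy.1).comp
        P.sub.unit_smooth.contMDiffAt).push (f := P.incl) P.incl_smooth.contMDiffAt).congr
        (Filter.Eventually.of_forall fun z => (P.incl_unit z).symm)
        (Filter.Eventually.of_forall fun _ => rfl)) (fun y hy => by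
      obtain ⟨c, hc, hc0, hcv, hcs⟩ := P.sub.exists_source_curve (x := y) hy.2
      rw [← hcv, vel_comp hc0 P.incl_smooth.contMDiffAt hc]
      refine P.big.vel_mem_algebroidFiber (ContMDiffAt.comp (0 : ℝ) P.incl_smooth.contMDiffAt hc)
        (by simp only [hc0, P.incl_unit]) ?_
      filter_upwards [hcs] with t ht
      rw [P.source_incl, ht])
  refine ⟨a, fun y => ?_, Subtype.ext ((ha x).trans ?_)⟩
  · by_cases hy : y ∈ tsupport χ
    · refine P.mem_subFiber_of_eq (v := χ y • X (P.sub.unit y))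
        (Submodule.smul_mem _ _ (hχs hy).2) ?_
      rw [ha y, map_smul]
    · have h0 : a.1 y = 0 := Subtype.ext ((ha y).trans (by
        rw [image_eq_zero_of_notMem_tsupport hy, zero_smul]
        rfl))
      rw [h0]
      exact Submodule.zero_mem _
  · rw [hχ.self_of_nhds, one_smul, hXv, hlv]

/-- Every element of the Lie algebroid of the subgroupoid is the velocity of a curve, defined for
all times, of arrows of the subgroupoid. -/
theorem exists_sub_curve {x : M} {l : P.big.algebroidFiber x} (hl : l ∈ P.subFiber x) :
    ∃ c : ℝ → A, ContMDiff 𝓘(ℝ, ℝ) (𝓡 p) ∞ c ∧ c 0 = P.sub.unit x ∧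
      (∀ t, P.sub.source (c t) = x) ∧ vel n (fun t => P.incl (c t)) = l.1 := by
  obtain ⟨v, hv, hlv⟩ := P.exists_of_mem_subFiber hl
  obtain ⟨c, hc, hc0, hcv, hcs⟩ := (P.sub.source_submersion.isSubmersionAt
    (P.sub.unit x)).exists_global_fibre_curve hv
  refine ⟨c, hc, hc0, fun t => (hcs t).trans (P.sub.source_unit x), ?_⟩
  rw [hlv, ← hcv, vel_comp hc0 P.incl_smooth.contMDiffAt (hc 0)]

variable [ChartedSpace (EuclideanSpace ℝ (Fin k)) P.HomogeneousSpace]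
  [IsManifold (𝓡 k) ∞ P.HomogeneousSpace] (hπ : IsSubmersion (𝓡 n) (𝓡 k) ∞ P.proj)

/-- The curve `d = g · c⁻¹` in the orbit of `g` under right translations, for a curve `c` of arrows
of the subgroupoid. -/
theorem exists_orbit_curve {g : G} {x : M} (hx : P.big.source g = x) {c : ℝ → A}
    (hc : ContMDiff 𝓘(ℝ, ℝ) (𝓡 p) ∞ c) (hc0 : c 0 = P.sub.unit x)
    (hcs : ∀ t, P.sub.source (c t) = x) :
    ∃ d : ℝ → G, ContMDiffAt 𝓘(ℝ, ℝ) (𝓡 n) ∞ d 0 ∧ d 0 = g ∧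
      vel n d = P.big.leftVec g (vel n fun t => P.incl (c t)) ∧ (∀ t, P.proj (d t) = P.proj g) ∧
      ∀ (e : ∀ y, P.QuotFiber y) (t : ℝ) (w : P.QuotFiber x),
        P.IsAd (P.sub.inv (c t)) (e (P.sub.target (c t))) w →
        P.thetaLin hπ hx w = P.thetaLin hπ (g := d t) rfl (e (P.big.source (d t))) := by
  subst hx
  have hg : ∀ t, P.big.source g = P.sub.target (P.sub.inv (c t)) := fun t => by
    rw [P.sub.target_inv, hcs]
  have hi : ContMDiffAt 𝓘(ℝ, ℝ) (𝓡 n) ∞ (fun t => P.incl (c t)) 0 :=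
    ContMDiffAt.comp (0 : ℝ) P.incl_smooth.contMDiffAt (hc 0)
  have hd : ∀ t, P.big.mul g (P.incl (P.sub.inv (c t))) = P.big.mul g (P.big.inv (P.incl (c t))) :=
    fun t => by rw [P.incl_inv]
  refine ⟨fun t => P.big.mul g (P.incl (P.sub.inv (c t))), ?_, ?_, ?_, fun t => P.proj_mul (hg t),
    fun e t w h => ?_⟩
  · simp only [hd]
    exact P.big.contMDiffAt_mul contMDiffAt_const (P.big.contMDiffAt_inv hi)
      (Filter.Eventually.of_forall fun t => by rw [P.big.target_inv, P.source_incl, hcs])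
  · simp only [hd]
    rw [hc0, P.incl_unit, P.big.inv_unit, P.big.mul_unit]
  · simp only [hd]
    exact (P.big.leftVec_vel hi (by rw [hc0, P.incl_unit])
      (Filter.Eventually.of_forall fun t => by rw [P.source_incl, hcs])).symm
  · have h1 : P.big.source (P.big.mul g (P.incl (P.sub.inv (c t)))) = P.sub.target (c t) := by
      rw [P.source_mul_incl (hg t), P.sub.source_inv]
    rw [P.thetaLin_congr hπ h1]
    exact (P.isAd_iff hπ (P.sub.source_inv _) ((P.sub.target_inv _).trans (hcs t)) rfl h1 _ _).1 h

/-- In the directions tangent to the orbits of the right translations, the pulled back connection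
differentiates a pullback from the homogeneous space to zero. -/
theorem ExtendsAction.eq_zero {D₀ : P.QuotConnection} (h : P.ExtendsAction D₀) {g : G}
    {l : P.big.algebroidSections} (hl : l.1 (P.big.source g) ∈ P.subFiber (P.big.source g))
    {τ : G → EuclideanSpace ℝ (Fin k)} (hτ : ∀ g', P.proj g' = P.proj g → τ g' = τ g)
    {w : EuclideanSpace ℝ (Fin k)}
    (hw : PullsTo (P.quotTheta hπ) g (P.big.leftVec g (l.1 (P.big.source g)).1)
      (pulledNabla (P.quotTheta hπ) D₀ g l) τ w) : w = 0 := by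
  obtain ⟨a, ha, hal⟩ := P.exists_sub_section hl
  obtain ⟨c, hc, hc0, hcs, hcv⟩ := P.exists_sub_curve hl
  obtain ⟨d, hd, hd0, hdv, hdp, hdθ⟩ := P.exists_orbit_curve hπ rfl hc hc0 hcs
  obtain ⟨ι, _, f, e, hf, hτf, rfl⟩ := hw
  have h1 : ∀ i t, ∃ w : P.QuotFiber (P.big.source g),
      P.IsAd (P.sub.inv (c t)) ((e i).1 (P.sub.target (c t))) w := fun i t =>
    P.exists_isAd hπ (P.sub.source_inv _) ((P.sub.target_inv _).trans (hcs t)) _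
  choose β hβ using h1
  rw [← hcv, ← hdv]
  -- it suffices to consider the coordinates
  ext j
  set ψ : EuclideanSpace ℝ (Fin k) →L[ℝ] ℝ := EuclideanSpace.proj j with hψ
  have h2 : ∀ i, HasDerivAt (fun t => ψ (P.thetaLin hπ rfl (β i t)))
      (ψ (P.thetaLin hπ rfl ((D₀.nabla l (e i)).1 (P.big.source g)))) 0 := by
    intro i
    rw [D₀.nabla_congr P.big.isPulledBundle hal.symm]
    exact h a (e i) ha _ c hc hc0 hcs (tangentVector_ext (by rw [Function.comp_apply, hc0,
      P.incl_unit]) (by rw [hal]; exact hcv)) (β i) (hβ i) (ψ.toLinearMap.comp (P.thetaLin hπ rfl))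
  have h3 : ∀ i, P.thetaLin hπ rfl (β i 0) =
      P.thetaLin hπ (g := g) rfl ((e i).1 (P.big.source g)) := by
    intro i
    rw [hdθ _ 0 _ (hβ i 0), hd0]
  have h4 : HasDerivAt (fun t => ∑ i, f i (d t) * ψ (P.thetaLin hπ rfl (β i t)))
      (∑ i, (tfun n (f i) g (vel n d) * ψ (P.thetaLin hπ rfl (β i 0)) +
        f i (d 0) * ψ (P.thetaLin hπ rfl ((D₀.nabla l (e i)).1 (P.big.source g))))) 0 :=
    HasDerivAt.fun_sum fun i _ => (vel_comp_real hd0 (hf i) hd).mul (h2 i)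
  have h5 : ∀ᶠ t in 𝓝 0, ∑ i, f i (d t) * ψ (P.thetaLin hπ rfl (β i t)) = ψ (τ g) := by
    have h6 : Filter.Tendsto d (𝓝 0) (𝓝 g) := by
      have := hd.continuousAt
      rwa [ContinuousAt, hd0] at this
    filter_upwards [h6.eventually hτf] with t ht
    rw [← hτ _ (hdp t), ht, map_sum]
    refine Finset.sum_congr rfl fun i _ => ?_
    rw [map_smul, hdθ _ t _ (hβ i t)]
    rfl
  -- the coordinates of `τ` are constant along `d`; their derivative is given by the Leibniz rule
  have h7 := h4.unique ((hasDerivAt_const (0 : ℝ) (ψ (τ g))).congr_of_eventuallyEq h5)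
  have h8 : ψ (∑ i, (tfun n (f i) g (vel n d) •
      P.quotTheta hπ g (P.big.source g) rfl ((e i).1 (P.big.source g)) +
        f i g • pulledNabla (P.quotTheta hπ) D₀ g l (e i))) = 0 := by
    rw [← h7, map_sum]
    refine Finset.sum_congr rfl fun i _ => ?_
    rw [map_add, map_smul, map_smul, h3, hd0]
    rfl
  exact h8

end LieGroupoidPair

namespace LieGroupoidPair

open Manifold IsPulledBundle

variable {m n p k : ℕ} {M G A : Type*}
  [TopologicalSpace M] [ChartedSpace (EuclideanSpace ℝ (Fin m)) M] [IsManifold (𝓡 m) ∞ M]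
  [T2Space M]
  [TopologicalSpace G] [ChartedSpace (EuclideanSpace ℝ (Fin n)) G] [IsManifold (𝓡 n) ∞ G]
  [TopologicalSpace A] [ChartedSpace (EuclideanSpace ℝ (Fin p)) A] [IsManifold (𝓡 p) ∞ A]
  (P : LieGroupoidPair m n p M G A)

theorem algebroid_val_congr (l : ∀ x, P.big.algebroidFiber x) {x y : M} (h : x = y) :
    ((l x).1 : EuclideanSpace ℝ (Fin n)) = (l y).1 := by
  subst h
  rfl

/-- The image of a section of the Lie algebroid under a local bisection of the subgroupoid, near a
point. -/
theorem exists_conj_section (S : P.sub.LocalBisection) {x : M} (hx : x ∈ S.base.source)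
    (l' : P.big.algebroidSections) : ∃ l : P.big.algebroidSections, ∀ᶠ x' in 𝓝 x,
      ((l.1 (S.base x')).1 : EuclideanSpace ℝ (Fin n)) =
        tmap n n (P.big.conj (P.incl ∘ S.sec)) (P.big.unit x') (l'.1 x').1 := by
  have hunit : ∀ y ∈ S.base.source,
      P.big.conj (P.incl ∘ S.sec) (P.big.unit y) = P.big.unit (S.base y) := fun y hy =>
    (conj_curve (P := P) hy (c := fun _ => P.big.unit y) contMDiffAt_const rfl
      (Filter.Eventually.of_forall fun _ => P.big.source_unit y)).2.1
  have hsymm : ∀ y ∈ S.base.target, ContMDiffAt (𝓡 m) (𝓡 m) ∞ S.base.symm y := fun y hy =>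
    S.symm_smooth.contMDiffAt (S.base.open_target.mem_nhds hy)
  obtain ⟨l, χ, hχ, -, hl⟩ := P.big.exists_algebroidSection
    (v := fun y => tmap n n (P.big.conj (P.incl ∘ S.sec)) (P.big.unit (S.base.symm y))
      (l'.1 (S.base.symm y)).1) (S.base.open_target.mem_nhds (S.base.map_source hx)) (fun y hy => by
      refine (((P.big.smoothAlongOn_iff.1 l'.2 (S.base.symm y)).comp (hsymm y hy)).push
        (conj_smooth (S.base.map_target hy))).congr ?_ (Filter.Eventually.of_forall fun _ => rfl)
      filter_upwards [S.base.open_target.mem_nhds hy] with z hz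
      rw [hunit _ (S.base.map_target hz), S.base.right_inv hz]) (fun y hy => by
      have h1 := conj_mem (P := P) (S.base.map_target hy) (l'.1 (S.base.symm y)).2
      rw [S.base.right_inv hy] at h1
      exact h1)
  refine ⟨l, ?_⟩
  filter_upwards [(S.base.continuousAt hx).eventually hχ, S.base.open_source.mem_nhds hx]
    with x' h1 h2
  rw [hl, h1, one_smul, S.base.left_inv h2]

/-- An equivariant connection is local, so that it suffices to know the sections near a point. -/
theorem BisectionEquivariant.isAd {D₀ : P.QuotConnection} (h : P.BisectionEquivariant D₀)
    (S : P.sub.LocalBisection) {l l' : P.big.algebroidSections} {e e' : P.quotSections} {x : M}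
    (hx : x ∈ S.base.source) (hl : ∀ᶠ x' in 𝓝 x,
      ((l.1 (S.base x')).1 : EuclideanSpace ℝ (Fin n)) =
        tmap n n (P.big.conj (P.incl ∘ S.sec)) (P.big.unit x') (l'.1 x').1)
    (he : ∀ᶠ x' in 𝓝 x, P.IsAd (S.sec x') (e'.1 x') (e.1 (S.base x'))) :
    P.IsAd (S.sec x) ((D₀.nabla l' e').1 x) ((D₀.nabla l e).1 (S.base x)) := by
  obtain ⟨V, hV, hVo, hxV⟩ := eventually_nhds_iff.1 (hl.and he)
  refine h (S.restrict hVo) l l' e e' (fun y hy => ?_) (fun y hy => (hV y hy.1).2) x ⟨hxV, hx⟩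
  exact tangentVector_ext (conj_curve (P := P) (S := S) hy.2 (c := fun _ => P.big.unit y)
    contMDiffAt_const rfl (Filter.Eventually.of_forall fun _ => P.big.source_unit y)).2.1
    (hV y hy.1).1.symm

variable [ChartedSpace (EuclideanSpace ℝ (Fin k)) P.HomogeneousSpace]
  [IsManifold (𝓡 k) ∞ P.HomogeneousSpace] (hπ : IsSubmersion (𝓡 n) (𝓡 k) ∞ P.proj)

include hπ in
/-- The image of a section of the quotient bundle under a local bisection of the subgroupoid, near a
point. -/
theorem exists_ad_section (S : P.sub.LocalBisection) {x : M} (hx : x ∈ S.base.source)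
    (e' : P.quotSections) : ∃ e : P.quotSections, ∀ᶠ x' in 𝓝 x,
      P.IsAd (S.sec x') (e'.1 x') (e.1 (S.base x')) := by
  have H := P.isPulledBundle_quot hπ
  have h1 : ∀ y, ∃ β : P.QuotFiber y, y ∈ S.base.target →
      P.IsAd (S.sec (S.base.symm y)) (e'.1 (S.base.symm y)) β := by
    intro y
    by_cases hy : y ∈ S.base.target
    · obtain ⟨β, hβ⟩ := P.exists_isAd hπ (S.source_sec _ (S.base.map_target hy))
        ((S.target_sec _ (S.base.map_target hy)).trans (S.base.right_inv hy)) (e'.1 (S.base.symm y))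
      exact ⟨β, fun _ => hβ⟩
    · exact ⟨0, fun h => absurd h hy⟩
  choose ε hε using h1
  obtain ⟨χ, hχ, hχ1, hχs⟩ := exists_cutoff (b := m)
    (S.base.open_target.mem_nhds (S.base.map_source hx))
  have h2 := H.cutoff_mem hχ (e := ε) (fun g hg => by
    have hg' := hχs hg
    refine ((H.smooth_section e' (P.rightMap S g)).comp (rightMap_smooth hg')).congr ?_ ?_
    · filter_upwards [eventually_source_mem_target hg'] with g' h using (proj_rightMap h).symm
    · filter_upwards [eventually_source_mem_target hg'] with g' h
      exact ((isAd_rightMap hπ h rfl _ _).1 (hε _ h)).trans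
        (P.thetaLin_congr hπ (source_rightMap h)).symm)
  refine ⟨⟨_, h2⟩, ?_⟩
  filter_upwards [(S.base.continuousAt hx).eventually hχ1, S.base.open_source.mem_nhds hx]
    with x' h1 h2
  have h3 := hε (S.base x') (S.base.map_source h2)
  rw [S.base.left_inv h2] at h3
  change P.IsAd (S.sec x') (e'.1 x') (χ (S.base x') • ε (S.base x'))
  rwa [h1, one_smul]

/-- The left-invariant vector fields of two sections related by a local bisection of the subgroupoid
are related by right translation. -/
theorem tmap_rightMap_section {S : P.sub.LocalBisection} {g : G}
    (hg : P.big.source g ∈ S.base.target) {l l' : P.big.algebroidSections}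
    (hl : ((l.1 (P.big.source g)).1 : EuclideanSpace ℝ (Fin n)) =
      tmap n n (P.big.conj (P.incl ∘ S.sec)) (P.big.unit (S.base.symm (P.big.source g)))
        (l'.1 (S.base.symm (P.big.source g))).1) :
    tmap n n (P.rightMap S) g (P.big.leftVec g (l.1 (P.big.source g)).1) =
      P.big.leftVec (P.rightMap S g) (l'.1 (P.big.source (P.rightMap S g))).1 := by
  rw [hl, tmap_rightMap hg (l'.1 _).2, P.algebroid_val_congr l'.1 (source_rightMap hg)]

include hπ in
/-- Related sections have the same projections at `g` and at its right translate. -/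
theorem LiftsTo.of_rightMap {S : P.sub.LocalBisection} {g : G}
    (hg : P.big.source g ∈ S.base.target) {l l' : P.big.algebroidSections}
    (hl : ((l.1 (P.big.source g)).1 : EuclideanSpace ℝ (Fin n)) =
      tmap n n (P.big.conj (P.incl ∘ S.sec)) (P.big.unit (S.base.symm (P.big.source g)))
        (l'.1 (S.base.symm (P.big.source g))).1)
    {X : P.verticalFields k} {v' : EuclideanSpace ℝ (Fin n)}
    (h : P.LiftsTo (P.rightMap S g) l' X v') :
    P.LiftsTo g l X (P.big.leftVec g (l.1 (P.big.source g)).1) := by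
  refine ⟨rfl, ?_⟩
  have h1 : tmap n k (fun g => P.proj (P.rightMap S g)) g = tmap n k P.proj g := by
    refine tmap_congr ?_
    filter_upwards [eventually_source_mem_target hg] with g' h using proj_rightMap h
  have h2 := h.2
  rw [h.1, ← P.tmap_rightMap_section hg hl,
    ← tmap_comp hπ.contMDiff.contMDiffAt (rightMap_smooth hg), h1] at h2
  rw [← h2, proj_rightMap hg]

/-- A compatible connection induces the same derivative at all points of the fibre of the projection
to the homogeneous space. -/
theorem IsCompatible.eq_of_pullsTo {D₀ : P.QuotConnection} (h : P.IsCompatible D₀)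
    (X Y : P.verticalFields k) (q : P.HomogeneousSpace) (g g' : G) (hg : P.proj g = q)
    (hg' : P.proj g' = q) (l l' : P.big.algebroidSections) (v v' : EuclideanSpace ℝ (Fin n))
    (β β' : P.verticalFiber k q) (hX : P.LiftsTo g l X v) (hX' : P.LiftsTo g' l' X v')
    (hY : PullsTo (P.quotTheta hπ) g v (pulledNabla (P.quotTheta hπ) D₀ g l)
      (fun g => P.vertTheta k g (P.proj g) rfl (Y.1 (P.proj g))) (P.vertTheta k g q hg β))
    (hY' : PullsTo (P.quotTheta hπ) g' v' (pulledNabla (P.quotTheta hπ) D₀ g' l')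
      (fun g => P.vertTheta k g (P.proj g) rfl (Y.1 (P.proj g))) (P.vertTheta k g' q hg' β')) :
    β = β' := by
  have H := P.isPulledBundle_quot hπ
  subst hg
  obtain ⟨a, ha, hga⟩ := P.proj_eq_iff.1 hg'.symm
  -- the two arrows differ by the right translation by a local bisection through `a`
  obtain ⟨S, hS, hSa⟩ := P.sub.exists_localBisection a
  have hb : S.base (P.sub.source a) = P.big.source g := by
    rw [← S.target_sec _ hS, hSa, ha]
  have hgt : P.big.source g ∈ S.base.target := by
    rw [← hb]
    exact S.base.map_source hS
  have hsymm : S.base.symm (P.big.source g) = P.sub.source a := by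
    rw [← hb, S.base.left_inv hS]
  obtain rfl : g' = P.rightMap S g := by rw [hga, rightMap, hsymm, hSa]
  obtain ⟨l₁, hl₁⟩ := P.exists_conj_section S hS l'
  have hl₁g : ((l₁.1 (P.big.source g)).1 : EuclideanSpace ℝ (Fin n)) =
      tmap n n (P.big.conj (P.incl ∘ S.sec)) (P.big.unit (S.base.symm (P.big.source g)))
        (l'.1 (S.base.symm (P.big.source g))).1 := by
    rw [hsymm, ← hl₁.self_of_nhds, P.algebroid_val_congr l₁.1 hb]
  have hX₁ := LiftsTo.of_rightMap P hπ hgt hl₁g hX'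
  -- the derivative at the translate of `g` is also obtained at `g`
  have hY₁ : PullsTo (P.quotTheta hπ) g (P.big.leftVec g (l₁.1 (P.big.source g)).1)
      (pulledNabla (P.quotTheta hπ) D₀ g l₁)
      (fun g => P.vertTheta k g (P.proj g) rfl (Y.1 (P.proj g))) β'.1 := by
    obtain ⟨ι, _, c, e', hc, hτ, hw⟩ := hY'
    choose e he using fun i => P.exists_ad_section hπ S hS (e' i)
    have hRs := rightMap_smooth (P := P) hgt
    have heg : ∀ᶠ g' in 𝓝 g, ∀ i, P.quotTheta hπ (P.rightMap S g') _ rfl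
        ((e' i).1 (P.big.source (P.rightMap S g'))) =
          P.quotTheta hπ g' _ rfl ((e i).1 (P.big.source g')) := by
      have h1 : Filter.Tendsto (fun g' => S.base.symm (P.big.source g')) (𝓝 g)
          (𝓝 (P.sub.source a)) := by
        rw [← hsymm]
        exact (S.base.continuousAt_symm hgt).comp P.big.source_smooth.continuous.continuousAt
      filter_upwards [h1.eventually (Filter.eventually_all.2 he),
        eventually_source_mem_target hgt] with g' h2 h3 i
      have h4 := h2 i
      rw [S.base.right_inv h3] at h4
      exact (P.thetaLin_congr hπ (source_rightMap h3)).trans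
        ((isAd_rightMap hπ h3 rfl _ _).1 h4).symm
    refine ⟨ι, inferInstance, fun i g' => c i (P.rightMap S g'), e,
      fun i => ContMDiffAt.comp g (hc i) hRs, ?_, ?_⟩
    · filter_upwards [hRs.continuousAt.eventually hτ, heg, eventually_source_mem_target hgt]
        with g' h1 h2 h3
      change (Y.1 (P.proj g')).1 = _
      rw [← proj_rightMap h3]
      refine h1.trans (Finset.sum_congr rfl fun i _ => ?_)
      rw [h2]
    · refine hw.trans (Finset.sum_congr rfl fun i _ => ?_)
      have h5 := (isAd_rightMap hπ hgt hsymm.symm _ _).1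
        (show P.IsAd (S.sec (P.sub.source a)) _ ((D₀.nabla l₁ (e i)).1 (P.big.source g)) by
          have h6 := BisectionEquivariant.isAd P h.2 S hS hl₁ (he i)
          rw [hb] at h6
          exact h6)
      rw [tfun_comp (hc i) hRs, P.tmap_rightMap_section hgt hl₁g, ← hX'.1,
        heg.self_of_nhds, pulledNabla_apply, pulledNabla_apply]
      have h7 := P.thetaLin_congr hπ (e := (D₀.nabla l' (e' i)).1)
        ((source_rightMap hgt).trans hsymm)
      rw [h5]
      exact congrArg (fun z => _ + c i (P.rightMap S g) • z) h7
  -- the directions `l` and `l₁` differ by an element of the Lie algebroid of the subgroupoid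
  have hδ := isDerivationAt_pulledNabla (Θ₁ := P.quotTheta hπ) D₀ (g := g) (l := l) (v := v)
    ((P.isLink_quot hπ).anchor₁_eq g l X v hX)
  have h1 := PullsTo.sub H hδ hY hY₁
  have h2 : (l - l₁).1 (P.big.source g) ∈ P.subFiber (P.big.source g) := by
    rw [← P.proj_leftVec_eq_zero_iff hπ]
    have h3 := P.thetaLin_mkQ hπ (g := g) rfl (l.1 (P.big.source g) - l₁.1 (P.big.source g))
    refine h3.symm.trans ?_
    rw [map_sub, map_sub, P.thetaLin_mkQ, P.thetaLin_mkQ, ← hX₁.2, ← hX.1, ← hX.2]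
    exact sub_self (X.1 (P.proj g)).1
  have h4 : v - P.big.leftVec g (l₁.1 (P.big.source g)).1 =
      P.big.leftVec g ((l - l₁).1 (P.big.source g)).1 := by
    have h5 := P.big.leftVec_add g ((l - l₁).1 (P.big.source g)).1 (l₁.1 (P.big.source g)).1
    rw [sub_eq_iff_eq_add, hX.1]
    refine Eq.trans ?_ h5
    congr 1
    exact (sub_add_cancel (l.1 (P.big.source g)).1 (l₁.1 (P.big.source g)).1).symm
  rw [h4, pulledNabla_sub] at h1
  have h7 := ExtendsAction.eq_zero P hπ h.1 h2 (fun g' hg' => by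
    change (Y.1 (P.proj g')).1 = (Y.1 (P.proj g)).1
    rw [hg']) h1
  exact Subtype.ext (sub_eq_zero.1 h7)

variable {P} in
/-- The inverse of the left translation by a local bisection. -/
theorem exists_leftMap_inverse {S : P.big.LocalBisection} {g : G}
    (h : P.big.target g ∈ S.base.source) : ∃ Λ : G → G,
      ContMDiffAt (𝓡 n) (𝓡 n) ∞ Λ (P.leftMap S g) ∧ Λ (P.leftMap S g) = g ∧
      (∀ᶠ g' in 𝓝 (P.leftMap S g), P.leftMap S (Λ g') = g' ∧ P.big.target (Λ g') ∈ S.base.source) ∧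
      ∀ l : ∀ x, P.big.algebroidFiber x, tmap n n Λ (P.leftMap S g)
        (P.big.leftVec (P.leftMap S g) (l (P.big.source (P.leftMap S g))).1) =
          P.big.leftVec g (l (P.big.source g)).1 := by
  have h1 : P.big.target (P.leftMap S g) ∈ (inverseBisection S).base.source := by
    rw [target_leftMap h]
    exact S.base.map_source h
  have h2 := leftMap_smooth h1
  have h3 := leftMap_inverseBisection h
  refine ⟨P.leftMap (inverseBisection S), h2, h3, ?_, fun l => ?_⟩
  · have h4 := h2.continuousAt.eventually ((P.big.target_smooth.continuous.continuousAt).eventually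
      (S.base.open_source.mem_nhds (by rwa [h3])))
    filter_upwards [h4, eventually_target_mem h1] with g' h5 h6
    exact ⟨leftMap_inverseBisection' h6, h5⟩
  · rw [tmap_leftMap h1 (l _).2, h3, P.algebroid_val_congr l (source_leftMap h)]

theorem vertical_val_congr (X : ∀ q, P.verticalFiber k q) {q q' : P.HomogeneousSpace} (h : q = q') :
    ((X q).1 : EuclideanSpace ℝ (Fin k)) = (X q').1 := by
  subst h
  rfl

theorem translateRelated_iff {S : P.big.LocalBisection} {X X' : ∀ q, P.verticalFiber k q} :
    P.TranslateRelated S X X' ↔ ∀ g, P.big.target g ∈ S.base.source →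
      tmap k k (P.translate S) (P.proj g) (X (P.proj g)).1 = (X' (P.proj (P.leftMap S g))).1 := by
  constructor
  · intro h g hg
    rw [← P.vertical_val_congr X' (translate_proj hg)]
    exact (tangentVector_eq_iff.1 (h (P.proj g) hg)).2
  · intro h q hq
    obtain ⟨g, rfl⟩ := P.proj_surjective q
    refine tangentVector_ext rfl ((h g hq).trans ?_)
    rw [P.vertical_val_congr X' (translate_proj (g := g) hq)]

theorem thetaLin_leftMap {S : P.big.LocalBisection} {g : G} (h : P.big.target g ∈ S.base.source)
    (e : ∀ x, P.QuotFiber x) :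
    P.thetaLin hπ (g := P.leftMap S g) rfl (e (P.big.source (P.leftMap S g))) =
      tmap k k (P.translate S) (P.proj g) (P.thetaLin hπ (g := g) rfl (e (P.big.source g))) := by
  rw [tmap_translate hπ h rfl (source_leftMap h), P.thetaLin_congr hπ (source_leftMap h)]

include hπ in
theorem LiftsTo.leftMap {S : P.big.LocalBisection} {g : G} (h : P.big.target g ∈ S.base.source)
    {l : P.big.algebroidSections} {X X' : P.verticalFields k} {v : EuclideanSpace ℝ (Fin n)}
    (hX : tmap k k (P.translate S) (P.proj g) (X.1 (P.proj g)).1 =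
      (X'.1 (P.proj (P.leftMap S g))).1) (hl : P.LiftsTo g l X v) :
    P.LiftsTo (P.leftMap S g) l X' (P.big.leftVec (P.leftMap S g)
      (l.1 (P.big.source (P.leftMap S g))).1) := by
  refine ⟨rfl, ?_⟩
  have h1 := P.thetaLin_leftMap hπ h (fun x => (P.subFiber x).mkQ (l.1 x))
  rw [P.thetaLin_mkQ, P.thetaLin_mkQ, ← hl.1] at h1
  rw [← hX, h1]
  exact congrArg _ hl.2

include hπ in
/-- The connection on the homogeneous space which corresponds to any connection on the quotient
bundle is invariant. -/
theorem PullbackAgrees.isInvariant {D₀ : P.QuotConnection} {D : P.FibrewiseAffineConnection k}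
    [T2Space P.HomogeneousSpace]
    (h : PullbackAgrees (n := n) (P.quotTheta hπ) (P.vertTheta k) P.LiftsTo D₀ D) :
    P.IsInvariant D := by
  have H := P.isPulledBundle_quot hπ
  intro S X X' Y Y' hX hY
  rw [P.translateRelated_iff] at hX hY ⊢
  intro g hg
  obtain ⟨l, v, β, hl, hw⟩ := exists_pullsTo H (P.isPulledBundle_vert hπ)
    (P.isLink_quot hπ) D₀ X Y g
  have hβ := h g l X v hl Y _ hw
  have hl' := LiftsTo.leftMap P hπ hg (hX g hg) hl
  -- the value at the translate of `g` is computed by the same coefficients, as `theta` is invariant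
  -- under translation
  obtain ⟨Λ, hΛ, hΛg, hΛe, hΛv⟩ := exists_leftMap_inverse hg
  rw [pulledNabla_apply] at hβ
  obtain ⟨ι, _, c, e, hc, hτ, hw⟩ := hw
  have hcΛ : ∀ i, ContMDiffAt (𝓡 n) 𝓘(ℝ, ℝ) ∞ (c i) (Λ (P.leftMap S g)) := fun i => by
    rw [hΛg]
    exact hc i
  refine Eq.trans (congrArg (tmap k k (P.translate S) (P.proj g)) (hβ.symm.trans hw)) ?_
  refine h _ l X' _ hl' Y' _ ⟨ι, inferInstance, fun i g' => c i (Λ g'), e,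
    fun i => ContMDiffAt.comp _ (hcΛ i) hΛ, ?_, ?_⟩
  · have h1 : Filter.Tendsto Λ (𝓝 (P.leftMap S g)) (𝓝 g) := by
      have := hΛ.continuousAt
      rwa [ContinuousAt, hΛg] at this
    filter_upwards [hΛe, h1.eventually hτ] with g' h2 h3
    obtain ⟨h4, h5⟩ := h2
    have h6 := hY _ h5
    change (Y'.1 (P.proj g')).1 = _
    rw [h4] at h6
    rw [← h6]
    refine (congrArg (tmap k k (P.translate S) (P.proj (Λ g'))) h3).trans ?_
    rw [map_sum]
    refine Finset.sum_congr rfl fun i _ => ?_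
    rw [map_smul]
    have h7 := P.thetaLin_leftMap hπ h5 (e i).1
    rw [h4] at h7
    exact congrArg _ h7.symm
  · rw [map_sum]
    refine Finset.sum_congr rfl fun i _ => ?_
    rw [map_add, map_smul, map_smul, tfun_comp (hcΛ i) hΛ, hΛv, ← hl.1, hΛg]
    have h7 := P.thetaLin_leftMap hπ hg (e i).1
    have h8 := P.thetaLin_leftMap hπ hg (D₀.nabla l (e i)).1
    rw [pulledNabla_apply, pulledNabla_apply]
    change _ = _ + c i (Λ (P.leftMap S g)) • _
    rw [hΛg]
    exact congrArg₂ (fun y z : EuclideanSpace ℝ (Fin k) => tfun n (c i) g v • y + c i g • z)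
      h7.symm h8.symm

end LieGroupoidPair

/-! ### Consequences of invariance -/

namespace LieGroupoidPair

open Manifold IsPulledBundle

variable {m n p k : ℕ} {M G A : Type*}
  [TopologicalSpace M] [ChartedSpace (EuclideanSpace ℝ (Fin m)) M] [IsManifold (𝓡 m) ∞ M]
  [T2Space M]
  [TopologicalSpace G] [ChartedSpace (EuclideanSpace ℝ (Fin n)) G] [IsManifold (𝓡 n) ∞ G]
  [TopologicalSpace A] [ChartedSpace (EuclideanSpace ℝ (Fin p)) A] [IsManifold (𝓡 p) ∞ A]
  (P : LieGroupoidPair m n p M G A)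
  [ChartedSpace (EuclideanSpace ℝ (Fin k)) P.HomogeneousSpace]
  [IsManifold (𝓡 k) ∞ P.HomogeneousSpace] (hπ : IsSubmersion (𝓡 n) (𝓡 k) ∞ P.proj)
  [T2Space P.HomogeneousSpace]

include hπ in
/-- The image of a vertical field under the translation by a local bisection, near a fibre. -/
theorem exists_translate_section (S : P.big.LocalBisection) {x : M} (hx : x ∈ S.base.source)
    (X : P.verticalFields k) : ∃ X' : P.verticalFields k, ∀ᶠ x' in 𝓝 x, ∀ g, P.big.target g = x' →
      tmap k k (P.translate S) (P.proj g) (X.1 (P.proj g)).1 =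
        (X'.1 (P.proj (P.leftMap S g))).1 := by
  have H := P.isPulledBundle_vert hπ
  have hinv : ∀ g, P.big.target g ∈ S.base.target →
      P.big.target (P.leftMap (inverseBisection S) g) ∈ S.base.source := by
    intro g hg
    rw [target_leftMap (S := inverseBisection S) hg]
    exact S.base.map_target hg
  have h1 : ∀ q, ∃ w : P.verticalFiber k q, ∀ g, P.proj g = q → P.big.target g ∈ S.base.target →
      (w.1 : EuclideanSpace ℝ (Fin k)) = tmap k k (P.translate S)
        (P.proj (P.leftMap (inverseBisection S) g))
          (X.1 (P.proj (P.leftMap (inverseBisection S) g))).1 := by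
    intro q
    obtain ⟨g, rfl⟩ := P.proj_surjective q
    by_cases hg : P.big.target g ∈ S.base.target
    · have hg' := hinv g hg
      obtain ⟨β, hβ⟩ := P.exists_thetaLin_eq hπ (g := P.leftMap (inverseBisection S) g) rfl
        (X.1 (P.proj (P.leftMap (inverseBisection S) g))).2
      have h2 := tmap_translate hπ hg' rfl (source_leftMap hg') β
      have h3 := P.thetaLin_mem_vert hπ (source_leftMap hg') β
      rw [← h2, leftMap_inverseBisection' hg] at h3
      refine ⟨⟨_, h3⟩, fun g₁ hg₁ ht => ?_⟩
      have h4 : P.proj (P.leftMap (inverseBisection S) g₁) =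
          P.proj (P.leftMap (inverseBisection S) g) := by
        rw [← translate_proj (S := inverseBisection S) hg, hg₁.symm,
          translate_proj (S := inverseBisection S) ht]
      rw [h4]
      exact congrArg _ hβ
    · refine ⟨0, fun g₁ hg₁ ht => absurd ?_ hg⟩
      have h2 := congrArg P.homTarget hg₁
      rw [P.homTarget_proj, P.homTarget_proj] at h2
      rwa [← h2]
  choose ε hε using h1
  obtain ⟨χ, hχ, hχ1, hχs⟩ := exists_cutoff (b := m)
    (S.base.open_target.mem_nhds (S.base.map_source hx))
  have hcut : ∀ g, P.proj g ∈ tsupport (fun q => χ (P.homTarget q)) →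
      P.big.target g ∈ S.base.target := fun g hg =>
    hχs (tsupport_comp_subset_preimage χ (P.homTarget_smooth hπ).continuous hg)
  have h2 := H.cutoff_mem (χ := fun q => χ (P.homTarget q)) (hχ.comp (P.homTarget_smooth hπ))
    (e := ε) (fun g hg => by
      have ht := hcut g hg
      have h3 := ((H.smooth_section X (P.leftMap (inverseBisection S) g)).comp
        (leftMap_smooth (S := inverseBisection S) ht)).push
        (translate_smooth hπ (S := S) (hinv g ht))
      refine h3.congr ?_ ?_
      · filter_upwards [eventually_target_mem (S := inverseBisection S) ht] with g' h'
        rw [translate_proj (hinv g' h'), leftMap_inverseBisection' h']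
      · filter_upwards [eventually_target_mem (S := inverseBisection S) ht] with g' h'
        exact hε _ g' rfl h')
  refine ⟨⟨_, h2⟩, ?_⟩
  filter_upwards [(S.base.continuousAt hx).eventually hχ1, S.base.open_source.mem_nhds hx]
    with x' h3 h4
  rintro g rfl
  have h5 : P.big.target (P.leftMap S g) ∈ S.base.target := by
    rw [target_leftMap h4]
    exact S.base.map_source h4
  have h6 := hε _ (P.leftMap S g) rfl h5
  rw [leftMap_inverseBisection h4] at h6
  rw [← h6]
  change _ = χ (P.homTarget (P.proj (P.leftMap S g))) • (ε (P.proj (P.leftMap S g))).1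
  rw [P.homTarget_proj, target_leftMap h4, h3]
  exact (one_smul ℝ _).symm

/-- An invariant connection is local, so that it suffices to know the fields near a fibre. -/
theorem IsInvariant.tmap_eq {D : P.FibrewiseAffineConnection k} (h : P.IsInvariant D)
    (S : P.big.LocalBisection) {X X' Y Y' : P.verticalFields k} {g : G}
    (hg : P.big.target g ∈ S.base.source)
    (hX : ∀ᶠ x in 𝓝 (P.big.target g), ∀ g', P.big.target g' = x →
      tmap k k (P.translate S) (P.proj g') (X.1 (P.proj g')).1 =
        (X'.1 (P.proj (P.leftMap S g'))).1)
    (hY : ∀ᶠ x in 𝓝 (P.big.target g), ∀ g', P.big.target g' = x →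
      tmap k k (P.translate S) (P.proj g') (Y.1 (P.proj g')).1 =
        (Y'.1 (P.proj (P.leftMap S g'))).1) :
    tmap k k (P.translate S) (P.proj g) ((D.nabla X Y).1 (P.proj g)).1 =
      ((D.nabla X' Y').1 (P.proj (P.leftMap S g))).1 := by
  obtain ⟨V, hV, hVo, hgV⟩ := eventually_nhds_iff.1 (hX.and hY)
  have h1 := h (S.restrict hVo) X X' Y Y'
    (P.translateRelated_iff.2 fun g' hg' => (hV _ hg'.1).1 g' rfl)
    (P.translateRelated_iff.2 fun g' hg' => (hV _ hg'.1).2 g' rfl)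
  exact P.translateRelated_iff.1 h1 g ⟨hgV, hg⟩

/-- An invariant connection induces the same derivative at all arrows with the same source. -/
theorem IsInvariant.eq_of_pullsTo {D : P.FibrewiseAffineConnection k} (h : P.IsInvariant D)
    (l : P.big.algebroidSections) (e : P.quotSections) (x : M) (g g' : G)
    (hg : P.big.source g = x) (hg' : P.big.source g' = x) (X X' : P.verticalFields k)
    (v v' : EuclideanSpace ℝ (Fin n)) (β β' : P.QuotFiber x) (hX : P.LiftsTo g l X v)
    (hX' : P.LiftsTo g' l X' v')
    (he : PullsTo (P.vertTheta k) g v (pulledNabla (P.vertTheta k) D g X)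
      (fun g => P.quotTheta hπ g (P.big.source g) rfl (e.1 (P.big.source g)))
      (P.quotTheta hπ g x hg β))
    (he' : PullsTo (P.vertTheta k) g' v' (pulledNabla (P.vertTheta k) D g' X')
      (fun g => P.quotTheta hπ g (P.big.source g) rfl (e.1 (P.big.source g)))
      (P.quotTheta hπ g' x hg' β')) : β = β' := by
  have H := P.isPulledBundle_vert hπ
  subst hg
  have hgg : P.big.source g' = P.big.target (P.big.inv g) := by rw [hg', P.big.target_inv]
  -- the two arrows differ by the left translation by a local bisection through `g' g⁻¹`
  obtain ⟨S, hS, hSg⟩ := P.big.exists_localBisection (P.big.mul g' (P.big.inv g))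
  rw [P.big.source_mul _ _ hgg, P.big.source_inv] at hS hSg
  obtain rfl : g' = P.leftMap S g := by
    rw [leftMap, hSg, P.big.inv_mul_cancel_right hg']
  obtain ⟨X₁, hX₁⟩ := P.exists_translate_section hπ S hS X
  have hl₁ := LiftsTo.leftMap P hπ hS (hX₁.self_of_nhds g rfl) hX
  rw [← hX'.1] at hl₁
  obtain ⟨Λ, hΛ, hΛg, hΛe, hΛv⟩ := exists_leftMap_inverse hS
  have hΛt : Filter.Tendsto Λ (𝓝 (P.leftMap S g)) (𝓝 g) := by
    have := hΛ.continuousAt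
    rwa [ContinuousAt, hΛg] at this
  obtain ⟨ι, _, c, Y, hc, hτ, hw⟩ := he
  choose Y' hY' using fun i => P.exists_translate_section hπ S hS (Y i)
  have hcΛ : ∀ i, ContMDiffAt (𝓡 n) 𝓘(ℝ, ℝ) ∞ (c i) (Λ (P.leftMap S g)) := fun i => by
    rw [hΛg]
    exact hc i
  -- the derivative at `g` is transported to its translate
  have he₁ : PullsTo (P.vertTheta k) (P.leftMap S g) v'
      (pulledNabla (P.vertTheta k) D (P.leftMap S g) X')
      (fun g => P.quotTheta hπ g (P.big.source g) rfl (e.1 (P.big.source g)))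
      (tmap k k (P.translate S) (P.proj g) (P.quotTheta hπ g _ rfl β)) := by
    refine ⟨ι, inferInstance, fun i g' => c i (Λ g'), Y',
      fun i => ContMDiffAt.comp _ (hcΛ i) hΛ, ?_, ?_⟩
    · filter_upwards [hΛe, hΛt.eventually hτ,
        hΛt.eventually (P.big.target_smooth.continuous.continuousAt.eventually
          (Filter.eventually_all.2 hY'))] with g' h1 h2 h3
      obtain ⟨h4, h5⟩ := h1
      have h6 := P.thetaLin_leftMap hπ h5 e.1
      rw [h4] at h6
      refine h6.trans ((congrArg (tmap k k (P.translate S) (P.proj (Λ g'))) h2).trans ?_)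
      rw [map_sum]
      refine Finset.sum_congr rfl fun i _ => ?_
      have h7 := h3 i (Λ g') rfl
      rw [h4] at h7
      rw [map_smul]
      exact congrArg _ h7
    · rw [hw, map_sum]
      refine Finset.sum_congr rfl fun i _ => ?_
      have h1 := IsInvariant.tmap_eq P h S hS hX₁ (hY' i)
      have h2 : (D.nabla X' (Y' i)).1 (P.proj (P.leftMap S g)) =
          (D.nabla X₁ (Y' i)).1 (P.proj (P.leftMap S g)) :=
        D.nabla_congr H (Subtype.ext (hX'.2.trans hl₁.2.symm)) _
      rw [← h2] at h1
      have h3 := (hY' i).self_of_nhds g rfl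
      rw [map_add, map_smul, map_smul, tfun_comp (hcΛ i) hΛ, hX'.1, hΛv l.1, ← hX.1, hΛg]
      change _ = _ + c i (Λ (P.leftMap S g)) • _
      rw [hΛg]
      exact congrArg₂ (fun y z : EuclideanSpace ℝ (Fin k) => tfun n (c i) g v • y + c i g • z)
        h3 h1
  have hδ := isDerivationAt_pulledNabla (Θ₁ := P.vertTheta k) D (g := P.leftMap S g) (l := X')
    (v := v') ((P.isLink_vert hπ).anchor₁_eq _ X' l v' hX')
  have h1 := PullsTo.unique H hδ he₁ he'
  have h2 := tmap_translate hπ hS rfl hg' β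
  exact P.thetaLin_injective hπ hg' (h2.symm.trans h1)

include hπ in
/-- The connection on the quotient bundle which corresponds to a connection on the homogeneous space
extends the infinitesimal action of the subgroupoid. -/
theorem PullbackAgrees.extendsAction {D₀ : P.QuotConnection} {D : P.FibrewiseAffineConnection k}
    (h : PullbackAgrees (n := n) (P.vertTheta k) (P.quotTheta hπ) (fun g X l v => P.LiftsTo g l X v)
      D D₀) : P.ExtendsAction D₀ := by
  have H := P.isPulledBundle_vert hπ
  have H' := P.isPulledBundle_quot hπ
  intro l e hl x c hc hc0 hcs hcv w hw φ
  obtain ⟨g, rfl⟩ := H'.surjective x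
  obtain ⟨d, hd, hd0, hdv, hdp, hdθ⟩ := P.exists_orbit_curve hπ rfl hc hc0 hcs
  have hcv' : vel n (fun t => P.incl (c t)) = (l.1 (P.big.source g)).1 :=
    (tangentVector_eq_iff.1 hcv).2
  rw [hcv'] at hdv
  -- the curve `d` lies in a fibre of the projection, so that its velocity lifts the zero field
  have hX : P.LiftsTo g l 0 (vel n d) :=
    ⟨hdv, by
      rw [hdv]
      exact ((P.proj_leftVec_eq_zero_iff hπ _).2 (hl _)).symm⟩
  obtain ⟨u, hu⟩ := PullsTo.exists H (g := g) (v := vel n d)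
    (δ := pulledNabla (P.vertTheta k) D g 0)
    (τ := fun g => P.quotTheta hπ g (P.big.source g) rfl (e.1 (P.big.source g)))
    (Filter.Eventually.of_forall fun g => H'.smooth_section e g)
    (Filter.Eventually.of_forall fun g => H'.mem _ _ _ _)
  have h1 := h g 0 l _ hX e u hu
  obtain ⟨ι, _, f, Y, hf, hτ, hu⟩ := hu
  obtain ⟨ψ, hψ⟩ := LinearMap.exists_leftInverse_of_injective (P.thetaLin hπ (g := g) rfl)
    (LinearMap.ker_eq_bot.2 (P.thetaLin_injective hπ rfl))
  have hψ' : ∀ β, ψ (P.thetaLin hπ (g := g) rfl β) = β := fun β => LinearMap.congr_fun hψ β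
  have h2 : ∀ᶠ t in 𝓝 0, φ (w t) =
      ∑ i, f i (d t) * φ (ψ (P.vertTheta k g _ rfl ((Y i).1 (P.proj g)))) := by
    have h3 : Filter.Tendsto d (𝓝 0) (𝓝 g) := by
      have := hd.continuousAt
      rwa [ContinuousAt, hd0] at this
    filter_upwards [h3.eventually hτ] with t ht
    rw [← hψ' (w t), hdθ _ t _ (hw t)]
    refine (congrArg (fun z => φ (ψ z)) ht).trans ?_
    rw [map_sum, map_sum]
    refine Finset.sum_congr rfl fun i _ => ?_
    rw [map_smul, map_smul, smul_eq_mul]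
    exact congrArg (fun z => f i (d t) * φ (ψ z)) (P.vertical_val_congr (Y i).1 (hdp t))
  have h4 : HasDerivAt (fun t => ∑ i, f i (d t) *
      φ (ψ (P.vertTheta k g _ rfl ((Y i).1 (P.proj g)))))
      (∑ i, tfun n (f i) g (vel n d) * φ (ψ (P.vertTheta k g _ rfl ((Y i).1 (P.proj g))))) 0 :=
    HasDerivAt.fun_sum fun i _ => (vel_comp_real hd0 (hf i) hd).mul_const _
  refine (h4.congr_of_eventuallyEq h2).congr_deriv ?_
  rw [← hψ' ((D₀.nabla l e).1 (P.big.source g))]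
  refine Eq.trans ?_ (congrArg (fun z => φ (ψ z)) (hu.symm.trans h1))
  rw [map_sum, map_sum]
  refine Finset.sum_congr rfl fun i _ => ?_
  have h5 : pulledNabla (P.vertTheta k) D g 0 (Y i) = 0 := by
    rw [pulledNabla_apply, map_zero]
    exact map_zero _
  rw [h5, smul_zero, add_zero, map_smul, map_smul, smul_eq_mul]

include hπ in
/-- The connection on the quotient bundle which corresponds to a connection on the homogeneous space
is equivariant. -/
theorem PullbackAgrees.bisectionEquivariant {D₀ : P.QuotConnection}
    {D : P.FibrewiseAffineConnection k}
    (h : PullbackAgrees (n := n) (P.vertTheta k) (P.quotTheta hπ) (fun g X l v => P.LiftsTo g l X v)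
      D D₀) : P.BisectionEquivariant D₀ := by
  have H := P.isPulledBundle_vert hπ
  have H' := P.isPulledBundle_quot hπ
  intro S l l' e e' hl he x hx
  obtain ⟨g, hg⟩ := H'.surjective (S.base x)
  have hgt : P.big.source g ∈ S.base.target := by
    rw [hg]
    exact S.base.map_source hx
  have hx' : x = S.base.symm (P.big.source g) := by rw [hg, S.base.left_inv hx]
  have hlg : ((l.1 (P.big.source g)).1 : EuclideanSpace ℝ (Fin n)) =
      tmap n n (P.big.conj (P.incl ∘ S.sec)) (P.big.unit (S.base.symm (P.big.source g)))
        (l'.1 (S.base.symm (P.big.source g))).1 := by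
    rw [← hx', P.algebroid_val_congr l.1 hg]
    exact (tangentVector_eq_iff.1 (hl x hx)).2.symm
  have hRs := rightMap_smooth (P := P) hgt
  obtain ⟨X, v, β, hX, hw⟩ := exists_pullsTo H H' (P.isLink_vert hπ) D l' e' (P.rightMap S g)
  have hβ := h _ X l' v hX e' _ hw
  have hX' := LiftsTo.of_rightMap P hπ hgt hlg hX
  obtain ⟨ι, _, c, Y, hc, hτ, hw⟩ := hw
  have h1 := h g X l _ hX' e _ ⟨ι, inferInstance, fun i g' => c i (P.rightMap S g'), Y,
    fun i => ContMDiffAt.comp g (hc i) hRs, by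
      filter_upwards [hRs.continuousAt.eventually hτ, eventually_source_mem_target hgt]
        with g' h2 h3
      have h4 := he _ (S.base.map_target h3)
      rw [S.base.right_inv h3] at h4
      refine ((isAd_rightMap hπ h3 rfl _ _).1 h4).trans
        ((P.thetaLin_congr hπ (source_rightMap h3)).symm.trans (h2.trans ?_))
      exact Finset.sum_congr rfl fun i _ => congrArg (fun z => c i (P.rightMap S g') • z)
        (P.vertical_val_congr (Y i).1 (proj_rightMap h3)), rfl⟩
  have key : P.IsAd (S.sec x) ((D₀.nabla l' e').1 x) ((D₀.nabla l e).1 (P.big.source g)) := by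
    rw [isAd_rightMap hπ hgt hx', ← P.thetaLin_congr hπ ((source_rightMap hgt).trans hx'.symm)]
    refine h1.symm.trans (Eq.trans ?_ (hw.symm.trans hβ))
    refine Finset.sum_congr rfl fun i _ => ?_
    rw [tfun_comp (hc i) hRs, P.tmap_rightMap_section hgt hlg, ← hX.1]
    exact congrArg₂ (fun y z : EuclideanSpace ℝ (Fin k) =>
      tfun n (c i) (P.rightMap S g) v • y + c i (P.rightMap S g) • z)
      (P.vertical_val_congr (Y i).1 (proj_rightMap hgt).symm)
      (P.vertical_val_congr (D.nabla X (Y i)).1 (proj_rightMap hgt).symm)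
  rw [hg] at key
  exact key

end LieGroupoidPair

/-! ### The bijection -/

theorem exists_equiv_of_existsUnique {α β : Type*} {r : α → β → Prop} (h : ∀ a, ∃! b, r a b)
    (h' : ∀ b, ∃! a, r a b) : ∃ Φ : α ≃ β, ∀ a b, Φ a = b ↔ r a b := by
  choose f hf hfu using h
  refine ⟨Equiv.ofBijective f ⟨fun a a' haa => ?_, fun b => ?_⟩, fun a b => ?_⟩
  · exact (h' (f a)).unique (hf a) (haa ▸ hf a')
  · obtain ⟨a, ha, -⟩ := h' b
    exact ⟨a, (hfu a b ha).symm⟩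
  · constructor
    · rintro rfl
      exact hf a
    · exact fun hab => (hfu a b hab).symm

namespace LieGroupoidPair

open Manifold

variable {m n p k : ℕ} {M G A : Type*}
  [TopologicalSpace M] [ChartedSpace (EuclideanSpace ℝ (Fin m)) M] [IsManifold (𝓡 m) ∞ M]
  [T2Space M]
  [TopologicalSpace G] [ChartedSpace (EuclideanSpace ℝ (Fin n)) G] [IsManifold (𝓡 n) ∞ G]
  [TopologicalSpace A] [ChartedSpace (EuclideanSpace ℝ (Fin p)) A] [IsManifold (𝓡 p) ∞ A]
  (P : LieGroupoidPair m n p M G A)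
  [ChartedSpace (EuclideanSpace ℝ (Fin k)) P.HomogeneousSpace]
  [IsManifold (𝓡 k) ∞ P.HomogeneousSpace] (hπ : IsSubmersion (𝓡 n) (𝓡 k) ∞ P.proj)

include hπ in
theorem exists_correspondence_equiv :
    ∃ Φ : {D₀ : P.QuotConnection // P.IsCompatible D₀} ≃
        {D : P.FibrewiseAffineConnection k // P.IsInvariant D},
      ∀ D₀ D, Φ D₀ = D ↔ P.Corresponds D₀.1 D.1 := by
  have := P.homogeneousSpace_t2Space
  have H := P.isPulledBundle_quot hπ
  have H' := P.isPulledBundle_vert hπ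
  have hℒ := P.isLink_quot hπ
  have hℒ' := P.isLink_vert hπ
  simp only [P.corresponds_iff hπ]
  refine exists_equiv_of_existsUnique (fun D₀ => ?_) fun D => ?_
  · obtain ⟨D, hD⟩ := exists_pullbackAgrees H H' hℒ D₀.1 (IsCompatible.eq_of_pullsTo P hπ D₀.2)
    exact ⟨⟨D, PullbackAgrees.isInvariant P hπ hD⟩, hD,
      fun D' hD' => Subtype.ext (PullbackAgrees.unique H H' hℒ hD' hD)⟩
  · obtain ⟨D₀, hD₀⟩ := exists_pullbackAgrees H' H hℒ' D.1 (IsInvariant.eq_of_pullsTo P hπ D.2)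
    exact ⟨⟨D₀, PullbackAgrees.extendsAction P hπ hD₀,
      PullbackAgrees.bisectionEquivariant P hπ hD₀⟩,
      PullbackAgrees.symm H' H hℒ' hD₀, fun D₀' hD₀' => Subtype.ext
        (PullbackAgrees.unique H' H hℒ' (PullbackAgrees.symm H H' hℒ hD₀') hD₀)⟩

end LieGroupoidPair

end

theorem mainTheorem1 {m n p : ℕ} {M G A : Type*}
    [TopologicalSpace M] [ChartedSpace (EuclideanSpace ℝ (Fin m)) M] [IsManifold (𝓡 m) ∞ M]
    [T2Space M] [SecondCountableTopology M]
    [TopologicalSpace G] [ChartedSpace (EuclideanSpace ℝ (Fin n)) G] [IsManifold (𝓡 n) ∞ G]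
    [T2Space G] [SecondCountableTopology G]
    [TopologicalSpace A] [ChartedSpace (EuclideanSpace ℝ (Fin p)) A] [IsManifold (𝓡 p) ∞ A]
    [T2Space A] [SecondCountableTopology A]
    (P : LieGroupoidPair m n p M G A) :
    (T2Space P.HomogeneousSpace ∧ SecondCountableTopology P.HomogeneousSpace ∧
      ∃ (k : ℕ) (_ : ChartedSpace (EuclideanSpace ℝ (Fin k)) P.HomogeneousSpace),
        IsManifold (𝓡 k) ∞ P.HomogeneousSpace ∧
          Manifold.IsSubmersion (𝓡 n) (𝓡 k) ∞ P.proj) ∧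
    ∀ (k : ℕ) [ChartedSpace (EuclideanSpace ℝ (Fin k)) P.HomogeneousSpace]
      [IsManifold (𝓡 k) ∞ P.HomogeneousSpace],
      Manifold.IsSubmersion (𝓡 n) (𝓡 k) ∞ P.proj →
      ∃ Φ : {D₀ : P.QuotConnection // P.IsCompatible D₀} ≃
          {D : P.FibrewiseAffineConnection k // P.IsInvariant D},
        ∀ D₀ D, Φ D₀ = D ↔ P.Corresponds D₀.1 D.1 := by
  refine ⟨⟨P.homogeneousSpace_t2Space, P.homogeneousSpace_secondCountableTopology,
    P.exists_quot_manifold⟩, ?_⟩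
  intro k _ _ hπ
  exact P.exists_correspondence_equiv hπ
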